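/- Let $\pi=\langle a,b\mid a^2=b^3\rangle$ be the group of the trefoil knot $3_1$, with Wirtinger generators $x_1=ab^{-1}$, $x_2=b^{-1}a$, $x_3=a^{-1}baba^{-1}$ (indices modulo 3). Let $\rho\colon\pi\to SO(3)$ be a homomorphism with non-abelian image such that $\rho(a)$ is the rotation through $\pi$ and $\rho(b)$ the rotation through $2\pi/3$ about two axes through the origin of $\mathbb R^3$ that form the angle $\phi$. Then: (i) $\rho(x_1),\rho(x_2),\rho(x_3)$ are rotations about axes through the origin through a common angle $\varphi_1$, and every such angle satisfies $\cos\varphi_1=\frac32\cos^2\phi-1$. (ii) The algebra $\mathfrak e(3)_\rho=\{X\in\mathfrak e(3): \mathrm{Ad}_{\rho(h)}X=X\ \forall h\in\pi\}$ is $0$. (iii) The invariant is $I_\rho(3_1)=4$, in the following sense. *Triangulation.* Use the pseudotriangulation of $S^3$ that comes from the three-crossing diagram. Its vertices are $A_i$ (upper) and $B_i$ (lower) over the $i$-th crossing ($i=1,2,3$), $O$ below and $P$ above the diagram. Put $g_{\rm ext}=1$, $g_i=x_i$, $g_c=x_1x_2$ for the five regions of the diagram (exterior, three lobes, centre). In terms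 of lifts to the covering branched along the knot, where $A_i$ is fixed by $x_i$ and $B_i$ by $x_{i+1}$, representatives of the 32 edges are the six edges on the knot $A_iB_{i-1}$ and $A_i\,(x_{i+1}B_{i+1})$, the edges $A_iB_i$, $A_iO$, $A_i\,(x_{i+1}O)$, $A_iP$, $B_iO$, $B_iP$, $(x_iB_i)P$, and the five edges $(g_RO)P$, one for each region $R$. The 24 tetrahedra are, with vertices in the order indicated and $\pm$ the orientation sign, $+A_iB_{i-1}OP$, $-A_iB_{i-1}(x_iO)P$, $-A_i(x_{i+1}B_{i+1})(x_{i+1}O)P$, $+A_i(x_{i+1}B_{i+1})(g_cO)P$, $-A_iB_iOP$, $+A_iB_i(x_{i+1}O)P$, $+A_i(x_iB_i)(x_iO)P$, $-A_i(x_iB_i)(g_cO)P$. *Geometry.* Let $\Gamma$ place the vertices in $\mathbb R^3$ with $\rho(x_i)\Gamma(A_i)=\Gamma(A_i)$ and $\rho(x_{i+1})\Gamma(B_i)=\Gamma(B_i)$, extended to lifts by $\Gamma(gv)=\rho(g)\Gamma(v)$; suppose that the signed volumes $V$ of all 24 tetrahedra are nonzero (such $\Gamma$ exist). For an edge $e$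 let $l_e$ be its length, $L_e=\frac12l_e^2$, $\omega_e$ its defect angle (full angle minus the sum of the dihedral angles at $e$ over the 24 tetrahedra, each with the sign of $V$, the full angle being taken so that $\omega_e=0$ at $\Gamma$), and $\Omega_e=\omega_e/l_e$. Let $(dx)$ have as its basis the coordinate of each $A_i$, $B_i$ along the axis on which it lies (with respect to a unit directing vector) and the Cartesian coordinates of $O$ and $P$ (12 in all). Let $f_1\colon\mathfrak e(3)_\rho\to(dx)$ be evaluation of infinitesimal motions, $f_2=(\partial L_e/\partial x)$ and $f_3=(\partial\Omega_e/\partial L_{e'})$, at $\Gamma$. Choose 12 edges $\mathcal B_2$ with complement $\mathcal B_3$; let $\operatorname{minor} f_2$ be the $12\times12$ minor of $f_2$ with rows $\mathcal B_2$, $\operatorname{minor} f_3$ the $20\times20$ minor of $f_3$ with rows and columns $\mathcal B_3$, and $\operatorname{minor} f_1=1$ the empty minor. *Claim.* For every such $\Gamma$ there is a choice with all minors nonzero, and for every such choice $$\tau=\frac{(\operatorname{minor} f_2)^2(-1)^{\operatorname{rank} f_2}}{\operatorname{minor} f_3\,(\operatorname{minor} f_1)^2},\qquad I_\rho(3_1)=\tau\cdot\frac{(2-2\cos\varphi_1)^{6}}{\prod'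 l_e^2\cdot\prod(-6V)}=4,$$ where $\prod'$ is over the six edges on the knot and $\prod$ over the 24 tetrahedra. -/

import Mathlib

open Matrix

namespace TrefoilInvariant

/-! ### The trefoil group and rotations -/

/-- The single relator `a² b⁻³`; the generators `a`, `b` are indexed by `0`, `1`. -/
def trefoilRels : Set (FreeGroup (Fin 2)) :=
  {FreeGroup.of 0 ^ 2 * (FreeGroup.of 1 ^ 3)⁻¹}

/-- The trefoil group `⟨a, b ∣ a² = b³⟩`. -/
abbrev TrefoilGroup : Type := PresentedGroup trefoilRels

/-- The generator `a`. -/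
def genA : TrefoilGroup := PresentedGroup.of 0

/-- The generator `b`. -/
def genB : TrefoilGroup := PresentedGroup.of 1

/-- The Wirtinger generators `x₁ = a b⁻¹`, `x₂ = b⁻¹ a`, `x₃ = a⁻¹ b a b a⁻¹` (indices in
`Fin 3 = {0, 1, 2}` stand for `1, 2, 3`, read modulo 3).  They satisfy the Wirtinger relations
`x₁ x₂ = x₂ x₃ = x₃ x₁`. -/
def wirt : Fin 3 → TrefoilGroup :=
  ![genA * genB⁻¹, genB⁻¹ * genA, genA⁻¹ * genB * genA * genB * genA⁻¹]

abbrev SO3 : Type := Matrix.specialOrthogonalGroup (Fin 3) ℝ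

/-- Rodrigues' matrix of the rotation through the angle `θ` about the axis spanned by the unit
vector `n`: `v ↦ cos θ v + sin θ (n × v) + (1 - cos θ) ⟨n, v⟩ n`. -/
noncomputable def rotation (n : Fin 3 → ℝ) (θ : ℝ) : Matrix (Fin 3) (Fin 3) ℝ :=
  Real.cos θ • (1 : Matrix (Fin 3) (Fin 3) ℝ)
    + Real.sin θ • !![0, -n 2, n 1; n 2, 0, -n 0; -n 1, n 0, 0]
    + (1 - Real.cos θ) • Matrix.vecMulVec n n

/-- `R` is a rotation through the angle `θ` about some axis through the origin. -/
def IsRotationThrough (R : SO3) (θ : ℝ) : Prop :=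
  ∃ n : Fin 3 → ℝ, n ⬝ᵥ n = 1 ∧ (R : Matrix (Fin 3) (Fin 3) ℝ) = rotation n θ

/-- The algebra `𝔢(3)_ρ` of the elements of `𝔢(3)` fixed by `Ad (ρ h)` for all `h`.  An element of
`𝔢(3)` is an infinitesimal motion `v ↦ W v + τ` with `W` skew-symmetric, stored as `(W, τ)`, and
`Ad R (W, τ) = (R W R⁻¹, R τ)` for a rotation `R` about the origin (here `R⁻¹ = Rᵀ`). -/
def centralizerAlgebra (ρ : TrefoilGroup →* SO3) :
    Submodule ℝ (Matrix (Fin 3) (Fin 3) ℝ × (Fin 3 → ℝ)) where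
  carrier := {X | X.1ᵀ = -X.1 ∧ ∀ h : TrefoilGroup,
    (ρ h : Matrix (Fin 3) (Fin 3) ℝ) * X.1 * (ρ h : Matrix (Fin 3) (Fin 3) ℝ)ᵀ = X.1 ∧
    (ρ h : Matrix (Fin 3) (Fin 3) ℝ) *ᵥ X.2 = X.2}
  zero_mem' := by simp
  add_mem' := by
    rintro X Y ⟨hX, hX'⟩ ⟨hY, hY'⟩
    refine ⟨?_, fun h => ⟨?_, ?_⟩⟩
    · simp only [Prod.fst_add, Matrix.transpose_add, hX, hY]; abel
    · simp only [Prod.fst_add, Matrix.mul_add, Matrix.add_mul, (hX' h).1, (hY' h).1]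
    · simp only [Prod.snd_add, Matrix.mulVec_add, (hX' h).2, (hY' h).2]
  smul_mem' := by
    rintro c X ⟨hX, hX'⟩
    refine ⟨?_, fun h => ⟨?_, ?_⟩⟩
    · simp only [Prod.smul_fst, Matrix.transpose_smul, hX, smul_neg]
    · simp only [Prod.smul_fst, Matrix.mul_smul, Matrix.smul_mul, (hX' h).1]
    · simp only [Prod.smul_snd, Matrix.mulVec_smul, (hX' h).2]

/-! ### The pseudotriangulation of the 3-sphere attached to the three-crossing trefoil diagram

`A i` is the upper and `B i` the lower point over the `i`-th crossing, `O` lies below and `P`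
above the diagram.  A simplex of the fundamental family in the branched covering is written through
lifted vertices `g · v`, given as pairs `(g, v)`.  The lift of `A i` is fixed by `xᵢ`, the lift of
`B i` by `xᵢ₊₁`.  The overpass `xᵢ` runs from `B (i-1)` through `A i` to `xᵢ₊₁ · B (i+1)`. -/

/-- The 8 vertices. -/
inductive Vertex : Type
  | A (i : Fin 3)
  | B (i : Fin 3)
  | O
  | P
  deriving DecidableEq, Fintype

/-- The 5 regions of the diagram on the sphere.  `lobe i` is the region with two sides that is
separated from the exterior region by the overpass `xᵢ` and from the central one by `xᵢ₋₁`. -/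
inductive Region : Type
  | exterior
  | lobe (i : Fin 3)
  | centre
  deriving DecidableEq, Fintype

/-- The group element `g` such that `(g · O, P)` is a lift of the edge `OP` through the region. -/
def regionLabel : Region → TrefoilGroup
  | .exterior => 1
  | .lobe i => wirt i
  | .centre => wirt 0 * wirt 1

/-- The 32 edges. -/
inductive Edge : Type
  /-- the link edge from `A i` to `B (i-1)` -/
  | linkOut (i : Fin 3)
  /-- the link edge from `A i` to `xᵢ₊₁ · B (i+1)` -/
  | linkIn (i : Fin 3)
  | AB (i : Fin 3)
  /-- the two edges from `A i` to `O`, on the two sides of the lower strand -/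
  | AO₁ (i : Fin 3)
  | AO₂ (i : Fin 3)
  | AP (i : Fin 3)
  | BO (i : Fin 3)
  /-- the two edges from `B i` to `P`, on the two sides of the upper strand -/
  | BP₁ (i : Fin 3)
  | BP₂ (i : Fin 3)
  | OP (r : Region)
  deriving DecidableEq, Fintype

/-- The end points of the lift of an edge that belongs to the fundamental family. -/
def edgeEnds : Edge → (TrefoilGroup × Vertex) × (TrefoilGroup × Vertex)
  | .linkOut i => ((1, .A i), (1, .B (i - 1)))
  | .linkIn i => ((1, .A i), (wirt (i + 1), .B (i + 1)))
  | .AB i => ((1, .A i), (1, .B i))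
  | .AO₁ i => ((1, .A i), (1, .O))
  | .AO₂ i => ((1, .A i), (wirt (i + 1), .O))
  | .AP i => ((1, .A i), (1, .P))
  | .BO i => ((1, .B i), (1, .O))
  | .BP₁ i => ((1, .B i), (1, .P))
  | .BP₂ i => ((wirt i, .B i), (1, .P))
  | .OP r => ((regionLabel r, .O), (1, .P))

/-- The 24 tetrahedra.  Each of the six link edges has one on either side of it, and there are four
tetrahedra `A i B i O P` at each crossing, one for each quadrant. -/
inductive Tet : Type
  /-- at `linkOut i`, in the exterior region -/
  | outExt (i : Fin 3)
  /-- at `linkOut i`, in the region `lobe i` -/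
  | outLobe (i : Fin 3)
  /-- at `linkIn i`, in the region `lobe (i+1)` -/
  | inLobe (i : Fin 3)
  /-- at `linkIn i`, in the central region -/
  | inCentre (i : Fin 3)
  /-- at the `i`-th crossing, in the exterior region -/
  | crossExt (i : Fin 3)
  /-- at the `i`-th crossing, in the region `lobe (i+1)` -/
  | crossLobeSucc (i : Fin 3)
  /-- at the `i`-th crossing, in the region `lobe i` -/
  | crossLobe (i : Fin 3)
  /-- at the `i`-th crossing, in the central region -/
  | crossCentre (i : Fin 3)
  deriving DecidableEq, Fintype

/-- The lifted vertices of a tetrahedron of the fundamental family, in the order `A, B, O, P`. -/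
def tetVertex : Tet → Fin 4 → TrefoilGroup × Vertex
  | .outExt i =>
      ![(1, .A i), (1, .B (i - 1)), (regionLabel .exterior, .O), (1, .P)]
  | .outLobe i =>
      ![(1, .A i), (1, .B (i - 1)), (regionLabel (.lobe i), .O), (1, .P)]
  | .inLobe i =>
      ![(1, .A i), (wirt (i + 1), .B (i + 1)), (regionLabel (.lobe (i + 1)), .O), (1, .P)]
  | .inCentre i =>
      ![(1, .A i), (wirt (i + 1), .B (i + 1)), (regionLabel .centre, .O), (1, .P)]
  | .crossExt i =>
      ![(1, .A i), (1, .B i), (regionLabel .exterior, .O), (1, .P)]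
  | .crossLobeSucc i =>
      ![(1, .A i), (1, .B i), (regionLabel (.lobe (i + 1)), .O), (1, .P)]
  | .crossLobe i =>
      ![(1, .A i), (wirt i, .B i), (regionLabel (.lobe i), .O), (1, .P)]
  | .crossCentre i =>
      ![(1, .A i), (wirt i, .B i), (regionLabel .centre, .O), (1, .P)]

/-- `1` if the order `A, B, O, P` of the vertices agrees with a fixed orientation of the 3-sphere
and `-1` otherwise.  Tetrahedra glued along a face are glued by an identification respecting the
types `A, B, O, P` of the vertices, so they have opposite signs. -/
def tetOrientation : Tet → ℝ
  | .outExt _ => 1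
  | .outLobe _ => -1
  | .inLobe _ => -1
  | .inCentre _ => 1
  | .crossExt _ => -1
  | .crossLobeSucc _ => 1
  | .crossLobe _ => 1
  | .crossCentre _ => -1

/-- Arranges the sides `AB, AO, AP, BO, BP, OP` of a tetrahedron in a symmetric table with rows and
columns `A, B, O, P`.  The diagonal entries are never used. -/
def sideTable (ab ao ap bo bp op : Edge) : Fin 4 → Fin 4 → Edge :=
  ![![ab, ab, ao, ap], ![ab, ab, bo, bp], ![ao, bo, op, op], ![ap, bp, op, op]]

/-- The edge of the triangulation over which the side `{p, q}` of a tetrahedron lies. -/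
def tetSide : Tet → Fin 4 → Fin 4 → Edge
  | .outExt i => sideTable (.linkOut i) (.AO₁ i) (.AP i) (.BO (i - 1)) (.BP₁ (i - 1)) (.OP .exterior)
  | .outLobe i => sideTable (.linkOut i) (.AO₁ i) (.AP i) (.BO (i - 1)) (.BP₁ (i - 1)) (.OP (.lobe i))
  | .inLobe i =>
      sideTable (.linkIn i) (.AO₂ i) (.AP i) (.BO (i + 1)) (.BP₂ (i + 1)) (.OP (.lobe (i + 1)))
  | .inCentre i => sideTable (.linkIn i) (.AO₂ i) (.AP i) (.BO (i + 1)) (.BP₂ (i + 1)) (.OP .centre)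
  | .crossExt i => sideTable (.AB i) (.AO₁ i) (.AP i) (.BO i) (.BP₁ i) (.OP .exterior)
  | .crossLobeSucc i => sideTable (.AB i) (.AO₂ i) (.AP i) (.BO i) (.BP₁ i) (.OP (.lobe (i + 1)))
  | .crossLobe i => sideTable (.AB i) (.AO₁ i) (.AP i) (.BO i) (.BP₂ i) (.OP (.lobe i))
  | .crossCentre i => sideTable (.AB i) (.AO₂ i) (.AP i) (.BO i) (.BP₂ i) (.OP .centre)

/-! ### The equivariant map to Euclidean space -/

/-- The equivariant map `Γ` is given by the images of the base lifts of the vertices; the lifts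
`g · A i` and `g · B i` are well defined only modulo the stabilizers of `A i` and `B i`. -/
def IsEquivariant (ρ : TrefoilGroup →* SO3) (Γ : Vertex → Fin 3 → ℝ) : Prop :=
  ∀ i : Fin 3,
    (ρ (wirt i) : Matrix (Fin 3) (Fin 3) ℝ) *ᵥ Γ (.A i) = Γ (.A i) ∧
    (ρ (wirt (i + 1)) : Matrix (Fin 3) (Fin 3) ℝ) *ᵥ Γ (.B i) = Γ (.B i)

/-- The image of the lifted vertex `g · v`. -/
def liftPos (ρ : TrefoilGroup →* SO3) (Γ : Vertex → Fin 3 → ℝ) (w : TrefoilGroup × Vertex) :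
    Fin 3 → ℝ :=
  (ρ w.1 : Matrix (Fin 3) (Fin 3) ℝ) *ᵥ Γ w.2

/-- `L_e = l_e² / 2`, where `l_e` is the Euclidean length of the image of the edge `e`. -/
noncomputable def halfSqLength (ρ : TrefoilGroup →* SO3) (Γ : Vertex → Fin 3 → ℝ) (e : Edge) : ℝ :=
  (liftPos ρ Γ (edgeEnds e).1 - liftPos ρ Γ (edgeEnds e).2) ⬝ᵥ
    (liftPos ρ Γ (edgeEnds e).1 - liftPos ρ Γ (edgeEnds e).2) / 2

/-- The signed volume of the image of a tetrahedron. -/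
noncomputable def volume (ρ : TrefoilGroup →* SO3) (Γ : Vertex → Fin 3 → ℝ) (T : Tet) : ℝ :=
  tetOrientation T *
    (Matrix.of ![liftPos ρ Γ (tetVertex T 1) - liftPos ρ Γ (tetVertex T 0),
      liftPos ρ Γ (tetVertex T 2) - liftPos ρ Γ (tetVertex T 0),
      liftPos ρ Γ (tetVertex T 3) - liftPos ρ Γ (tetVertex T 0)]).det / 6

/-- All the volumes are nonzero. -/
def InGeneralPosition (ρ : TrefoilGroup →* SO3) (Γ : Vertex → Fin 3 → ℝ) : Prop :=
  ∀ T : Tet, volume ρ Γ T ≠ 0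

/-- The interior dihedral angle at the edge `{p, q}` of a Euclidean tetrahedron with vertices
`p, q, r, s`, where `M p q` is half of the squared length of the edge `{p, q}`, and so on.
With `e = q - p`, `a = r - p`, `b = s - p` it is the angle between the components of `a` and `b`
orthogonal to `e`, and `⟨a, b⟩ = M p r + M p s - M r s`, etc. -/
noncomputable def dihedral (M : Fin 4 → Fin 4 → ℝ) (p q r s : Fin 4) : ℝ :=
  let ee := 2 * M p q
  let aa := 2 * M p r
  let bb := 2 * M p s
  let ae := M p r + M p q - M q r
  let be := M p s + M p q - M q s
  let ab := M p r + M p s - M r s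
  Real.arccos ((ab * ee - ae * be) / Real.sqrt ((aa * ee - ae ^ 2) * (bb * ee - be ^ 2)))

/-- The six edges `{p, q}` of a tetrahedron, each followed by its opposite edge `{r, s}`. -/
def tetPairs : Fin 6 → Fin 4 × Fin 4 × Fin 4 × Fin 4 :=
  ![(0, 1, 2, 3), (0, 2, 1, 3), (0, 3, 1, 2), (1, 2, 0, 3), (1, 3, 0, 2), (2, 3, 0, 1)]

/-- The sum of the signed dihedral angles at the edge `e`, over all the sides of all the tetrahedra
of the fundamental family that lie over `e`, when the (halved squared) lengths of the edges are
`L`.  The dihedral angles of `T` carry the sign of `volume ρ Γ T`. -/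
noncomputable def angleSum (ρ : TrefoilGroup →* SO3) (Γ : Vertex → Fin 3 → ℝ) (L : Edge → ℝ)
    (e : Edge) : ℝ :=
  ∑ T : Tet, ∑ k : Fin 6,
    if tetSide T (tetPairs k).1 (tetPairs k).2.1 = e then
      Real.sign (volume ρ Γ T) *
        dihedral (fun p q => L (tetSide T p q)) (tetPairs k).1 (tetPairs k).2.1
          (tetPairs k).2.2.1 (tetPairs k).2.2.2
    else 0

/-- The defect angle `ω_e` as a function of the edge lengths near the lengths of `Γ`: the full angle
around `e` minus the sum of the signed dihedral angles at `e`.  The full angle is determined modulo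
`2π` (it is `2π` off the link and plus or minus the rotation angle `φ₁` on it), and the configuration
that comes from `Γ` is flat, `ω_e = 0`; this condition fixes the representative of the full angle
as the angle sum at the lengths of `Γ`. -/
noncomputable def defect (ρ : TrefoilGroup →* SO3) (Γ : Vertex → Fin 3 → ℝ) (L : Edge → ℝ)
    (e : Edge) : ℝ :=
  angleSum ρ Γ (halfSqLength ρ Γ) e - angleSum ρ Γ L e

/-- `Ω_e = ω_e / l_e`. -/
noncomputable def bigOmega (ρ : TrefoilGroup →* SO3) (Γ : Vertex → Fin 3 → ℝ) (L : Edge → ℝ)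
    (e : Edge) : ℝ :=
  defect ρ Γ L e / Real.sqrt (2 * L e)

/-! ### The complex and its torsion -/

/-- `u i` is a unit directing vector of the axis of `ρ (xᵢ)`. -/
def IsAxisFamily (ρ : TrefoilGroup →* SO3) (u : Fin 3 → Fin 3 → ℝ) : Prop :=
  ∀ i : Fin 3, u i ⬝ᵥ u i = 1 ∧ (ρ (wirt i) : Matrix (Fin 3) (Fin 3) ℝ) *ᵥ u i = u i

/-- The distinguished basis of the space `(dx)`: one coordinate, along the axis, for each vertex on
the link and three Cartesian coordinates for each of `O` and `P`. -/
inductive Coord : Type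
  | a (i : Fin 3)
  | b (i : Fin 3)
  | o (j : Fin 3)
  | p (j : Fin 3)
  deriving DecidableEq, Fintype

/-- The displacement of the vertices given by a basis vector of `(dx)`. -/
def displacement (u : Fin 3 → Fin 3 → ℝ) : Coord → Vertex → Fin 3 → ℝ
  | .a i => Pi.single (.A i) (u i)
  | .b i => Pi.single (.B i) (u (i + 1))
  | .o j => Pi.single .O (Pi.single j 1)
  | .p j => Pi.single .P (Pi.single j 1)

/-- The matrix of `f₁ : 𝔢(3)_ρ → (dx)`: the velocity field `v ↦ W v + τ` at the vertices, in
coordinates.  `β` is the distinguished basis of `𝔢(3)_ρ`. -/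
noncomputable def f₁ {n : ℕ} (ρ : TrefoilGroup →* SO3) (u : Fin 3 → Fin 3 → ℝ)
    (Γ : Vertex → Fin 3 → ℝ) (β : Module.Basis (Fin n) ℝ (centralizerAlgebra ρ)) :
    Matrix Coord (Fin n) ℝ :=
  Matrix.of fun c k => ∑ v : Vertex,
    displacement u c v ⬝ᵥ ((β k).1.1 *ᵥ Γ v + (β k).1.2)

/-- The matrix of `f₂ : (dx) → (dL)`, the partial derivatives of the `L_e` in the coordinates of
the vertices. -/
noncomputable def f₂ (ρ : TrefoilGroup →* SO3) (u : Fin 3 → Fin 3 → ℝ)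
    (Γ : Vertex → Fin 3 → ℝ) : Matrix Edge Coord ℝ :=
  Matrix.of fun e c => deriv (fun t : ℝ => halfSqLength ρ (Γ + t • displacement u c) e) 0

/-- The matrix of `f₃ : (dL) → (dΩ)`, the partial derivatives `∂Ω_e / ∂L_e'` at the lengths of
`Γ`. -/
noncomputable def f₃ (ρ : TrefoilGroup →* SO3) (Γ : Vertex → Fin 3 → ℝ) : Matrix Edge Edge ℝ :=
  Matrix.of fun e e' =>
    deriv (fun s : ℝ => bigOmega ρ Γ (Function.update (halfSqLength ρ Γ) e' s) e)
      (halfSqLength ρ Γ e')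

/-- A choice of subsets of the distinguished bases: `(dx)` is split into `B₁` (of size
`n = dim 𝔢(3)_ρ`) and its complement `C₁`, and `(dL)` into `B₂` and its complement `B₃`. -/
structure MinorChoice (n m k : ℕ) where
  B₁ : Fin n → Coord
  C₁ : Fin m → Coord
  B₂ : Fin m → Edge
  B₃ : Fin k → Edge
  bijective_coord : Function.Bijective (Sum.elim B₁ C₁)
  bijective_edge : Function.Bijective (Sum.elim B₂ B₃)

namespace MinorChoice

variable {n m k : ℕ} (s : MinorChoice n m k)

noncomputable def minor₁ (ρ : TrefoilGroup →* SO3) (u : Fin 3 → Fin 3 → ℝ)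
    (Γ : Vertex → Fin 3 → ℝ) (β : Module.Basis (Fin n) ℝ (centralizerAlgebra ρ)) : ℝ :=
  ((f₁ ρ u Γ β).submatrix s.B₁ id).det

noncomputable def minor₂ (ρ : TrefoilGroup →* SO3) (u : Fin 3 → Fin 3 → ℝ)
    (Γ : Vertex → Fin 3 → ℝ) : ℝ :=
  ((f₂ ρ u Γ).submatrix s.B₂ s.C₁).det

noncomputable def minor₃ (ρ : TrefoilGroup →* SO3) (Γ : Vertex → Fin 3 → ℝ) : ℝ :=
  ((f₃ ρ Γ).submatrix s.B₃ s.B₃).det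

/-- The three minors are nonzero, so that they can be used to compute the torsion. -/
def Nondegenerate (ρ : TrefoilGroup →* SO3) (u : Fin 3 → Fin 3 → ℝ)
    (Γ : Vertex → Fin 3 → ℝ) (β : Module.Basis (Fin n) ℝ (centralizerAlgebra ρ)) : Prop :=
  s.minor₁ ρ u Γ β ≠ 0 ∧ s.minor₂ ρ u Γ ≠ 0 ∧ s.minor₃ ρ Γ ≠ 0

/-- The torsion
`τ = (minor f₂)² (-1)^(rank f₂) / (minor f₃ (minor f₁)²)` of the complex
`0 → 𝔢(3)_ρ → (dx) → (dL) → (dΩ) → (dx)* → 𝔢(3)_ρ* → 0` with the maps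
`f₁, f₂, f₃, -f₂ᵀ, f₁ᵀ`. -/
noncomputable def torsion (ρ : TrefoilGroup →* SO3) (u : Fin 3 → Fin 3 → ℝ)
    (Γ : Vertex → Fin 3 → ℝ) (β : Module.Basis (Fin n) ℝ (centralizerAlgebra ρ)) : ℝ :=
  s.minor₂ ρ u Γ ^ 2 * (-1) ^ (f₂ ρ u Γ).rank / (s.minor₃ ρ Γ * s.minor₁ ρ u Γ β ^ 2)

/-- The invariant
`I_ρ = τ (2 - 2 cos φ₁)^6 / (∏' l² ∏ (-6 V))`: the trefoil has one component, which carries the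
6 vertices `A i`, `B i`; the first product is over the 6 edges on the link and the second one over
all the tetrahedra. -/
noncomputable def invariant (ρ : TrefoilGroup →* SO3) (u : Fin 3 → Fin 3 → ℝ)
    (Γ : Vertex → Fin 3 → ℝ) (β : Module.Basis (Fin n) ℝ (centralizerAlgebra ρ)) (φ₁ : ℝ) : ℝ :=
  s.torsion ρ u Γ β *
    ((2 - 2 * Real.cos φ₁) ^ 6 /
      ((∏ i : Fin 3,
          (2 * halfSqLength ρ Γ (.linkOut i)) * (2 * halfSqLength ρ Γ (.linkIn i))) *
        ∏ T : Tet, (-6 * volume ρ Γ T)))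

end MinorChoice

end TrefoilInvariant

/-! The quadratic form of `f₃` is brought to an explicit normal form; every volume, coordinate and
length then cancels against the normalising factor of the invariant, and the number 4 remains.

The form. The defects vanish at `Γ`, so `∂Ω/∂L` is `-1/l` times the derivative of the angle sum. The
derivative of a dihedral angle carries the factor `l / |6V|`; hence no square roots survive, and
`f₃` is a symmetric matrix given as a sum over tetrahedra (`f₃_form`, `f₃_symm`). Moving the
vertices changes a dihedral angle by the difference of the spin rates of its two faces. Each face of
the triangulation occurs twice with opposite signs, so these contributions cancel and `f₃ f₂ = 0`
(`f₃_edgeVar`).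

Diagonalisation. All rotations fix the origin, so the cones from the origin over the faces also
cancel in the total (`sum_coneBoundary`). Five points in general position in 3-space have one stress
up to scale, and therefore a tetrahedron together with its cones gives a form of rank one
(`tetForm_cross`): one square for each of the 12 quadrants of the crossings. At a link edge the two
link vertices are collinear with the origin. The two tetrahedra beside such an edge give a form in
only two functionals (`tetForm_collinear`), whose determinant contains the factor `2 - 2 cos φ₁`
(`IsGeneric.det_linkBlock`). The six link edges together produce the power `(2 - 2 cos φ₁)^6`.

The minors. `minor_reduction` expresses the minor of `f₃` on `B₃` through the square of the minor of
`f₂` on `B₂`, for every choice at once, with a factor built from determinants in bases adapted to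
the normal form. These are the basis of edge variations (`sqDet_edgeBasis`), the basis of
displacements (`sqDet_moveMatrix`), the elimination of the functionals with monomial pivots
(`det_squareRows`), and a 3 by 3 determinant for the functionals left over (`det_moveRows`). With
`c` the cosine between two axes, the last pivot and the 3 by 3 determinant both contain `(1 - c)/(1
+ c)`, and the latter has an additional factor 2. Its square is the value of the invariant
(`monomial_relation`).

This requires that the origin is in general position too. The resulting relation between the minors
has no denominators, so it extends by continuity to all `Γ` (`IsCoherent.minor_relation`).
Infinitesimal rigidity makes `f₂` injective (`displacement_eq_zero`), so a nonzero minor of `f₂`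
exists, and the relation makes the complementary minor of `f₃` nonzero.

The representation. `ρ(x₁x₂)` has cube 1 and conjugates the images of the Wirtinger generators
cyclically. Carrying one axis around by it gives coherently directed axes (`exists_isCoherent`), in
which everything is computed. Non-commutativity makes the axes distinct, which also forces the
centralizer algebra to vanish, and a trace gives `cos φ₁`. -/

namespace TrefoilInvariant

/-! ### Squares of determinants of matrices with rows and columns in different types -/

section SqDet

variable {α β γ δ : Type*} [Fintype α] [Fintype β] [Fintype γ] [Fintype δ]
  [DecidableEq α] [DecidableEq β] [DecidableEq γ] [DecidableEq δ]

open Classical in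
/-- The square of the determinant; it does not depend on an identification of rows and columns. -/
noncomputable def sqDet (M : Matrix α β ℝ) : ℝ :=
  if h : Nonempty (β ≃ α) then (M.submatrix h.some id).det ^ 2 else 0

/-- Two identifications of columns with rows differ by a permutation, which affects the determinant
only by its sign. -/
theorem sqDet_eq (M : Matrix α β ℝ) (e : β ≃ α) : sqDet M = (M.submatrix e id).det ^ 2 := by
  have h : Nonempty (β ≃ α) := ⟨e⟩
  rw [sqDet, dif_pos h, ← sq_abs, ← sq_abs (M.submatrix e id).det]
  congr 1
  have := Matrix.abs_det_submatrix_equiv_equiv (h.some.trans e.symm) (Equiv.refl β)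
    (M.submatrix e id)
  rw [← this]
  congr 2
  ext i j
  simp

theorem sqDet_self (M : Matrix α α ℝ) : sqDet M = M.det ^ 2 := sqDet_eq M (Equiv.refl α)

theorem sqDet_submatrix (M : Matrix α β ℝ) (f : γ ≃ α) (g : δ ≃ β) (e : β ≃ α) :
    sqDet (M.submatrix f g) = sqDet M := by
  rw [sqDet_eq M e, sqDet_eq _ ((g.trans e).trans f.symm)]
  congr 1
  have : (M.submatrix f g).submatrix ((g.trans e).trans f.symm) id
      = (M.submatrix e id).submatrix g g := by
    ext i j; simp
  rw [this, Matrix.det_submatrix_equiv_self]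

theorem sqDet_mul (M : Matrix α β ℝ) (N : Matrix β γ ℝ) (e : β ≃ α) (f : γ ≃ β) :
    sqDet (M * N) = sqDet M * sqDet N := by
  rw [sqDet_eq M e, sqDet_eq N f, sqDet_eq _ (f.trans e), ← mul_pow, mul_comm]
  congr 1
  rw [← Matrix.det_submatrix_equiv_self f (M.submatrix e id), mul_comm, ← Matrix.det_mul]
  congr 1
  ext i j
  simp only [submatrix_apply, mul_apply, Equiv.coe_trans, Function.comp, id]
  exact (Equiv.sum_comp f fun k => M (e (f i)) k * N k j).symm

/-- The transformation law of the determinant of a bilinear form. Only the square of the transition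
determinant enters, so bases indexed by unrelated types cause no sign problem. -/
theorem det_transpose_mul_mul (M : Matrix α β ℝ) (Λ : Matrix α α ℝ) (e : β ≃ α) :
    (Mᵀ * Λ * M).det = Λ.det * sqDet M := by
  have h : Mᵀ * Λ * M = (M.submatrix e id)ᵀ * (Λ.submatrix e e) * (M.submatrix e id) := by
    rw [transpose_submatrix, Matrix.submatrix_mul_equiv, Matrix.submatrix_mul_equiv, submatrix_id_id]
  rw [h, det_mul, det_mul, det_transpose, det_submatrix_equiv_self, sqDet_eq M e]
  ring

theorem sqDet_fromBlocks_zero₂₁ {α' β' : Type*} [Fintype α'] [Fintype β'] [DecidableEq α']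
    [DecidableEq β'] (A : Matrix α β ℝ) (B : Matrix α β' ℝ) (D : Matrix α' β' ℝ)
    (e : β ≃ α) (f : β' ≃ α') :
    sqDet (fromBlocks A B 0 D) = sqDet A * sqDet D := by
  rw [sqDet_eq _ (Equiv.sumCongr e f), sqDet_eq A e, sqDet_eq D f, ← mul_pow]
  have : (fromBlocks A B 0 D).submatrix (Equiv.sumCongr e f) id
      = fromBlocks (A.submatrix e id) (B.submatrix e id) 0 (D.submatrix f id) := by
    ext (i | i) (j | j) <;> rfl
  rw [this, det_fromBlocks_zero₂₁]

theorem sqDet_fromBlocks_zero₁₂ {α' β' : Type*} [Fintype α'] [Fintype β'] [DecidableEq α']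
    [DecidableEq β'] (A : Matrix α β ℝ) (C : Matrix α' β ℝ) (D : Matrix α' β' ℝ)
    (e : β ≃ α) (f : β' ≃ α') :
    sqDet (fromBlocks A 0 C D) = sqDet A * sqDet D := by
  rw [sqDet_eq _ (Equiv.sumCongr e f), sqDet_eq A e, sqDet_eq D f, ← mul_pow]
  have : (fromBlocks A 0 C D).submatrix (Equiv.sumCongr e f) id
      = fromBlocks (A.submatrix e id) 0 (C.submatrix f id) (D.submatrix f id) := by
    ext (i | i) (j | j) <;> rfl
  rw [this, det_fromBlocks_zero₁₂]

/-- The determinant of a symmetric form with an isotropic summand. -/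
theorem det_isotropic (A : Matrix α α ℝ) (C₁ : Matrix α β ℝ) (C₂ : Matrix β β ℝ)
    (D₁ : Matrix β α ℝ) (D₂ Z : Matrix β β ℝ) :
    (fromBlocks (fromBlocks A 0 0 0) (fromRows C₁ C₂) (fromCols D₁ D₂) Z).det
      = (-1) ^ Fintype.card β * (A.det * C₂.det * D₂.det) := by
  -- Exchanging the two groups of columns indexed by `β` makes the matrix block triangular; the
  -- exchange accounts for the sign.
  have h1 : fromBlocks (fromBlocks A 0 0 0) (fromRows C₁ C₂) (fromCols D₁ D₂) Z
      = (fromBlocks A (fromCols 0 C₁) (fromRows 0 D₁) (fromBlocks 0 C₂ D₂ Z)).submatrix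
        (Equiv.sumAssoc α β β) (Equiv.sumAssoc α β β) := by
    ext ((i | i) | i) ((j | j) | j) <;> rfl
  have h2 : fromBlocks A (fromCols 0 C₁) (fromRows 0 D₁) (fromBlocks 0 C₂ D₂ Z)
      * fromBlocks (1 : Matrix α α ℝ) 0 0 (fromBlocks 0 1 1 0 : Matrix (β ⊕ β) (β ⊕ β) ℝ)
      = fromBlocks A (fromCols C₁ 0) (fromRows 0 D₁) (fromBlocks C₂ 0 Z D₂) := by
    rw [fromBlocks_multiply, fromBlocks_multiply]
    simp only [Matrix.mul_one, Matrix.mul_zero, add_zero, zero_add]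
    congr 1
    ext i (j | j) <;> simp [Matrix.mul_apply, fromBlocks, Matrix.one_apply]
  -- The sign of the exchange: a unipotent factor puts `1` in the corner, and the Schur complement
  -- is then `-1`.
  have h3 : (fromBlocks 0 1 1 0 : Matrix (β ⊕ β) (β ⊕ β) ℝ).det = (-1) ^ Fintype.card β := by
    have h4 : (fromBlocks 0 1 1 0 : Matrix (β ⊕ β) (β ⊕ β) ℝ) * fromBlocks 1 0 1 1
        = fromBlocks 1 1 1 0 := by
      rw [fromBlocks_multiply]; simp
    have h5 := congrArg det h4
    rw [det_mul, det_fromBlocks_zero₁₂, det_fromBlocks_one₁₁] at h5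
    simpa [det_neg] using h5
  have h6 : (fromBlocks A (fromCols C₁ 0) (fromRows 0 D₁) (fromBlocks C₂ 0 Z D₂)).det
      = A.det * C₂.det * D₂.det := by
    have h7 : fromBlocks A (fromCols C₁ 0) (fromRows 0 D₁) (fromBlocks C₂ 0 Z D₂)
      = (fromBlocks (fromBlocks A C₁ 0 C₂) 0 (fromCols D₁ Z) D₂).submatrix
        (Equiv.sumAssoc α β β).symm (Equiv.sumAssoc α β β).symm := by
      ext (i | (i | i)) (j | (j | j)) <;> rfl
    rw [h7, det_submatrix_equiv_self, det_fromBlocks_zero₁₂, det_fromBlocks_zero₂₁]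
  rw [h1, det_submatrix_equiv_self]
  have h8 := congrArg det h2
  rw [det_mul, det_fromBlocks_zero₁₂, det_one, one_mul, h3, h6] at h8
  have h9 : ((-1 : ℝ) ^ Fintype.card β) * (-1) ^ Fintype.card β = 1 := by
    rw [← mul_pow]; simp
  linear_combination (-1) ^ Fintype.card β * h8
    - (fromBlocks A (fromCols 0 C₁) (fromRows 0 D₁) (fromBlocks 0 C₂ D₂ Z)).det * h9

/-- A matrix whose nonzero off-diagonal entries respect a ranking is triangular. -/
theorem det_of_ranking (M : Matrix α α ℝ) (r : α → ℕ)
    (h : ∀ i j, i ≠ j → M i j ≠ 0 → r i < r j) : M.det = ∏ i, M i i := by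
  rw [det_apply, Finset.sum_eq_single (1 : Equiv.Perm α)]
  · simp
  · intro σ _ hσ
    -- A permutation with nonzero product lowers the rank weakly at every index and strictly where
    -- it moves one, yet the sum of all ranks is permutation invariant.
    suffices h0 : ∏ i, M (σ i) i = 0 by rw [h0, smul_zero]
    by_contra hne
    have h1 : ∀ i, M (σ i) i ≠ 0 := fun i => Finset.prod_ne_zero_iff.1 hne i (Finset.mem_univ i)
    obtain ⟨j, hj⟩ : ∃ j, σ j ≠ j := by
      by_contra hall; push Not at hall; exact hσ (Equiv.ext hall)
    have h2 : ∑ i, r (σ i) < ∑ i, r i := by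
      refine Finset.sum_lt_sum (fun i _ => ?_) ⟨j, Finset.mem_univ j, h _ _ hj (h1 j)⟩
      by_cases hi : σ i = i
      · rw [hi]
      · exact (h _ _ hi (h1 i)).le
    rw [Equiv.sum_comp σ r] at h2
    exact lt_irrefl _ h2
  · simp

end SqDet

/-! ### The minors of a degenerate symmetric form -/

section Reduction

variable {E m k Q y r L : Type*} [Fintype E] [Fintype m] [Fintype k] [Fintype Q] [Fintype y]
  [Fintype r] [Fintype L] [DecidableEq E] [DecidableEq m] [DecidableEq k] [DecidableEq Q]
  [DecidableEq y] [DecidableEq r] [DecidableEq L]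

theorem fromRows_zero_one_transpose_mul {β : Type*} (X : Matrix (Q ⊕ y) β ℝ) :
    (fromRows 0 1 : Matrix (Q ⊕ y) y ℝ)ᵀ * X = X.toRows₂ := by
  ext i j
  simp [Matrix.mul_apply, Matrix.transpose_apply, Matrix.one_apply]

/-- The rows `y` are the functionals beyond the square block of `Kb`, the columns `Y` span radical
directions of the form, and `R` spans the kernel of `Kb`. Adjoining the unit vectors of `y` to the
image of `[n Y]` gives a square matrix; in these vectors `Λ` takes the isotropic shape of
`det_isotropic`, and comparing determinants isolates the restriction of the form to `n`. -/
theorem minor_reduction_flat (Kb : Matrix (Q ⊕ y) (Q ⊕ r) ℝ) (Λ : Matrix (Q ⊕ y) (Q ⊕ y) ℝ)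
    (hΛ : Λᵀ = Λ)
    (Y : Matrix (Q ⊕ r) y ℝ) (R : Matrix (Q ⊕ r) r ℝ) (n : Matrix (Q ⊕ r) k ℝ)
    (hR : Kb * R = 0) (hY : Kbᵀ * Λ * Kb * Y = 0) (hR2 : R.toRows₂.det ≠ 0) (e : k ⊕ y ≃ Q) :
    (nᵀ * (Kbᵀ * Λ * Kb) * n).det * (Λ * Kb * Y).toRows₂.det ^ 2 * R.toRows₂.det ^ 2
      = (-1) ^ Fintype.card y * Λ.det * Kb.toBlocks₁₁.det ^ 2
        * sqDet (fromCols (fromCols n Y) R) := by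
  set n' : Matrix (Q ⊕ r) (k ⊕ y) ℝ := fromCols n Y with hn'
  -- Subtracting multiples of the kernel vectors `R` clears the rows `r` of `n'`; the remainder `A`
  -- lives on the rows `Q` and has the same image under `Kb`.
  set B : Matrix r (k ⊕ y) ℝ := R.toRows₂⁻¹ * n'.toRows₂ with hB
  set A : Matrix Q (k ⊕ y) ℝ := n'.toRows₁ - R.toRows₁ * B with hA
  have hu : IsUnit R.toRows₂.det := isUnit_iff_ne_zero.2 hR2
  have h2 : R.toRows₂ * B = n'.toRows₂ := by rw [hB, mul_nonsing_inv_cancel_left _ _ hu]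
  have hnA : n' = fromRows A 0 + R * B := by
    have : R * B = fromRows (R.toRows₁ * B) (R.toRows₂ * B) := by
      rw [← fromRows_mul, fromRows_toRows]
    rw [this, h2, hA]
    ext (i | i) j <;> simp
  have s1 : sqDet (fromCols n' R) = sqDet A * R.toRows₂.det ^ 2 := by
    have : fromCols n' R = fromBlocks A R.toRows₁ 0 R.toRows₂
        * (fromBlocks 1 0 B 1 : Matrix ((k ⊕ y) ⊕ r) ((k ⊕ y) ⊕ r) ℝ) := by
      rw [fromBlocks_multiply]
      simp only [Matrix.mul_one, Matrix.mul_zero, Matrix.zero_mul, zero_add]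
      rw [hnA]
      ext (i | i) (j | j)
      · simp [Matrix.mul_apply]
      · simp
      · simp [Matrix.mul_apply]
      · simp
    rw [this, sqDet_mul _ _ (Equiv.sumCongr e (Equiv.refl r)) (Equiv.refl _),
      sqDet_fromBlocks_zero₂₁ _ _ _ e (Equiv.refl r), sqDet_self, sqDet_self,
      det_fromBlocks_zero₁₂, det_one, det_one]
    ring
  have hKn : Kb * n' = fromRows (Kb.toBlocks₁₁ * A) (Kb.toBlocks₂₁ * A) := by
    rw [hnA, Matrix.mul_add, ← Matrix.mul_assoc, hR, Matrix.zero_mul, add_zero]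
    conv_lhs => rw [← fromBlocks_toBlocks Kb]
    ext (i | i) j <;> simp [Matrix.mul_apply]
  set M : Matrix (Q ⊕ y) ((k ⊕ y) ⊕ y) ℝ := fromCols (Kb * n') (fromRows 0 1) with hM
  have s2 : sqDet M = sqDet A * Kb.toBlocks₁₁.det ^ 2 := by
    have : M = fromBlocks (Kb.toBlocks₁₁ * A) 0 (Kb.toBlocks₂₁ * A) 1 := by
      rw [hM, hKn]; ext (i | i) (j | j) <;> rfl
    rw [this, sqDet_fromBlocks_zero₁₂ _ _ _ e (Equiv.refl y), sqDet_mul _ _ (Equiv.refl Q) e,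
      sqDet_self, sqDet_self, det_one]
    ring
  -- The determinant of this Gram matrix is computed twice: by change of basis here, by its block
  -- shape below.
  have s3 : (Mᵀ * Λ * M).det = Λ.det * sqDet M :=
    det_transpose_mul_mul M Λ (Equiv.sumCongr e (Equiv.refl y))
  have hsym : (Kbᵀ * Λ * Kb)ᵀ = Kbᵀ * Λ * Kb := by
    simp only [transpose_mul, transpose_transpose, hΛ, Matrix.mul_assoc]
  have hY' : Yᵀ * (Kbᵀ * Λ * Kb) = 0 := by
    rw [← hsym, ← transpose_mul, hY, transpose_zero]
  have s4 : Mᵀ * Λ * M = fromBlocks (fromBlocks (nᵀ * (Kbᵀ * Λ * Kb) * n) 0 0 0)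
      (fromRows ((Λ * Kb * n).toRows₂)ᵀ ((Λ * Kb * Y).toRows₂)ᵀ)
      (fromCols (Λ * Kb * n).toRows₂ (Λ * Kb * Y).toRows₂) Λ.toBlocks₂₂ := by
    have a1 : Mᵀ * Λ * M = fromBlocks ((Kb * n')ᵀ * Λ * (Kb * n'))
        ((Kb * n')ᵀ * Λ * (fromRows 0 1 : Matrix (Q ⊕ y) y ℝ))
        ((fromRows 0 1 : Matrix (Q ⊕ y) y ℝ)ᵀ * Λ * (Kb * n'))
        ((fromRows 0 1 : Matrix (Q ⊕ y) y ℝ)ᵀ * Λ * (fromRows 0 1 : Matrix (Q ⊕ y) y ℝ)) := by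
      rw [hM, transpose_fromCols, fromRows_mul, fromRows_mul_fromCols]
    have a3 : (fromRows 0 1 : Matrix (Q ⊕ y) y ℝ)ᵀ * Λ * (Kb * n')
        = fromCols (Λ * Kb * n).toRows₂ (Λ * Kb * Y).toRows₂ := by
      rw [Matrix.mul_assoc, fromRows_zero_one_transpose_mul, ← Matrix.mul_assoc, hn', mul_fromCols]
      ext i (j | j) <;> rfl
    have a4 : (Kb * n')ᵀ * Λ * (fromRows 0 1 : Matrix (Q ⊕ y) y ℝ)
        = fromRows ((Λ * Kb * n).toRows₂)ᵀ ((Λ * Kb * Y).toRows₂)ᵀ := by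
      have := congrArg transpose a3
      rw [transpose_fromCols] at this
      rw [← this]
      simp only [transpose_mul, transpose_transpose, hΛ, Matrix.mul_assoc]
    have a5 : (Kb * n')ᵀ * Λ * (Kb * n') = fromBlocks (nᵀ * (Kbᵀ * Λ * Kb) * n) 0 0 0 := by
      have : (Kb * n')ᵀ * Λ * (Kb * n') = n'ᵀ * (Kbᵀ * Λ * Kb) * n' := by
        simp only [transpose_mul, Matrix.mul_assoc]
      rw [this, hn', transpose_fromCols, fromRows_mul, fromRows_mul_fromCols, hY', Matrix.zero_mul,
        Matrix.zero_mul, Matrix.mul_assoc nᵀ _ Y, hY, Matrix.mul_zero]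
    have a6 : (fromRows 0 1 : Matrix (Q ⊕ y) y ℝ)ᵀ * Λ * (fromRows 0 1 : Matrix (Q ⊕ y) y ℝ)
        = Λ.toBlocks₂₂ := by
      rw [fromRows_zero_one_transpose_mul]
      ext i j
      simp [Matrix.mul_apply, Matrix.one_apply, Matrix.toBlocks₂₂]
    rw [a1, a3, a4, a5, a6]
  rw [s4, det_isotropic, det_transpose, s2] at s3
  have h9 : ((-1 : ℝ) ^ Fintype.card y) * (-1) ^ Fintype.card y = 1 := by
    rw [← mul_pow]; simp
  rw [s1]
  linear_combination (-1) ^ Fintype.card y * R.toRows₂.det ^ 2 * s3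
    - (nᵀ * (Kbᵀ * Λ * Kb) * n).det * (Λ * Kb * Y).toRows₂.det ^ 2 * R.toRows₂.det ^ 2 * h9

/-- The complementary minors of `S` and `F` are related through any basis `[Bas mv]` of the edge
space in which `S` factors as `Kbᵀ Λ Kb`. The unit vectors of the rows chosen for `S` are expanded
in this basis. Their determinant together with the image of `F` is the minor of `F`, while the form
in their coordinates is handled by `minor_reduction_flat`. -/
theorem minor_reduction {S : Matrix E E ℝ} {F : Matrix E m ℝ} (hS : Sᵀ = S) (hSF : S * F = 0)
    (ι : m ⊕ k ≃ E) (Bas : Matrix E (Q ⊕ r) ℝ) (mv : Matrix E L ℝ) (eB : (Q ⊕ r) ⊕ L ≃ E)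
    (hB : sqDet (fromCols Bas mv) ≠ 0)
    (T : Matrix m (L ⊕ (y ⊕ r)) ℝ) (eT : L ⊕ (y ⊕ r) ≃ m)
    (Y : Matrix (Q ⊕ r) y ℝ) (R : Matrix (Q ⊕ r) r ℝ)
    (hT : F * T = fromCols mv (Bas * fromCols Y R))
    (Kb : Matrix (Q ⊕ y) (Q ⊕ r) ℝ) (Λ : Matrix (Q ⊕ y) (Q ⊕ y) ℝ) (hΛ : Λᵀ = Λ)
    (hK : Basᵀ * S * Bas = Kbᵀ * Λ * Kb) (hR : Kb * R = 0) (hR2 : R.toRows₂.det ≠ 0)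
    (e : k ⊕ y ≃ Q) :
    (S.submatrix (ι ∘ Sum.inr) (ι ∘ Sum.inr)).det * (Λ * Kb * Y).toRows₂.det ^ 2
        * R.toRows₂.det ^ 2 * sqDet (fromCols Bas mv)
      = (-1) ^ Fintype.card y * Λ.det * Kb.toBlocks₁₁.det ^ 2 * sqDet T
        * (F.submatrix (ι ∘ Sum.inl) id).det ^ 2 := by
  have hST : S * fromCols mv (Bas * fromCols Y R) = 0 := by
    rw [← hT, ← Matrix.mul_assoc, hSF, Matrix.zero_mul]
  rw [mul_fromCols] at hST
  have hSmv : S * mv = 0 := by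
    ext i j; exact congrFun (congrFun hST i) (Sum.inl j)
  have hSY' : S * (Bas * fromCols Y R) = 0 := by
    ext i j; exact congrFun (congrFun hST i) (Sum.inr j)
  have hSY : S * (Bas * Y) = 0 := by
    rw [mul_fromCols, mul_fromCols] at hSY'
    ext i j; exact congrFun (congrFun hSY' i) (Sum.inl j)
  have hY : Kbᵀ * Λ * Kb * Y = 0 := by
    rw [← hK, Matrix.mul_assoc, Matrix.mul_assoc, hSY, Matrix.mul_zero]
  -- the unit vectors in terms of the basis
  set I3 : Matrix E k ℝ := (1 : Matrix E E ℝ).submatrix id (ι ∘ Sum.inr) with hI3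
  obtain ⟨n, x, hnx⟩ : ∃ (n : Matrix (Q ⊕ r) k ℝ) (x : Matrix L k ℝ), I3 = Bas * n + mv * x := by
    have hG : IsUnit ((fromCols Bas mv).submatrix id eB.symm).det := by
      rw [isUnit_iff_ne_zero]
      intro h0
      apply hB
      have := sqDet_submatrix (fromCols Bas mv) (Equiv.refl E) eB.symm eB
      rw [← this, sqDet_self]
      simp only [Equiv.coe_refl, h0]; norm_num
    set G := (fromCols Bas mv).submatrix id eB.symm
    refine ⟨((G⁻¹ * I3).submatrix eB id).toRows₁, ((G⁻¹ * I3).submatrix eB id).toRows₂, ?_⟩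
    rw [← fromCols_mul_fromRows, fromRows_toRows]
    have : fromCols Bas mv * (G⁻¹ * I3).submatrix eB id = G * (G⁻¹ * I3) := by
      ext i j
      simp only [Matrix.mul_apply, submatrix_apply, id, G]
      rw [← Equiv.sum_comp eB]
      simp
    rw [this, mul_nonsing_inv_cancel_left _ _ hG]
  have hmvS : mvᵀ * S = 0 := by
    have := congrArg transpose hSmv
    rwa [transpose_mul, hS, transpose_zero] at this
  -- The columns of `mv` lie in the radical of `S`, so only the `Bas`-coordinates `n` of the unit
  -- vectors contribute to the minor.
  have hm3 : S.submatrix (ι ∘ Sum.inr) (ι ∘ Sum.inr) = nᵀ * (Kbᵀ * Λ * Kb) * n := by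
    have h1 : S.submatrix (ι ∘ Sum.inr) (ι ∘ Sum.inr) = I3ᵀ * S * I3 := by
      ext i j
      simp [hI3, Matrix.mul_apply, Matrix.one_apply]
    rw [h1, hnx, transpose_add, transpose_mul, transpose_mul, Matrix.add_mul,
      Matrix.mul_assoc xᵀ, hmvS, Matrix.mul_zero, add_zero, Matrix.mul_add,
      Matrix.mul_assoc _ S (mv * x), ← Matrix.mul_assoc S, hSmv, Matrix.zero_mul, Matrix.mul_zero,
      add_zero, ← hK]
    simp only [Matrix.mul_assoc]
  have hflat := minor_reduction_flat Kb Λ hΛ Y R n hR hY hR2 e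
  let eW : k ⊕ (L ⊕ (y ⊕ r)) ≃ (Q ⊕ r) ⊕ L :=
    calc k ⊕ (L ⊕ (y ⊕ r)) ≃ (L ⊕ (y ⊕ r)) ⊕ k := Equiv.sumComm _ _
      _ ≃ m ⊕ k := Equiv.sumCongr eT (Equiv.refl _)
      _ ≃ E := ι
      _ ≃ (Q ⊕ r) ⊕ L := eB.symm
  let eU : (k ⊕ (y ⊕ r)) ≃ Q ⊕ r :=
    (Equiv.sumAssoc k y r).symm.trans (Equiv.sumCongr e (Equiv.refl r))
  let eV : (k ⊕ (y ⊕ r)) ⊕ L ≃ k ⊕ (L ⊕ (y ⊕ r)) :=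
    (Equiv.sumAssoc _ _ _).trans (Equiv.sumCongr (Equiv.refl k) (Equiv.sumComm _ _))
  -- The determinant of `[I3, F T]` is factored twice: through the splitting of the rows (`c1`) and
  -- through the basis `[Bas mv]` (`c2`).
  have hdet : (F.submatrix (ι ∘ Sum.inl) id).det ^ 2 * sqDet T
      = sqDet (fromCols Bas mv) * sqDet (fromCols (fromCols n Y) R) := by
    have c1 : sqDet (fromCols I3 (F * T))
        = (F.submatrix (ι ∘ Sum.inl) id).det ^ 2 * sqDet T := by
      have d1 : fromCols I3 (F * T) = fromCols F I3 * fromBlocks 0 T (1 : Matrix k k ℝ) 0 := by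
        ext i (j | j) <;> simp [Matrix.mul_apply, Matrix.one_apply]
      have d2 : sqDet (fromCols F I3) = (F.submatrix (ι ∘ Sum.inl) id).det ^ 2 := by
        rw [sqDet_eq _ ι]
        have : (fromCols F I3).submatrix ι id
            = fromBlocks (F.submatrix (ι ∘ Sum.inl) id) 0 (F.submatrix (ι ∘ Sum.inr) id) 1 := by
          ext (i | i) (j | j) <;> simp [hI3, Matrix.one_apply]
        rw [this, det_fromBlocks_zero₁₂, det_one, mul_one]
      have d3 : sqDet (fromBlocks 0 T (1 : Matrix k k ℝ) 0) = sqDet T := by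
        have d4 := sqDet_submatrix (fromBlocks T 0 0 (1 : Matrix k k ℝ)) (Equiv.refl _)
          (Equiv.sumComm k (L ⊕ (y ⊕ r))) (Equiv.sumCongr eT (Equiv.refl k))
        rw [sqDet_fromBlocks_zero₂₁ _ _ _ eT (Equiv.refl k), sqDet_self, det_one] at d4
        have d5 : (fromBlocks T 0 0 (1 : Matrix k k ℝ)).submatrix (Equiv.refl (m ⊕ k))
            (Equiv.sumComm k (L ⊕ (y ⊕ r))) = fromBlocks 0 T 1 0 := by
          ext (i | i) (j | j) <;> rfl
        rw [d5] at d4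
        rw [d4]; ring
      rw [d1, sqDet_mul _ _ ι ((Equiv.sumComm _ _).trans (Equiv.sumCongr eT (Equiv.refl k))), d2, d3]
    have c2 : sqDet (fromCols I3 (F * T))
        = sqDet (fromCols Bas mv) * sqDet (fromCols (fromCols n Y) R) := by
      have d1 : fromCols I3 (F * T) = fromCols Bas mv
          * fromBlocks n (fromCols 0 (fromCols Y R)) x (fromCols 1 0) := by
        rw [fromCols_mul_fromBlocks, ← hnx, hT]
        simp only [mul_fromCols, Matrix.mul_zero, Matrix.mul_one]
        ext i (j | (j | (j | j))) <;> simp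
      have d2 := sqDet_submatrix (fromBlocks n (fromCols 0 (fromCols Y R)) x (fromCols 1 0))
        (Equiv.refl _) eV eW
      have d3 : (fromBlocks n (fromCols 0 (fromCols Y R)) x (fromCols 1 0)).submatrix
          (Equiv.refl ((Q ⊕ r) ⊕ L)) eV
          = fromBlocks (fromCols n (fromCols Y R)) 0 (fromCols x 0) 1 := by
        ext (i | i) ((j | (j | j)) | j) <;> rfl
      have d4 := sqDet_submatrix (fromCols n (fromCols Y R)) (Equiv.refl _) (Equiv.sumAssoc k y r) eU
      have d5 : (fromCols n (fromCols Y R)).submatrix (Equiv.refl (Q ⊕ r)) (Equiv.sumAssoc k y r)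
          = fromCols (fromCols n Y) R := by
        ext i ((j | j) | j) <;> rfl
      rw [d5] at d4
      rw [d3, sqDet_fromBlocks_zero₁₂ _ _ _ eU (Equiv.refl L), sqDet_self, det_one] at d2
      rw [d1, sqDet_mul _ _ eB eW, ← d2, d4]
      ring
    rw [← c1, c2]
  rw [hm3]
  linear_combination sqDet (fromCols Bas mv) * hflat
    - (-1) ^ Fintype.card y * Λ.det * Kb.toBlocks₁₁.det ^ 2 * hdet

end Reduction

end TrefoilInvariant

/-! ### Derivatives of dihedral angles with respect to the edge lengths. -/

namespace TrefoilInvariant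

/-- The derivative of `- |6V| l · dihedral / l²`, up to normalisation: the numerator of the cosine
of the dihedral angle is differentiated with its denominators kept proportional. -/
noncomputable def hingeRate (M m : Fin 4 → Fin 4 → ℝ) (p q r s : Fin 4) : ℝ :=
  let ee := 2 * M p q
  let aa := 2 * M p r
  let bb := 2 * M p s
  let ae := M p r + M p q - M q r
  let be := M p s + M p q - M q s
  let ab := M p r + M p s - M r s
  let dee := 2 * m p q
  let daa := 2 * m p r
  let dbb := 2 * m p s
  let dae := m p r + m p q - m q r
  let dbe := m p s + m p q - m q s
  let dab := m p r + m p s - m r s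
  ((dab * ee + ab * dee - dae * be - ae * dbe)
    - (ab * ee - ae * be) / 2 * ((daa * ee + aa * dee - 2 * ae * dae) / (aa * ee - ae ^ 2)
      + (dbb * ee + bb * dee - 2 * be * dbe) / (bb * ee - be ^ 2))) / ee

theorem hasDerivAt_arccos_div_sqrt {N D₁ D₂ : ℝ → ℝ} {N' D₁' D₂' t : ℝ}
    (hN : HasDerivAt N N' t) (h₁ : HasDerivAt D₁ D₁' t) (h₂ : HasDerivAt D₂ D₂' t)
    (p₁ : 0 < D₁ t) (p₂ : 0 < D₂ t) (hd : 0 < D₁ t * D₂ t - N t ^ 2) :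
    HasDerivAt (fun s => Real.arccos (N s / Real.sqrt (D₁ s * D₂ s)))
      (-(N' - N t / 2 * (D₁' / D₁ t + D₂' / D₂ t)) / Real.sqrt (D₁ t * D₂ t - N t ^ 2)) t := by
  have hD : 0 < D₁ t * D₂ t := mul_pos p₁ p₂
  have hs : 0 < Real.sqrt (D₁ t * D₂ t) := Real.sqrt_pos.2 hD
  have hss : Real.sqrt (D₁ t * D₂ t) ^ 2 = D₁ t * D₂ t := Real.sq_sqrt hD.le
  set σ := Real.sqrt (D₁ t * D₂ t) with hσ
  have hx : 1 - (N t / σ) ^ 2 = (D₁ t * D₂ t - N t ^ 2) / σ ^ 2 := by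
    rw [← hss] at *; field_simp
  have hlt : (N t / σ) ^ 2 < 1 := by
    have : 0 < 1 - (N t / σ) ^ 2 := by rw [hx]; positivity
    linarith
  have hne1 : N t / σ ≠ 1 := fun h => by rw [h] at hlt; norm_num at hlt
  have hnem : N t / σ ≠ -1 := fun h => by rw [h] at hlt; norm_num at hlt
  have hsq : HasDerivAt (fun s => Real.sqrt (D₁ s * D₂ s))
      ((D₁' * D₂ t + D₁ t * D₂') / (2 * σ)) t := (h₁.mul h₂).sqrt hD.ne'
  have hq := hN.div hsq hs.ne'
  have hc := (Real.hasDerivAt_arccos hnem hne1).comp t hq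
  refine hc.congr_deriv ?_
  have hr : Real.sqrt (1 - (N t / σ) ^ 2) = Real.sqrt (D₁ t * D₂ t - N t ^ 2) / σ := by
    rw [hx, Real.sqrt_div hd.le, Real.sqrt_sq hs.le]
  have hδ : 0 < Real.sqrt (D₁ t * D₂ t - N t ^ 2) := Real.sqrt_pos.2 hd
  rw [hr, ← hσ]
  set δ := Real.sqrt (D₁ t * D₂ t - N t ^ 2)
  have h1 := p₁.ne'
  have h2 := p₂.ne'
  field_simp
  rw [hss]
  field_simp

/-- The Gram expression under the root is called `g`, so that it can be replaced later by the
squared length of the edge times the square of a triple product. -/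
theorem hasDerivAt_dihedral {M : ℝ → Fin 4 → Fin 4 → ℝ} {m : Fin 4 → Fin 4 → ℝ} {t : ℝ}
    {p q r s : Fin 4} (hM : ∀ i j, HasDerivAt (fun t => M t i j) (m i j) t)
    (he : M t p q ≠ 0)
    (p₁ : 0 < 2 * M t p r * (2 * M t p q) - (M t p r + M t p q - M t q r) ^ 2)
    (p₂ : 0 < 2 * M t p s * (2 * M t p q) - (M t p s + M t p q - M t q s) ^ 2)
    {g : ℝ} (hg : 0 < g)
    (hd : (2 * M t p r * (2 * M t p q) - (M t p r + M t p q - M t q r) ^ 2)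
        * (2 * M t p s * (2 * M t p q) - (M t p s + M t p q - M t q s) ^ 2)
      - ((M t p r + M t p s - M t r s) * (2 * M t p q)
        - (M t p r + M t p q - M t q r) * (M t p s + M t p q - M t q s)) ^ 2 = g) :
    HasDerivAt (fun t => dihedral (M t) p q r s)
      (-(2 * M t p q * hingeRate (M t) m p q r s) / Real.sqrt g) t := by
  subst hd
  have d1 : ∀ i j, HasDerivAt (fun t => 2 * M t i j) (2 * m i j) t := fun i j => (hM i j).const_mul 2
  have d2 : ∀ i j k l i' j', HasDerivAt (fun t => M t i j + M t k l - M t i' j')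
      (m i j + m k l - m i' j') t := fun i j k l i' j' => ((hM i j).add (hM k l)).sub (hM i' j')
  have hN := ((d2 p r p s r s).mul (d1 p q)).sub ((d2 p r p q q r).mul (d2 p s p q q s))
  have h1 := ((d1 p r).mul (d1 p q)).sub ((d2 p r p q q r).pow 2)
  have h2 := ((d1 p s).mul (d1 p q)).sub ((d2 p s p q q s).pow 2)
  have h := hasDerivAt_arccos_div_sqrt hN h1 h2 p₁ p₂ hg
  refine h.congr_deriv ?_
  simp only [hingeRate, Pi.mul_apply, Pi.sub_apply, Pi.pow_apply]
  congr 1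
  rw [mul_div_cancel₀ _ (mul_ne_zero two_ne_zero he)]
  congr 1
  norm_num
  ring

/-- `hingeRate` as a linear map in the variation of the edge data. -/
noncomputable def hingeLin (M : Fin 4 → Fin 4 → ℝ) (p q r s : Fin 4) :
    (Fin 4 → Fin 4 → ℝ) →ₗ[ℝ] ℝ where
  toFun m := hingeRate M m p q r s
  map_add' m m' := by simp only [hingeRate, Pi.add_apply]; ring
  map_smul' c m := by simp only [hingeRate, Pi.smul_apply, smul_eq_mul, RingHom.id_apply]; ring

/-- Linearity in the variation; it assembles the values at the unit variations, the matrix entries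
of `f₃`, into the value at an arbitrary variation. -/
theorem hingeRate_sum {ι : Type*} (t : Finset ι) (M : Fin 4 → Fin 4 → ℝ) (p q r s : Fin 4)
    (c : ι → ℝ) (m : ι → Fin 4 → Fin 4 → ℝ) :
    ∑ e ∈ t, c e * hingeRate M (m e) p q r s
      = hingeRate M (fun i j => ∑ e ∈ t, c e * m e i j) p q r s := by
  have h : (fun i j => ∑ e ∈ t, c e * m e i j) = ∑ e ∈ t, c e • m e := by
    ext i j; simp [Finset.sum_apply]
  have h2 := map_sum (hingeLin M p q r s) (fun e => c e • m e) t
  rw [h]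
  simp only [map_smul] at h2
  exact h2.symm

end TrefoilInvariant

namespace TrefoilInvariant

/-! ### Triple products and Gram identities in three-space -/

/-- The triple product `⟨p, q × r⟩`. -/
def triple (p q r : Fin 3 → ℝ) : ℝ :=
  p 0 * (q 1 * r 2 - q 2 * r 1) + p 1 * (q 2 * r 0 - q 0 * r 2) + p 2 * (q 0 * r 1 - q 1 * r 0)

theorem det_of_eq_triple (p q r : Fin 3 → ℝ) : (Matrix.of ![p, q, r]).det = triple p q r := by
  rw [Matrix.det_fin_three]; simp [triple]; ring

theorem dot3 (p q : Fin 3 → ℝ) : p ⬝ᵥ q = p 0 * q 0 + p 1 * q 1 + p 2 * q 2 := by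
  simp [dotProduct, Fin.sum_univ_three]

/-- By Jacobi's identity for minors, this 2 by 2 minor formed from Gram minors is `⟨e, e⟩` times the
Gram determinant of `e, a, b`, which is the square of the triple product. -/
theorem gram_hinge (e a b : Fin 3 → ℝ) :
    (a ⬝ᵥ a * (e ⬝ᵥ e) - (a ⬝ᵥ e) ^ 2) * (b ⬝ᵥ b * (e ⬝ᵥ e) - (b ⬝ᵥ e) ^ 2)
      - (a ⬝ᵥ b * (e ⬝ᵥ e) - a ⬝ᵥ e * (b ⬝ᵥ e)) ^ 2 = e ⬝ᵥ e * triple e a b ^ 2 := by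
  simp only [dot3, triple]; ring

theorem lagrange_nonneg (e a : Fin 3 → ℝ) : 0 ≤ a ⬝ᵥ a * (e ⬝ᵥ e) - (a ⬝ᵥ e) ^ 2 := by
  have : a ⬝ᵥ a * (e ⬝ᵥ e) - (a ⬝ᵥ e) ^ 2 = (e 1 * a 2 - e 2 * a 1) ^ 2
      + (e 2 * a 0 - e 0 * a 2) ^ 2 + (e 0 * a 1 - e 1 * a 0) ^ 2 := by
    simp only [dot3]; ring
  rw [this]; positivity

theorem dot_self_pos_of_triple {e a b : Fin 3 → ℝ} (h : triple e a b ≠ 0) : 0 < e ⬝ᵥ e := by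
  rcases (show 0 ≤ e ⬝ᵥ e by rw [dot3]; nlinarith [sq_nonneg (e 0), sq_nonneg (e 1), sq_nonneg (e 2)]).lt_or_eq with h0 | h0
  · exact h0
  · have := dotProduct_self_eq_zero.1 h0.symm
    exact absurd (by simp [triple, this]) h

theorem lagrange_pos {e a b : Fin 3 → ℝ} (h : triple e a b ≠ 0) :
    0 < a ⬝ᵥ a * (e ⬝ᵥ e) - (a ⬝ᵥ e) ^ 2 := by
  rcases (lagrange_nonneg e a).lt_or_eq with h0 | h0
  · exact h0
  · have h1 := gram_hinge e a b
    rw [← h0, zero_mul] at h1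
    have : 0 < e ⬝ᵥ e * triple e a b ^ 2 := mul_pos (dot_self_pos_of_triple h) (by positivity)
    nlinarith [sq_nonneg (a ⬝ᵥ b * (e ⬝ᵥ e) - a ⬝ᵥ e * (b ⬝ᵥ e))]

theorem triple_swap (e a b : Fin 3 → ℝ) : triple e b a = -triple e a b := by
  simp only [triple]; ring

/-- Half of the squared distance. -/
noncomputable def halfSq (p q : Fin 3 → ℝ) : ℝ := (p - q) ⬝ᵥ (p - q) / 2

theorem halfSq_comm (p q : Fin 3 → ℝ) : halfSq p q = halfSq q p := by
  simp only [halfSq, dot3, Pi.sub_apply]; ring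

/-- The table of the half squared distances of four points. -/
noncomputable def distTable (x : Fin 4 → Fin 3 → ℝ) : Fin 4 → Fin 4 → ℝ := fun i j => halfSq (x i) (x j)

theorem polar_halfSq (p q r : Fin 3 → ℝ) :
    halfSq p r + halfSq p q - halfSq q r = (r - p) ⬝ᵥ (q - p) := by
  simp only [halfSq, dot3, Pi.sub_apply]; ring

theorem two_halfSq (p q : Fin 3 → ℝ) : 2 * halfSq p q = (q - p) ⬝ᵥ (q - p) := by
  simp only [halfSq, dot3, Pi.sub_apply]; ring

/-- The root of the Gram expression is the edge length times `|6V|`. One factor of the length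
cancels, and the remaining one is absorbed when `ω` is divided by `l`. Entries on the diagonal of
the table are unconstrained because the angle never uses them. -/
theorem hasDerivAt_dihedral_of_points {M : ℝ → Fin 4 → Fin 4 → ℝ} {m : Fin 4 → Fin 4 → ℝ} {t : ℝ}
    {p q r s : Fin 4} (hM : ∀ i j, HasDerivAt (fun t => M t i j) (m i j) t)
    (x : Fin 4 → Fin 3 → ℝ) (hx : ∀ i j, i ≠ j → M t i j = halfSq (x i) (x j))
    (hpq : p ≠ q) (hpr : p ≠ r) (hps : p ≠ s) (hqr : q ≠ r) (hqs : q ≠ s) (hrs : r ≠ s)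
    (h : triple (x q - x p) (x r - x p) (x s - x p) ≠ 0) :
    HasDerivAt (fun t => dihedral (M t) p q r s)
      (-(Real.sqrt (2 * M t p q) * (hingeRate (distTable x) m p q r s
        / |triple (x q - x p) (x r - x p) (x s - x p)|))) t := by
  have hee : 0 < 2 * M t p q := by
    rw [hx _ _ hpq, two_halfSq]; exact dot_self_pos_of_triple h
  have hH : hingeRate (M t) m p q r s = hingeRate (distTable x) m p q r s := by
    simp only [hingeRate, distTable, hx _ _ hpq, hx _ _ hpr, hx _ _ hps, hx _ _ hqr, hx _ _ hqs,
      hx _ _ hrs]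
  have h' : triple (x q - x p) (x s - x p) (x r - x p) ≠ 0 := by
    rw [triple_swap]; exact neg_ne_zero.2 h
  have key := hasDerivAt_dihedral (p := p) (q := q) (r := r) (s := s) (t := t) hM
    (by linarith)
    (by rw [hx _ _ hpr, hx _ _ hpq, hx _ _ hqr, polar_halfSq, two_halfSq, two_halfSq]
        exact lagrange_pos h)
    (by rw [hx _ _ hps, hx _ _ hpq, hx _ _ hqs, polar_halfSq, two_halfSq, two_halfSq]
        exact lagrange_pos h')
    (g := 2 * M t p q * triple (x q - x p) (x r - x p) (x s - x p) ^ 2) (by positivity)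
    (by
      have h2 : ∀ a b c : Fin 4, a ≠ b → a ≠ c → b ≠ c →
          M t a b + M t a c - M t b c = (x b - x a) ⬝ᵥ (x c - x a) := by
        intro a b c hab hac hbc
        rw [hx _ _ hab, hx _ _ hac, hx _ _ hbc, halfSq_comm (x b), polar_halfSq]
      have h3 : ∀ a b c : Fin 4, a ≠ b → a ≠ c → b ≠ c →
          M t a c + M t a b - M t b c = (x c - x a) ⬝ᵥ (x b - x a) := by
        intro a b c hab hac hbc
        rw [hx _ _ hab, hx _ _ hac, hx _ _ hbc, polar_halfSq]
      rw [h2 p r s hpr hps hrs, h3 p q r hpq hpr hqr, h3 p q s hpq hps hqs,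
        hx _ _ hpr, hx _ _ hps, hx _ _ hpq, two_halfSq, two_halfSq, two_halfSq]
      exact gram_hinge _ _ _)
  refine key.congr_deriv ?_
  rw [Real.sqrt_mul hee.le, Real.sqrt_sq_eq_abs, hH]
  have h5 : 0 < Real.sqrt (2 * M t p q) := Real.sqrt_pos.2 hee
  have h6 : 0 < |triple (x q - x p) (x r - x p) (x s - x p)| := abs_pos.2 h
  have h7 : 2 * M t p q = Real.sqrt (2 * M t p q) ^ 2 := (Real.sq_sqrt hee.le).symm
  set σ := Real.sqrt (2 * M t p q)
  rw [h7]
  field_simp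

/-! ### The lifted points -/

variable {ρ : TrefoilGroup →* SO3} {Γ : Vertex → Fin 3 → ℝ}

theorem dot_rot (R : SO3) (x y : Fin 3 → ℝ) :
    ((R : Matrix (Fin 3) (Fin 3) ℝ) *ᵥ x) ⬝ᵥ ((R : Matrix (Fin 3) (Fin 3) ℝ) *ᵥ y) = x ⬝ᵥ y := by
  have h : (R : Matrix (Fin 3) (Fin 3) ℝ)ᵀ * (R : Matrix (Fin 3) (Fin 3) ℝ) = 1 := by
    have := (Matrix.mem_specialOrthogonalGroup_iff.1 R.2).1
    have := (Matrix.mem_orthogonalGroup_iff' (Fin 3) ℝ).1 this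
    simpa [Matrix.star_eq_conjTranspose] using this
  rw [Matrix.dotProduct_mulVec, Matrix.vecMul_mulVec, h, Matrix.vecMul_one]

theorem halfSq_rot (R : SO3) (x y : Fin 3 → ℝ) :
    halfSq ((R : Matrix (Fin 3) (Fin 3) ℝ) *ᵥ x) ((R : Matrix (Fin 3) (Fin 3) ℝ) *ᵥ y)
      = halfSq x y := by
  rw [halfSq, ← Matrix.mulVec_sub, dot_rot, halfSq]

theorem genA_sq : genA ^ 2 = genB ^ 3 := by
  have h : (PresentedGroup.mk trefoilRels (FreeGroup.of 0 ^ 2 * (FreeGroup.of 1 ^ 3)⁻¹)) = 1 :=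
    PresentedGroup.one_of_mem rfl
  simp only [map_mul, map_pow, map_inv] at h
  exact mul_inv_eq_one.1 h

/-- The Wirtinger relations. The centrality of `a² = b³` enters in the case of the third generator.
-/
theorem wirt_mul_wirt_succ (i : Fin 3) : wirt i * wirt (i + 1) = genA * genB * genA⁻¹ := by
  have h := genA_sq
  have h1 : genB⁻¹ * genB⁻¹ * genA = genB * genA⁻¹ := by
    have : genB⁻¹ * genB⁻¹ * genA * genA = genB := by
      rw [mul_assoc, ← pow_two genA, h]; group
    rw [eq_mul_inv_iff_mul_eq, this]
  fin_cases i
  · show genA * genB⁻¹ * (genB⁻¹ * genA) = _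
    rw [mul_assoc genA genB, ← h1]; group
  · show genB⁻¹ * genA * (genA⁻¹ * genB * genA * genB * genA⁻¹) = _
    group
  · show genA⁻¹ * genB * genA * genB * genA⁻¹ * (genA * genB⁻¹) = _
    have h2 : genB * genA ^ 2 = genA ^ 2 * genB := by rw [h]; group
    have h3 : genA⁻¹ * genB * genA * genA = genA * genB := by
      rw [mul_assoc, ← pow_two, mul_assoc, h2]; group
    have h4 : genA⁻¹ * genB * genA = genA * genB * genA⁻¹ := by
      rw [eq_mul_inv_iff_mul_eq, h3]
    rw [← h4]; group

theorem regionLabel_centre (i : Fin 3) : regionLabel .centre = wirt i * wirt (i + 1) := by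
  rw [wirt_mul_wirt_succ]; exact wirt_mul_wirt_succ 0

theorem liftPos_mul (g h : TrefoilGroup) (v : Vertex) :
    liftPos ρ Γ (g * h, v) = (ρ g : Matrix (Fin 3) (Fin 3) ℝ) *ᵥ liftPos ρ Γ (h, v) := by
  simp [liftPos, Matrix.mulVec_mulVec]

theorem liftPos_A (hE : IsEquivariant ρ Γ) (g : TrefoilGroup) (i : Fin 3) :
    liftPos ρ Γ (g * wirt i, .A i) = liftPos ρ Γ (g, .A i) := by
  rw [liftPos_mul]; simp only [liftPos]; rw [(hE i).1]

theorem liftPos_B (hE : IsEquivariant ρ Γ) (g : TrefoilGroup) (i : Fin 3) :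
    liftPos ρ Γ (g * wirt (i + 1), .B i) = liftPos ρ Γ (g, .B i) := by
  rw [liftPos_mul]; simp only [liftPos]; rw [(hE i).2]

/-- The lifted vertices of the tetrahedron `T`. -/
noncomputable def tetPos (ρ : TrefoilGroup →* SO3) (Γ : Vertex → Fin 3 → ℝ) (T : Tet) (p : Fin 4) : Fin 3 → ℝ :=
  liftPos ρ Γ (tetVertex T p)

theorem halfSqLength_eq (e : Edge) :
    halfSqLength ρ Γ e = halfSq (liftPos ρ Γ (edgeEnds e).1) (liftPos ρ Γ (edgeEnds e).2) := rfl

theorem halfSq_lift_mul (k g h : TrefoilGroup) (v w : Vertex) :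
    halfSq (liftPos ρ Γ (k * g, v)) (liftPos ρ Γ (k * h, w))
      = halfSq (liftPos ρ Γ (g, v)) (liftPos ρ Γ (h, w)) := by
  rw [liftPos_mul, liftPos_mul, halfSq_rot]

end TrefoilInvariant

/-! ### Independence of edge lengths from the lift, and the entries of `f₃`. -/

namespace TrefoilInvariant

variable {ρ : TrefoilGroup →* SO3} {Γ : Vertex → Fin 3 → ℝ}

theorem halfSq_A (hE : IsEquivariant ρ Γ) (i : Fin 3) (k : TrefoilGroup) (v : Vertex) :
    halfSq (liftPos ρ Γ (1, .A i)) (liftPos ρ Γ (wirt i * k, v))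
      = halfSq (liftPos ρ Γ (1, .A i)) (liftPos ρ Γ (k, v)) := by
  rw [← liftPos_A hE, one_mul]
  conv_lhs => rw [← mul_one (wirt i), mul_assoc, one_mul]
  rw [halfSq_lift_mul, ← liftPos_A hE 1 i, one_mul]

theorem halfSq_B (hE : IsEquivariant ρ Γ) (i : Fin 3) (k : TrefoilGroup) (v : Vertex) :
    halfSq (liftPos ρ Γ (1, .B i)) (liftPos ρ Γ (wirt (i + 1) * k, v))
      = halfSq (liftPos ρ Γ (1, .B i)) (liftPos ρ Γ (k, v)) := by
  rw [← liftPos_B hE, one_mul]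
  conv_lhs => rw [← mul_one (wirt (i + 1)), mul_assoc, one_mul]
  rw [halfSq_lift_mul, ← liftPos_B hE 1 i, one_mul]

theorem halfSq_A_one (hE : IsEquivariant ρ Γ) (i : Fin 3) (v : Vertex) :
    halfSq (liftPos ρ Γ (1, .A i)) (liftPos ρ Γ (wirt i, v))
      = halfSq (liftPos ρ Γ (1, .A i)) (liftPos ρ Γ (1, v)) := by
  have := halfSq_A hE i 1 v; rwa [mul_one] at this

theorem halfSq_B_one (hE : IsEquivariant ρ Γ) (i : Fin 3) (v : Vertex) :
    halfSq (liftPos ρ Γ (1, .B i)) (liftPos ρ Γ (wirt (i + 1), v))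
      = halfSq (liftPos ρ Γ (1, .B i)) (liftPos ρ Γ (1, v)) := by
  have := halfSq_B hE i 1 v; rwa [mul_one] at this

theorem tetSide_comm (T : Tet) (p q : Fin 4) : tetSide T p q = tetSide T q p := by
  cases T <;> fin_cases p <;> fin_cases q <;> rfl

theorem halfSq_one_mul (k : TrefoilGroup) (v w : Vertex) :
    halfSq (liftPos ρ Γ (k, v)) (liftPos ρ Γ (k, w))
      = halfSq (liftPos ρ Γ (1, v)) (liftPos ρ Γ (1, w)) := by
  have := halfSq_lift_mul (ρ := ρ) (Γ := Γ) k 1 1 v w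
  rwa [mul_one] at this

theorem forall_lt_fin_four {P : Fin 4 → Fin 4 → Prop} (h01 : P 0 1) (h02 : P 0 2) (h03 : P 0 3)
    (h12 : P 1 2) (h13 : P 1 3) (h23 : P 2 3) (p q : Fin 4) (h : p < q) : P p q := by
  fin_cases p <;> fin_cases q <;> first | assumption | exact absurd h (by decide)

/-- A side of a tetrahedron of the fundamental family may be a translate of the chosen lift of its
edge. The translating element is a group element that can be removed from both ends, or a stabilizer
of `A i` or `B i`, or a product of such. -/
theorem halfSqLength_tetSide_of_lt (hE : IsEquivariant ρ Γ) (T : Tet) (p q : Fin 4) (h : p < q) :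
    halfSqLength ρ Γ (tetSide T p q) = halfSq (tetPos ρ Γ T p) (tetPos ρ Γ T q) := by
  have e1 : ∀ i : Fin 3, i - 1 + 1 = i := by decide
  have key := @forall_lt_fin_four (fun p q => halfSqLength ρ Γ (tetSide T p q)
    = halfSq (tetPos ρ Γ T p) (tetPos ρ Γ T q))
  cases T with
  | outExt i => exact key rfl rfl rfl rfl rfl rfl p q h
  | outLobe i =>
    refine key rfl ?_ rfl ?_ rfl rfl p q h
    · exact (halfSq_A_one hE i .O).symm
    · have := halfSq_B_one hE (i - 1) .O
      rw [e1] at this; exact this.symm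
  | inLobe i =>
    refine key rfl rfl rfl ?_ rfl rfl p q h
    exact (halfSq_one_mul (wirt (i + 1)) (.B (i + 1)) .O).symm
  | inCentre i =>
    refine key rfl ?_ rfl ?_ rfl rfl p q h
    · show _ = halfSq (liftPos ρ Γ (1, .A i)) (liftPos ρ Γ (regionLabel .centre, .O))
      rw [regionLabel_centre i]; exact (halfSq_A hE i _ _).symm
    · show _ = halfSq (liftPos ρ Γ (wirt (i + 1), .B (i + 1)))
        (liftPos ρ Γ (regionLabel .centre, .O))
      rw [regionLabel_centre (i + 1)]
      have h1 := halfSq_lift_mul (ρ := ρ) (Γ := Γ) (wirt (i + 1)) 1 (wirt (i + 1 + 1)) (.B (i + 1)) .O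
      rw [mul_one] at h1
      rw [h1]; exact (halfSq_B_one hE (i + 1) .O).symm
  | crossExt i => exact key rfl rfl rfl rfl rfl rfl p q h
  | crossLobeSucc i =>
    refine key rfl rfl rfl ?_ rfl rfl p q h
    exact (halfSq_B_one hE i .O).symm
  | crossLobe i =>
    refine key ?_ ?_ rfl ?_ rfl rfl p q h
    · exact (halfSq_A_one hE i (.B i)).symm
    · exact (halfSq_A_one hE i .O).symm
    · exact (halfSq_one_mul (wirt i) (.B i) .O).symm
  | crossCentre i =>
    refine key ?_ ?_ rfl ?_ rfl rfl p q h
    · exact (halfSq_A_one hE i (.B i)).symm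
    · show _ = halfSq (liftPos ρ Γ (1, .A i)) (liftPos ρ Γ (regionLabel .centre, .O))
      rw [regionLabel_centre i]; exact (halfSq_A hE i _ _).symm
    · show _ = halfSq (liftPos ρ Γ (wirt i, .B i)) (liftPos ρ Γ (regionLabel .centre, .O))
      rw [regionLabel_centre i]
      have h1 := halfSq_lift_mul (ρ := ρ) (Γ := Γ) (wirt i) 1 (wirt (i + 1)) (.B i) .O
      rw [mul_one] at h1
      rw [h1]; exact (halfSq_B_one hE i .O).symm

theorem halfSqLength_tetSide (hE : IsEquivariant ρ Γ) (T : Tet) (p q : Fin 4) (h : p ≠ q) :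
    halfSqLength ρ Γ (tetSide T p q) = halfSq (tetPos ρ Γ T p) (tetPos ρ Γ T q) := by
  rcases lt_or_gt_of_ne h with h' | h'
  · exact halfSqLength_tetSide_of_lt hE T p q h'
  · rw [tetSide_comm T p q, halfSq_comm]
    exact halfSqLength_tetSide_of_lt hE T q p h'

/-- Six times the signed volume without the orientation sign. -/
noncomputable def tetDet (ρ : TrefoilGroup →* SO3) (Γ : Vertex → Fin 3 → ℝ) (T : Tet) : ℝ :=
  triple (tetPos ρ Γ T 1 - tetPos ρ Γ T 0) (tetPos ρ Γ T 2 - tetPos ρ Γ T 0)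
    (tetPos ρ Γ T 3 - tetPos ρ Γ T 0)

theorem volume_eq (T : Tet) : volume ρ Γ T = tetOrientation T * tetDet ρ Γ T / 6 := by
  rw [volume, det_of_eq_triple]; rfl

theorem tetOrientation_sq (T : Tet) : tetOrientation T * tetOrientation T = 1 := by
  cases T <;> norm_num [tetOrientation]

theorem tetDet_ne_zero (hG : InGeneralPosition ρ Γ) (T : Tet) : tetDet ρ Γ T ≠ 0 := by
  intro h; apply hG T; rw [volume_eq, h]; simp

/-- The six edges compute the same volume up to the sign of an ordering of the vertices. -/
theorem triple_hinge (x : Fin 4 → Fin 3 → ℝ) (k : Fin 6) :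
    |triple (x (tetPairs k).2.1 - x (tetPairs k).1) (x (tetPairs k).2.2.1 - x (tetPairs k).1)
      (x (tetPairs k).2.2.2 - x (tetPairs k).1)|
    = |triple (x 1 - x 0) (x 2 - x 0) (x 3 - x 0)| := by
  rw [abs_eq_abs]
  fin_cases k <;> simp only [tetPairs, triple, Pi.sub_apply] <;> simp <;> first
    | exact Or.inl (by ring1) | exact Or.inr (by ring1)

/-- The contribution to `f₃` of the `k`-th side of `T` for the variation `ℓ` of the edges. -/
noncomputable def tetHinge (ρ : TrefoilGroup →* SO3) (Γ : Vertex → Fin 3 → ℝ) (T : Tet) (ℓ : Edge → ℝ) (k : Fin 6) : ℝ :=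
  hingeRate (distTable (tetPos ρ Γ T)) (fun p q => ℓ (tetSide T p q)) (tetPairs k).1
    (tetPairs k).2.1 (tetPairs k).2.2.1 (tetPairs k).2.2.2

theorem hasDerivAt_dihedral_tet (hE : IsEquivariant ρ Γ) (hG : InGeneralPosition ρ Γ)
    (T : Tet) (k : Fin 6) (e' : Edge) :
    HasDerivAt (fun s : ℝ => dihedral
        (fun p q => Function.update (halfSqLength ρ Γ) e' s (tetSide T p q)) (tetPairs k).1
        (tetPairs k).2.1 (tetPairs k).2.2.1 (tetPairs k).2.2.2)
      (-(Real.sqrt (2 * halfSqLength ρ Γ (tetSide T (tetPairs k).1 (tetPairs k).2.1))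
        * (tetHinge ρ Γ T (Pi.single e' 1) k / |tetDet ρ Γ T|))) (halfSqLength ρ Γ e') := by
  have hne : (tetPairs k).1 ≠ (tetPairs k).2.1 ∧ (tetPairs k).1 ≠ (tetPairs k).2.2.1 ∧
      (tetPairs k).1 ≠ (tetPairs k).2.2.2 ∧ (tetPairs k).2.1 ≠ (tetPairs k).2.2.1 ∧
      (tetPairs k).2.1 ≠ (tetPairs k).2.2.2 ∧ (tetPairs k).2.2.1 ≠ (tetPairs k).2.2.2 := by
    fin_cases k <;> decide
  obtain ⟨h1, h2, h3, h4, h5, h6⟩ := hne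
  have hM : ∀ i j, HasDerivAt
      (fun s : ℝ => Function.update (halfSqLength ρ Γ) e' s (tetSide T i j))
      ((Pi.single e' 1 : Edge → ℝ) (tetSide T i j)) (halfSqLength ρ Γ e') := by
    intro i j
    have := hasDerivAt_update (halfSqLength ρ Γ) e' (halfSqLength ρ Γ e')
    exact (hasDerivAt_pi.1 this) _
  have htri : triple (tetPos ρ Γ T (tetPairs k).2.1 - tetPos ρ Γ T (tetPairs k).1)
      (tetPos ρ Γ T (tetPairs k).2.2.1 - tetPos ρ Γ T (tetPairs k).1)
      (tetPos ρ Γ T (tetPairs k).2.2.2 - tetPos ρ Γ T (tetPairs k).1) ≠ 0 := by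
    rw [← abs_ne_zero, triple_hinge, abs_ne_zero]; exact tetDet_ne_zero hG T
  have key := hasDerivAt_dihedral_of_points (t := halfSqLength ρ Γ e')
    (M := fun s p q => Function.update (halfSqLength ρ Γ) e' s (tetSide T p q)) hM (tetPos ρ Γ T)
    (fun i j hij => by
      rw [Function.update_eq_self]; exact halfSqLength_tetSide hE T i j hij)
    h1 h2 h3 h4 h5 h6 htri
  rw [triple_hinge, Function.update_eq_self] at key
  exact key

theorem halfSqLength_pos (hE : IsEquivariant ρ Γ) (hG : InGeneralPosition ρ Γ) (T : Tet)
    (k : Fin 6) : 0 < halfSqLength ρ Γ (tetSide T (tetPairs k).1 (tetPairs k).2.1) := by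
  have hne : (tetPairs k).1 ≠ (tetPairs k).2.1 := by fin_cases k <;> decide
  have htri : triple (tetPos ρ Γ T (tetPairs k).2.1 - tetPos ρ Γ T (tetPairs k).1)
      (tetPos ρ Γ T (tetPairs k).2.2.1 - tetPos ρ Γ T (tetPairs k).1)
      (tetPos ρ Γ T (tetPairs k).2.2.2 - tetPos ρ Γ T (tetPairs k).1) ≠ 0 := by
    rw [← abs_ne_zero, triple_hinge, abs_ne_zero]; exact tetDet_ne_zero hG T
  have := dot_self_pos_of_triple htri
  rw [← two_halfSq, ← halfSqLength_tetSide hE T _ _ hne] at this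
  linarith

theorem exists_tetSide (e : Edge) : ∃ (T : Tet) (k : Fin 6),
    tetSide T (tetPairs k).1 (tetPairs k).2.1 = e := by
  have e1 : ∀ i : Fin 3, i + 1 - 1 = i := by decide
  cases e with
  | linkOut i => exact ⟨.outExt i, 0, rfl⟩
  | linkIn i => exact ⟨.inLobe i, 0, rfl⟩
  | AB i => exact ⟨.crossExt i, 0, rfl⟩
  | AO₁ i => exact ⟨.crossExt i, 1, rfl⟩
  | AO₂ i => exact ⟨.crossLobeSucc i, 1, rfl⟩
  | AP i => exact ⟨.crossExt i, 2, rfl⟩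
  | BO i => exact ⟨.crossExt i, 3, rfl⟩
  | BP₁ i => exact ⟨.crossExt i, 4, rfl⟩
  | BP₂ i => exact ⟨.crossLobe i, 4, rfl⟩
  | OP r => cases r with
    | exterior => exact ⟨.crossExt 0, 5, rfl⟩
    | lobe i => exact ⟨.crossLobe i, 5, rfl⟩
    | centre => exact ⟨.crossCentre 0, 5, rfl⟩

theorem halfSqLength_pos' (hE : IsEquivariant ρ Γ) (hG : InGeneralPosition ρ Γ) (e : Edge) :
    0 < halfSqLength ρ Γ e := by
  obtain ⟨T, k, h⟩ := exists_tetSide e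
  rw [← h]; exact halfSqLength_pos hE hG T k

/-- With `x` six times the volume and `y` the orientation, the sign of the dihedral angle and the
absolute value in its derivative merge into a rational expression. -/
theorem sign_div_abs (x : ℝ) (hx : x ≠ 0) (y : ℝ) (hy : y * y = 1) :
    Real.sign (y * x / 6) / |x| = y / x := by
  have hy' : y = 1 ∨ y = -1 := by
    have : (y - 1) * (y + 1) = 0 := by linear_combination hy
    rcases mul_eq_zero.1 this with h | h
    · exact Or.inl (by linarith)
    · exact Or.inr (by linarith)
  rcases hx.lt_or_gt with h | h <;> rcases hy' with rfl | rfl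
  · rw [Real.sign_of_neg (by linarith), abs_of_neg h]; field_simp
  · rw [Real.sign_of_pos (by linarith), abs_of_neg h]; field_simp
  · rw [Real.sign_of_pos (by linarith), abs_of_pos h]
  · rw [Real.sign_of_neg (by linarith), abs_of_pos h]

/-- All square roots disappear: `1/l` in `Ω` cancels the length in the derivative of the angle, and
the sign of `V` cancels the absolute value in `1/|6V|`. -/
theorem f₃_apply (hE : IsEquivariant ρ Γ) (hG : InGeneralPosition ρ Γ) (e e' : Edge) :
    f₃ ρ Γ e e' = ∑ T : Tet, ∑ k : Fin 6,
      if tetSide T (tetPairs k).1 (tetPairs k).2.1 = e then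
        tetOrientation T / tetDet ρ Γ T * tetHinge ρ Γ T (Pi.single e' 1) k else 0 := by
  have hA : HasDerivAt (fun s : ℝ => angleSum ρ Γ (Function.update (halfSqLength ρ Γ) e' s) e)
      (∑ T : Tet, ∑ k : Fin 6,
      if tetSide T (tetPairs k).1 (tetPairs k).2.1 = e then
        Real.sign (volume ρ Γ T) *
        (-(Real.sqrt (2 * halfSqLength ρ Γ (tetSide T (tetPairs k).1 (tetPairs k).2.1))
        * (tetHinge ρ Γ T (Pi.single e' 1) k / |tetDet ρ Γ T|))) else 0) (halfSqLength ρ Γ e') := by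
    unfold angleSum
    refine HasDerivAt.fun_sum fun T _ => HasDerivAt.fun_sum fun k _ => ?_
    split_ifs
    · exact (hasDerivAt_dihedral_tet hE hG T k e').const_mul _
    · exact hasDerivAt_const _ _
  have hLe := halfSqLength_pos' hE hG e
  have hsq : HasDerivAt (fun s : ℝ => Real.sqrt (2 * Function.update (halfSqLength ρ Γ) e' s e))
      ((2 * (Pi.single e' 1 : Edge → ℝ) e) / (2 * Real.sqrt (2 * halfSqLength ρ Γ e)))
      (halfSqLength ρ Γ e') := by
    have h1 : HasDerivAt (fun s : ℝ => Function.update (halfSqLength ρ Γ) e' s e)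
        ((Pi.single e' 1 : Edge → ℝ) e) (halfSqLength ρ Γ e') :=
      (hasDerivAt_pi.1 (hasDerivAt_update (halfSqLength ρ Γ) e' (halfSqLength ρ Γ e'))) e
    have h2 := (h1.const_mul 2).sqrt (by rw [Function.update_eq_self]; positivity)
    rwa [Function.update_eq_self] at h2
  have hσ : Real.sqrt (2 * halfSqLength ρ Γ e) ≠ 0 := (Real.sqrt_pos.2 (by linarith)).ne'
  have hO := (hA.const_sub (angleSum ρ Γ (halfSqLength ρ Γ) e)).div hsq
    (by rw [Function.update_eq_self]; exact hσ)
  have : f₃ ρ Γ e e' = _ := hO.deriv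
  rw [this]
  -- The defect is zero at `Γ`, so the term of the quotient rule that differentiates `l` drops out.
  rw [Function.update_eq_self, sub_self, zero_mul, sub_zero, pow_two, mul_div_mul_right _ _ hσ,
    neg_div, Finset.sum_div, ← Finset.sum_neg_distrib]
  refine Finset.sum_congr rfl fun T _ => ?_
  rw [Finset.sum_div, ← Finset.sum_neg_distrib]
  refine Finset.sum_congr rfl fun k _ => ?_
  split_ifs with h
  · rw [h, ← sign_div_abs _ (tetDet_ne_zero hG T) _ (tetOrientation_sq T), ← volume_eq]
    field_simp
  · simp

/-- The bilinear form of `f₃`, as a sum over the tetrahedra. -/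
theorem f₃_bilin (hE : IsEquivariant ρ Γ) (hG : InGeneralPosition ρ Γ) (ℓ' ℓ : Edge → ℝ) :
    ℓ' ⬝ᵥ (f₃ ρ Γ *ᵥ ℓ) = ∑ T : Tet, tetOrientation T / tetDet ρ Γ T *
      ∑ k : Fin 6, ℓ' (tetSide T (tetPairs k).1 (tetPairs k).2.1) * tetHinge ρ Γ T ℓ k := by
  have h1 : ∀ e, (f₃ ρ Γ *ᵥ ℓ) e = ∑ T : Tet, ∑ k : Fin 6,
      if tetSide T (tetPairs k).1 (tetPairs k).2.1 = e then
        tetOrientation T / tetDet ρ Γ T * tetHinge ρ Γ T ℓ k else 0 := by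
    intro e
    simp only [Matrix.mulVec, dotProduct, f₃_apply hE hG, Finset.sum_mul]
    rw [Finset.sum_comm]
    refine Finset.sum_congr rfl fun T _ => ?_
    rw [Finset.sum_comm]
    refine Finset.sum_congr rfl fun k _ => ?_
    split_ifs
    · have h2 := hingeRate_sum Finset.univ (distTable (tetPos ρ Γ T)) (tetPairs k).1
        (tetPairs k).2.1 (tetPairs k).2.2.1 (tetPairs k).2.2.2 ℓ
        (fun e' p q => (Pi.single e' 1 : Edge → ℝ) (tetSide T p q))
      have h3 : (fun i j => ∑ e', ℓ e' * (Pi.single e' 1 : Edge → ℝ) (tetSide T i j))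
          = fun p q => ℓ (tetSide T p q) := by
        ext i j; simp [Pi.single_apply]
      rw [h3] at h2
      rw [tetHinge, ← h2, Finset.mul_sum]
      refine Finset.sum_congr rfl fun e' _ => ?_
      rw [tetHinge]; ring
    · simp
  simp only [dotProduct, h1, Finset.mul_sum]
  rw [Finset.sum_comm]
  refine Finset.sum_congr rfl fun T _ => ?_
  rw [Finset.sum_comm]
  refine Finset.sum_congr rfl fun k _ => ?_
  simp only [mul_ite, mul_zero, Finset.sum_ite_eq, Finset.mem_univ, if_true]
  ring

end TrefoilInvariant

/-! ### Cancellation of face terms over the closed triangulation. -/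

namespace TrefoilInvariant

variable {ρ : TrefoilGroup →* SO3} {Γ ξ : Vertex → Fin 3 → ℝ}

theorem sum_tet (F : Tet → ℝ) : ∑ T, F T = ∑ i : Fin 3,
    (F (.outExt i) + F (.outLobe i) + F (.inLobe i) + F (.inCentre i)
      + F (.crossExt i) + F (.crossLobeSucc i) + F (.crossLobe i) + F (.crossCentre i)) := by
  simp only [Finset.sum_add_distrib]
  simp only [Fin.sum_univ_three]
  have : (Finset.univ : Finset Tet) = {.outExt 0, .outExt 1, .outExt 2, .outLobe 0, .outLobe 1,
    .outLobe 2, .inLobe 0, .inLobe 1, .inLobe 2, .inCentre 0, .inCentre 1, .inCentre 2,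
    .crossExt 0, .crossExt 1, .crossExt 2, .crossLobeSucc 0, .crossLobeSucc 1, .crossLobeSucc 2,
    .crossLobe 0, .crossLobe 1, .crossLobe 2, .crossCentre 0, .crossCentre 1, .crossCentre 2} := by
    decide
  rw [this]
  repeat rw [Finset.sum_insert (by decide)]
  rw [Finset.sum_singleton]
  ring

theorem rot_liftPos (g h : TrefoilGroup) (v : Vertex) :
    (ρ g : Matrix (Fin 3) (Fin 3) ℝ) *ᵥ liftPos ρ Γ (h, v) = liftPos ρ Γ (g * h, v) :=
  (liftPos_mul g h v).symm

/-- The value of a function of (positioned) faces at the face `p q r` of `T`. -/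
noncomputable def faceVal (ρ : TrefoilGroup →* SO3) (Γ ξ : Vertex → Fin 3 → ℝ)
    (Φ : (Fin 3 → Fin 3 → ℝ) → (Fin 3 → Fin 3 → ℝ) → Edge → Edge → Edge → ℝ) (T : Tet)
    (p q r : Fin 4) : ℝ :=
  Φ ![tetPos ρ Γ T p, tetPos ρ Γ T q, tetPos ρ Γ T r]
    ![tetPos ρ ξ T p, tetPos ρ ξ T q, tetPos ρ ξ T r] (tetSide T p q) (tetSide T p r)
    (tetSide T q r)

/-- The alternating sum of a function of faces over the boundary of `T`. -/
noncomputable def faceBoundary (ρ : TrefoilGroup →* SO3) (Γ ξ : Vertex → Fin 3 → ℝ)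
    (Φ : (Fin 3 → Fin 3 → ℝ) → (Fin 3 → Fin 3 → ℝ) → Edge → Edge → Edge → ℝ) (T : Tet) : ℝ :=
  faceVal ρ Γ ξ Φ T 0 1 2 - faceVal ρ Γ ξ Φ T 0 1 3 + faceVal ρ Γ ξ Φ T 0 2 3
    - faceVal ρ Γ ξ Φ T 1 2 3

/-- A rotation invariant function of faces sums to zero over the boundaries of all tetrahedra. -/
theorem sum_faceBoundary (hE : IsEquivariant ρ Γ) (hξ : IsEquivariant ρ ξ)
    (Φ : (Fin 3 → Fin 3 → ℝ) → (Fin 3 → Fin 3 → ℝ) → Edge → Edge → Edge → ℝ)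
    (inv : ∀ (R : SO3) (x y : Fin 3 → Fin 3 → ℝ) (a b c : Edge),
      Φ ![(R : Matrix (Fin 3) (Fin 3) ℝ) *ᵥ x 0, (R : Matrix (Fin 3) (Fin 3) ℝ) *ᵥ x 1,
          (R : Matrix (Fin 3) (Fin 3) ℝ) *ᵥ x 2]
        ![(R : Matrix (Fin 3) (Fin 3) ℝ) *ᵥ y 0, (R : Matrix (Fin 3) (Fin 3) ℝ) *ᵥ y 1,
          (R : Matrix (Fin 3) (Fin 3) ℝ) *ᵥ y 2] a b c = Φ x y a b c) :
    ∑ T : Tet, tetOrientation T * faceBoundary ρ Γ ξ Φ T = 0 := by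
  have key : ∀ (g g₁ g₂ g₃ : TrefoilGroup) (v₁ v₂ v₃ : Vertex) (a b c : Edge),
      Φ ![liftPos ρ Γ (g * g₁, v₁), liftPos ρ Γ (g * g₂, v₂), liftPos ρ Γ (g * g₃, v₃)]
        ![liftPos ρ ξ (g * g₁, v₁), liftPos ρ ξ (g * g₂, v₂), liftPos ρ ξ (g * g₃, v₃)] a b c
      = Φ ![liftPos ρ Γ (g₁, v₁), liftPos ρ Γ (g₂, v₂), liftPos ρ Γ (g₃, v₃)]
        ![liftPos ρ ξ (g₁, v₁), liftPos ρ ξ (g₂, v₂), liftPos ρ ξ (g₃, v₃)] a b c := by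
    intro g g₁ g₂ g₃ v₁ v₂ v₃ a b c
    have := inv (ρ g) ![liftPos ρ Γ (g₁, v₁), liftPos ρ Γ (g₂, v₂), liftPos ρ Γ (g₃, v₃)]
      ![liftPos ρ ξ (g₁, v₁), liftPos ρ ξ (g₂, v₂), liftPos ρ ξ (g₃, v₃)] a b c
    simp only [rot_liftPos, Matrix.cons_val_zero, Matrix.cons_val_one, Matrix.cons_val] at this
    simpa only [faceVal, tetPos, tetVertex, tetSide, sideTable, regionLabel, Matrix.cons_val_zero,
      Matrix.cons_val_one, Matrix.cons_val] using this
  -- The faces of type `A B O` on the two sides of the overpass are different lifts of the same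
  -- face. They are matched by the rotation `ρ (xᵢ)`, which fixes `A i`.
  have h1 : ∀ i, faceVal ρ Γ ξ Φ (.outLobe i) 0 1 2 = faceVal ρ Γ ξ Φ (.outExt i) 0 1 2 := by
    intro i
    have e1 : i - 1 + 1 = i := by revert i; decide
    have := key (wirt i) 1 1 1 (.A i) (.B (i - 1)) .O (.linkOut i) (.AO₁ i) (.BO (i - 1))
    have a1 := liftPos_A hE 1 i
    have a2 := liftPos_A hξ 1 i
    have b1 := liftPos_B hE 1 (i - 1)
    have b2 := liftPos_B hξ 1 (i - 1)
    rw [e1] at b1 b2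
    rw [one_mul] at a1 a2 b1 b2
    simp only [mul_one, a1, a2, b1, b2] at this
    simpa only [faceVal, tetPos, tetVertex, tetSide, sideTable, regionLabel, Matrix.cons_val_zero,
      Matrix.cons_val_one, Matrix.cons_val] using this
  have h2 : ∀ i, faceVal ρ Γ ξ Φ (.inCentre i) 0 1 2 = faceVal ρ Γ ξ Φ (.inLobe i) 0 1 2 := by
    intro i
    have := key (wirt i) 1 (wirt (i + 1)) (wirt (i + 1)) (.A i) (.B (i + 1)) .O
      (.linkIn i) (.AO₂ i) (.BO (i + 1))
    have a1 := liftPos_A hE 1 i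
    have a2 := liftPos_A hξ 1 i
    have b1 := liftPos_B hE (wirt (i + 1)) (i + 1)
    have b2 := liftPos_B hξ (wirt (i + 1)) (i + 1)
    rw [← regionLabel_centre, regionLabel_centre i] at b1 b2
    rw [one_mul] at a1 a2
    simp only [mul_one, a1, a2, b1, b2] at this
    rw [← regionLabel_centre i] at this
    simpa only [faceVal, tetPos, tetVertex, tetSide, sideTable, regionLabel, Matrix.cons_val_zero,
      Matrix.cons_val_one, Matrix.cons_val] using this
  have h3 : ∀ i, faceVal ρ Γ ξ Φ (.crossLobe i) 0 1 2 = faceVal ρ Γ ξ Φ (.crossExt i) 0 1 2 := by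
    intro i
    have := key (wirt i) 1 1 1 (.A i) (.B i) .O (.AB i) (.AO₁ i) (.BO i)
    have a1 := liftPos_A hE 1 i
    have a2 := liftPos_A hξ 1 i
    rw [one_mul] at a1 a2
    simp only [mul_one, a1, a2] at this
    simpa only [faceVal, tetPos, tetVertex, tetSide, sideTable, regionLabel, Matrix.cons_val_zero,
      Matrix.cons_val_one, Matrix.cons_val] using this
  have h4 : ∀ i, faceVal ρ Γ ξ Φ (.crossCentre i) 0 1 2
      = faceVal ρ Γ ξ Φ (.crossLobeSucc i) 0 1 2 := by
    intro i
    have := key (wirt i) 1 1 (wirt (i + 1)) (.A i) (.B i) .O (.AB i) (.AO₂ i) (.BO i)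
    have a1 := liftPos_A hE 1 i
    have a2 := liftPos_A hξ 1 i
    rw [one_mul] at a1 a2
    simp only [mul_one, a1, a2] at this
    rw [← regionLabel_centre i] at this
    simpa only [faceVal, tetPos, tetVertex, tetSide, sideTable, regionLabel, Matrix.cons_val_zero,
      Matrix.cons_val_one, Matrix.cons_val] using this
  -- Faces of types `A B P` and `A O P` are glued by the identity, because the lift of `P` is the
  -- same in all tetrahedra.
  have k1 : ∀ i, faceVal ρ Γ ξ Φ (.outLobe i) 0 1 3 = faceVal ρ Γ ξ Φ (.outExt i) 0 1 3 :=
    fun i => by simp only [faceVal, tetPos, tetVertex, tetSide, sideTable, Matrix.cons_val_zero,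
      Matrix.cons_val_one, Matrix.cons_val]
  have k2 : ∀ i, faceVal ρ Γ ξ Φ (.inCentre i) 0 1 3 = faceVal ρ Γ ξ Φ (.inLobe i) 0 1 3 :=
    fun i => by simp only [faceVal, tetPos, tetVertex, tetSide, sideTable, Matrix.cons_val_zero,
      Matrix.cons_val_one, Matrix.cons_val]
  have k3 : ∀ i, faceVal ρ Γ ξ Φ (.crossLobeSucc i) 0 1 3 = faceVal ρ Γ ξ Φ (.crossExt i) 0 1 3 :=
    fun i => by simp only [faceVal, tetPos, tetVertex, tetSide, sideTable, Matrix.cons_val_zero,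
      Matrix.cons_val_one, Matrix.cons_val]
  have k4 : ∀ i, faceVal ρ Γ ξ Φ (.crossCentre i) 0 1 3 = faceVal ρ Γ ξ Φ (.crossLobe i) 0 1 3 :=
    fun i => by simp only [faceVal, tetPos, tetVertex, tetSide, sideTable, Matrix.cons_val_zero,
      Matrix.cons_val_one, Matrix.cons_val]
  have l1 : ∀ i, faceVal ρ Γ ξ Φ (.crossExt i) 0 2 3 = faceVal ρ Γ ξ Φ (.outExt i) 0 2 3 :=
    fun i => by simp only [faceVal, tetPos, tetVertex, tetSide, sideTable, Matrix.cons_val_zero,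
      Matrix.cons_val_one, Matrix.cons_val]
  have l2 : ∀ i, faceVal ρ Γ ξ Φ (.crossLobe i) 0 2 3 = faceVal ρ Γ ξ Φ (.outLobe i) 0 2 3 :=
    fun i => by simp only [faceVal, tetPos, tetVertex, tetSide, sideTable, Matrix.cons_val_zero,
      Matrix.cons_val_one, Matrix.cons_val]
  have l3 : ∀ i, faceVal ρ Γ ξ Φ (.crossLobeSucc i) 0 2 3 = faceVal ρ Γ ξ Φ (.inLobe i) 0 2 3 :=
    fun i => by simp only [faceVal, tetPos, tetVertex, tetSide, sideTable, Matrix.cons_val_zero,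
      Matrix.cons_val_one, Matrix.cons_val]
  have l4 : ∀ i, faceVal ρ Γ ξ Φ (.crossCentre i) 0 2 3 = faceVal ρ Γ ξ Φ (.inCentre i) 0 2 3 :=
    fun i => by simp only [faceVal, tetPos, tetVertex, tetSide, sideTable, Matrix.cons_val_zero,
      Matrix.cons_val_one, Matrix.cons_val]
  -- Faces of type `B O P` join tetrahedra with different indices of `A`; the reindexing `shift`
  -- lets them cancel after summation over `i`.
  have s1 : ∀ i, faceVal ρ Γ ξ Φ (.outExt (i + 1)) 1 2 3 = faceVal ρ Γ ξ Φ (.crossExt i) 1 2 3 := by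
    intro i
    have e1 : i + 1 - 1 = i := by revert i; decide
    simp only [faceVal, tetPos, tetVertex, tetSide, sideTable, e1, Matrix.cons_val_zero,
      Matrix.cons_val_one, Matrix.cons_val]
  have s2 : ∀ i, faceVal ρ Γ ξ Φ (.outLobe (i + 1)) 1 2 3
      = faceVal ρ Γ ξ Φ (.crossLobeSucc i) 1 2 3 := by
    intro i
    have e1 : i + 1 - 1 = i := by revert i; decide
    simp only [faceVal, tetPos, tetVertex, tetSide, sideTable, e1, Matrix.cons_val_zero,
      Matrix.cons_val_one, Matrix.cons_val]
  have s3 : ∀ i, faceVal ρ Γ ξ Φ (.crossLobe (i + 1)) 1 2 3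
      = faceVal ρ Γ ξ Φ (.inLobe i) 1 2 3 := by
    intro i
    simp only [faceVal, tetPos, tetVertex, tetSide, sideTable, Matrix.cons_val_zero,
      Matrix.cons_val_one, Matrix.cons_val]
  have s4 : ∀ i, faceVal ρ Γ ξ Φ (.crossCentre (i + 1)) 1 2 3
      = faceVal ρ Γ ξ Φ (.inCentre i) 1 2 3 := by
    intro i
    simp only [faceVal, tetPos, tetVertex, tetSide, sideTable, Matrix.cons_val_zero,
      Matrix.cons_val_one, Matrix.cons_val]
  have shift : ∀ f : Fin 3 → ℝ, ∑ i, f (i + 1) = ∑ i, f i := fun f =>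
    Equiv.sum_comp (Equiv.addRight (1 : Fin 3)) f
  have t1 := shift fun i => faceVal ρ Γ ξ Φ (.outExt i) 1 2 3
  have t2 := shift fun i => faceVal ρ Γ ξ Φ (.outLobe i) 1 2 3
  have t3 := shift fun i => faceVal ρ Γ ξ Φ (.crossLobe i) 1 2 3
  have t4 := shift fun i => faceVal ρ Γ ξ Φ (.crossCentre i) 1 2 3
  simp only [s1, s2, s3, s4] at t1 t2 t3 t4
  rw [sum_tet]
  simp only [faceBoundary, tetOrientation, h1, h2, h3, h4, k1, k2, k3, k4, l1, l2, l3, l4]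
  simp only [mul_add, mul_sub, one_mul, neg_mul, Finset.sum_add_distrib, Finset.sum_sub_distrib,
    Finset.sum_neg_distrib]
  linear_combination t1 - t2 + t3 - t4

/-! ### The variation of the dihedral angles under a displacement of the vertices -/

/-- The rate of rotation about the moving edge `p q` of the half plane through `r`. -/
noncomputable def spinRate (p q r p' q' r' : Fin 3 → ℝ) : ℝ :=
  triple (q - p) ((q - p) ⨯₃ (r - p)) ((q' - p') ⨯₃ (r - p) + (q - p) ⨯₃ (r' - p'))
    / ((q - p) ⬝ᵥ (q - p) * (((q - p) ⨯₃ (r - p)) ⬝ᵥ ((q - p) ⨯₃ (r - p))))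

/-- Compares the components of `n` along the normals of the two faces at `e`. Applied to the
variation of a normal, the difference is the rotation of that face about `e`. -/
theorem cross_lagrange (e a b n : Fin 3 → ℝ) :
    ((e ⨯₃ a) ⬝ᵥ (e ⨯₃ a)) * (n ⬝ᵥ (e ⨯₃ b)) - ((e ⨯₃ a) ⬝ᵥ (e ⨯₃ b)) * (n ⬝ᵥ (e ⨯₃ a))
      = triple e a b * triple e (e ⨯₃ a) n := by
  simp only [dot3, triple, cross_apply, Matrix.cons_val_zero, Matrix.cons_val_one, Matrix.cons_val]
  ring

theorem cross_dot_cross' (e a b : Fin 3 → ℝ) :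
    (e ⨯₃ a) ⬝ᵥ (e ⨯₃ b) = a ⬝ᵥ b * (e ⬝ᵥ e) - a ⬝ᵥ e * (b ⬝ᵥ e) := by
  simp only [dot3, cross_apply, Matrix.cons_val_zero, Matrix.cons_val_one, Matrix.cons_val]
  ring

theorem dot_cross_variation (e a b e' a' b' : Fin 3 → ℝ) :
    (e' ⨯₃ a + e ⨯₃ a') ⬝ᵥ (e ⨯₃ b) + (e' ⨯₃ b + e ⨯₃ b') ⬝ᵥ (e ⨯₃ a)
      = (a' ⬝ᵥ b + a ⬝ᵥ b') * (e ⬝ᵥ e) + a ⬝ᵥ b * (2 * (e ⬝ᵥ e')) - (a' ⬝ᵥ e + a ⬝ᵥ e') * (b ⬝ᵥ e)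
        - a ⬝ᵥ e * (b' ⬝ᵥ e + b ⬝ᵥ e') := by
  simp only [dot3, cross_apply, Matrix.cons_val_zero, Matrix.cons_val_one, Matrix.cons_val,
    Pi.add_apply]
  ring

/-- The angle between two half planes changes by the difference of their rotation rates. In terms of
the normals `e × a` and `e × b`, the logarithmic derivatives of the denominators remove the change
in length of each normal, so that only its turning about the edge is left. -/
theorem hingeRate_displacement (x ξ : Fin 4 → Fin 3 → ℝ) (p q r s : Fin 4)
    (h : triple (x q - x p) (x r - x p) (x s - x p) ≠ 0) :
    hingeRate (distTable x) (fun i j => (x i - x j) ⬝ᵥ (ξ i - ξ j)) p q r s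
        / triple (x q - x p) (x r - x p) (x s - x p)
      = spinRate (x p) (x q) (x r) (ξ p) (ξ q) (ξ r) - spinRate (x p) (x q) (x s) (ξ p) (ξ q) (ξ s) := by
  have h' : triple (x q - x p) (x s - x p) (x r - x p) ≠ 0 := by
    rw [triple_swap]; exact neg_ne_zero.2 h
  have hee := dot_self_pos_of_triple h
  have hr := lagrange_pos h
  have hs := lagrange_pos h'
  simp only [hingeRate, distTable, polar_halfSq, two_halfSq, spinRate]
  have hab : halfSq (x p) (x r) + halfSq (x p) (x s) - halfSq (x r) (x s)
      = (x r - x p) ⬝ᵥ (x s - x p) := by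
    rw [halfSq_comm (x r), polar_halfSq, dotProduct_comm]
  have d1 : ∀ i, 2 * ((x p - x i) ⬝ᵥ (ξ p - ξ i)) = 2 * ((x i - x p) ⬝ᵥ (ξ i - ξ p)) := by
    intro i; simp only [dot3, Pi.sub_apply]; ring
  have d2 : ∀ i j, (x p - x i) ⬝ᵥ (ξ p - ξ i) + (x p - x j) ⬝ᵥ (ξ p - ξ j)
      - (x j - x i) ⬝ᵥ (ξ j - ξ i)
      = (ξ i - ξ p) ⬝ᵥ (x j - x p) + (x i - x p) ⬝ᵥ (ξ j - ξ p) := by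
    intro i j; simp only [dot3, Pi.sub_apply]; ring
  have d3 : (x p - x r) ⬝ᵥ (ξ p - ξ r) + (x p - x s) ⬝ᵥ (ξ p - ξ s)
      - (x r - x s) ⬝ᵥ (ξ r - ξ s)
      = (ξ r - ξ p) ⬝ᵥ (x s - x p) + (x r - x p) ⬝ᵥ (ξ s - ξ p) := by
    simp only [dot3, Pi.sub_apply]; ring
  rw [hab, d1, d1, d1, d2, d2, d3]
  set e := x q - x p
  set a := x r - x p
  set b := x s - x p
  set e' := ξ q - ξ p
  set a' := ξ r - ξ p
  set b' := ξ s - ξ p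
  have v1 := dot_cross_variation e a b e' a' b'
  have v2 := dot_cross_variation e a a e' a' a'
  have v3 := dot_cross_variation e b b e' b' b'
  have c1 := cross_lagrange e a b (e' ⨯₃ a + e ⨯₃ a')
  have c2 := cross_lagrange e b a (e' ⨯₃ b + e ⨯₃ b')
  rw [triple_swap e a b] at c2
  rw [dotProduct_comm (e ⨯₃ b) (e ⨯₃ a)] at c2
  have n1 := cross_dot_cross' e a a
  have n2 := cross_dot_cross' e b b
  have n3 := cross_dot_cross' e a b
  rw [← pow_two] at n1 n2
  rw [n1] at c1; rw [n2] at c2; rw [n3] at c1 c2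
  rw [n1, n2]
  set n' := e' ⨯₃ a + e ⨯₃ a'
  set k' := e' ⨯₃ b + e ⨯₃ b'
  have w1 : (2 * (a ⬝ᵥ a') * (e ⬝ᵥ e) + a ⬝ᵥ a * (2 * (e ⬝ᵥ e')) - 2 * (a ⬝ᵥ e) * (a' ⬝ᵥ e + a ⬝ᵥ e'))
      = 2 * (n' ⬝ᵥ (e ⨯₃ a)) := by
    rw [dotProduct_comm a' a] at v2; linear_combination -v2
  have w2 : (2 * (b ⬝ᵥ b') * (e ⬝ᵥ e) + b ⬝ᵥ b * (2 * (e ⬝ᵥ e')) - 2 * (b ⬝ᵥ e) * (b' ⬝ᵥ e + b ⬝ᵥ e'))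
      = 2 * (k' ⬝ᵥ (e ⨯₃ b)) := by
    rw [dotProduct_comm b' b] at v3; linear_combination -v3
  rw [w1, w2, ← v1]
  have e1 : n' ⬝ᵥ (e ⨯₃ b) = ((a ⬝ᵥ b * (e ⬝ᵥ e) - a ⬝ᵥ e * (b ⬝ᵥ e)) * (n' ⬝ᵥ (e ⨯₃ a))
      + triple e a b * triple e (e ⨯₃ a) n') / (a ⬝ᵥ a * (e ⬝ᵥ e) - (a ⬝ᵥ e) ^ 2) := by
    rw [eq_div_iff hr.ne']; linear_combination c1
  have e2 : k' ⬝ᵥ (e ⨯₃ a) = ((a ⬝ᵥ b * (e ⬝ᵥ e) - a ⬝ᵥ e * (b ⬝ᵥ e)) * (k' ⬝ᵥ (e ⨯₃ b))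
      - triple e a b * triple e (e ⨯₃ b) k') / (b ⬝ᵥ b * (e ⬝ᵥ e) - (b ⬝ᵥ e) ^ 2) := by
    rw [eq_div_iff hs.ne']; linear_combination c2
  rw [e1, e2]
  have hee' := hee.ne'
  have hr' := hr.ne'
  have hs' := hs.ne'
  set D1 := a ⬝ᵥ a * (e ⬝ᵥ e) - (a ⬝ᵥ e) ^ 2
  set D2 := b ⬝ᵥ b * (e ⬝ᵥ e) - (b ⬝ᵥ e) ^ 2
  field_simp
  ring

end TrefoilInvariant

namespace TrefoilInvariant

variable {ρ : TrefoilGroup →* SO3} {Γ ξ : Vertex → Fin 3 → ℝ}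

/-! ### The coefficients of the variation of a dihedral angle -/

/-- The vector `w` in the plane of `q - p` and `r - p` with `⟨w, q - p⟩ = ⟨w, r - p⟩ = 1`. -/
noncomputable def coplanarDual (p q r : Fin 3 → ℝ) : Fin 3 → ℝ :=
  ((r - p) ⬝ᵥ (r - p) * ((q - p) ⬝ᵥ (q - p)) - ((r - p) ⬝ᵥ (q - p)) ^ 2)⁻¹ •
    (((r - p) ⬝ᵥ (r - p) - (r - p) ⬝ᵥ (q - p)) • (q - p)
      + ((q - p) ⬝ᵥ (q - p) - (r - p) ⬝ᵥ (q - p)) • (r - p))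

/-- The affine function that is `1` at `p`, vanishes at `q` and `r` and is constant along the normal
to the plane `p q r`. -/
noncomputable def hval (p q r x : Fin 3 → ℝ) : ℝ := 1 - (x - p) ⬝ᵥ coplanarDual p q r

theorem hval_swap (p q r x : Fin 3 → ℝ) : hval p q r x = hval p r q x := by
  have : coplanarDual p q r = coplanarDual p r q := by
    simp only [coplanarDual, dotProduct_comm (q - p) (r - p)]
    rw [add_comm, mul_comm ((r - p) ⬝ᵥ (r - p))]
  rw [hval, hval, this]

theorem coplanarDual_left {p q r : Fin 3 → ℝ}
    (h : (r - p) ⬝ᵥ (r - p) * ((q - p) ⬝ᵥ (q - p)) - ((r - p) ⬝ᵥ (q - p)) ^ 2 ≠ 0) :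
    (q - p) ⬝ᵥ coplanarDual p q r = 1 := by
  simp only [coplanarDual, dotProduct_smul, dotProduct_add, smul_eq_mul,
    dotProduct_comm (q - p) (r - p)]
  field_simp
  ring

theorem coplanarDual_right {p q r : Fin 3 → ℝ}
    (h : (r - p) ⬝ᵥ (r - p) * ((q - p) ⬝ᵥ (q - p)) - ((r - p) ⬝ᵥ (q - p)) ^ 2 ≠ 0) :
    (r - p) ⬝ᵥ coplanarDual p q r = 1 := by
  simp only [coplanarDual, dotProduct_smul, dotProduct_add, smul_eq_mul]
  field_simp
  ring

/-- The coefficient of the edge `p q` itself in the variation of the dihedral angle at `p q`. -/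
noncomputable def hdiag (p q r s : Fin 3 → ℝ) : ℝ :=
  (2 * ((r - p) ⬝ᵥ (s - p)) - (s - p) ⬝ᵥ (q - p) - (r - p) ⬝ᵥ (q - p)
    - ((r - p) ⬝ᵥ (s - p) * ((q - p) ⬝ᵥ (q - p)) - (r - p) ⬝ᵥ (q - p) * ((s - p) ⬝ᵥ (q - p))) *
      (((r - p) ⬝ᵥ (r - p) - (r - p) ⬝ᵥ (q - p))
        / ((r - p) ⬝ᵥ (r - p) * ((q - p) ⬝ᵥ (q - p)) - ((r - p) ⬝ᵥ (q - p)) ^ 2)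
      + ((s - p) ⬝ᵥ (s - p) - (s - p) ⬝ᵥ (q - p))
        / ((s - p) ⬝ᵥ (s - p) * ((q - p) ⬝ᵥ (q - p)) - ((s - p) ⬝ᵥ (q - p)) ^ 2)))
    / ((q - p) ⬝ᵥ (q - p))

/-- The variation of the dihedral angle at `p q`, with explicit coefficients. -/
noncomputable def hinge (p q r s : Fin 3 → ℝ) (pq pr ps qr qs rs : ℝ) : ℝ :=
  hdiag p q r s * pq + hval p q r s * pr + hval p q s r * ps + hval q p r s * qr
    + hval q p s r * qs - rs

/-- The expanded coefficients are values of affine functions attached to single faces. In this form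
the symmetry of `f₃` and the effect of affine dependencies can be read off. -/
theorem hingeRate_eq_hinge (x : Fin 4 → Fin 3 → ℝ) (m : Fin 4 → Fin 4 → ℝ) (p q r s : Fin 4)
    (h : triple (x q - x p) (x r - x p) (x s - x p) ≠ 0) :
    hingeRate (distTable x) m p q r s
      = hinge (x p) (x q) (x r) (x s) (m p q) (m p r) (m p s) (m q r) (m q s) (m r s) := by
  have h' : triple (x q - x p) (x s - x p) (x r - x p) ≠ 0 := by
    rw [triple_swap]; exact neg_ne_zero.2 h
  have hee := (dot_self_pos_of_triple h).ne'
  have hr := (lagrange_pos h).ne'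
  have hs := (lagrange_pos h').ne'
  simp only [hingeRate, distTable, polar_halfSq, two_halfSq, hinge, hval, hdiag, coplanarDual]
  have hab : halfSq (x p) (x r) + halfSq (x p) (x s) - halfSq (x r) (x s)
      = (x r - x p) ⬝ᵥ (x s - x p) := by
    rw [halfSq_comm (x r), polar_halfSq, dotProduct_comm]
  rw [hab]
  have e1 : ∀ i, x i - x q = (x i - x p) - (x q - x p) := fun i => by abel
  rw [e1 r, e1 s, e1 p]
  set e := x q - x p
  set a := x r - x p
  set b := x s - x p
  simp only [sub_self, zero_sub, dotProduct_sub, sub_dotProduct, neg_dotProduct, dotProduct_neg,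
    dotProduct_smul, dotProduct_add, smul_eq_mul, dotProduct_comm e a, dotProduct_comm e b,
    dotProduct_comm b a]
  set aa := a ⬝ᵥ a
  set bb := b ⬝ᵥ b
  set ee := e ⬝ᵥ e
  set ae := a ⬝ᵥ e
  set be := b ⬝ᵥ e
  set ab := a ⬝ᵥ b
  set D := aa * ee - ae ^ 2 with hD
  set D' := bb * ee - be ^ 2 with hD'
  field_simp
  rw [show ee * (aa - ae - (ae - ee)) - (ae - ee) ^ 2 = D by rw [hD]; ring,
    show ee * (bb - be - (be - ee)) - (be - ee) ^ 2 = D' by rw [hD']; ring]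
  field_simp
  rw [hD, hD']
  ring

/-- Dihedral angles are invariant under dilations. -/
theorem hinge_halfSq {p q r s : Fin 3 → ℝ} (h : triple (q - p) (r - p) (s - p) ≠ 0) :
    hinge p q r s (halfSq p q) (halfSq p r) (halfSq p s) (halfSq q r) (halfSq q s) (halfSq r s)
      = 0 := by
  have h0 := hingeRate_eq_hinge ![p, q, r, s] (distTable ![p, q, r, s]) 0 1 2 3 h
  have h' : triple (q - p) (s - p) (r - p) ≠ 0 := by
    rw [triple_swap]; exact neg_ne_zero.2 h
  have hr := (lagrange_pos h).ne'
  have hs := (lagrange_pos h').ne'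
  have : hingeRate (distTable ![p, q, r, s]) (distTable ![p, q, r, s]) 0 1 2 3 = 0 := by
    simp only [hingeRate, distTable, polar_halfSq, two_halfSq, Matrix.cons_val_zero,
      Matrix.cons_val_one, Matrix.cons_val]
    rw [div_eq_zero_iff]; left
    have e1 : ∀ A B C : ℝ, A * B + A * B - 2 * C * C = 2 * (A * B - C ^ 2) := by intros; ring
    rw [e1, e1, mul_div_assoc, mul_div_assoc, div_self hr, div_self hs]
    ring
  rw [this] at h0
  exact h0.symm

/-! ### Symmetry -/

theorem triple_tetPos_ne_zero (hG : InGeneralPosition ρ Γ) (T : Tet) (k : Fin 6) :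
    triple (tetPos ρ Γ T (tetPairs k).2.1 - tetPos ρ Γ T (tetPairs k).1)
      (tetPos ρ Γ T (tetPairs k).2.2.1 - tetPos ρ Γ T (tetPairs k).1)
      (tetPos ρ Γ T (tetPairs k).2.2.2 - tetPos ρ Γ T (tetPairs k).1) ≠ 0 := by
  rw [← abs_ne_zero, triple_hinge, abs_ne_zero]
  exact tetDet_ne_zero hG T

theorem tetHinge_eq (hG : InGeneralPosition ρ Γ) (T : Tet) (ℓ : Edge → ℝ) (k : Fin 6) :
    tetHinge ρ Γ T ℓ k = hinge (tetPos ρ Γ T (tetPairs k).1) (tetPos ρ Γ T (tetPairs k).2.1)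
      (tetPos ρ Γ T (tetPairs k).2.2.1) (tetPos ρ Γ T (tetPairs k).2.2.2)
      (ℓ (tetSide T (tetPairs k).1 (tetPairs k).2.1)) (ℓ (tetSide T (tetPairs k).1 (tetPairs k).2.2.1))
      (ℓ (tetSide T (tetPairs k).1 (tetPairs k).2.2.2))
      (ℓ (tetSide T (tetPairs k).2.1 (tetPairs k).2.2.1))
      (ℓ (tetSide T (tetPairs k).2.1 (tetPairs k).2.2.2))
      (ℓ (tetSide T (tetPairs k).2.2.1 (tetPairs k).2.2.2)) :=
  hingeRate_eq_hinge _ _ _ _ _ _ (triple_tetPos_ne_zero hG T k)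

/-- The contribution of a tetrahedron with vertices `A B O P` to the form of `f₃`. -/
noncomputable def tetForm (A B O P : Fin 3 → ℝ) (ab' ao' ap' bo' bp' op' ab ao ap bo bp op : ℝ) : ℝ :=
  ab' * hinge A B O P ab ao ap bo bp op + ao' * hinge A O B P ao ab ap bo op bp
    + ap' * hinge A P B O ap ab ao bp op bo + bo' * hinge B O A P bo ab bp ao op ap
    + bp' * hinge B P A O bp ab bo ap op ao + op' * hinge O P A B op ao bo ap bp ab

/-- For two edges at a common vertex `p`, the coefficient is the value at the fourth vertex of the
function `hval` of their face, and that function is symmetric in the other two vertices of the face.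
For opposite edges the coefficient is `-1`. -/
theorem tetForm_symm (A B O P : Fin 3 → ℝ) (ab' ao' ap' bo' bp' op' ab ao ap bo bp op : ℝ) :
    tetForm A B O P ab' ao' ap' bo' bp' op' ab ao ap bo bp op
      = tetForm A B O P ab ao ap bo bp op ab' ao' ap' bo' bp' op' := by
  simp only [tetForm, hinge, hval_swap A O B, hval_swap A P B, hval_swap A P O, hval_swap B O A,
    hval_swap B P A, hval_swap B P O, hval_swap O B A, hval_swap O P A, hval_swap O P B,
    hval_swap P B A, hval_swap P O A, hval_swap P O B]
  ring

theorem sum_tetHinge (hG : InGeneralPosition ρ Γ) (T : Tet) (ℓ' ℓ : Edge → ℝ) :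
    ∑ k : Fin 6, ℓ' (tetSide T (tetPairs k).1 (tetPairs k).2.1) * tetHinge ρ Γ T ℓ k
      = tetForm (tetPos ρ Γ T 0) (tetPos ρ Γ T 1) (tetPos ρ Γ T 2) (tetPos ρ Γ T 3)
        (ℓ' (tetSide T 0 1)) (ℓ' (tetSide T 0 2)) (ℓ' (tetSide T 0 3)) (ℓ' (tetSide T 1 2))
        (ℓ' (tetSide T 1 3)) (ℓ' (tetSide T 2 3))
        (ℓ (tetSide T 0 1)) (ℓ (tetSide T 0 2)) (ℓ (tetSide T 0 3)) (ℓ (tetSide T 1 2))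
        (ℓ (tetSide T 1 3)) (ℓ (tetSide T 2 3)) := by
  simp only [tetHinge_eq hG, Fin.sum_univ_six, tetForm]
  simp only [tetPairs, Matrix.cons_val_zero, Matrix.cons_val_one, Matrix.cons_val]
  rw [tetSide_comm T 1 0, tetSide_comm T 2 1, tetSide_comm T 3 1, tetSide_comm T 2 0,
    tetSide_comm T 3 0, tetSide_comm T 3 2]

theorem f₃_form (hE : IsEquivariant ρ Γ) (hG : InGeneralPosition ρ Γ) (ℓ' ℓ : Edge → ℝ) :
    ℓ' ⬝ᵥ (f₃ ρ Γ *ᵥ ℓ) = ∑ T : Tet, tetOrientation T / tetDet ρ Γ T *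
      tetForm (tetPos ρ Γ T 0) (tetPos ρ Γ T 1) (tetPos ρ Γ T 2) (tetPos ρ Γ T 3)
        (ℓ' (tetSide T 0 1)) (ℓ' (tetSide T 0 2)) (ℓ' (tetSide T 0 3)) (ℓ' (tetSide T 1 2))
        (ℓ' (tetSide T 1 3)) (ℓ' (tetSide T 2 3))
        (ℓ (tetSide T 0 1)) (ℓ (tetSide T 0 2)) (ℓ (tetSide T 0 3)) (ℓ (tetSide T 1 2))
        (ℓ (tetSide T 1 3)) (ℓ (tetSide T 2 3)) := by
  rw [f₃_bilin hE hG]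
  simp only [sum_tetHinge hG]

theorem f₃_symm (hE : IsEquivariant ρ Γ) (hG : InGeneralPosition ρ Γ) : (f₃ ρ Γ)ᵀ = f₃ ρ Γ := by
  ext e e'
  have h : ∀ e e', f₃ ρ Γ e e' = Pi.single e 1 ⬝ᵥ (f₃ ρ Γ *ᵥ Pi.single e' 1) := by
    intro e e'; simp
  rw [transpose_apply, h, h e e', f₃_form hE hG, f₃_form hE hG]
  exact Finset.sum_congr rfl fun T _ => by rw [tetForm_symm]

/-! ### Displacements of the vertices do not change the angles -/

/-- The variation of the half squared length of an edge under the displacement `ξ`. -/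
noncomputable def edgeVar (ρ : TrefoilGroup →* SO3) (Γ ξ : Vertex → Fin 3 → ℝ) (e : Edge) : ℝ :=
  (liftPos ρ Γ (edgeEnds e).1 - liftPos ρ Γ (edgeEnds e).2) ⬝ᵥ
    (liftPos ρ ξ (edgeEnds e).1 - liftPos ρ ξ (edgeEnds e).2)

theorem liftPos_add (w : TrefoilGroup × Vertex) :
    liftPos ρ (Γ + ξ) w = liftPos ρ Γ w + liftPos ρ ξ w := by
  simp [liftPos, mulVec_add]

theorem halfSq_add (p q p' q' : Fin 3 → ℝ) :
    halfSq (p + p') (q + q') = halfSq p q + halfSq p' q' + (p - q) ⬝ᵥ (p' - q') := by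
  simp only [halfSq, dot3, Pi.sub_apply, Pi.add_apply]; ring

/-- Polarisation: the independence of the half squared lengths from the lift, applied to `Γ + ξ`,
`Γ` and `ξ`, gives it for the mixed term. -/
theorem edgeVar_tetSide (hE : IsEquivariant ρ Γ) (hξ : IsEquivariant ρ ξ) (T : Tet) (p q : Fin 4)
    (h : p ≠ q) : edgeVar ρ Γ ξ (tetSide T p q)
      = (tetPos ρ Γ T p - tetPos ρ Γ T q) ⬝ᵥ (tetPos ρ ξ T p - tetPos ρ ξ T q) := by
  have hs : IsEquivariant ρ (Γ + ξ) := fun i => by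
    simp only [Pi.add_apply, mulVec_add, (hE i).1, (hE i).2, (hξ i).1, (hξ i).2, and_self]
  have h1 := halfSqLength_tetSide hs T p q h
  rw [halfSqLength_eq] at h1
  simp only [tetPos, liftPos_add, halfSq_add] at h1 ⊢
  have h2 := halfSqLength_tetSide hE T p q h
  have h3 := halfSqLength_tetSide hξ T p q h
  rw [halfSqLength_eq] at h2 h3
  simp only [tetPos] at h2 h3
  rw [edgeVar]
  linarith

theorem hinge_displacement {p q r s : Fin 3 → ℝ} (p' q' r' s' : Fin 3 → ℝ)
    (h : triple (q - p) (r - p) (s - p) ≠ 0) :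
    hinge p q r s ((p - q) ⬝ᵥ (p' - q')) ((p - r) ⬝ᵥ (p' - r')) ((p - s) ⬝ᵥ (p' - s'))
      ((q - r) ⬝ᵥ (q' - r')) ((q - s) ⬝ᵥ (q' - s')) ((r - s) ⬝ᵥ (r' - s'))
        / triple (q - p) (r - p) (s - p)
      = spinRate p q r p' q' r' - spinRate p q s p' q' s' := by
  have h1 := hingeRate_displacement ![p, q, r, s] ![p', q', r', s'] 0 1 2 3 h
  rw [hingeRate_eq_hinge _ _ _ _ _ _ h] at h1
  exact h1

end TrefoilInvariant

namespace TrefoilInvariant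

variable {ρ : TrefoilGroup →* SO3} {Γ ξ : Vertex → Fin 3 → ℝ}

theorem triple_rot (R : SO3) (x y z : Fin 3 → ℝ) :
    triple ((R : Matrix (Fin 3) (Fin 3) ℝ) *ᵥ x) ((R : Matrix (Fin 3) (Fin 3) ℝ) *ᵥ y)
      ((R : Matrix (Fin 3) (Fin 3) ℝ) *ᵥ z) = triple x y z := by
  have hd : (R : Matrix (Fin 3) (Fin 3) ℝ).det = 1 :=
    (Matrix.mem_specialOrthogonalGroup_iff.1 R.2).2
  rw [← det_of_eq_triple, ← det_of_eq_triple]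
  have : Matrix.of ![(R : Matrix (Fin 3) (Fin 3) ℝ) *ᵥ x, (R : Matrix (Fin 3) (Fin 3) ℝ) *ᵥ y,
      (R : Matrix (Fin 3) (Fin 3) ℝ) *ᵥ z]
      = Matrix.of ![x, y, z] * (R : Matrix (Fin 3) (Fin 3) ℝ)ᵀ := by
    ext i j
    fin_cases i <;> simp [Matrix.mul_apply, Matrix.mulVec, dotProduct, mul_comm]
  rw [this, det_mul, det_transpose, hd, mul_one]

/-- Written in inner products and triple products, the spin rate is visibly invariant under
rotations. -/
theorem spinRate_eq (p q r p' q' r' : Fin 3 → ℝ) :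
    spinRate p q r p' q' r' = ((r - p) ⬝ᵥ (q - p) * triple (q - p) (q' - p') (r - p)
      + (q - p) ⬝ᵥ (q - p) * triple (q - p) (r - p) (r' - p'))
      / ((q - p) ⬝ᵥ (q - p) * ((r - p) ⬝ᵥ (r - p) * ((q - p) ⬝ᵥ (q - p))
        - (r - p) ⬝ᵥ (q - p) * ((r - p) ⬝ᵥ (q - p)))) := by
  rw [spinRate, cross_dot_cross']
  congr 1
  simp only [dot3, triple, cross_apply, Matrix.cons_val_zero, Matrix.cons_val_one, Matrix.cons_val,
    Pi.add_apply]
  ring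

theorem spinRate_rot (R : SO3) (p q r p' q' r' : Fin 3 → ℝ) :
    spinRate ((R : Matrix (Fin 3) (Fin 3) ℝ) *ᵥ p) ((R : Matrix (Fin 3) (Fin 3) ℝ) *ᵥ q)
      ((R : Matrix (Fin 3) (Fin 3) ℝ) *ᵥ r) ((R : Matrix (Fin 3) (Fin 3) ℝ) *ᵥ p')
      ((R : Matrix (Fin 3) (Fin 3) ℝ) *ᵥ q') ((R : Matrix (Fin 3) (Fin 3) ℝ) *ᵥ r')
      = spinRate p q r p' q' r' := by
  simp only [spinRate_eq, ← mulVec_sub, dot_rot, triple_rot]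

/-- The determinants of the six orderings of the vertices of a tetrahedron in `tetForm`. -/
theorem triple_orders (A B O P : Fin 3 → ℝ) :
    triple (O - A) (B - A) (P - A) = -triple (B - A) (O - A) (P - A) ∧
    triple (P - A) (B - A) (O - A) = triple (B - A) (O - A) (P - A) ∧
    triple (O - B) (A - B) (P - B) = triple (B - A) (O - A) (P - A) ∧
    triple (P - B) (A - B) (O - B) = -triple (B - A) (O - A) (P - A) ∧
    triple (P - O) (A - O) (B - O) = triple (B - A) (O - A) (P - A) := by
  refine ⟨?_, ?_, ?_, ?_, ?_⟩ <;> simp only [triple, Pi.sub_apply] <;> ring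

/-- Displacements of the vertices are in the kernel of `f₃`. -/
theorem f₃_edgeVar (hE : IsEquivariant ρ Γ) (hξ : IsEquivariant ρ ξ) (hG : InGeneralPosition ρ Γ)
    (ℓ : Edge → ℝ) : ℓ ⬝ᵥ (f₃ ρ Γ *ᵥ edgeVar ρ Γ ξ) = 0 := by
  rw [f₃_form hE hG]
  -- The face function is the sum of the spins of the face about its three edges, weighted by `ℓ`;
  -- the alternating signs come from the cyclic order of the vertices.
  have h := sum_faceBoundary hE hξ (fun x y a b c => ℓ a * spinRate (x 0) (x 1) (x 2) (y 0) (y 1) (y 2)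
    - ℓ b * spinRate (x 0) (x 2) (x 1) (y 0) (y 2) (y 1)
    + ℓ c * spinRate (x 1) (x 2) (x 0) (y 1) (y 2) (y 0)) (by
      intro R x y a b c
      simp only [Matrix.cons_val_zero, Matrix.cons_val_one, Matrix.cons_val, spinRate_rot])
  rw [← h]
  refine Finset.sum_congr rfl fun T _ => ?_
  rw [div_mul_eq_mul_div, mul_div_assoc]
  congr 1
  have hT := tetDet_ne_zero hG T
  rw [edgeVar_tetSide hE hξ T 0 1 (by decide), edgeVar_tetSide hE hξ T 0 2 (by decide),
    edgeVar_tetSide hE hξ T 0 3 (by decide), edgeVar_tetSide hE hξ T 1 2 (by decide),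
    edgeVar_tetSide hE hξ T 1 3 (by decide), edgeVar_tetSide hE hξ T 2 3 (by decide)]
  simp only [faceBoundary, faceVal, Matrix.cons_val_zero, Matrix.cons_val_one, Matrix.cons_val]
  unfold tetDet at hT ⊢
  set A := tetPos ρ Γ T 0
  set B := tetPos ρ Γ T 1
  set O := tetPos ρ Γ T 2
  set P := tetPos ρ Γ T 3
  set A' := tetPos ρ ξ T 0
  set B' := tetPos ρ ξ T 1
  set O' := tetPos ρ ξ T 2
  set P' := tetPos ρ ξ T 3
  obtain ⟨t1, t2, t3, t4, t5⟩ := triple_orders A B O P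
  have c : ∀ x y x' y' : Fin 3 → ℝ, (x - y) ⬝ᵥ (x' - y') = (y - x) ⬝ᵥ (y' - x') := by
    intro x y x' y'; simp only [dot3, Pi.sub_apply]; ring
  have h1 := hinge_displacement A' B' O' P' hT
  have h2 := hinge_displacement A' O' B' P' (t1 ▸ neg_ne_zero.2 hT)
  have h3 := hinge_displacement A' P' B' O' (t2 ▸ hT)
  have h4 := hinge_displacement B' O' A' P' (t3 ▸ hT)
  have h5 := hinge_displacement B' P' A' O' (t4 ▸ neg_ne_zero.2 hT)
  have h6 := hinge_displacement O' P' A' B' (t5 ▸ hT)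
  rw [t1, c O B, div_neg] at h2
  rw [t2, c P B, c P O] at h3
  rw [t3, c B A, c O A] at h4
  rw [t4, c B A, c P A, c P O, div_neg] at h5
  rw [t5, c O A, c O B, c P A, c P B] at h6
  simp only [tetForm, add_div, mul_div_assoc]
  linear_combination ℓ (tetSide T 0 1) * h1 - ℓ (tetSide T 0 2) * h2 + ℓ (tetSide T 0 3) * h3
    + ℓ (tetSide T 1 2) * h4 - ℓ (tetSide T 1 3) * h5 + ℓ (tetSide T 2 3) * h6

end TrefoilInvariant

namespace TrefoilInvariant

/-! ### Affine dependencies -/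

/-- An affine function respects affine dependencies, and this one is 1 at `p` and vanishes at `q`
and `r`. -/
theorem hval_dependency {p q r x y : Fin 3 → ℝ} {αp αq αr αx αy : ℝ}
    (h : (r - p) ⬝ᵥ (r - p) * ((q - p) ⬝ᵥ (q - p)) - ((r - p) ⬝ᵥ (q - p)) ^ 2 ≠ 0)
    (h0 : αp + αq + αr + αx + αy = 0)
    (h1 : αp • p + αq • q + αr • r + αx • x + αy • y = 0) :
    αp + αx * hval p q r x + αy * hval p q r y = 0 := by
  have hq := coplanarDual_left h
  have hr := coplanarDual_right h
  have h2 : αq • (q - p) + αr • (r - p) + αx • (x - p) + αy • (y - p) = 0 := by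
    have : αp = -(αq + αr + αx + αy) := by linarith
    rw [this] at h1
    rw [← h1]
    module
  have h3 := congrArg (· ⬝ᵥ coplanarDual p q r) h2
  simp only [add_dotProduct, smul_dotProduct, hq, hr, zero_dotProduct, smul_eq_mul] at h3
  rw [hval, hval]
  linear_combination h0 - h3

theorem hval_of_decomposition {p q r x n : Fin 3 → ℝ} {c d : ℝ}
    (h : (r - p) ⬝ᵥ (r - p) * ((q - p) ⬝ᵥ (q - p)) - ((r - p) ⬝ᵥ (q - p)) ^ 2 ≠ 0)
    (hx : x - p = c • (q - p) + d • (r - p) + n) (h1 : n ⬝ᵥ (q - p) = 0) (h2 : n ⬝ᵥ (r - p) = 0) :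
    hval p q r x = 1 - c - d := by
  have hn : n ⬝ᵥ coplanarDual p q r = 0 := by
    simp only [coplanarDual, dotProduct_smul, dotProduct_add, h1, h2, smul_zero, add_zero]
  rw [hval, hx]
  simp only [add_dotProduct, smul_dotProduct, coplanarDual_left h, coplanarDual_right h, hn,
    smul_eq_mul]
  ring

theorem triple_vertex (p q r s : Fin 3 → ℝ) : triple (q - p) (r - p) (s - p)
    = triple q r s - triple p r s + triple p q s - triple p q r := by
  simp only [triple, Pi.sub_apply]; ring

theorem triple_origin (p q r : Fin 3 → ℝ) : triple (q - p) (r - p) (0 - p) = -triple p q r := by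
  simp only [triple, Pi.sub_apply, Pi.zero_apply]; ring

/-- Cramer's rule for four vectors in 3-space; completed by a coefficient at the origin it becomes
the affine dependency of the five points. -/
theorem cramer_relation (p q r s : Fin 3 → ℝ) :
    triple q r s • p + (-triple p r s) • q + triple p q s • r + (-triple p q r) • s = 0 := by
  ext i
  simp only [Pi.add_apply, Pi.smul_apply, smul_eq_mul, Pi.zero_apply, triple]
  fin_cases i <;> simp <;> ring

/-- The linear functional `∑ αᵢ αⱼ mᵢⱼ` of five points with affine dependency `α`. -/
def stress (αp αq αr αs αx pq pr ps px qr qs qx rs rx sx : ℝ) : ℝ :=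
  αp * αq * pq + αp * αr * pr + αp * αs * ps + αp * αx * px + αq * αr * qr + αq * αs * qs
    + αq * αx * qx + αr * αs * rs + αr * αx * rx + αs * αx * sx

/-- Coordinatewise this is the identity `∑ αᵢ αⱼ (xᵢ - xⱼ)² = 2 (∑ αᵢ)(∑ αᵢ xᵢ²) - 2 (∑ αᵢ xᵢ)²`
over ordered pairs. -/
theorem stress_halfSq {p q r s x : Fin 3 → ℝ} {αp αq αr αs αx : ℝ}
    (h0 : αp + αq + αr + αs + αx = 0) (h1 : αp • p + αq • q + αr • r + αs • s + αx • x = 0) :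
    stress αp αq αr αs αx (halfSq p q) (halfSq p r) (halfSq p s) (halfSq p x) (halfSq q r)
      (halfSq q s) (halfSq q x) (halfSq r s) (halfSq r x) (halfSq s x) = 0 := by
  have h2 : ∀ i, αp * p i + αq * q i + αr * r i + αs * s i + αx * x i = 0 := fun i => by
    simpa using congrFun h1 i
  have key : ∀ p q r s x : ℝ, αp * p + αq * q + αr * r + αs * s + αx * x = 0 →
      stress αp αq αr αs αx ((p - q) ^ 2) ((p - r) ^ 2) ((p - s) ^ 2) ((p - x) ^ 2)
        ((q - r) ^ 2) ((q - s) ^ 2) ((q - x) ^ 2) ((r - s) ^ 2) ((r - x) ^ 2) ((s - x) ^ 2) = 0 := by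
    intro p q r s x h
    rw [stress]
    linear_combination (αp * p ^ 2 + αq * q ^ 2 + αr * r ^ 2 + αs * s ^ 2 + αx * x ^ 2) * h0
      - (αp * p + αq * q + αr * r + αs * s + αx * x) * h
  have k0 := key _ _ _ _ _ (h2 0)
  have k1 := key _ _ _ _ _ (h2 1)
  have k2 := key _ _ _ _ _ (h2 2)
  simp only [stress, halfSq, dot3, Pi.sub_apply] at k0 k1 k2 ⊢
  linear_combination (k0 + k1 + k2) / 2

/-- The variations of the three dihedral angles at `p q` of the tetrahedra spanned by `p q` and two
of the points `r`, `s`, `0`. -/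
theorem hinge_five_points (p q r s : Fin 3 → ℝ) (hX : triple (q - p) (r - p) (s - p) ≠ 0)
    (hr : triple p q r ≠ 0) (hs : triple p q s ≠ 0) (pq pr ps px qr qs qx rs rx sx : ℝ) :
    hinge p q r s pq pr ps qr qs rs / triple (q - p) (r - p) (s - p)
      + hinge p q r 0 pq pr px qr qx rx / triple p q r
      - hinge p q s 0 pq ps px qs qx sx / triple p q s
    = stress (triple q r s) (-triple p r s) (triple p q s) (-triple p q r)
        (-triple (q - p) (r - p) (s - p)) pq pr ps px qr qs qx rs rx sx
      / (triple p q s * -triple p q r * -triple (q - p) (r - p) (s - p)) := by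
  have hr' : triple (q - p) (r - p) (0 - p) ≠ 0 := by rw [triple_origin]; exact neg_ne_zero.2 hr
  have hs' : triple (q - p) (s - p) (0 - p) ≠ 0 := by rw [triple_origin]; exact neg_ne_zero.2 hs
  have sw : ∀ {a b c : Fin 3 → ℝ}, triple a b c ≠ 0 → triple a c b ≠ 0 := by
    intro a b c h; rw [triple_swap]; exact neg_ne_zero.2 h
  have fl : ∀ {x : Fin 3 → ℝ}, ∀ y, triple (q - p) (x - p) (y - p) ≠ 0 →
      triple (p - q) (x - q) (y - q) ≠ 0 := by
    intro x y h
    have : triple (p - q) (x - q) (y - q) = -triple (q - p) (x - p) (y - p) := by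
      simp only [triple, Pi.sub_apply]; ring
    rw [this]; exact neg_ne_zero.2 h
  have hsum : triple q r s + -triple p r s + triple p q s + -triple p q r
      + -triple (q - p) (r - p) (s - p) = 0 := by rw [triple_vertex]; ring
  have hrel : triple q r s • p + (-triple p r s) • q + triple p q s • r + (-triple p q r) • s
      + (-triple (q - p) (r - p) (s - p)) • (0 : Fin 3 → ℝ) = 0 := by
    rw [smul_zero, add_zero, cramer_relation]
  have m1 := hinge_halfSq hX
  have m2 := hinge_halfSq hr'
  have m3 := hinge_halfSq hs'
  have m4 := stress_halfSq hsum hrel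
  have hpq : halfSq p q ≠ 0 := by
    have := dot_self_pos_of_triple hX
    rw [← two_halfSq] at this
    intro h; rw [h] at this; simp at this
  -- The dependency is evaluated on the six affine functions belonging to the faces `p q r`, `p q
  -- s`, `p q 0` at either end of `p q`. This determines every coefficient apart from that of `p q`
  -- itself.
  have d1 := hval_dependency (lagrange_pos hX).ne' hsum hrel
  have d2 := hval_dependency (p := q) (q := p) (lagrange_pos (fl _ hX)).ne'
    (by linear_combination hsum) (by refine Eq.trans ?_ hrel; abel)
      (αq := triple q r s) (αp := -triple p r s) (αr := triple p q s)
      (αx := -triple p q r) (αy := -triple (q - p) (r - p) (s - p)) (r := r) (x := s) (y := 0)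
  have d3 := hval_dependency (p := p) (q := q) (lagrange_pos (sw hX)).ne'
    (by linear_combination hsum) (by refine Eq.trans ?_ hrel; abel)
      (αp := triple q r s) (αq := -triple p r s) (αx := triple p q s)
      (αr := -triple p q r) (αy := -triple (q - p) (r - p) (s - p)) (x := r) (r := s) (y := 0)
  have d4 := hval_dependency (p := q) (q := p) (lagrange_pos (sw (fl _ hX))).ne'
    (by linear_combination hsum) (by refine Eq.trans ?_ hrel; abel)
      (αq := triple q r s) (αp := -triple p r s) (αx := triple p q s)
      (αr := -triple p q r) (αy := -triple (q - p) (r - p) (s - p)) (x := r) (r := s) (y := 0)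
  have d5 := hval_dependency (p := p) (q := q) (lagrange_pos (sw hr')).ne'
    (by linear_combination hsum) (by refine Eq.trans ?_ hrel; abel)
      (αp := triple q r s) (αq := -triple p r s) (αx := triple p q s)
      (αy := -triple p q r) (αr := -triple (q - p) (r - p) (s - p)) (x := r) (y := s) (r := 0)
  have d6 := hval_dependency (p := q) (q := p) (lagrange_pos (sw (fl _ hr'))).ne'
    (by linear_combination hsum) (by refine Eq.trans ?_ hrel; abel)
      (αq := triple q r s) (αp := -triple p r s) (αx := triple p q s)
      (αy := -triple p q r) (αr := -triple (q - p) (r - p) (s - p)) (x := r) (y := s) (r := 0)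
  simp only [hinge, stress] at m1 m2 m3 m4 ⊢
  set W := triple (q - p) (r - p) (s - p)
  set R := triple p q r
  set S := triple p q s
  set α := triple q r s
  set β := triple p r s
  have e1 : hval p q r s = (α - W * hval p q r 0) / R := by
    rw [eq_div_iff hr]; linear_combination -d1
  have e2 : hval q p r s = (-β - W * hval q p r 0) / R := by
    rw [eq_div_iff hr]; linear_combination -d2
  have e3 : hval p q s r = (-α + W * hval p q s 0) / S := by
    rw [eq_div_iff hs]; linear_combination d3
  have e4 : hval q p s r = (β + W * hval q p s 0) / S := by
    rw [eq_div_iff hs]; linear_combination d4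
  have e5 : hval p q 0 s = (α + S * hval p q 0 r) / R := by
    rw [eq_div_iff hr]; linear_combination -d5
  have e6 : hval q p 0 s = (-β + S * hval q p 0 r) / R := by
    rw [eq_div_iff hr]; linear_combination -d6
  rw [e1, e2, e3, e4] at m1
  rw [e5, e6] at m3
  rw [e1, e2, e3, e4, e5, e6]
  -- the coefficient of `pq` is determined by the invariance under dilations
  have hc : hdiag p q r s / W + hdiag p q r 0 / R - hdiag p q s 0 / S
      = α * -β / (S * -R * -W) := by
    apply mul_right_cancel₀ hpq
    linear_combination (norm := skip) m1 / W + m2 / R - m3 / S - m4 / (S * R * W)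
    field_simp
    ring
  field_simp at hc ⊢
  linear_combination pq * hc

end TrefoilInvariant

/-! ### A tetrahedron compared with its cones from the origin. -/

namespace TrefoilInvariant

/-- The linear functional of the edges of a tetrahedron with vertices `A B O P` that generates the
conditions for its cone over the origin to be flat. -/
noncomputable def crossRow (A B O P : Fin 3 → ℝ) (ab ao ap bo bp op : ℝ) : ℝ :=
  triple B O P * -triple A O P * ab + triple B O P * triple A B P * ao
    + triple B O P * -triple A B O * ap + -triple A O P * triple A B P * bo
    + -triple A O P * -triple A B O * bp + triple A B P * -triple A B O * op

/-- The contribution to the angles of the cone over a face `x y z` from the origin. -/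
noncomputable def coneFace (x y z : Fin 3 → ℝ) (xy' xz' yz' xy xz yz : ℝ) : ℝ :=
  (xy' * hinge x y z 0 xy xz 0 yz 0 0 + xz' * hinge x z y 0 xz xy 0 yz 0 0
    + yz' * hinge y z x 0 yz xy 0 xz 0 0) / triple x y z

theorem triple_perm₁ (a b c : Fin 3 → ℝ) : triple b a c = -triple a b c := by
  simp only [triple]; ring

theorem triple_rotate (a b c : Fin 3 → ℝ) : triple b c a = triple a b c := by
  simp only [triple]; ring

theorem triple_rotate' (a b c : Fin 3 → ℝ) : triple c a b = triple a b c := by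
  simp only [triple]; ring

/-- The form of a tetrahedron in general position with respect to the origin. -/
theorem tetForm_cross {A B O P : Fin 3 → ℝ} (hΔ : triple (B - A) (O - A) (P - A) ≠ 0)
    (h1 : triple A B O ≠ 0) (h2 : triple A B P ≠ 0) (h3 : triple A O P ≠ 0)
    (h4 : triple B O P ≠ 0) (ab' ao' ap' bo' bp' op' ab ao ap bo bp op : ℝ) :
    tetForm A B O P ab' ao' ap' bo' bp' op' ab ao ap bo bp op / triple (B - A) (O - A) (P - A)
      = -(coneFace A B O ab' ao' bo' ab ao bo - coneFace A B P ab' ap' bp' ab ap bp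
          + coneFace A O P ao' ap' op' ao ap op - coneFace B O P bo' bp' op' bo bp op)
        - crossRow A B O P ab' ao' ap' bo' bp' op' * crossRow A B O P ab ao ap bo bp op
          / (triple (B - A) (O - A) (P - A) * (triple B O P * triple A O P * triple A B P
            * triple A B O)) := by
  obtain ⟨t1, t2, t3, t4, t5⟩ := triple_orders A B O P
  have p1 : triple A O B = -triple A B O := triple_swap A B O
  have p2 : triple A P B = -triple A B P := triple_swap A B P
  have p3 : triple A P O = -triple A O P := triple_swap A O P
  have p4 : triple B P O = -triple B O P := triple_swap B O P
  have p5 : triple O B P = -triple B O P := triple_perm₁ _ _ _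
  have p6 : triple P B O = triple B O P := triple_rotate' _ _ _
  have p7 : triple O A P = -triple A O P := triple_perm₁ _ _ _
  have p8 : triple B O A = triple A B O := triple_rotate _ _ _
  have p9 : triple P A O = triple A O P := triple_rotate' _ _ _
  have p10 : triple B P A = triple A B P := triple_rotate _ _ _
  have p11 : triple P A B = triple A B P := triple_rotate' _ _ _
  have p12 : triple O A B = triple A B O := triple_rotate' _ _ _
  have p13 : triple O P A = triple A O P := triple_rotate _ _ _
  have p14 : triple O P B = triple B O P := triple_rotate _ _ _
  have p15 : triple B A P = -triple A B P := triple_perm₁ _ _ _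
  have p16 : triple B A O = -triple A B O := triple_perm₁ _ _ _
  have n : ∀ {x : ℝ}, x ≠ 0 → -x ≠ 0 := fun h => neg_ne_zero.2 h
  -- The five point identity at each of the six edges, with the edges to the origin kept unvaried.
  have r1 := hinge_five_points A B O P hΔ h1 h2 ab ao ap 0 bo bp 0 op 0 0
  have r2 := hinge_five_points A O B P (t1 ▸ n hΔ) (p1 ▸ n h1) h3 ao ab ap 0 bo op 0 bp 0 0
  have r3 := hinge_five_points A P B O (t2 ▸ hΔ) (p2 ▸ n h2) (p3 ▸ n h3) ap ab ao 0 bp op 0 bo 0 0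
  have r4 := hinge_five_points B O A P (t3 ▸ hΔ) (p8 ▸ h1) h4 bo ab bp 0 ao op 0 ap 0 0
  have r5 := hinge_five_points B P A O (t4 ▸ n hΔ) (p10 ▸ h2) (p4 ▸ n h4) bp ab bo 0 ap op 0 ao 0 0
  have r6 := hinge_five_points O P A B (t5 ▸ hΔ) (p13 ▸ h3) (p14 ▸ h4) op ao bo 0 ap bp 0 ab 0 0
  rw [t1, p1, p5] at r2
  rw [t2, p2, p3, p6] at r3
  rw [t3, p8, p7, p15] at r4
  rw [t4, p10, p4, p9, p16] at r5
  rw [t5, p13, p14, p11, p12] at r6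
  simp only [tetForm, coneFace]
  -- All six edges meet the same functional, because the stress of the five points is unique; hence
  -- the rank one form.
  set K := crossRow A B O P ab ao ap bo bp op with hK
  replace r1 := r1.trans (congrArg (· / _) (by simp only [hK, crossRow, stress]; ring : _ = K))
  replace r2 := r2.trans (congrArg (· / _) (by simp only [hK, crossRow, stress]; ring : _ = K))
  replace r3 := r3.trans (congrArg (· / _) (by simp only [hK, crossRow, stress]; ring : _ = K))
  replace r4 := r4.trans (congrArg (· / _) (by simp only [hK, crossRow, stress]; ring : _ = K))
  replace r5 := r5.trans (congrArg (· / _) (by simp only [hK, crossRow, stress]; ring : _ = K))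
  replace r6 := r6.trans (congrArg (· / _) (by simp only [hK, crossRow, stress]; ring : _ = K))
  simp only [crossRow]
  simp only [div_eq_mul_inv] at r1 r2 r3 r4 r5 r6 ⊢
  set Δ := triple (B - A) (O - A) (P - A)
  set U := triple A B O
  set V := triple A B P
  set W := triple A O P
  set X := triple B O P
  have v2 : V * V⁻¹ = 1 := mul_inv_cancel₀ h2
  have v1 : U * U⁻¹ = 1 := mul_inv_cancel₀ h1
  have v3 : W * W⁻¹ = 1 := mul_inv_cancel₀ h3
  have v4 : X * X⁻¹ = 1 := mul_inv_cancel₀ h4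
  clear_value Δ U V W X K
  linear_combination (norm := skip) ab' * r1 - ao' * r2 + ap' * r3 + bo' * r4 - bp' * r5 + op' * r6
  generalize hinge A B O 0 ab ao 0 bo 0 0 = c1
  generalize hinge A B P 0 ab ap 0 bp 0 0 = c2
  field_simp
  ring

end TrefoilInvariant

namespace TrefoilInvariant

/-! ### Tetrahedra with an edge on a line through the origin -/

section Collinear

variable {u O P : Fin 3 → ℝ}

theorem gram_pos_left (h : triple u O P ≠ 0) (hu : u ⬝ᵥ u = 1) : 0 < O ⬝ᵥ O - (u ⬝ᵥ O) ^ 2 := by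
  have := lagrange_pos h
  rw [hu, dotProduct_comm O u] at this
  linarith

/-- The component of `P` normal to the plane spanned by `u` and `O`. -/
theorem normal_component (h : triple u O P ≠ 0) (hu : u ⬝ᵥ u = 1) :
    ∃ n : Fin 3 → ℝ, n ⬝ᵥ u = 0 ∧ n ⬝ᵥ O = 0 ∧
      P = (u ⬝ᵥ P - (O ⬝ᵥ P - (u ⬝ᵥ O) * (u ⬝ᵥ P)) / (O ⬝ᵥ O - (u ⬝ᵥ O) ^ 2) * (u ⬝ᵥ O)) • u
        + ((O ⬝ᵥ P - (u ⬝ᵥ O) * (u ⬝ᵥ P)) / (O ⬝ᵥ O - (u ⬝ᵥ O) ^ 2)) • O + n := by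
  have ho := (gram_pos_left h hu).ne'
  refine ⟨P - ((u ⬝ᵥ P - (O ⬝ᵥ P - (u ⬝ᵥ O) * (u ⬝ᵥ P)) / (O ⬝ᵥ O - (u ⬝ᵥ O) ^ 2) * (u ⬝ᵥ O)) • u
        + ((O ⬝ᵥ P - (u ⬝ᵥ O) * (u ⬝ᵥ P)) / (O ⬝ᵥ O - (u ⬝ᵥ O) ^ 2)) • O), ?_, ?_, by abel⟩
  · simp only [sub_dotProduct, add_dotProduct, smul_dotProduct, smul_eq_mul, hu,
      dotProduct_comm P u, dotProduct_comm O u]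
    ring
  · simp only [sub_dotProduct, add_dotProduct, smul_dotProduct, smul_eq_mul, hu,
      dotProduct_comm P O]
    field_simp
    ring

theorem triple_collinear (a b : ℝ) : triple (b • u - a • u) (O - a • u) (P - a • u)
    = (b - a) * triple u O P := by
  simp only [triple, Pi.sub_apply, Pi.smul_apply, smul_eq_mul]; ring

theorem triple_collinear' (a b : ℝ) : triple (a • u - O) (b • u - O) (P - O)
    = -((a - b) * triple u O P) := by
  simp only [triple, Pi.sub_apply, Pi.smul_apply, smul_eq_mul]; ring

theorem triple_collinear'' (a b : ℝ) : triple (O - a • u) (b • u - a • u) (P - a • u)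
    = (a - b) * triple u O P := by
  simp only [triple, Pi.sub_apply, Pi.smul_apply, smul_eq_mul]; ring

/-- Modulo a normal of the plane of `u` and `O`, the point `P` is a multiple of `O` plus a multiple
of `u`. The function is 1 at `O` and 0 on the axis, so its value at `P` is the multiple of `O`; it
does not depend on `a` and `b`. -/
theorem hval_apex (h : triple u O P ≠ 0) (hu : u ⬝ᵥ u = 1) {a b : ℝ} (hab : a - b ≠ 0) :
    hval O (a • u) (b • u) P = (O ⬝ᵥ P - (u ⬝ᵥ O) * (u ⬝ᵥ P)) / (O ⬝ᵥ O - (u ⬝ᵥ O) ^ 2) := by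
  obtain ⟨n, n1, n2, hP⟩ := normal_component h hu
  set σ := (O ⬝ᵥ P - (u ⬝ᵥ O) * (u ⬝ᵥ P)) / (O ⬝ᵥ O - (u ⬝ᵥ O) ^ 2)
  set τ := u ⬝ᵥ P - σ * (u ⬝ᵥ O)
  have hD := (lagrange_pos (e := a • u - O) (a := b • u - O) (b := P - O)
    (by rw [triple_collinear']; exact neg_ne_zero.2 (mul_ne_zero hab h))).ne'
  rw [hval_of_decomposition (n := n) (c := (τ - b * (1 - σ)) / (a - b))
    (d := (a * (1 - σ) - τ) / (a - b)) hD ?_ ?_ ?_]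
  · field_simp; ring
  · ext i
    have := congrFun hP i
    simp only [Pi.add_apply, Pi.smul_apply, Pi.sub_apply, smul_eq_mul] at this ⊢
    rw [this]; field_simp; ring
  · rw [dotProduct_sub, dotProduct_smul, n1, n2]; simp
  · rw [dotProduct_sub, dotProduct_smul, n1, n2]; simp

theorem hval_base (h : triple u O P ≠ 0) (hu : u ⬝ᵥ u = 1) {a b : ℝ} (hab : a - b ≠ 0) :
    (a - b) * hval (a • u) O (b • u) P
      = u ⬝ᵥ P - b - (O ⬝ᵥ P - (u ⬝ᵥ O) * (u ⬝ᵥ P)) / (O ⬝ᵥ O - (u ⬝ᵥ O) ^ 2) * (u ⬝ᵥ O - b) := by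
  obtain ⟨n, n1, n2, hP⟩ := normal_component h hu
  set σ := (O ⬝ᵥ P - (u ⬝ᵥ O) * (u ⬝ᵥ P)) / (O ⬝ᵥ O - (u ⬝ᵥ O) ^ 2)
  have hD := (lagrange_pos (e := O - a • u) (a := b • u - a • u) (b := P - a • u)
    (by rw [triple_collinear'']; exact mul_ne_zero hab h)).ne'
  rw [hval_of_decomposition (n := n) (c := σ)
    (d := -(u ⬝ᵥ P - σ * (u ⬝ᵥ O) + σ * a - a) / (a - b)) hD ?_ ?_ ?_]
  · field_simp; ring
  · ext i
    have := congrFun hP i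
    simp only [Pi.add_apply, Pi.smul_apply, Pi.sub_apply, smul_eq_mul] at this ⊢
    rw [this]; field_simp; ring
  · rw [dotProduct_sub, dotProduct_smul, n1, n2]; simp
  · rw [dotProduct_sub, dotProduct_smul, dotProduct_smul, n1]; simp

theorem halfSq_smul_left (hu : u ⬝ᵥ u = 1) (a : ℝ) (x : Fin 3 → ℝ) :
    halfSq (a • u) x = (a ^ 2 - 2 * a * (u ⬝ᵥ x) + x ⬝ᵥ x) / 2 := by
  simp only [halfSq, sub_dotProduct, dotProduct_sub, smul_dotProduct, dotProduct_smul, hu,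
    smul_eq_mul, dotProduct_comm x u]
  ring

/-- The substitute for `hinge_five_points` when two of the vertices and the origin are on a line.
The length variations enter only through the discrepancies `ao/a - bo/b` and `ap/a - bp/b`, which
vanish when the lengths vary as functions proportional to the position along the axis. -/
theorem hinge_collinear (h : triple u O P ≠ 0) (hu : u ⬝ᵥ u = 1) {a b : ℝ} (ha : a ≠ 0) (hb : b ≠ 0)
    (hab : b - a ≠ 0) (ao ap bo bp op : ℝ) :
    hinge (a • u) O (b • u) P ao 0 ap bo op bp / ((b - a) * triple u O P)
      + hinge (a • u) O P 0 ao ap 0 op 0 0 / (a * triple u O P)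
    = b / ((b - a) * triple u O P) * (-((O ⬝ᵥ P - (u ⬝ᵥ O) * (u ⬝ᵥ P)) / (O ⬝ᵥ O - (u ⬝ᵥ O) ^ 2))
        * (ao / a - bo / b) + (ap / a - bp / b)) := by
  have hab' : a - b ≠ 0 := fun h => hab (by linarith)
  have h1 := hval_apex h hu hab'
  have h2 := hval_apex h hu (a := a) (b := 0) (by simpa using ha)
  have h3 := hval_base h hu hab'
  have h4 := hval_base h hu (a := a) (b := 0) (by simpa using ha)
  rw [zero_smul] at h2 h4
  have T1 : triple (O - a • u) (b • u - a • u) (P - a • u) ≠ 0 := by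
    rw [triple_collinear'']; exact mul_ne_zero hab' h
  have T1' : triple (O - a • u) (P - a • u) (b • u - a • u) ≠ 0 := by
    rw [triple_swap]; exact neg_ne_zero.2 T1
  have T2 : triple (O - a • u) (P - a • u) (0 - a • u) ≠ 0 := by
    have : triple (O - a • u) (P - a • u) (0 - a • u) = -(a * triple u O P) := by
      simp only [triple, Pi.sub_apply, Pi.smul_apply, smul_eq_mul, Pi.zero_apply]; ring
    rw [this]; exact neg_ne_zero.2 (mul_ne_zero ha h)
  have T3 : triple (a • u - O) (P - O) (b • u - O) ≠ 0 := by
    rw [triple_swap, triple_collinear', neg_neg]; exact mul_ne_zero hab' h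
  have d1 := hval_dependency (p := a • u) (q := O) (r := P) (x := b • u) (y := 0) (αp := b)
    (αq := 0) (αr := 0) (αx := -a) (αy := a - b) (lagrange_pos T1').ne' (by ring)
    (by ext i; simp; ring)
  have d2 := hval_dependency (p := O) (q := a • u) (r := P) (x := b • u) (y := 0) (αp := 0)
    (αq := b) (αr := 0) (αx := -a) (αy := a - b) (lagrange_pos T3).ne' (by ring)
    (by ext i; simp; ring)
  have m1 := hinge_halfSq T1
  have m2 := hinge_halfSq T2
  have hM : halfSq (a • u) O ≠ 0 := by
    have := dot_self_pos_of_triple T1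
    rw [← two_halfSq] at this
    intro h; rw [h] at this; simp at this
  have q1 := halfSq_smul_left (u := u) hu a
  have q2 := halfSq_smul_left (u := u) hu b
  have q3 : ∀ x, halfSq x 0 = x ⬝ᵥ x / 2 := fun x => by simp [halfSq]
  have q4 : halfSq O (b • u) = halfSq (b • u) O := halfSq_comm _ _
  have q5 : halfSq O P = (O ⬝ᵥ O + P ⬝ᵥ P - 2 * (O ⬝ᵥ P)) / 2 := by
    simp only [halfSq, sub_dotProduct, dotProduct_sub, dotProduct_comm P O]; ring
  have ho := (gram_pos_left h hu).ne'
  simp only [hinge] at m1 m2 ⊢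
  rw [q4] at m1
  set σ := (O ⬝ᵥ P - (u ⬝ᵥ O) * (u ⬝ᵥ P)) / (O ⬝ᵥ O - (u ⬝ᵥ O) ^ 2) with hσ
  have hz : O ⬝ᵥ P = σ * (O ⬝ᵥ O - (u ⬝ᵥ O) ^ 2) + (u ⬝ᵥ O) * (u ⬝ᵥ P) := by
    rw [hσ]; field_simp; ring
  have f1 : hval (a • u) O P (b • u) = (b + (a - b) * hval (a • u) O P 0) / a := by
    rw [eq_div_iff ha]; linear_combination -d1
  have f2 : hval O (a • u) P (b • u) = ((a - b) * hval O (a • u) P 0) / a := by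
    rw [eq_div_iff ha]; linear_combination -d2
  have f3 : hval (a • u) O (b • u) P = (u ⬝ᵥ P - b - σ * (u ⬝ᵥ O - b)) / (a - b) := by
    rw [eq_div_iff hab']; linear_combination h3
  have f4 : hval (a • u) O 0 P = (u ⬝ᵥ P - σ * (u ⬝ᵥ O)) / a := by
    rw [eq_div_iff ha]; linear_combination h4
  rw [f1, f2, f3, h1] at m1
  rw [h2, f4] at m2
  rw [f1, f2, h1]
  have hc : hdiag (a • u) O (b • u) P / (b - a) + hdiag (a • u) O P 0 / a
      = -(b * σ / (a * (b - a))) := by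
    apply mul_right_cancel₀ hM
    linear_combination (norm := skip) m1 / (b - a) + m2 / a
    rw [q3 P, q3 O, q3 (a • u), q1 P, q2 P, q1 (b • u), q5, hz]
    rw [q1 O, q2 O]
    simp only [dotProduct_smul, smul_dotProduct, hu, smul_eq_mul]
    have : a - b = -(b - a) := by ring
    rw [this]
    field_simp
    ring
  have hc' : hdiag (a • u) O (b • u) P / ((b - a) * triple u O P)
      + hdiag (a • u) O P 0 / (a * triple u O P) = -(b * σ / (a * (b - a))) / triple u O P := by
    rw [← hc]; field_simp
  linear_combination (norm := skip) ao * hc'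
  field_simp
  ring

/-- With the link edge unvaried, the tetrahedron and its cones give a form in the two discrepancies
only; the coefficients are the position of `O` and `P` around the axis. -/
theorem tetForm_collinear (h : triple u O P ≠ 0) (hu : u ⬝ᵥ u = 1) {a b : ℝ} (ha : a ≠ 0)
    (hb : b ≠ 0) (hab : b - a ≠ 0) (ao' ap' bo' bp' op' ao ap bo bp op : ℝ) :
    tetForm (a • u) (b • u) O P 0 ao' ap' bo' bp' op' 0 ao ap bo bp op
        / triple (b • u - a • u) (O - a • u) (P - a • u)
      = -(coneFace (a • u) (b • u) O 0 ao' bo' 0 ao bo - coneFace (a • u) (b • u) P 0 ap' bp' 0 ap bp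
          + coneFace (a • u) O P ao' ap' op' ao ap op - coneFace (b • u) O P bo' bp' op' bo bp op)
        + a * b / ((b - a) * triple u O P)
          * ((ao' / a - bo' / b) * (ap / a - bp / b) + (ap' / a - bp' / b) * (ao / a - bo / b)
            - (O ⬝ᵥ P - (u ⬝ᵥ O) * (u ⬝ᵥ P)) / (O ⬝ᵥ O - (u ⬝ᵥ O) ^ 2)
              * ((ao' / a - bo' / b) * (ao / a - bo / b))
            - (O ⬝ᵥ P - (u ⬝ᵥ O) * (u ⬝ᵥ P)) / (P ⬝ᵥ P - (u ⬝ᵥ P) ^ 2)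
              * ((ap' / a - bp' / b) * (ap / a - bp / b))) := by
  have h' : triple u P O ≠ 0 := by rw [triple_swap]; exact neg_ne_zero.2 h
  have hab' : a - b ≠ 0 := fun h => hab (by linarith)
  have r1 := hinge_collinear h hu ha hb hab ao ap bo bp op
  have r2 := hinge_collinear h hu hb ha hab' bo bp ao ap op
  have r3 := hinge_collinear h' hu ha hb hab ap ao bp bo op
  have r4 := hinge_collinear h' hu hb ha hab' bp bo ap ao op
  have z1 : ∀ (a b : ℝ) (x : Fin 3 → ℝ), triple (a • u) (b • u) x = 0 := fun a b x => by
    simp only [triple, Pi.smul_apply, smul_eq_mul]; ring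
  have z2 : ∀ (a : ℝ), triple (a • u) O P = a * triple u O P := fun a => by
    simp only [triple, Pi.smul_apply, smul_eq_mul]; ring
  have w1 : ∀ a : ℝ, triple O P (a • u) = a * triple u O P := fun a => by
    rw [triple_rotate, z2]
  have w2 : triple (P - O) (a • u - O) (b • u - O) = (b - a) * triple u O P := by
    simp only [triple, Pi.sub_apply, Pi.smul_apply, smul_eq_mul]; ring
  have r5 := hinge_five_points O P (a • u) (b • u) (w2 ▸ mul_ne_zero hab h)
    (w1 a ▸ mul_ne_zero ha h) (w1 b ▸ mul_ne_zero hb h) op ao bo 0 ap bp 0 0 0 0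
  have w3 : ∀ x : Fin 3 → ℝ, triple x (a • u) (b • u) = 0 := fun x => by
    rw [← triple_rotate, z1]
  simp only [stress, w1, w2, w3, neg_zero, zero_mul, mul_zero, add_zero, zero_div] at r5
  rw [dotProduct_comm P O, triple_swap] at r3 r4
  -- The cones over the two faces containing the axis are degenerate. Their `coneFace` is zero by
  -- the convention for division by zero, which is harmless since the cancellation of the cones uses
  -- only invariance.
  simp only [coneFace, z1, div_zero, sub_zero, zero_add, triple_collinear, z2, tetForm, zero_mul]
  set v := triple u O P
  have e1 : a - b = -(b - a) := by ring
  rw [e1] at r2 r4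
  linear_combination (norm := skip) ao' * r1 - bo' * r2 - ap' * r3 + bp' * r4 + op' * r5
  have hv : v ≠ 0 := h
  have ho := (gram_pos_left h hu).ne'
  have hp := (gram_pos_left h' hu).ne'
  field_simp
  ring

end Collinear

end TrefoilInvariant

namespace TrefoilInvariant

variable {ρ : TrefoilGroup →* SO3} {u : Fin 3 → Fin 3 → ℝ} {a b : Fin 3 → ℝ} {O P : Fin 3 → ℝ}

/-! ### Coherently oriented axes -/

/-- Unit vectors along the axes of the `ρ (xᵢ)` that are permuted by the Wirtinger generators as the
strands of the diagram are. -/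
structure IsCoherent (ρ : TrefoilGroup →* SO3) (u : Fin 3 → Fin 3 → ℝ) : Prop where
  unit : ∀ i, u i ⬝ᵥ u i = 1
  fixed : ∀ i, (ρ (wirt i) : Matrix (Fin 3) (Fin 3) ℝ) *ᵥ u i = u i
  step : ∀ i, (ρ (wirt i) : Matrix (Fin 3) (Fin 3) ℝ) *ᵥ u (i + 1) = u (i + 2)

/-- The position of the vertices with coordinates `a`, `b` along the axes. -/
def place (u : Fin 3 → Fin 3 → ℝ) (a b : Fin 3 → ℝ) (O P : Fin 3 → ℝ) : Vertex → Fin 3 → ℝ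
  | .A i => a i • u i
  | .B i => b i • u (i + 1)
  | .O => O
  | .P => P

theorem fin3_a (i : Fin 3) : i + 1 + 1 = i + 2 := by revert i; decide
theorem fin3_b (i : Fin 3) : i + 1 + 2 = i := by revert i; decide
theorem fin3_d (i : Fin 3) : i + 2 + 1 = i := by revert i; decide
theorem fin3_e (i : Fin 3) : i + 2 + 2 = i + 1 := by revert i; decide
theorem fin3_f (i : Fin 3) : i - 1 = i + 2 := by revert i; decide

theorem IsCoherent.equivariant (h : IsCoherent ρ u) (a b : Fin 3 → ℝ) (O P : Fin 3 → ℝ) :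
    IsEquivariant ρ (place u a b O P) := fun i => by
  simp only [place, mulVec_smul, h.fixed, and_self]

/-- The image of the lift of `O` in a region. -/
def regionPos (ρ : TrefoilGroup →* SO3) (O : Fin 3 → ℝ) (r : Region) : Fin 3 → ℝ :=
  (ρ (regionLabel r) : Matrix (Fin 3) (Fin 3) ℝ) *ᵥ O

theorem liftPos_one (Γ : Vertex → Fin 3 → ℝ) (v : Vertex) : liftPos ρ Γ (1, v) = Γ v := by
  simp [liftPos]

/-- The positions of the vertices of a tetrahedron: the ends `a i • u i`, `b j • u j'` of its side on
an axis or between two axes, and the region. -/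
def tetData (ρ : TrefoilGroup →* SO3) (u : Fin 3 → Fin 3 → ℝ) (a b : Fin 3 → ℝ) (O P : Fin 3 → ℝ) :
    Tet → Fin 4 → Fin 3 → ℝ
  | .outExt i => ![a i • u i, b (i + 2) • u i, regionPos ρ O .exterior, P]
  | .outLobe i => ![a i • u i, b (i + 2) • u i, regionPos ρ O (.lobe i), P]
  | .inLobe i => ![a i • u i, b (i + 1) • u i, regionPos ρ O (.lobe (i + 1)), P]
  | .inCentre i => ![a i • u i, b (i + 1) • u i, regionPos ρ O .centre, P]
  | .crossExt i => ![a i • u i, b i • u (i + 1), regionPos ρ O .exterior, P]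
  | .crossLobeSucc i => ![a i • u i, b i • u (i + 1), regionPos ρ O (.lobe (i + 1)), P]
  | .crossLobe i => ![a i • u i, b i • u (i + 2), regionPos ρ O (.lobe i), P]
  | .crossCentre i => ![a i • u i, b i • u (i + 2), regionPos ρ O .centre, P]

theorem IsCoherent.tetPos_place (h : IsCoherent ρ u) (T : Tet) :
    tetPos ρ (place u a b O P) T = tetData ρ u a b O P T := by
  ext p
  have hB : ∀ i, liftPos ρ (place u a b O P) (wirt i, .B i) = b i • u (i + 2) := fun i => by
    simp only [liftPos, place, mulVec_smul, h.step]
  have hO : ∀ r, liftPos ρ (place u a b O P) (regionLabel r, .O) = regionPos ρ O r := fun r => rfl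
  cases T <;> fin_cases p <;>
    simp [tetPos, tetVertex, tetData, liftPos_one, hB, hO, place, fin3_b, fin3_f, fin3_d]

end TrefoilInvariant

namespace TrefoilInvariant

variable {ρ : TrefoilGroup →* SO3} {Γ : Vertex → Fin 3 → ℝ}
  {u : Fin 3 → Fin 3 → ℝ} {a b : Fin 3 → ℝ} {O P : Fin 3 → ℝ}

/-! ### The combinatorics of crossings and link edges -/

/-- The four quadrants at a crossing. -/
inductive Corner : Type
  | ext
  | succ
  | lobe
  | centre
  deriving DecidableEq

instance : Fintype Corner := ⟨{.ext, .succ, .lobe, .centre}, fun x => by cases x <;> decide⟩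

/-- The two edges of an overpass. -/
inductive Side : Type
  | out
  | inn
  deriving DecidableEq

instance : Fintype Side := ⟨{.out, .inn}, fun x => by cases x <;> decide⟩

/-- The index of the axis through the lower vertex of the tetrahedron in a quadrant. -/
def Corner.axis (i : Fin 3) : Corner → Fin 3
  | .ext => i + 1
  | .succ => i + 1
  | .lobe => i + 2
  | .centre => i + 2

def Corner.region (i : Fin 3) : Corner → Region
  | .ext => .exterior
  | .succ => .lobe (i + 1)
  | .lobe => .lobe i
  | .centre => .centre

def Corner.tet (i : Fin 3) : Corner → Tet
  | .ext => .crossExt i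
  | .succ => .crossLobeSucc i
  | .lobe => .crossLobe i
  | .centre => .crossCentre i

def Corner.edgeAO (i : Fin 3) : Corner → Edge
  | .ext => .AO₁ i
  | .succ => .AO₂ i
  | .lobe => .AO₁ i
  | .centre => .AO₂ i

def Corner.edgeBP (i : Fin 3) : Corner → Edge
  | .ext => .BP₁ i
  | .succ => .BP₁ i
  | .lobe => .BP₂ i
  | .centre => .BP₂ i

def Corner.sign : Corner → ℝ
  | .ext => -1
  | .succ => 1
  | .lobe => 1
  | .centre => -1

def Side.link (i : Fin 3) : Side → Edge
  | .out => .linkOut i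
  | .inn => .linkIn i

/-- The region beside a link edge in which the tetrahedron is positively oriented. -/
def Side.regionPlus (_i : Fin 3) : Side → Region
  | .out => .exterior
  | .inn => .centre

def Side.regionMinus (i : Fin 3) : Side → Region
  | .out => .lobe i
  | .inn => .lobe (i + 1)

def Side.tetPlus (i : Fin 3) : Side → Tet
  | .out => .outExt i
  | .inn => .inCentre i

def Side.tetMinus (i : Fin 3) : Side → Tet
  | .out => .outLobe i
  | .inn => .inLobe i

/-- The index of the lower vertex of a link edge. -/
def Side.lower (i : Fin 3) : Side → Fin 3
  | .out => i + 2
  | .inn => i + 1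

def Side.edgeAO (i : Fin 3) : Side → Edge
  | .out => .AO₁ i
  | .inn => .AO₂ i

def Side.edgeBP (i : Fin 3) : Side → Edge
  | .out => .BP₁ (i + 2)
  | .inn => .BP₂ (i + 1)

theorem sum_tet_split (F : Tet → ℝ) : ∑ T, F T
    = ∑ i, ∑ s : Side, (F (s.tetPlus i) + F (s.tetMinus i)) + ∑ i, ∑ c : Corner, F (c.tet i) := by
  rw [sum_tet, ← Finset.sum_add_distrib]
  refine Finset.sum_congr rfl fun i _ => ?_
  have h1 : ∀ G : Side → ℝ, ∑ s, G s = G .out + G .inn := fun G => by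
    rw [show (Finset.univ : Finset Side) = {.out, .inn} from rfl, Finset.sum_pair (by decide)]
  have h2 : ∀ G : Corner → ℝ, ∑ s, G s = G .ext + G .succ + G .lobe + G .centre := fun G => by
    rw [show (Finset.univ : Finset Corner) = {.ext, .succ, .lobe, .centre} from rfl]
    rw [Finset.sum_insert (by decide), Finset.sum_insert (by decide), Finset.sum_pair (by decide)]
    ring
  rw [h1, h2]
  simp only [Side.tetPlus, Side.tetMinus, Corner.tet]
  ring

/-! ### The linear functionals that diagonalize the form -/

/-- `[u, u', O]` at a quadrant. -/
def cornerE (ρ : TrefoilGroup →* SO3) (u : Fin 3 → Fin 3 → ℝ) (O : Fin 3 → ℝ) (i : Fin 3)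
    (c : Corner) : ℝ :=
  triple (u i) (u (c.axis i)) (regionPos ρ O (c.region i))

/-- `[u, u', P]` at a quadrant. -/
def cornerF (u : Fin 3 → Fin 3 → ℝ) (P : Fin 3 → ℝ) (i : Fin 3) (c : Corner) : ℝ :=
  triple (u i) (u (c.axis i)) P

/-- `[u, O, P]` for an axis and a region. -/
def axisVol (ρ : TrefoilGroup →* SO3) (u : Fin 3 → Fin 3 → ℝ) (O P : Fin 3 → ℝ) (i : Fin 3)
    (r : Region) : ℝ :=
  triple (u i) (regionPos ρ O r) P

/-- The functional of the edges that describes the change of shape of a quadrant with the origin as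
fifth vertex. -/
noncomputable def cornerRow (ρ : TrefoilGroup →* SO3) (u : Fin 3 → Fin 3 → ℝ) (a b O P : Fin 3 → ℝ)
    (i : Fin 3) (c : Corner) (ℓ : Edge → ℝ) : ℝ :=
  -(ℓ (.AB i) / (a i * b i)) / (cornerE ρ u O i c * cornerF u P i c)
    - ℓ (.OP (c.region i)) / (axisVol ρ u O P i (c.region i) * axisVol ρ u O P (c.axis i) (c.region i))
    + ℓ (c.edgeAO i) / a i / (axisVol ρ u O P i (c.region i) * cornerE ρ u O i c)
    - ℓ (.BO i) / b i / (axisVol ρ u O P (c.axis i) (c.region i) * cornerE ρ u O i c)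
    - ℓ (.AP i) / a i / (axisVol ρ u O P i (c.region i) * cornerF u P i c)
    + ℓ (c.edgeBP i) / b i / (axisVol ρ u O P (c.axis i) (c.region i) * cornerF u P i c)

noncomputable def cornerCoeff (ρ : TrefoilGroup →* SO3) (u : Fin 3 → Fin 3 → ℝ)
    (a b O P : Fin 3 → ℝ) (i : Fin 3) (c : Corner) : ℝ :=
  -(c.sign * (a i * b i * axisVol ρ u O P i (c.region i)
    * axisVol ρ u O P (c.axis i) (c.region i) * cornerE ρ u O i c * cornerF u P i c))
    / tetDet ρ (place u a b O P) (c.tet i)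

noncomputable def linkRowO (a b : Fin 3 → ℝ) (i : Fin 3) (s : Side) (ℓ : Edge → ℝ) : ℝ :=
  ℓ (s.edgeAO i) / a i - ℓ (.BO (s.lower i)) / b (s.lower i)

noncomputable def linkRowP (a b : Fin 3 → ℝ) (i : Fin 3) (s : Side) (ℓ : Edge → ℝ) : ℝ :=
  ℓ (.AP i) / a i - ℓ (s.edgeBP i) / b (s.lower i)

noncomputable def linkXi (ρ : TrefoilGroup →* SO3) (u : Fin 3 → Fin 3 → ℝ) (O P : Fin 3 → ℝ)
    (i : Fin 3) (s : Side) : ℝ :=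
  1 / axisVol ρ u O P i (s.regionPlus i) - 1 / axisVol ρ u O P i (s.regionMinus i)

/-- The inner product of the components orthogonal to the `i`-th axis. -/
noncomputable def axisDot (u : Fin 3 → Fin 3 → ℝ) (i : Fin 3) (x y : Fin 3 → ℝ) : ℝ :=
  x ⬝ᵥ y - (u i ⬝ᵥ x) * (u i ⬝ᵥ y)

noncomputable def linkEta (ρ : TrefoilGroup →* SO3) (u : Fin 3 → Fin 3 → ℝ) (O P : Fin 3 → ℝ)
    (i : Fin 3) (s : Side) : ℝ :=
  axisDot u i (regionPos ρ O (s.regionPlus i)) P / axisVol ρ u O P i (s.regionPlus i)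
    - axisDot u i (regionPos ρ O (s.regionMinus i)) P / axisVol ρ u O P i (s.regionMinus i)

/-- The square of the distance to the `i`-th axis of the lifts of `O` beside a link edge. -/
noncomputable def linkDistO (ρ : TrefoilGroup →* SO3) (u : Fin 3 → Fin 3 → ℝ) (O : Fin 3 → ℝ)
    (i : Fin 3) (s : Side) : ℝ :=
  axisDot u i (regionPos ρ O (s.regionPlus i)) (regionPos ρ O (s.regionPlus i))

noncomputable def linkFactor (a b : Fin 3 → ℝ) (i : Fin 3) (s : Side) : ℝ :=
  a i * b (s.lower i) / (b (s.lower i) - a i)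

/-- The lifts of `O` on the two sides of a link edge on the `i`-th axis differ by `ρ (xᵢ)`, which
fixes that axis; they have the same height along it. -/
theorem IsCoherent.regionMinus_dot (h : IsCoherent ρ u) (i : Fin 3) (s : Side) :
    u i ⬝ᵥ regionPos ρ O (s.regionPlus i) = u i ⬝ᵥ regionPos ρ O (s.regionMinus i) := by
  cases s
  · have := dot_rot (ρ (wirt i)) (u i) O
    rw [h.fixed] at this
    simpa [Side.regionPlus, Side.regionMinus, regionPos, regionLabel] using this.symm
  · have := dot_rot (ρ (wirt i)) (u i) ((ρ (wirt (i + 1)) : Matrix (Fin 3) (Fin 3) ℝ) *ᵥ O)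
    rw [h.fixed] at this
    simp only [Side.regionPlus, Side.regionMinus, regionPos]
    rw [regionLabel_centre i, map_mul]
    simpa [regionLabel, mulVec_mulVec] using this

theorem regionPos_dot_self (r : Region) : regionPos ρ O r ⬝ᵥ regionPos ρ O r = O ⬝ᵥ O :=
  dot_rot _ _ _

/-- Undoing the rotation of the region carries the two axes to consecutive ones. Thus only the three
numbers `[uᵢ, uᵢ₊₁, O]` occur, up to sign. -/
theorem IsCoherent.cornerE_eq (h : IsCoherent ρ u) (i : Fin 3) :
    cornerE ρ u O i .ext = triple (u i) (u (i + 1)) O ∧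
    cornerE ρ u O i .succ = -triple (u (i + 1)) (u (i + 2)) O ∧
    cornerE ρ u O i .lobe = triple (u i) (u (i + 1)) O ∧
    cornerE ρ u O i .centre = -triple (u (i + 1)) (u (i + 2)) O := by
  have s1 := h.step (i + 1)
  rw [fin3_a, fin3_b] at s1
  refine ⟨?_, ?_, ?_, ?_⟩
  · simp [cornerE, Corner.axis, Corner.region, regionPos, regionLabel]
  · rw [← triple_perm₁, ← triple_rot (ρ (wirt (i + 1))), s1, h.fixed]; rfl
  · rw [← triple_rot (ρ (wirt i)), h.fixed, h.step]; rfl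
  · rw [← triple_perm₁, ← triple_rot (ρ (wirt i * wirt (i + 1)))]
    have e : ∀ x : Fin 3 → ℝ, (ρ (wirt i * wirt (i + 1)) : Matrix (Fin 3) (Fin 3) ℝ) *ᵥ x
        = (ρ (wirt i) : Matrix (Fin 3) (Fin 3) ℝ) *ᵥ
          ((ρ (wirt (i + 1)) : Matrix (Fin 3) (Fin 3) ℝ) *ᵥ x) := by
      intro x; rw [map_mul]; simp [mulVec_mulVec]
    rw [e (u (i + 2)), e (u (i + 1)), s1, h.fixed, h.fixed, h.step, ← regionLabel_centre]; rfl

theorem cornerF_eq (i : Fin 3) :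
    cornerF u P i .ext = triple (u i) (u (i + 1)) P ∧
    cornerF u P i .succ = triple (u i) (u (i + 1)) P ∧
    cornerF u P i .lobe = -triple (u (i + 2)) (u i) P ∧
    cornerF u P i .centre = -triple (u (i + 2)) (u i) P :=
  ⟨rfl, rfl, triple_perm₁ _ _ _, triple_perm₁ _ _ _⟩

/-! ### Rotation invariance of the cones -/

theorem hval_rot (R : SO3) (p q r x : Fin 3 → ℝ) :
    hval ((R : Matrix (Fin 3) (Fin 3) ℝ) *ᵥ p) ((R : Matrix (Fin 3) (Fin 3) ℝ) *ᵥ q)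
      ((R : Matrix (Fin 3) (Fin 3) ℝ) *ᵥ r) ((R : Matrix (Fin 3) (Fin 3) ℝ) *ᵥ x)
      = hval p q r x := by
  simp only [hval, coplanarDual, ← mulVec_sub, dotProduct_smul, dotProduct_add, dot_rot]

theorem hinge_rot (R : SO3) (p q r s : Fin 3 → ℝ) (pq pr ps qr qs rs : ℝ) :
    hinge ((R : Matrix (Fin 3) (Fin 3) ℝ) *ᵥ p) ((R : Matrix (Fin 3) (Fin 3) ℝ) *ᵥ q)
      ((R : Matrix (Fin 3) (Fin 3) ℝ) *ᵥ r) ((R : Matrix (Fin 3) (Fin 3) ℝ) *ᵥ s) pq pr ps qr qs rs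
      = hinge p q r s pq pr ps qr qs rs := by
  simp only [hinge, hval_rot, hdiag, ← mulVec_sub, dot_rot]

theorem coneFace_rot (R : SO3) (x y z : Fin 3 → ℝ) (xy' xz' yz' xy xz yz : ℝ) :
    coneFace ((R : Matrix (Fin 3) (Fin 3) ℝ) *ᵥ x) ((R : Matrix (Fin 3) (Fin 3) ℝ) *ᵥ y)
      ((R : Matrix (Fin 3) (Fin 3) ℝ) *ᵥ z) xy' xz' yz' xy xz yz
      = coneFace x y z xy' xz' yz' xy xz yz := by
  have h0 : (R : Matrix (Fin 3) (Fin 3) ℝ) *ᵥ 0 = 0 := mulVec_zero _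
  have h : ∀ p q r : Fin 3 → ℝ, ∀ pq pr ps qr qs rs,
      hinge ((R : Matrix (Fin 3) (Fin 3) ℝ) *ᵥ p) ((R : Matrix (Fin 3) (Fin 3) ℝ) *ᵥ q)
      ((R : Matrix (Fin 3) (Fin 3) ℝ) *ᵥ r) 0 pq pr ps qr qs rs
      = hinge p q r 0 pq pr ps qr qs rs := by
    intro p q r pq pr ps qr qs rs
    conv_lhs => rw [← h0]
    rw [hinge_rot]
  simp only [coneFace, h, triple_rot]

/-- The boundary of the cone over a tetrahedron. -/
noncomputable def coneBoundary (ρ : TrefoilGroup →* SO3) (Γ : Vertex → Fin 3 → ℝ) (ℓ' ℓ : Edge → ℝ) (T : Tet) : ℝ :=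
  coneFace (tetPos ρ Γ T 0) (tetPos ρ Γ T 1) (tetPos ρ Γ T 2) (ℓ' (tetSide T 0 1))
      (ℓ' (tetSide T 0 2)) (ℓ' (tetSide T 1 2)) (ℓ (tetSide T 0 1)) (ℓ (tetSide T 0 2))
      (ℓ (tetSide T 1 2))
    - coneFace (tetPos ρ Γ T 0) (tetPos ρ Γ T 1) (tetPos ρ Γ T 3) (ℓ' (tetSide T 0 1))
      (ℓ' (tetSide T 0 3)) (ℓ' (tetSide T 1 3)) (ℓ (tetSide T 0 1)) (ℓ (tetSide T 0 3))
      (ℓ (tetSide T 1 3))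
    + coneFace (tetPos ρ Γ T 0) (tetPos ρ Γ T 2) (tetPos ρ Γ T 3) (ℓ' (tetSide T 0 2))
      (ℓ' (tetSide T 0 3)) (ℓ' (tetSide T 2 3)) (ℓ (tetSide T 0 2)) (ℓ (tetSide T 0 3))
      (ℓ (tetSide T 2 3))
    - coneFace (tetPos ρ Γ T 1) (tetPos ρ Γ T 2) (tetPos ρ Γ T 3) (ℓ' (tetSide T 1 2))
      (ℓ' (tetSide T 1 3)) (ℓ' (tetSide T 2 3)) (ℓ (tetSide T 1 2)) (ℓ (tetSide T 1 3))
      (ℓ (tetSide T 2 3))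

/-- The origin is fixed by every `ρ g`, so the cone over a face depends only on the face modulo the
group and appears twice with opposite signs. -/
theorem sum_coneBoundary (hE : IsEquivariant ρ Γ) (ℓ' ℓ : Edge → ℝ) :
    ∑ T : Tet, tetOrientation T * coneBoundary ρ Γ ℓ' ℓ T = 0 := by
  have h := sum_faceBoundary hE hE (fun x _ a b c =>
    coneFace (x 0) (x 1) (x 2) (ℓ' a) (ℓ' b) (ℓ' c) (ℓ a) (ℓ b) (ℓ c)) (by
      intro R x y a b c
      simp only [Matrix.cons_val_zero, Matrix.cons_val_one, Matrix.cons_val, coneFace_rot])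
  rw [← h]
  rfl

theorem f₃_form_cone (hE : IsEquivariant ρ Γ) (hG : InGeneralPosition ρ Γ) (ℓ' ℓ : Edge → ℝ) :
    ℓ' ⬝ᵥ (f₃ ρ Γ *ᵥ ℓ) = ∑ T : Tet, tetOrientation T *
      (tetForm (tetPos ρ Γ T 0) (tetPos ρ Γ T 1) (tetPos ρ Γ T 2) (tetPos ρ Γ T 3)
        (ℓ' (tetSide T 0 1)) (ℓ' (tetSide T 0 2)) (ℓ' (tetSide T 0 3)) (ℓ' (tetSide T 1 2))
        (ℓ' (tetSide T 1 3)) (ℓ' (tetSide T 2 3))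
        (ℓ (tetSide T 0 1)) (ℓ (tetSide T 0 2)) (ℓ (tetSide T 0 3)) (ℓ (tetSide T 1 2))
        (ℓ (tetSide T 1 3)) (ℓ (tetSide T 2 3)) / tetDet ρ Γ T + coneBoundary ρ Γ ℓ' ℓ T) := by
  simp only [mul_add, Finset.sum_add_distrib, sum_coneBoundary hE, add_zero]
  rw [f₃_form hE hG]
  refine Finset.sum_congr rfl fun T _ => ?_
  ring

end TrefoilInvariant

/-! ### The form of `f₃` as a sum over link edges and quadrants. -/

namespace TrefoilInvariant

variable {ρ : TrefoilGroup →* SO3}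
  {u : Fin 3 → Fin 3 → ℝ} {a b : Fin 3 → ℝ} {O P : Fin 3 → ℝ}

theorem IsCoherent.tetPos_corner (h : IsCoherent ρ u) (i : Fin 3) (c : Corner) :
    tetPos ρ (place u a b O P) (c.tet i)
      = ![a i • u i, b i • u (c.axis i), regionPos ρ O (c.region i), P] := by
  rw [h.tetPos_place]; cases c <;> rfl

theorem IsCoherent.tetPos_tetPlus (h : IsCoherent ρ u) (i : Fin 3) (s : Side) :
    tetPos ρ (place u a b O P) (s.tetPlus i)
      = ![a i • u i, b (s.lower i) • u i, regionPos ρ O (s.regionPlus i), P] := by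
  rw [h.tetPos_place]; cases s <;> rfl

theorem IsCoherent.tetPos_tetMinus (h : IsCoherent ρ u) (i : Fin 3) (s : Side) :
    tetPos ρ (place u a b O P) (s.tetMinus i)
      = ![a i • u i, b (s.lower i) • u i, regionPos ρ O (s.regionMinus i), P] := by
  rw [h.tetPos_place]; cases s <;> rfl

theorem tetSide_corner (i : Fin 3) (c : Corner) :
    tetSide (c.tet i) 0 1 = .AB i ∧ tetSide (c.tet i) 0 2 = c.edgeAO i ∧
    tetSide (c.tet i) 0 3 = .AP i ∧ tetSide (c.tet i) 1 2 = .BO i ∧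
    tetSide (c.tet i) 1 3 = c.edgeBP i ∧ tetSide (c.tet i) 2 3 = .OP (c.region i) := by
  cases c <;> refine ⟨rfl, rfl, rfl, rfl, rfl, rfl⟩

theorem tetSide_tetPlus (i : Fin 3) (s : Side) :
    tetSide (s.tetPlus i) 0 1 = s.link i ∧ tetSide (s.tetPlus i) 0 2 = s.edgeAO i ∧
    tetSide (s.tetPlus i) 0 3 = .AP i ∧ tetSide (s.tetPlus i) 1 2 = .BO (s.lower i) ∧
    tetSide (s.tetPlus i) 1 3 = s.edgeBP i ∧ tetSide (s.tetPlus i) 2 3 = .OP (s.regionPlus i) := by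
  cases s <;> simp [Side.tetPlus, tetSide, sideTable, Side.link, Side.edgeAO, Side.edgeBP,
    Side.lower, Side.regionPlus, fin3_f]

theorem tetSide_tetMinus (i : Fin 3) (s : Side) :
    tetSide (s.tetMinus i) 0 1 = s.link i ∧ tetSide (s.tetMinus i) 0 2 = s.edgeAO i ∧
    tetSide (s.tetMinus i) 0 3 = .AP i ∧ tetSide (s.tetMinus i) 1 2 = .BO (s.lower i) ∧
    tetSide (s.tetMinus i) 1 3 = s.edgeBP i ∧ tetSide (s.tetMinus i) 2 3 = .OP (s.regionMinus i) := by
  cases s <;> simp [Side.tetMinus, tetSide, sideTable, Side.link, Side.edgeAO, Side.edgeBP,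
    Side.lower, Side.regionMinus, fin3_f]

theorem IsCoherent.tetDet_tetPlus (h : IsCoherent ρ u) (i : Fin 3) (s : Side) :
    tetDet ρ (place u a b O P) (s.tetPlus i)
      = (b (s.lower i) - a i) * axisVol ρ u O P i (s.regionPlus i) := by
  rw [tetDet, h.tetPos_tetPlus]; exact triple_collinear _ _

theorem IsCoherent.tetDet_tetMinus (h : IsCoherent ρ u) (i : Fin 3) (s : Side) :
    tetDet ρ (place u a b O P) (s.tetMinus i)
      = (b (s.lower i) - a i) * axisVol ρ u O P i (s.regionMinus i) := by
  rw [tetDet, h.tetPos_tetMinus]; exact triple_collinear _ _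

theorem mul_neg_sub_add (ε X Y : ℝ) : ε * (-X - Y + X) = -(ε * Y) := by ring

theorem neg_add_add_self' (X Y : ℝ) : -X + Y + X = Y := by ring

/-- Configurations in general position also with respect to the origin. -/
structure IsGeneric (ρ : TrefoilGroup →* SO3) (u : Fin 3 → Fin 3 → ℝ) (a b O P : Fin 3 → ℝ) : Prop where
  coherent : IsCoherent ρ u
  general : InGeneralPosition ρ (place u a b O P)
  a_ne : ∀ i, a i ≠ 0
  b_ne : ∀ i, b i ≠ 0
  e_ne : ∀ i, triple (u i) (u (i + 1)) O ≠ 0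
  f_ne : ∀ i, triple (u i) (u (i + 1)) P ≠ 0

namespace IsGeneric

variable (h : IsGeneric ρ u a b O P)
include h

theorem plus_ne (i : Fin 3) (s : Side) :
    b (s.lower i) - a i ≠ 0 ∧ axisVol ρ u O P i (s.regionPlus i) ≠ 0 := by
  have := tetDet_ne_zero h.general (s.tetPlus i)
  rw [h.coherent.tetDet_tetPlus] at this
  exact mul_ne_zero_iff.1 this

theorem minus_ne (i : Fin 3) (s : Side) : axisVol ρ u O P i (s.regionMinus i) ≠ 0 := by
  have := tetDet_ne_zero h.general (s.tetMinus i)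
  rw [h.coherent.tetDet_tetMinus] at this
  exact (mul_ne_zero_iff.1 this).2

theorem corner_left_ne (i : Fin 3) (c : Corner) : axisVol ρ u O P i (c.region i) ≠ 0 := by
  cases c
  · exact (h.plus_ne i .out).2
  · exact h.minus_ne i .inn
  · exact h.minus_ne i .out
  · exact (h.plus_ne i .inn).2

theorem corner_right_ne (i : Fin 3) (c : Corner) :
    axisVol ρ u O P (c.axis i) (c.region i) ≠ 0 := by
  cases c
  · exact (h.plus_ne (i + 1) .out).2
  · exact h.minus_ne (i + 1) .out
  · have := h.minus_ne (i + 2) .inn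
    simp only [Side.regionMinus, fin3_d] at this
    exact this
  · exact (h.plus_ne (i + 2) .inn).2

theorem cornerE_ne (i : Fin 3) (c : Corner) : cornerE ρ u O i c ≠ 0 := by
  obtain ⟨h1, h2, h3, h4⟩ := h.coherent.cornerE_eq (O := O) i
  have e1 := h.e_ne (i + 1)
  rw [fin3_a] at e1
  cases c
  · rw [h1]; exact h.e_ne i
  · rw [h2]; exact neg_ne_zero.2 e1
  · rw [h3]; exact h.e_ne i
  · rw [h4]; exact neg_ne_zero.2 e1

theorem cornerF_ne (i : Fin 3) (c : Corner) : cornerF u P i c ≠ 0 := by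
  obtain ⟨h1, h2, h3, h4⟩ := cornerF_eq (u := u) (P := P) i
  have e1 := h.f_ne (i + 2)
  rw [fin3_d] at e1
  cases c
  · rw [h1]; exact h.f_ne i
  · rw [h2]; exact h.f_ne i
  · rw [h3]; exact neg_ne_zero.2 e1
  · rw [h4]; exact neg_ne_zero.2 e1

/-- Scaling the vertices back to unit vectors on the axes turns `crossRow` into a multiple of
`cornerRow`; the multiple, squared and divided by the volumes, is `cornerCoeff`. -/
theorem corner_form (i : Fin 3) (c : Corner) (ℓ' ℓ : Edge → ℝ) :
    tetOrientation (c.tet i) *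
      (tetForm (tetPos ρ (place u a b O P) (c.tet i) 0) (tetPos ρ (place u a b O P) (c.tet i) 1)
        (tetPos ρ (place u a b O P) (c.tet i) 2) (tetPos ρ (place u a b O P) (c.tet i) 3)
        (ℓ' (tetSide (c.tet i) 0 1)) (ℓ' (tetSide (c.tet i) 0 2)) (ℓ' (tetSide (c.tet i) 0 3))
        (ℓ' (tetSide (c.tet i) 1 2)) (ℓ' (tetSide (c.tet i) 1 3)) (ℓ' (tetSide (c.tet i) 2 3))
        (ℓ (tetSide (c.tet i) 0 1)) (ℓ (tetSide (c.tet i) 0 2)) (ℓ (tetSide (c.tet i) 0 3))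
        (ℓ (tetSide (c.tet i) 1 2)) (ℓ (tetSide (c.tet i) 1 3)) (ℓ (tetSide (c.tet i) 2 3))
        / tetDet ρ (place u a b O P) (c.tet i)
      + coneBoundary ρ (place u a b O P) ℓ' ℓ (c.tet i))
    = cornerCoeff ρ u a b O P i c * (cornerRow ρ u a b O P i c ℓ' * cornerRow ρ u a b O P i c ℓ) := by
  obtain ⟨s1, s2, s3, s4, s5, s6⟩ := tetSide_corner i c
  have hd := tetDet_ne_zero h.general (c.tet i)
  have hε : tetOrientation (c.tet i) = c.sign := by cases c <;> rfl
  simp only [coneBoundary, cornerCoeff, s1, s2, s3, s4, s5, s6, hε]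
  unfold tetDet at hd ⊢
  rw [h.coherent.tetPos_corner] at hd ⊢
  simp only [Matrix.cons_val_zero, Matrix.cons_val_one, Matrix.cons_val] at hd ⊢
  have ha := h.a_ne i
  have hb := h.b_ne i
  have he := h.cornerE_ne i c
  have hf := h.cornerF_ne i c
  have hv := h.corner_left_ne i c
  have hv' := h.corner_right_ne i c
  set R := regionPos ρ O (c.region i)
  have q1 : triple (a i • u i) (b i • u (c.axis i)) R = a i * b i * cornerE ρ u O i c := by
    simp only [triple, Pi.smul_apply, smul_eq_mul, cornerE, R]; ring
  have q2 : triple (a i • u i) (b i • u (c.axis i)) P = a i * b i * cornerF u P i c := by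
    simp only [triple, Pi.smul_apply, smul_eq_mul, cornerF]; ring
  have q3 : triple (a i • u i) R P = a i * axisVol ρ u O P i (c.region i) := by
    simp only [triple, Pi.smul_apply, smul_eq_mul, axisVol, R]; ring
  have q4 : triple (b i • u (c.axis i)) R P = b i * axisVol ρ u O P (c.axis i) (c.region i) := by
    simp only [triple, Pi.smul_apply, smul_eq_mul, axisVol, R]; ring
  have cr : ∀ ℓ : Edge → ℝ, crossRow (a i • u i) (b i • u (c.axis i)) R P (ℓ (.AB i))
      (ℓ (c.edgeAO i)) (ℓ (.AP i)) (ℓ (.BO i)) (ℓ (c.edgeBP i)) (ℓ (.OP (c.region i)))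
      = a i ^ 2 * b i ^ 2 * axisVol ρ u O P i (c.region i) * axisVol ρ u O P (c.axis i) (c.region i)
        * cornerE ρ u O i c * cornerF u P i c * cornerRow ρ u a b O P i c ℓ := by
    intro ℓ
    rw [crossRow, q1, q2, q3, q4, cornerRow]
    field_simp
    ring
  rw [tetForm_cross hd (by rw [q1]; positivity) (by rw [q2]; positivity) (by rw [q3]; positivity)
    (by rw [q4]; positivity), cr, cr, q1, q2, q3, q4]
  refine (mul_neg_sub_add _ _ _).trans ?_
  field_simp

/-- Stated for an arbitrary region `r`, so that it serves the tetrahedra on both sides of the link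
edge. -/
theorem link_form (i : Fin 3) (s : Side) (ℓ' ℓ : Edge → ℝ) (h' : ℓ' (s.link i) = 0)
    (h0 : ℓ (s.link i) = 0) (T : Tet) (r : Region)
    (hp : tetPos ρ (place u a b O P) T
      = ![a i • u i, b (s.lower i) • u i, regionPos ρ O r, P])
    (hs : tetSide T 0 1 = s.link i ∧ tetSide T 0 2 = s.edgeAO i ∧
      tetSide T 0 3 = .AP i ∧ tetSide T 1 2 = .BO (s.lower i) ∧
      tetSide T 1 3 = s.edgeBP i ∧ tetSide T 2 3 = .OP r) :
    (tetForm (tetPos ρ (place u a b O P) T 0) (tetPos ρ (place u a b O P) T 1)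
        (tetPos ρ (place u a b O P) T 2) (tetPos ρ (place u a b O P) T 3)
        (ℓ' (tetSide T 0 1)) (ℓ' (tetSide T 0 2)) (ℓ' (tetSide T 0 3))
        (ℓ' (tetSide T 1 2)) (ℓ' (tetSide T 1 3)) (ℓ' (tetSide T 2 3))
        (ℓ (tetSide T 0 1)) (ℓ (tetSide T 0 2)) (ℓ (tetSide T 0 3))
        (ℓ (tetSide T 1 2)) (ℓ (tetSide T 1 3)) (ℓ (tetSide T 2 3))
        / tetDet ρ (place u a b O P) T
      + coneBoundary ρ (place u a b O P) ℓ' ℓ T)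
    = linkFactor a b i s / axisVol ρ u O P i r *
      (linkRowO a b i s ℓ' * linkRowP a b i s ℓ + linkRowP a b i s ℓ' * linkRowO a b i s ℓ
        - axisDot u i (regionPos ρ O r) P / axisDot u i (regionPos ρ O r) (regionPos ρ O r)
          * (linkRowO a b i s ℓ' * linkRowO a b i s ℓ)
        - axisDot u i (regionPos ρ O r) P / axisDot u i P P
          * (linkRowP a b i s ℓ' * linkRowP a b i s ℓ)) := by
  obtain ⟨s1, s2, s3, s4, s5, s6⟩ := hs
  have hd := tetDet_ne_zero h.general T
  have hab := (h.plus_ne i s).1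
  simp only [coneBoundary, s1, s2, s3, s4, s5, s6, h', h0]
  unfold tetDet at hd ⊢
  rw [hp] at hd ⊢
  simp only [Matrix.cons_val_zero, Matrix.cons_val_one, Matrix.cons_val] at hd ⊢
  rw [triple_collinear] at hd
  have hv : triple (u i) (regionPos ρ O r) P ≠ 0 := (mul_ne_zero_iff.1 hd).2
  rw [tetForm_collinear hv (h.coherent.unit i) (h.a_ne i) (h.b_ne _) hab]
  rw [neg_add_add_self']
  simp only [linkFactor, axisVol, linkRowO, linkRowP, axisDot, ← pow_two]
  rw [div_div]

/-- The two tetrahedra at a link edge involve the same two discrepancies, since the lengths of `AO`,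
`BO`, `AP`, `BP` are shared. Only `[u, O, P]` and the inner product around the axis change from one
side to the other. -/
theorem f₃_eq_sum (ℓ' ℓ : Edge → ℝ) (h' : ∀ i, ∀ s : Side, ℓ' (s.link i) = 0)
    (h0 : ∀ i, ∀ s : Side, ℓ (s.link i) = 0) :
    ℓ' ⬝ᵥ (f₃ ρ (place u a b O P) *ᵥ ℓ) = ∑ i, ∑ s : Side, linkFactor a b i s *
        (linkXi ρ u O P i s * (linkRowO a b i s ℓ' * linkRowP a b i s ℓ
          + linkRowP a b i s ℓ' * linkRowO a b i s ℓ)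
        - linkEta ρ u O P i s / linkDistO ρ u O i s * (linkRowO a b i s ℓ' * linkRowO a b i s ℓ)
        - linkEta ρ u O P i s / axisDot u i P P * (linkRowP a b i s ℓ' * linkRowP a b i s ℓ))
      + ∑ i, ∑ c, cornerCoeff ρ u a b O P i c *
        (cornerRow ρ u a b O P i c ℓ' * cornerRow ρ u a b O P i c ℓ) := by
  rw [f₃_form_cone (h.coherent.equivariant a b O P) h.general, sum_tet_split]
  congr 1
  · refine Finset.sum_congr rfl fun i _ => Finset.sum_congr rfl fun s _ => ?_
    rw [h.link_form i s ℓ' ℓ (h' i s) (h0 i s) (s.tetPlus i) (s.regionPlus i)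
      (h.coherent.tetPos_tetPlus i s) (tetSide_tetPlus i s),
      h.link_form i s ℓ' ℓ (h' i s) (h0 i s) (s.tetMinus i) (s.regionMinus i)
      (h.coherent.tetPos_tetMinus i s) (tetSide_tetMinus i s)]
    have e1 : tetOrientation (s.tetPlus i) = 1 := by cases s <;> rfl
    have e2 : tetOrientation (s.tetMinus i) = -1 := by cases s <;> rfl
    -- The distance from the axis is the same for both lifts of `O`, so the two contributions have a
    -- common denominator.
    have e3 : axisDot u i (regionPos ρ O (s.regionMinus i)) (regionPos ρ O (s.regionMinus i))
        = linkDistO ρ u O i s := by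
      simp only [linkDistO, axisDot, regionPos_dot_self, h.coherent.regionMinus_dot]
    rw [e1, e2, e3, linkXi, linkEta, ← linkDistO]
    ring
  · exact Finset.sum_congr rfl fun i _ => Finset.sum_congr rfl fun c _ => h.corner_form i c ℓ' ℓ

/-- The row of `f₃` of a link edge at variations that only involve the opposite edges. -/
theorem f₃_linkOut (ℓ : Edge → ℝ) (h1 : ℓ (.linkOut 0) = 0) (h2 : ℓ (.AO₁ 0) = 0)
    (h3 : ℓ (.AP 0) = 0) (h4 : ℓ (.BO 2) = 0) (h5 : ℓ (.BP₁ 2) = 0) :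
    (f₃ ρ (place u a b O P) *ᵥ ℓ) (.linkOut 0)
      = (ℓ (.OP (.lobe 0)) / axisVol ρ u O P 0 (.lobe 0)
        - ℓ (.OP .exterior) / axisVol ρ u O P 0 .exterior) / (b 2 - a 0) := by
  have key := f₃_form (h.coherent.equivariant a b O P) h.general (Pi.single (.linkOut 0) 1) ℓ
  rw [single_one_dotProduct, sum_tet_split] at key
  rw [key]
  have v1 := h.coherent.tetDet_tetPlus (a := a) (b := b) (O := O) (P := P) 0 .out
  have v2 := h.coherent.tetDet_tetMinus (a := a) (b := b) (O := O) (P := P) 0 .out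
  have z : ∀ (i : Fin 3) (s : Side) (e : Edge), e ≠ .linkOut 0 →
      (Pi.single (.linkOut 0) 1 : Edge → ℝ) e = 0 := fun i s e he => by simp [he]
  have hc : ∑ i, ∑ c : Corner, tetOrientation (c.tet i) / tetDet ρ (place u a b O P) (c.tet i) *
      tetForm (tetPos ρ (place u a b O P) (c.tet i) 0) (tetPos ρ (place u a b O P) (c.tet i) 1)
        (tetPos ρ (place u a b O P) (c.tet i) 2) (tetPos ρ (place u a b O P) (c.tet i) 3)
        ((Pi.single (.linkOut 0) 1 : Edge → ℝ) (tetSide (c.tet i) 0 1))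
        ((Pi.single (.linkOut 0) 1 : Edge → ℝ) (tetSide (c.tet i) 0 2))
        ((Pi.single (.linkOut 0) 1 : Edge → ℝ) (tetSide (c.tet i) 0 3))
        ((Pi.single (.linkOut 0) 1 : Edge → ℝ) (tetSide (c.tet i) 1 2))
        ((Pi.single (.linkOut 0) 1 : Edge → ℝ) (tetSide (c.tet i) 1 3))
        ((Pi.single (.linkOut 0) 1 : Edge → ℝ) (tetSide (c.tet i) 2 3))
        (ℓ (tetSide (c.tet i) 0 1)) (ℓ (tetSide (c.tet i) 0 2)) (ℓ (tetSide (c.tet i) 0 3))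
        (ℓ (tetSide (c.tet i) 1 2)) (ℓ (tetSide (c.tet i) 1 3)) (ℓ (tetSide (c.tet i) 2 3)) = 0 := by
    refine Finset.sum_eq_zero fun i _ => Finset.sum_eq_zero fun c _ => ?_
    obtain ⟨s1, s2, s3, s4, s5, s6⟩ := tetSide_corner i c
    rw [s1, s2, s3, s4, s5, s6]
    have w1 : c.edgeAO i ≠ .linkOut 0 := by cases c <;> simp [Corner.edgeAO]
    have w2 : c.edgeBP i ≠ .linkOut 0 := by cases c <;> simp [Corner.edgeBP]
    simp [tetForm, w1, w2]
  rw [hc, add_zero]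
  have hl : ∀ (i : Fin 3) (s : Side), (i, s) ≠ (0, .out) → s.link i ≠ .linkOut 0 := by
    intro i s; cases s <;> simp [Side.link]
  rw [Finset.sum_eq_single (0 : Fin 3), Finset.sum_eq_single Side.out]
  · obtain ⟨s1, s2, s3, s4, s5, s6⟩ := tetSide_tetPlus 0 .out
    obtain ⟨r1, r2, r3, r4, r5, r6⟩ := tetSide_tetMinus 0 .out
    rw [s1, s2, s3, s4, s5, s6, r1, r2, r3, r4, r5, r6, v1, v2]
    have hab := h.plus_ne 0 .out
    have hv := h.minus_ne 0 .out
    simp only [Side.link, Side.edgeAO, Side.edgeBP, Side.lower, Side.regionPlus, Side.regionMinus,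
      zero_add] at *
    simp only [tetForm, Pi.single_eq_same, ne_eq, reduceCtorEq, not_false_eq_true,
      Pi.single_eq_of_ne, zero_mul, one_mul, add_zero, hinge, h1, h2, h3, h4, h5, mul_zero, zero_sub,
      zero_add]
    simp only [Side.tetPlus, Side.tetMinus, tetOrientation]
    obtain ⟨hab, hv1⟩ := hab
    field_simp
    ring
  · intro s _ hs
    have w := hl 0 s (by simpa using hs)
    obtain ⟨s1, s2, s3, s4, s5, s6⟩ := tetSide_tetPlus 0 s
    obtain ⟨r1, r2, r3, r4, r5, r6⟩ := tetSide_tetMinus 0 s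
    rw [s1, s2, s3, s4, s5, s6, r1, r2, r3, r4, r5, r6]
    have w1 : s.edgeAO 0 ≠ .linkOut 0 := by cases s <;> simp [Side.edgeAO]
    have w2 : s.edgeBP 0 ≠ .linkOut 0 := by cases s <;> simp [Side.edgeBP]
    simp [tetForm, w, w1, w2]
  · simp
  · intro i _ hi
    refine Finset.sum_eq_zero fun s _ => ?_
    have w := hl i s (by simp [hi])
    obtain ⟨s1, s2, s3, s4, s5, s6⟩ := tetSide_tetPlus i s
    obtain ⟨r1, r2, r3, r4, r5, r6⟩ := tetSide_tetMinus i s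
    rw [s1, s2, s3, s4, s5, s6, r1, r2, r3, r4, r5, r6]
    have w1 : s.edgeAO i ≠ .linkOut 0 := by cases s <;> simp [Side.edgeAO]
    have w2 : s.edgeBP i ≠ .linkOut 0 := by cases s <;> simp [Side.edgeBP]
    simp [tetForm, w, w1, w2]
  · simp

end IsGeneric

end TrefoilInvariant

namespace TrefoilInvariant

variable {ρ : TrefoilGroup →* SO3}
  {u : Fin 3 → Fin 3 → ℝ} {a b : Fin 3 → ℝ} {O P : Fin 3 → ℝ}

/-! ### Coordinates on the edge variations that vanish on all link edges but one -/

/-- The coordinates that measure the discrepancies along the link, and the one for the link edge. -/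
inductive LinkCoord : Type
  | m
  | o (i : Fin 3) (s : Side)
  | p (i : Fin 3) (s : Side)
  deriving DecidableEq, Fintype

/-- The other coordinates, apart from four that are adapted to the rotations of `O` and `P`. -/
inductive ConeCoord : Type
  | ab (i : Fin 3)
  | op (r : Region)
  | sigma
  | tau
  deriving DecidableEq, Fintype

abbrev VarCoord : Type := (LinkCoord ⊕ ConeCoord) ⊕ (Fin 2 ⊕ Fin 2)

/-- The coordinates of the lengths of the edges at `O`. -/
def sigmaOf (x : VarCoord → ℝ) : Fin 3 → ℝ :=
  ![x (.inr (.inl 0)), x (.inr (.inl 1)), x (.inl (.inr .sigma))]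

/-- The coordinates of the lengths of the edges at `P`. -/
def tauOf (x : VarCoord → ℝ) : Fin 3 → ℝ :=
  ![x (.inr (.inr 0)), x (.inr (.inr 1)), x (.inl (.inr .tau))]

theorem sigmaOf_add (x y : VarCoord → ℝ) : sigmaOf (x + y) = sigmaOf x + sigmaOf y := by
  simp [sigmaOf]

theorem sigmaOf_smul (c : ℝ) (x : VarCoord → ℝ) : sigmaOf (c • x) = c • sigmaOf x := by
  simp [sigmaOf]

theorem tauOf_add (x y : VarCoord → ℝ) : tauOf (x + y) = tauOf x + tauOf y := by
  simp [tauOf]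

theorem tauOf_smul (c : ℝ) (x : VarCoord → ℝ) : tauOf (c • x) = c • tauOf x := by
  simp [tauOf]

/-- The edge variation with given coordinates. -/
def edgeOfCoord (a b : Fin 3 → ℝ) : (VarCoord → ℝ) →ₗ[ℝ] (Edge → ℝ) where
  toFun x
    | .linkOut i => if i = 0 then x (.inl (.inl .m)) else 0
    | .linkIn _ => 0
    | .AB i => a i * b i * x (.inl (.inr (.ab i)))
    | .AO₁ i => a i * (sigmaOf x i + x (.inl (.inl (.o i .out))))
    | .AO₂ i => a i * (sigmaOf x (i + 2) + x (.inl (.inl (.o i .inn))))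
    | .AP i => a i * tauOf x i
    | .BO i => b i * sigmaOf x (i + 1)
    | .BP₁ i => b i * (tauOf x (i + 1) - x (.inl (.inl (.p (i + 1) .out))))
    | .BP₂ i => b i * (tauOf x (i + 2) - x (.inl (.inl (.p (i + 2) .inn))))
    | .OP r => x (.inl (.inr (.op r)))
  map_add' x y := by
    ext e
    cases e <;> simp only [sigmaOf_add, tauOf_add, Pi.add_apply]
    case linkOut i => split_ifs <;> simp
    all_goals ring
  map_smul' c x := by
    ext e
    cases e <;> simp only [sigmaOf_smul, tauOf_smul, Pi.smul_apply, smul_eq_mul, RingHom.id_apply]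
    case linkOut i => split_ifs <;> simp
    all_goals ring

/-- The coordinates of an edge variation. -/
noncomputable def coordOfEdge (a b : Fin 3 → ℝ) (ℓ : Edge → ℝ) : VarCoord → ℝ
  | .inl (.inl .m) => ℓ (.linkOut 0)
  | .inl (.inl (.o i s)) => linkRowO a b i s ℓ
  | .inl (.inl (.p i s)) => linkRowP a b i s ℓ
  | .inl (.inr (.ab i)) => ℓ (.AB i) / (a i * b i)
  | .inl (.inr (.op r)) => ℓ (.OP r)
  | .inl (.inr .sigma) => ℓ (.BO 1) / b 1
  | .inl (.inr .tau) => ℓ (.AP 2) / a 2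
  | .inr (.inl j) => ℓ (.BO (![2, 0] j)) / b (![2, 0] j)
  | .inr (.inr j) => ℓ (.AP (![0, 1] j)) / a (![0, 1] j)

theorem sigmaOf_coordOfEdge (ℓ : Edge → ℝ) (j : Fin 3) :
    sigmaOf (coordOfEdge a b ℓ) j = ℓ (.BO (j + 2)) / b (j + 2) := by
  fin_cases j <;> rfl

theorem tauOf_coordOfEdge (ℓ : Edge → ℝ) (j : Fin 3) :
    tauOf (coordOfEdge a b ℓ) j = ℓ (.AP j) / a j := by
  fin_cases j <;> rfl

/-- Edge variations that vanish on the link edges other than the first one. -/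
def LinkFree (ℓ : Edge → ℝ) : Prop := ∀ i, ∀ s : Side, s.link i ≠ .linkOut 0 → ℓ (s.link i) = 0

theorem edgeOfCoord_coordOfEdge (ha : ∀ i, a i ≠ 0) (hb : ∀ i, b i ≠ 0) {ℓ : Edge → ℝ}
    (h : LinkFree ℓ) : edgeOfCoord a b (coordOfEdge a b ℓ) = ℓ := by
  ext e
  cases e <;> simp only [edgeOfCoord, LinearMap.coe_mk, AddHom.coe_mk, sigmaOf_coordOfEdge,
    tauOf_coordOfEdge, coordOfEdge, linkRowO, linkRowP, Side.edgeAO, Side.edgeBP, Side.lower,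
    fin3_b, fin3_e, fin3_a]
  case linkOut i =>
    split_ifs with hi
    · rw [hi]
    · exact (h i .out (by simp [Side.link, hi])).symm
  case linkIn i => exact (h i .inn (by simp [Side.link])).symm
  case AB i => have := ha i; have := hb i; field_simp
  case AO₁ i => have := ha i; have := hb (i + 2); field_simp; ring
  case AO₂ i => have := ha i; have := hb (i + 1); field_simp; ring
  case AP i => have := ha i; field_simp
  case BO i => have := hb i; field_simp
  case BP₁ i => have := hb i; have := ha (i + 1); field_simp; ring
  case BP₂ i =>
    have e1 : i + 2 + 1 = i := fin3_d i
    simp only [e1]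
    have := hb i; have := ha (i + 2); field_simp; ring

theorem linkFree_edgeOfCoord (x : VarCoord → ℝ) : LinkFree (edgeOfCoord a b x) := by
  intro i s
  cases s
  · simp only [Side.link, edgeOfCoord, LinearMap.coe_mk, AddHom.coe_mk]
    intro h
    rw [if_neg]
    rintro rfl
    exact h rfl
  · intro _; rfl

/-- The functionals on edge variations that bring `f₃` to normal form: two for the distinguished
link edge, two for every link edge, one for every quadrant. -/
abbrev NormalRow : Type := Fin 2 ⊕ ((Fin 2 × (Fin 3 × Side)) ⊕ (Fin 3 × Corner))

/-- The variation with the value on the distinguished link edge removed. -/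
def dropLink (ℓ : Edge → ℝ) : Edge → ℝ := ℓ - ℓ (.linkOut 0) • Pi.single (.linkOut 0) 1

noncomputable def normalRow (ρ : TrefoilGroup →* SO3) (u : Fin 3 → Fin 3 → ℝ) (a b O P : Fin 3 → ℝ) :
    (Edge → ℝ) →ₗ[ℝ] (NormalRow → ℝ) where
  toFun ℓ := Sum.elim ![ℓ (.linkOut 0), (f₃ ρ (place u a b O P) *ᵥ dropLink ℓ) (.linkOut 0)]
    (Sum.elim (fun l => ![linkRowO a b l.2.1 l.2.2 ℓ, linkRowP a b l.2.1 l.2.2 ℓ] l.1)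
      fun k => cornerRow ρ u a b O P k.1 k.2 ℓ)
  map_add' x y := by
    have e : dropLink (x + y) = dropLink x + dropLink y := by
      simp only [dropLink, Pi.add_apply, add_smul]; abel
    ext r
    rcases r with r | ⟨⟨r, l⟩ | ⟨i, c⟩⟩
    · fin_cases r
      · simp
      · simp [e, mulVec_add]
    · fin_cases r
      · simp [linkRowO]; ring
      · simp [linkRowP]; ring
    · simp [cornerRow]; ring
  map_smul' t x := by
    have e : dropLink (t • x) = t • dropLink x := by
      simp only [dropLink, Pi.smul_apply, smul_sub, smul_smul, smul_eq_mul]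
    ext r
    rcases r with r | ⟨⟨r, l⟩ | ⟨i, c⟩⟩
    · fin_cases r
      · simp
      · simp [e, mulVec_smul]
    · fin_cases r
      · simp [linkRowO]; ring
      · simp [linkRowP]; ring
    · simp [cornerRow]; ring

/-- The normal form of `f₃` at a link edge. -/
noncomputable def linkBlock (ρ : TrefoilGroup →* SO3) (u : Fin 3 → Fin 3 → ℝ) (a b O P : Fin 3 → ℝ)
    (l : Fin 3 × Side) : Matrix (Fin 2) (Fin 2) ℝ :=
  linkFactor a b l.1 l.2 •
    !![-(linkEta ρ u O P l.1 l.2 / linkDistO ρ u O l.1 l.2), linkXi ρ u O P l.1 l.2;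
      linkXi ρ u O P l.1 l.2, -(linkEta ρ u O P l.1 l.2 / axisDot u l.1 P P)]

/-- The normal form of `f₃` on the variations vanishing on all link edges but one. -/
noncomputable def normalForm (ρ : TrefoilGroup →* SO3) (u : Fin 3 → Fin 3 → ℝ) (a b O P : Fin 3 → ℝ) :
    Matrix NormalRow NormalRow ℝ :=
  fromBlocks !![f₃ ρ (place u a b O P) (.linkOut 0) (.linkOut 0), 1; 1, 0] 0 0
    (fromBlocks (blockDiagonal (linkBlock ρ u a b O P)) 0 0
      (diagonal fun k => cornerCoeff ρ u a b O P k.1 k.2))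

theorem normalForm_transpose : (normalForm ρ u a b O P)ᵀ = normalForm ρ u a b O P := by
  have h2 : (blockDiagonal (linkBlock ρ u a b O P))ᵀ = blockDiagonal (linkBlock ρ u a b O P) := by
    rw [blockDiagonal_transpose]
    congr 1; ext l i j
    fin_cases i <;> fin_cases j <;> simp [linkBlock]
  have h1 : ∀ t : ℝ, (!![t, 1; 1, 0] : Matrix (Fin 2) (Fin 2) ℝ)ᵀ = !![t, 1; 1, 0] := fun t => by
    ext i j; fin_cases i <;> fin_cases j <;> rfl
  simp only [normalForm, fromBlocks_transpose, h2, h1, transpose_zero, diagonal_transpose]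

theorem blockDiagonal_mulVec {o m : Type*} [Fintype o] [Fintype m] [DecidableEq o]
    (M : o → Matrix m m ℝ) (x : m × o → ℝ) (k : m × o) :
    (blockDiagonal M *ᵥ x) k = (M k.2 *ᵥ fun i => x (i, k.2)) k.1 := by
  simp only [mulVec, dotProduct, Fintype.sum_prod_type, blockDiagonal_apply]
  refine Finset.sum_congr rfl fun i _ => ?_
  simp [ite_mul]

namespace IsGeneric

variable (h : IsGeneric ρ u a b O P)
include h

/-- The five other link edges can be made constant by displacements along the knot; the sixth
cannot, since moving all link vertices together changes no link edge. Its variation is therefore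
carried along and is paired with the row of `f₃` of that edge, which gives the block `!![f₃, 1; 1,
0]`. -/
theorem f₃_form_normal {ℓ' ℓ : Edge → ℝ} (h' : LinkFree ℓ') (h0 : LinkFree ℓ) :
    ℓ' ⬝ᵥ (f₃ ρ (place u a b O P) *ᵥ ℓ)
      = normalRow ρ u a b O P ℓ' ⬝ᵥ (normalForm ρ u a b O P *ᵥ normalRow ρ u a b O P ℓ) := by
  have key : ∀ ℓ : Edge → ℝ, LinkFree ℓ → ∀ i, ∀ s : Side, dropLink ℓ (s.link i) = 0 := by
    intro ℓ hℓ i s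
    by_cases e : s.link i = .linkOut 0
    · rw [e]; simp [dropLink]
    · rw [dropLink, Pi.sub_apply, hℓ i s e]; simp [e]
  have hd : ∀ ℓ : Edge → ℝ, ℓ = dropLink ℓ + ℓ (.linkOut 0) • Pi.single (.linkOut 0) 1 := by
    intro ℓ; rw [dropLink, sub_add_cancel]
  have hne : ∀ ℓ : Edge → ℝ, ∀ e : Edge, e ≠ .linkOut 0 → dropLink ℓ e = ℓ e := by
    intro ℓ e he; simp [dropLink, he]
  have hAO : ∀ (c : Corner) (i : Fin 3), c.edgeAO i ≠ .linkOut 0 := by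
    intro c i; cases c <;> simp [Corner.edgeAO]
  have hBP : ∀ (c : Corner) (i : Fin 3), c.edgeBP i ≠ .linkOut 0 := by
    intro c i; cases c <;> simp [Corner.edgeBP]
  have hAO' : ∀ (c : Side) (i : Fin 3), c.edgeAO i ≠ .linkOut 0 := by
    intro c i; cases c <;> simp [Side.edgeAO]
  have hBP' : ∀ (c : Side) (i : Fin 3), c.edgeBP i ≠ .linkOut 0 := by
    intro c i; cases c <;> simp [Side.edgeBP]
  have hc : ∀ (ℓ : Edge → ℝ) i c, cornerRow ρ u a b O P i c (dropLink ℓ)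
      = cornerRow ρ u a b O P i c ℓ := by
    intro ℓ i c
    simp only [cornerRow, hne _ _ (hAO _ _), hne _ _ (hBP _ _), ne_eq, reduceCtorEq,
      not_false_eq_true, hne]
  have hO : ∀ (ℓ : Edge → ℝ) i s, linkRowO a b i s (dropLink ℓ) = linkRowO a b i s ℓ := by
    intro ℓ i s
    simp only [linkRowO, hne _ _ (hAO' _ _), ne_eq, reduceCtorEq, not_false_eq_true, hne]
  have hP : ∀ (ℓ : Edge → ℝ) i s, linkRowP a b i s (dropLink ℓ) = linkRowP a b i s ℓ := by
    intro ℓ i s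
    simp only [linkRowP, hne _ _ (hBP' _ _), ne_eq, reduceCtorEq, not_false_eq_true, hne]
  have sum := h.f₃_eq_sum _ _ (key ℓ' h') (key ℓ h0)
  have symm : ∀ x y : Edge → ℝ, x ⬝ᵥ (f₃ ρ (place u a b O P) *ᵥ y)
      = y ⬝ᵥ (f₃ ρ (place u a b O P) *ᵥ x) := by
    intro x y
    conv_lhs => rw [← f₃_symm (h.coherent.equivariant a b O P) h.general]
    rw [mulVec_transpose, dotProduct_comm, ← dotProduct_mulVec]
  conv_lhs => rw [hd ℓ', hd ℓ]
  rw [mulVec_add, mulVec_smul, add_dotProduct, dotProduct_add, dotProduct_add, sum]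
  rw [dotProduct_smul, smul_dotProduct, smul_dotProduct, dotProduct_smul,
    symm (dropLink ℓ') (Pi.single _ _), single_one_dotProduct, single_one_dotProduct,
    single_one_dotProduct]
  have e0 : (f₃ ρ (place u a b O P) *ᵥ Pi.single (.linkOut 0) 1) (.linkOut 0)
      = f₃ ρ (place u a b O P) (.linkOut 0) (.linkOut 0) := by
    rw [mulVec_single_one]; rfl
  rw [e0]
  simp only [hc, hO, hP]
  simp only [normalForm, normalRow, LinearMap.coe_mk, AddHom.coe_mk, fromBlocks_mulVec,
    Sum.elim_comp_inl, Sum.elim_comp_inr, zero_mulVec, add_zero, zero_add,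
    sumElim_dotProduct_sumElim]
  have eC : ∀ f g : Fin 3 × Corner → ℝ, f ⬝ᵥ (diagonal (fun k : Fin 3 × Corner =>
      cornerCoeff ρ u a b O P k.1 k.2) *ᵥ g)
      = ∑ i, ∑ c, cornerCoeff ρ u a b O P i c * (f (i, c) * g (i, c)) := by
    intro f g
    simp only [dotProduct, mulVec_diagonal, Fintype.sum_prod_type]
    exact Finset.sum_congr rfl fun i _ => Finset.sum_congr rfl fun c _ => by ring
  have eL : ∀ f g : Fin 2 × (Fin 3 × Side) → ℝ,
      f ⬝ᵥ (blockDiagonal (linkBlock ρ u a b O P) *ᵥ g) = ∑ i, ∑ s, linkFactor a b i s *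
        (linkXi ρ u O P i s * (f (0, (i, s)) * g (1, (i, s)) + f (1, (i, s)) * g (0, (i, s)))
        - linkEta ρ u O P i s / linkDistO ρ u O i s * (f (0, (i, s)) * g (0, (i, s)))
        - linkEta ρ u O P i s / axisDot u i P P * (f (1, (i, s)) * g (1, (i, s)))) := by
    intro f g
    simp only [dotProduct, Fintype.sum_prod_type, blockDiagonal_mulVec]
    rw [Fin.sum_univ_two, ← Finset.sum_add_distrib]
    refine Finset.sum_congr rfl fun i _ => ?_
    rw [← Finset.sum_add_distrib]
    refine Finset.sum_congr rfl fun s _ => ?_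
    simp [linkBlock, mulVec, dotProduct, Fin.sum_univ_two]
    ring
  rw [eC, eL]
  simp [dotProduct, mulVec, Fin.sum_univ_two]
  ring

end IsGeneric

end TrefoilInvariant

namespace TrefoilInvariant

variable {ρ : TrefoilGroup →* SO3}
  {u : Fin 3 → Fin 3 → ℝ} {a b : Fin 3 → ℝ} {O P : Fin 3 → ℝ}

/-! ### The Wirtinger generators in terms of the axes -/

theorem triple_eq_dot_cross (x y z : Fin 3 → ℝ) : triple x y z = x ⬝ᵥ (y ⨯₃ z) := by
  rw [dot3]; simp [triple, cross_apply]

/-- For independent `x` and `y` the vectors `x`, `y`, `x × y` form a basis; the identity `key` is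
the squared norm computed in it. -/
theorem eq_of_dot_eq {x y v w : Fin 3 → ℝ} (h : (x ⬝ᵥ y) ^ 2 ≠ x ⬝ᵥ x * (y ⬝ᵥ y))
    (hx : x ⬝ᵥ v = x ⬝ᵥ w) (hy : y ⬝ᵥ v = y ⬝ᵥ w) (hn : triple x y v = triple x y w) : v = w := by
  have hx' : x ⬝ᵥ (v - w) = 0 := by rw [dotProduct_sub, hx, sub_self]
  have hy' : y ⬝ᵥ (v - w) = 0 := by rw [dotProduct_sub, hy, sub_self]
  have hn' : triple x y (v - w) = 0 := by
    have : triple x y (v - w) = triple x y v - triple x y w := by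
      simp only [triple, Pi.sub_apply]; ring
    rw [this, hn, sub_self]
  rw [← sub_eq_zero]
  set d := v - w
  have key : (x ⬝ᵥ x * (y ⬝ᵥ y) - (x ⬝ᵥ y) ^ 2) * (d ⬝ᵥ d) = triple x y d ^ 2
      + (x ⬝ᵥ d) * (y ⬝ᵥ y * (x ⬝ᵥ d) - x ⬝ᵥ y * (y ⬝ᵥ d))
      + (y ⬝ᵥ d) * (x ⬝ᵥ x * (y ⬝ᵥ d) - x ⬝ᵥ y * (x ⬝ᵥ d)) := by
    simp only [triple, dot3]; ring
  rw [hx', hy', hn'] at key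
  have : d ⬝ᵥ d = 0 := by
    have h1 : x ⬝ᵥ x * (y ⬝ᵥ y) - (x ⬝ᵥ y) ^ 2 ≠ 0 := fun h0 => h (by linarith)
    refine (mul_eq_zero.1 (key.trans ?_)).resolve_left h1
    ring
  exact dotProduct_self_eq_zero.1 this

theorem rot_cross (R : SO3) (x y : Fin 3 → ℝ) :
    (R : Matrix (Fin 3) (Fin 3) ℝ) *ᵥ (x ⨯₃ y)
      = ((R : Matrix (Fin 3) (Fin 3) ℝ) *ᵥ x) ⨯₃ ((R : Matrix (Fin 3) (Fin 3) ℝ) *ᵥ y) := by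
  have h : ∀ z, z ⬝ᵥ ((R : Matrix (Fin 3) (Fin 3) ℝ) *ᵥ (x ⨯₃ y)) = z ⬝ᵥ
      (((R : Matrix (Fin 3) (Fin 3) ℝ) *ᵥ x) ⨯₃ ((R : Matrix (Fin 3) (Fin 3) ℝ) *ᵥ y)) := by
    intro z
    have hz : z = (R : Matrix (Fin 3) (Fin 3) ℝ) *ᵥ ((R⁻¹ : SO3) : Matrix (Fin 3) (Fin 3) ℝ) *ᵥ z := by
      have : (R : Matrix (Fin 3) (Fin 3) ℝ) * ((R⁻¹ : SO3) : Matrix (Fin 3) (Fin 3) ℝ) = 1 := by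
        exact congrArg Subtype.val (mul_inv_cancel R)
      rw [mulVec_mulVec, this, one_mulVec]
    rw [hz, dot_rot, ← triple_eq_dot_cross, ← triple_eq_dot_cross, triple_rot]
  exact dotProduct_eq _ _ (fun z => by rw [dotProduct_comm, h, dotProduct_comm])

/-- The cosine of the angle between two of the axes. -/
def axisCos (u : Fin 3 → Fin 3 → ℝ) : ℝ := u 0 ⬝ᵥ u 1

/-- The cosine of the angle of rotation. -/
noncomputable def rotCos (u : Fin 3 → Fin 3 → ℝ) : ℝ := axisCos u / (1 + axisCos u)

/-- The sine of the angle of rotation. -/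
noncomputable def rotSin (u : Fin 3 → Fin 3 → ℝ) : ℝ :=
  triple (u 0) (u 1) (u 2) / (1 - axisCos u ^ 2)

/-- The rotation `ρ (xᵢ)` fixes `u i` and takes `u (i + 1)` to `u (i + 2)`, so the three pairwise
inner products agree. -/
theorem IsCoherent.dot_succ (h : IsCoherent ρ u) (i : Fin 3) : u i ⬝ᵥ u (i + 1) = axisCos u := by
  have key : ∀ i, u i ⬝ᵥ u (i + 1) = u i ⬝ᵥ u (i + 2) := fun i => by
    have := dot_rot (ρ (wirt i)) (u i) (u (i + 1))
    rw [h.fixed, h.step] at this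
    exact this.symm
  have h0 := key 0
  have h1 := key 1
  have h2 := key 2
  simp only [Fin.reduceAdd, zero_add] at h0 h1 h2
  fin_cases i
  · rfl
  · change u 1 ⬝ᵥ u 2 = _
    rw [h1, dotProduct_comm]; rfl
  · change u 2 ⬝ᵥ u 0 = _
    rw [dotProduct_comm, ← h0]; rfl

theorem triple_cyclic_axes (i : Fin 3) :
    triple (u i) (u (i + 1)) (u (i + 2)) = triple (u 0) (u 1) (u 2) := by
  fin_cases i
  · rfl
  · change triple (u 1) (u 2) (u 0) = _
    simp only [triple]; ring
  · change triple (u 2) (u 0) (u 1) = _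
    simp only [triple]; ring

/-- The third axis is determined by its inner products with the first two and by the triple product.
The coefficients turn out to be the cosine and sine of the rotation angle, which is why `rotCos` and
`rotSin` are defined as they are. -/
theorem IsCoherent.axis_add_two (h : IsCoherent ρ u) (hc : axisCos u ^ 2 ≠ 1) (i : Fin 3) :
    u (i + 2) = rotCos u • (u i + u (i + 1)) + rotSin u • (u i ⨯₃ u (i + 1)) := by
  have h1 := h.dot_succ i
  have h2 := h.dot_succ (i + 1)
  have h3 := h.dot_succ (i + 2)
  rw [fin3_a] at h2
  rw [fin3_d] at h3
  have u1 := h.unit i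
  have u2 := h.unit (i + 1)
  have ht := triple_cyclic_axes (u := u) i
  have c1 : 1 + axisCos u ≠ 0 := fun e => hc (by rw [show axisCos u = -1 by linarith]; norm_num)
  have c2 : 1 - axisCos u ^ 2 ≠ 0 := fun e => hc (by linarith)
  have hh : ∀ x y : Fin 3 → ℝ, triple x y (x ⨯₃ y) = x ⬝ᵥ x * (y ⬝ᵥ y) - (x ⬝ᵥ y) ^ 2 := by
    intro x y
    simp [triple, cross_apply, dot3]; ring
  have hl : ∀ (x y v w z : Fin 3 → ℝ) (s t : ℝ), triple x y (s • (v + w) + t • z)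
      = s * (triple x y v + triple x y w) + t * triple x y z := by
    intro x y v w z s t
    simp only [triple, Pi.add_apply, Pi.smul_apply, smul_eq_mul]; ring
  have h0 : ∀ x y : Fin 3 → ℝ, triple x y x = 0 ∧ triple x y y = 0 := by
    intro x y; constructor <;> (simp only [triple]; ring)
  refine eq_of_dot_eq (x := u i) (y := u (i + 1)) ?_ ?_ ?_ ?_
  · rw [h1, u1, u2]; simpa using hc
  · rw [dotProduct_comm, h3, dotProduct_add, dotProduct_smul, dotProduct_smul, dotProduct_add,
      dot_self_cross, u1, h1, rotCos]
    simp only [smul_eq_mul]; field_simp; ring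
  · rw [h2, dotProduct_add, dotProduct_smul, dotProduct_smul, dotProduct_add,
      dot_cross_self, u2, dotProduct_comm, h1, rotCos]
    simp only [smul_eq_mul]; field_simp; ring
  · rw [ht, hl, hh, (h0 _ _).1, (h0 _ _).2, u1, u2, h1, rotSin]
    field_simp
    ring

theorem triple_cross_self (x y : Fin 3 → ℝ) :
    triple x y (x ⨯₃ y) = x ⬝ᵥ x * (y ⬝ᵥ y) - (x ⬝ᵥ y) ^ 2 := by
  simp [triple, cross_apply, dot3]; ring

theorem exists_frame_coords {x y : Fin 3 → ℝ} (h : (x ⬝ᵥ y) ^ 2 ≠ x ⬝ᵥ x * (y ⬝ᵥ y))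
    (v : Fin 3 → ℝ) : ∃ q : Fin 3 → ℝ, v = q 0 • x + q 1 • y + q 2 • (x ⨯₃ y) := by
  have h1 : x ⬝ᵥ x * (y ⬝ᵥ y) - (x ⬝ᵥ y) ^ 2 ≠ 0 := fun h0 => h (by linarith)
  set g := x ⬝ᵥ x * (y ⬝ᵥ y) - (x ⬝ᵥ y) ^ 2 with hg
  refine ⟨![(y ⬝ᵥ y * (x ⬝ᵥ v) - x ⬝ᵥ y * (y ⬝ᵥ v)) / g,
    (x ⬝ᵥ x * (y ⬝ᵥ v) - x ⬝ᵥ y * (x ⬝ᵥ v)) / g, triple x y v / g], ?_⟩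
  refine eq_of_dot_eq h ?_ ?_ ?_
  · simp only [dotProduct_add, dotProduct_smul, dot_self_cross, smul_eq_mul, cons_val_zero,
      cons_val_one, cons_val]
    field_simp; rw [hg]; ring
  · simp only [dotProduct_add, dotProduct_smul, dot_cross_self, smul_eq_mul, cons_val_zero,
      cons_val_one, cons_val, dotProduct_comm y x]
    field_simp; rw [hg]; ring
  · have hl : ∀ (x y v w z : Fin 3 → ℝ) (r s t : ℝ), triple x y (r • v + s • w + t • z)
        = r * triple x y v + s * triple x y w + t * triple x y z := by
      intro x y v w z r s t
      simp only [triple, Pi.add_apply, Pi.smul_apply, smul_eq_mul]; ring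
    have h0 : triple x y x = 0 ∧ triple x y y = 0 := by
      constructor <;> (simp only [triple]; ring)
    rw [hl, h0.1, h0.2, triple_cross_self, ← hg]
    simp only [cons_val_zero, cons_val_one, cons_val]
    field_simp; ring

/-- The `ρ (xᵢ)` are the rotations about the axes through a common angle. -/
theorem IsCoherent.rodrigues (h : IsCoherent ρ u) (hc : axisCos u ^ 2 ≠ 1) (i : Fin 3)
    (v : Fin 3 → ℝ) : (ρ (wirt i) : Matrix (Fin 3) (Fin 3) ℝ) *ᵥ v
      = rotCos u • v + rotSin u • (u i ⨯₃ v) + ((1 - rotCos u) * (u i ⬝ᵥ v)) • u i := by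
  have h1 := h.dot_succ i
  have u1 := h.unit i
  have u2 := h.unit (i + 1)
  have c1 : 1 + axisCos u ≠ 0 := fun e => hc (by rw [show axisCos u = -1 by linarith]; norm_num)
  have hC : (1 - rotCos u) * axisCos u = rotCos u := by rw [rotCos]; field_simp; ring
  obtain ⟨q, rfl⟩ := exists_frame_coords (x := u i) (y := u (i + 1)) (by
    rw [h1, u1, u2]; simpa using hc) v
  have hx : u i ⨯₃ (u i ⨯₃ u (i + 1)) = axisCos u • u i - u (i + 1) := by
    rw [cross_cross_eq_smul_sub_smul', h1, u1, one_smul]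
  -- Both sides are linear in the vector and are compared on `u i`, `u (i + 1)` and their cross
  -- product.
  simp only [mulVec_add, mulVec_smul, rot_cross, h.fixed, h.step, h.axis_add_two hc i, map_add,
    map_smul, cross_self, hx, dotProduct_add, dotProduct_smul, dot_self_cross, u1, h1, smul_eq_mul]
  ext k
  simp only [Pi.add_apply, Pi.smul_apply, Pi.sub_apply, Pi.zero_apply, smul_eq_mul]
  linear_combination (-q 1 * u i k) * hC

theorem IsCoherent.rotSin_sq (h : IsCoherent ρ u) (hc : axisCos u ^ 2 ≠ 1) :
    rotSin u ^ 2 = 1 - rotCos u ^ 2 := by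
  have hn := h.unit 2
  have e2 := h.axis_add_two hc 0
  have h1 := h.dot_succ 0
  simp only [zero_add] at e2 h1
  have u1 := h.unit 0
  have u2 := h.unit 1
  rw [e2] at hn
  have hq : (u 0 ⨯₃ u 1) ⬝ᵥ (u 0 ⨯₃ u 1) = 1 - axisCos u ^ 2 := by
    rw [cross_dot_cross, u1, u2, dotProduct_comm (u 1) (u 0), h1]; ring
  have hw : (u 0 ⨯₃ u 1) ⬝ᵥ u 1 = 0 := by rw [dotProduct_comm, dot_cross_self]
  have hy : (u 0 ⨯₃ u 1) ⬝ᵥ u 0 = 0 := by rw [dotProduct_comm, dot_self_cross]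
  simp only [add_dotProduct, dotProduct_add, smul_dotProduct, dotProduct_smul, smul_eq_mul,
    dot_self_cross, dot_cross_self, hq, hy, hw, u1, u2, h1, dotProduct_comm (u 1) (u 0)] at hn
  have c1 : 1 + axisCos u ≠ 0 := fun e => hc (by rw [show axisCos u = -1 by linarith]; norm_num)
  have hcc : 1 - axisCos u ^ 2 ≠ 0 := fun e => hc (by linarith)
  have : (rotSin u ^ 2 - (1 - rotCos u ^ 2)) * (1 - axisCos u ^ 2) = 0 := by
    have hC' : rotCos u * (1 + axisCos u) = axisCos u := by rw [rotCos]; field_simp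
    linear_combination hn - (rotCos u + rotCos u * axisCos u + axisCos u) * hC'
  exact sub_eq_zero.1 ((mul_eq_zero.1 this).resolve_right hcc)

/-! ### Coordinates in the frame of two of the axes -/

/-- The vector with given coordinates with respect to two axes and their cross product. -/
def frameVec (u : Fin 3 → Fin 3 → ℝ) (q : Fin 3 → ℝ) : Fin 3 → ℝ :=
  q 0 • u 0 + q 1 • u 1 + q 2 • (u 0 ⨯₃ u 1)

theorem IsCoherent.exists_frameVec (h : IsCoherent ρ u) (hc : axisCos u ^ 2 ≠ 1) (v : Fin 3 → ℝ) :
    ∃ q, v = frameVec u q :=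
  exists_frame_coords (by rw [h.unit, h.unit, ← axisCos]; simpa using hc) v

theorem IsCoherent.triple_frameVec (h : IsCoherent ρ u) (q r s : Fin 3 → ℝ) :
    triple (frameVec u q) (frameVec u r) (frameVec u s) = (1 - axisCos u ^ 2) * triple q r s := by
  have h0 := h.unit 0
  have h1 := h.unit 1
  have key := triple_cross_self (u 0) (u 1)
  rw [h0, h1, one_mul, ← axisCos] at key
  rw [← key]
  simp only [triple, frameVec, Pi.add_apply, Pi.smul_apply, smul_eq_mul]
  ring

theorem IsCoherent.axes_frameVec (h : IsCoherent ρ u) (hc : axisCos u ^ 2 ≠ 1) :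
    u 0 = frameVec u ![1, 0, 0] ∧ u 1 = frameVec u ![0, 1, 0] ∧
      u 2 = frameVec u ![rotCos u, rotCos u, rotSin u] := by
  have h2 := h.axis_add_two hc 0
  simp only [zero_add] at h2
  refine ⟨?_, ?_, ?_⟩
  · simp [frameVec]
  · simp [frameVec]
  · conv_lhs => rw [h2]
    simp [frameVec]

theorem IsCoherent.rot_frameVec (h : IsCoherent ρ u) (hc : axisCos u ^ 2 ≠ 1) (q : Fin 3 → ℝ) :
    (ρ (wirt 0) : Matrix (Fin 3) (Fin 3) ℝ) *ᵥ frameVec u q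
      = frameVec u ![q 0 + rotCos u * q 1 + axisCos u * rotSin u * q 2,
        rotCos u * q 1 - rotSin u * q 2, rotSin u * q 1 + rotCos u * q 2] ∧
    (ρ (wirt 1) : Matrix (Fin 3) (Fin 3) ℝ) *ᵥ frameVec u q
      = frameVec u ![rotCos u * q 0 + rotSin u * q 2,
        rotCos u * q 0 + q 1 - axisCos u * rotSin u * q 2, -(rotSin u * q 0) + rotCos u * q 2] ∧
    (ρ (wirt 2) : Matrix (Fin 3) (Fin 3) ℝ) *ᵥ frameVec u q
      = frameVec u ![(rotCos u ^ 2 - rotSin u ^ 2) * q 1 + 2 * rotSin u * rotCos u * q 2,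
        q 0 + (rotCos u + axisCos u * rotSin u ^ 2 + rotCos u ^ 2) * q 1
          - 2 * axisCos u * rotSin u * rotCos u * q 2,
        2 * rotSin u * rotCos u * q 1 + (rotSin u ^ 2 - rotCos u ^ 2) * q 2] := by
  have h1 := h.dot_succ 0
  have e2 := h.axis_add_two hc 0
  have u1 := h.unit 0
  have u2 := h.unit 1
  simp only [zero_add] at e2 h1
  have c1 : 1 + axisCos u ≠ 0 := fun e => hc (by rw [show axisCos u = -1 by linarith]; norm_num)
  have hC : (1 - rotCos u) * axisCos u = rotCos u := by rw [rotCos]; field_simp; ring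
  have a1 : u 0 ⨯₃ (u 0 ⨯₃ u 1) = axisCos u • u 0 - u 1 := by
    rw [cross_cross_eq_smul_sub_smul', h1, u1, one_smul]
  have a2 : u 1 ⨯₃ (u 0 ⨯₃ u 1) = u 0 - axisCos u • u 1 := by
    rw [cross_cross_eq_smul_sub_smul', dotProduct_comm, h1, u2, one_smul]
  have a3 : u 1 ⨯₃ u 0 = -(u 0 ⨯₃ u 1) := (cross_anticomm _ _).symm
  have f0 := h.fixed 0
  have f1 := h.fixed 1
  have s0 := h.step 0
  have s1 := h.step 1
  have s2 := h.step 2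
  simp only [zero_add, Fin.reduceAdd] at s0 s1 s2
  have x10 : (ρ (wirt 1) : Matrix (Fin 3) (Fin 3) ℝ) *ᵥ u 0
      = rotCos u • u 0 + rotCos u • u 1 - rotSin u • (u 0 ⨯₃ u 1) := by
    rw [h.rodrigues hc, a3, dotProduct_comm, h1, hC]
    simp only [smul_neg]; abel
  have x21 : (ρ (wirt 2) : Matrix (Fin 3) (Fin 3) ℝ) *ᵥ u 1
      = (rotCos u ^ 2 - rotSin u ^ 2) • u 0
        + (rotCos u + axisCos u * rotSin u ^ 2 + rotCos u ^ 2) • u 1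
        + (2 * rotSin u * rotCos u) • (u 0 ⨯₃ u 1) := by
    have h2 := h.dot_succ 1
    simp only [Fin.reduceAdd] at h2
    rw [h.rodrigues hc, dotProduct_comm, h2, hC, e2]
    have a4 : (u 0 ⨯₃ u 1) ⨯₃ u 1 = -(u 0 - axisCos u • u 1) := by
      rw [← a2, cross_anticomm]
    simp only [map_add, map_smul, LinearMap.add_apply, LinearMap.smul_apply, cross_self, a4]
    ext k
    simp only [Pi.add_apply, Pi.smul_apply, Pi.sub_apply, Pi.zero_apply, Pi.neg_apply, smul_eq_mul]
    ring
  refine ⟨?_, ?_, ?_⟩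
  · simp only [frameVec, mulVec_add, mulVec_smul, rot_cross, f0, s0, e2, map_add, map_smul,
      cross_self, a1]
    ext k
    simp [smul_eq_mul]; ring
  · simp only [frameVec, mulVec_add, mulVec_smul, rot_cross, f1, x10, map_add, map_sub, map_smul,
      LinearMap.add_apply, LinearMap.smul_apply, LinearMap.sub_apply, cross_self]
    have a4 : (u 0 ⨯₃ u 1) ⨯₃ u 1 = -(u 0 - axisCos u • u 1) := by
      rw [← a2, cross_anticomm]
    rw [a4]
    ext k
    simp [smul_eq_mul]; ring
  · simp only [frameVec, mulVec_add, mulVec_smul, rot_cross, s2, x21, map_add, map_smul,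
      cross_self, a2, a3]
    ext k
    have a3k := congrFun a3 k
    simp only [Pi.neg_apply] at a3k
    simp [smul_eq_mul]
    linear_combination (q 2 * (rotCos u ^ 2 - rotSin u ^ 2)) * a3k

end TrefoilInvariant

namespace TrefoilInvariant

variable {ρ : TrefoilGroup →* SO3}
  {u : Fin 3 → Fin 3 → ℝ} {a b : Fin 3 → ℝ} {O P : Fin 3 → ℝ}

/-! ### Relations between the volumes -/

/-- `[uᵢ, uᵢ₊₁, X]`. -/
def axisFace (u : Fin 3 → Fin 3 → ℝ) (X : Fin 3 → ℝ) (i : Fin 3) : ℝ := triple (u i) (u (i + 1)) X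

theorem regionPos_exterior : regionPos ρ O .exterior = O := by simp [regionPos, regionLabel]

theorem regionPos_lobe (i : Fin 3) :
    regionPos ρ O (.lobe i) = (ρ (wirt i) : Matrix (Fin 3) (Fin 3) ℝ) *ᵥ O := rfl

theorem regionPos_centre (i : Fin 3) :
    regionPos ρ O .centre = (ρ (wirt i) : Matrix (Fin 3) (Fin 3) ℝ) *ᵥ
      ((ρ (wirt (i + 1)) : Matrix (Fin 3) (Fin 3) ℝ) *ᵥ O) := by
  simp only [regionPos]
  rw [regionLabel_centre i, map_mul]; simp [mulVec_mulVec]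

/-- The rational parametrisation of the circle by `w = cot (φ₁/2)`, realised as `rotSin u * (1 +
axisCos u)`. It turns relations between the volumes into polynomial identities without side
conditions. -/
theorem IsCoherent.exists_param (h : IsCoherent ρ u) (hc : axisCos u ^ 2 ≠ 1) :
    ∃ w : ℝ, axisCos u = (w ^ 2 - 1) / 2 ∧ rotCos u = (w ^ 2 - 1) / (w ^ 2 + 1) ∧
      rotSin u = 2 * w / (w ^ 2 + 1) := by
  have c1 : 1 + axisCos u ≠ 0 := fun e => hc (by rw [show axisCos u = -1 by linarith]; norm_num)
  have hS := h.rotSin_sq hc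
  have hw : (rotSin u * (1 + axisCos u)) ^ 2 = 1 + 2 * axisCos u := by
    rw [mul_pow, hS, rotCos]; field_simp; ring
  have hw' : (rotSin u * (1 + axisCos u)) ^ 2 + 1 = 2 * (1 + axisCos u) := by rw [hw]; ring
  refine ⟨rotSin u * (1 + axisCos u), ?_, ?_, ?_⟩
  · rw [hw]; ring
  · rw [hw', hw, rotCos]; field_simp; ring
  · rw [hw']; field_simp

/-- All volumes as polynomials in the coordinates in a frame. -/
theorem IsCoherent.exists_coords (h : IsCoherent ρ u) (hc : axisCos u ^ 2 ≠ 1)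
    (O P : Fin 3 → ℝ) : ∃ (w : ℝ) (o p : Fin 3 → ℝ), axisCos u = (w ^ 2 - 1) / 2 ∧
    (∀ X x, (X = O ∧ x = o) ∨ (X = P ∧ x = p) →
      axisFace u X 0 = (1 - axisCos u ^ 2) * x 2 ∧
      axisFace u X 1 = (1 - axisCos u ^ 2) * (2 * w * x 0 - (w ^ 2 - 1) * x 2) / (w ^ 2 + 1) ∧
      axisFace u X 2 = (1 - axisCos u ^ 2) * (2 * w * x 1 - (w ^ 2 - 1) * x 2) / (w ^ 2 + 1)) ∧
    ∀ r : Region, ∃ x, regionPos ρ O r = frameVec u x ∧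
      (x = match r with
        | .exterior => o
        | .lobe 0 => ![o 0 + (w ^ 2 - 1) / (w ^ 2 + 1) * o 1
            + (w ^ 2 - 1) / 2 * (2 * w / (w ^ 2 + 1)) * o 2,
          (w ^ 2 - 1) / (w ^ 2 + 1) * o 1 - 2 * w / (w ^ 2 + 1) * o 2,
          2 * w / (w ^ 2 + 1) * o 1 + (w ^ 2 - 1) / (w ^ 2 + 1) * o 2]
        | .lobe 1 => ![(w ^ 2 - 1) / (w ^ 2 + 1) * o 0 + 2 * w / (w ^ 2 + 1) * o 2,
          (w ^ 2 - 1) / (w ^ 2 + 1) * o 0 + o 1 - (w ^ 2 - 1) / 2 * (2 * w / (w ^ 2 + 1)) * o 2,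
          -(2 * w / (w ^ 2 + 1) * o 0) + (w ^ 2 - 1) / (w ^ 2 + 1) * o 2]
        | .lobe 2 => ![(((w ^ 2 - 1) / (w ^ 2 + 1)) ^ 2 - (2 * w / (w ^ 2 + 1)) ^ 2) * o 1
            + 2 * (2 * w / (w ^ 2 + 1)) * ((w ^ 2 - 1) / (w ^ 2 + 1)) * o 2,
          o 0 + ((w ^ 2 - 1) / (w ^ 2 + 1) + (w ^ 2 - 1) / 2 * (2 * w / (w ^ 2 + 1)) ^ 2
              + ((w ^ 2 - 1) / (w ^ 2 + 1)) ^ 2) * o 1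
            - 2 * ((w ^ 2 - 1) / 2) * (2 * w / (w ^ 2 + 1)) * ((w ^ 2 - 1) / (w ^ 2 + 1)) * o 2,
          2 * (2 * w / (w ^ 2 + 1)) * ((w ^ 2 - 1) / (w ^ 2 + 1)) * o 1
            + ((2 * w / (w ^ 2 + 1)) ^ 2 - ((w ^ 2 - 1) / (w ^ 2 + 1)) ^ 2) * o 2]
        | .centre => ![(w ^ 2 - 1) / (w ^ 2 + 1) * o 1 + 2 * w / (w ^ 2 + 1) * o 2,
          o 0 + (w ^ 2 - 1) / (w ^ 2 + 1) * o 1 - (w ^ 2 - 1) / 2 * (2 * w / (w ^ 2 + 1)) * o 2,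
          2 * w / (w ^ 2 + 1) * o 1 - (w ^ 2 - 1) / (w ^ 2 + 1) * o 2]) ∧
      axisVol ρ u O P 0 r = (1 - axisCos u ^ 2) * (x 1 * p 2 - x 2 * p 1) ∧
      axisVol ρ u O P 1 r = (1 - axisCos u ^ 2) * (x 2 * p 0 - x 0 * p 2) ∧
      axisVol ρ u O P 2 r = (1 - axisCos u ^ 2) * ((w ^ 2 - 1) * (x 1 * p 2 - x 2 * p 1)
        + (w ^ 2 - 1) * (x 2 * p 0 - x 0 * p 2) + 2 * w * (x 0 * p 1 - x 1 * p 0)) / (w ^ 2 + 1) := by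
  obtain ⟨w, w1, w2, w3⟩ := h.exists_param hc
  obtain ⟨o, hO⟩ := h.exists_frameVec hc O
  obtain ⟨p, hP⟩ := h.exists_frameVec hc P
  obtain ⟨e0, e1, e2⟩ := h.axes_frameVec hc
  have hw : w ^ 2 + 1 ≠ 0 := by positivity
  refine ⟨w, o, p, w1, ?_, ?_⟩
  · intro X x hX
    have hx : X = frameVec u x := by
      rcases hX with ⟨rfl, rfl⟩ | ⟨rfl, rfl⟩ <;> assumption
    rw [hx]
    refine ⟨?_, ?_, ?_⟩
    · change triple (u 0) (u 1) _ = _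
      rw [e0, e1, h.triple_frameVec]; simp [triple]
    · change triple (u 1) (u 2) _ = _
      rw [e1, e2, h.triple_frameVec, w2, w3]; simp [triple]; field_simp
    · change triple (u 2) (u 0) _ = _
      rw [e2, e0, h.triple_frameVec, w2, w3]; simp [triple]; field_simp; ring
  · intro r
    have hr : ∀ x, regionPos ρ O r = frameVec u x →
        axisVol ρ u O P 0 r = (1 - axisCos u ^ 2) * (x 1 * p 2 - x 2 * p 1) ∧
        axisVol ρ u O P 1 r = (1 - axisCos u ^ 2) * (x 2 * p 0 - x 0 * p 2) ∧
        axisVol ρ u O P 2 r = (1 - axisCos u ^ 2) * ((w ^ 2 - 1) * (x 1 * p 2 - x 2 * p 1)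
          + (w ^ 2 - 1) * (x 2 * p 0 - x 0 * p 2) + 2 * w * (x 0 * p 1 - x 1 * p 0))
          / (w ^ 2 + 1) := by
      intro x hx
      simp only [axisVol, hx]
      rw [hP]
      refine ⟨?_, ?_, ?_⟩
      · rw [e0, h.triple_frameVec]; simp [triple]
      · rw [e1, h.triple_frameVec]; simp [triple]
      · rw [e2, h.triple_frameVec, w2, w3]; simp [triple]; field_simp
    refine ⟨_, ?_, rfl, hr _ ?_⟩
    all_goals
      rcases r with _ | j | _
      · rw [regionPos_exterior, hO]
      · rw [regionPos_lobe, hO]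
        obtain ⟨r0, r1, r2⟩ := h.rot_frameVec hc o
        fin_cases j
        · exact r0.trans (by rw [w1, w2, w3])
        · exact r1.trans (by rw [w1, w2, w3])
        · exact r2.trans (by rw [w1, w2, w3])
      · rw [regionPos_centre 0, hO]
        have r1 := (h.rot_frameVec hc o).2.1
        rw [zero_add, r1, (h.rot_frameVec hc _).1, w1, w2, w3]
        congr 1
        ext k
        fin_cases k <;> simp <;> field_simp <;> ring

end TrefoilInvariant

/-! ### The two non-monomial identities between volumes, and the blocks of the link edges. -/

namespace TrefoilInvariant

variable {ρ : TrefoilGroup →* SO3}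
  {u : Fin 3 → Fin 3 → ℝ} {a b : Fin 3 → ℝ} {O P : Fin 3 → ℝ}

theorem sum_face_vol (ρ : TrefoilGroup →* SO3) (u : Fin 3 → Fin 3 → ℝ) (O P : Fin 3 → ℝ) :
    axisFace u O 0 * axisVol ρ u O P 2 .exterior + axisFace u O 1 * axisVol ρ u O P 0 .exterior
      + axisFace u O 2 * axisVol ρ u O P 1 .exterior = 0 := by
  simp only [axisFace, axisVol, regionPos_exterior, triple, Fin.reduceAdd, zero_add]
  ring

/-- The last pivot of the elimination is a sum of several products of volumes; this polynomial
identity in frame coordinates reduces it to a monomial with the factor `(1 - c)/(1 + c)`. -/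
theorem IsCoherent.volume_relation (h : IsCoherent ρ u) (hc : axisCos u ^ 2 ≠ 1)
    (O P : Fin 3 → ℝ) :
    (1 + axisCos u) * (-(axisFace u P 1 + axisFace u P 2) * axisFace u P 0 * axisFace u O 0
        * axisVol ρ u O P 2 .exterior
      + axisFace u P 1 * axisFace u P 2 * (axisVol ρ u O P 0 .exterior * axisFace u O 1
        + axisVol ρ u O P 1 .exterior * axisFace u O 2)
      + (axisVol ρ u O P 2 (.lobe 0) * axisFace u P 0 + axisVol ρ u O P 1 .exterior * axisFace u P 2)
        * (axisFace u O 1 * axisFace u P 2 - axisFace u O 2 * axisFace u P 1))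
    = -(1 - axisCos u) * (axisFace u O 0 * axisVol ρ u O P 2 .exterior * axisFace u P 0
      * axisFace u P 2) := by
  obtain ⟨w, o, p, hw, hf, hr⟩ := h.exists_coords hc O P
  obtain ⟨o0, o1, o2⟩ := hf O o (Or.inl ⟨rfl, rfl⟩)
  obtain ⟨p0, p1, p2⟩ := hf P p (Or.inr ⟨rfl, rfl⟩)
  obtain ⟨x, -, rfl, a0, a1, a2⟩ := hr .exterior
  obtain ⟨y, -, rfl, b0, b1, b2⟩ := hr (.lobe 0)
  have h1 : w ^ 2 + 1 ≠ 0 := by positivity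
  rw [o0, o1, o2, p0, p1, p2, a0, a1, a2, b2, hw]
  simp only [cons_val_zero, cons_val_one, cons_val]
  field_simp
  ring

/-- The rows stand for the three quadrants left over by the elimination, the columns for the common
motion along the knot and the radial motions of `O` and `P`. The factor 2 here is the source of the
value 4. -/
theorem IsCoherent.volume_det (h : IsCoherent ρ u) (hc : axisCos u ^ 2 ≠ 1)
    (O P : Fin 3 → ℝ) :
    (1 + axisCos u) * (Matrix.det
      !![axisVol ρ u O P 1 (.lobe 2) - axisVol ρ u O P 2 (.lobe 2), -axisFace u P 1, -axisFace u O 2;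
        axisVol ρ u O P 0 .centre - axisVol ρ u O P 1 .centre, -axisFace u P 0, axisFace u O 2;
        axisVol ρ u O P 1 .centre - axisVol ρ u O P 2 .centre, -axisFace u P 1, axisFace u O 0])
    = -2 * (1 - axisCos u) * (axisFace u P 1 * axisFace u O 2 * axisVol ρ u O P 1 .centre) := by
  obtain ⟨w, o, p, hw, hf, hr⟩ := h.exists_coords hc O P
  obtain ⟨o0, o1, o2⟩ := hf O o (Or.inl ⟨rfl, rfl⟩)
  obtain ⟨p0, p1, p2⟩ := hf P p (Or.inr ⟨rfl, rfl⟩)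
  obtain ⟨x, -, rfl, a0, a1, a2⟩ := hr .centre
  obtain ⟨y, -, rfl, b0, b1, b2⟩ := hr (.lobe 2)
  have h1 : w ^ 2 + 1 ≠ 0 := by positivity
  rw [det_fin_three]
  simp only [of_apply, cons_val_zero, cons_val_one, cons_val, cons_val']
  rw [o0, o2, p0, p1, a0, a1, a2, b1, b2, hw]
  simp only [cons_val_zero, cons_val_one, cons_val]
  field_simp
  ring

/-! ### The determinant of the block of a link edge -/

theorem axisDot_mul_axisDot {i : Fin 3} (hu : u i ⬝ᵥ u i = 1) (Y P : Fin 3 → ℝ) :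
    axisDot u i Y Y * axisDot u i P P = axisDot u i Y P ^ 2 + triple (u i) Y P ^ 2 := by
  have key : u i ⬝ᵥ u i * (Y ⬝ᵥ Y * (P ⬝ᵥ P) - (Y ⬝ᵥ P) ^ 2) - (u i ⬝ᵥ Y) ^ 2 * (P ⬝ᵥ P)
      + 2 * (u i ⬝ᵥ Y) * (u i ⬝ᵥ P) * (Y ⬝ᵥ P) - (u i ⬝ᵥ P) ^ 2 * (Y ⬝ᵥ Y) = triple (u i) Y P ^ 2 := by
    simp only [triple, dot3]; ring
  simp only [axisDot]
  rw [hu] at key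
  linear_combination key

theorem IsCoherent.rot_axisDot (h : IsCoherent ρ u) (hc : axisCos u ^ 2 ≠ 1) (i : Fin 3)
    (Y P : Fin 3 → ℝ) :
    triple (u i) ((ρ (wirt i) : Matrix (Fin 3) (Fin 3) ℝ) *ᵥ Y) P
      = rotCos u * triple (u i) Y P - rotSin u * axisDot u i Y P ∧
    axisDot u i ((ρ (wirt i) : Matrix (Fin 3) (Fin 3) ℝ) *ᵥ Y) P
      = rotCos u * axisDot u i Y P + rotSin u * triple (u i) Y P := by
  have hu := h.unit i
  have e1 : triple (u i) (u i ⨯₃ Y) P = -(u i ⬝ᵥ u i * (Y ⬝ᵥ P)) + (u i ⬝ᵥ Y) * (u i ⬝ᵥ P) := by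
    simp only [dot3]; simp [triple, cross_apply]; ring
  have e2 : (u i ⨯₃ Y) ⬝ᵥ P = triple (u i) Y P := by
    simp only [dot3]; simp [triple, cross_apply]; ring
  have e3 : ∀ (x y z : Fin 3 → ℝ) (r s t : ℝ), triple (u i) (r • x + s • y + t • z) P
      = r * triple (u i) x P + s * triple (u i) y P + t * triple (u i) z P := by
    intro x y z r s t
    simp only [triple, Pi.add_apply, Pi.smul_apply, smul_eq_mul]; ring
  have e4 : triple (u i) (u i) P = 0 := by simp only [triple]; ring
  rw [h.rodrigues hc, e3, e1, e4]
  simp only [axisDot, add_dotProduct, smul_dotProduct, dotProduct_add, dotProduct_smul, smul_eq_mul,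
    dot_self_cross, e2, hu]
  constructor <;> ring

/-- The pair `(z, v)` is turned by the rotation angle on crossing the link edge, so `z² + v²` is
preserved and `z/v - z'/v'` is `-S (z² + v²)/(v v')`. Then `S² = 1 - C²` leaves `2 - 2C`. -/
theorem block_identity {C S v z v' z' oo pp : ℝ} (hS : S ^ 2 = 1 - C ^ 2) (hv' : v' = C * v - S * z)
    (hz' : z' = C * z + S * v) (hv : v ≠ 0) (hv0 : v' ≠ 0) (ho : oo * pp = z ^ 2 + v ^ 2) :
    (z / v - z' / v') / oo * ((z / v - z' / v') / pp) - (1 / v - 1 / v') ^ 2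
      = (2 - 2 * C) / (v * v') := by
  have hpos : z ^ 2 + v ^ 2 ≠ 0 := by positivity
  have e : (z / v - z' / v') / oo * ((z / v - z' / v') / pp)
      = (z / v - z' / v') ^ 2 / (z ^ 2 + v ^ 2) := by
    rw [← ho]; ring
  have e2 : z / v - z' / v' = -S * (z ^ 2 + v ^ 2) / (v * v') := by
    field_simp
    rw [hz', hv']; ring
  rw [e, e2]
  field_simp
  have : v' * C = v' * C := rfl
  rw [hv']
  linear_combination v ^ 2 * hS

theorem IsGeneric.axisCos_sq_ne (h : IsGeneric ρ u a b O P) : axisCos u ^ 2 ≠ 1 := by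
  intro hc
  have h0 := h.cornerE_ne 0 .ext
  rw [(h.coherent.cornerE_eq 0).1] at h0
  have h2 := lagrange_pos (e := u 0) (a := u 1) (b := O) h0
  rw [h.coherent.unit, h.coherent.unit, dotProduct_comm, ← axisCos, hc] at h2
  linarith

/-- This is where the full angle around the knot enters: each link edge contributes one factor `2 -
2 cos φ₁`. -/
theorem IsGeneric.det_linkBlock (h : IsGeneric ρ u a b O P) (l : Fin 3 × Side) :
    (linkBlock ρ u a b O P l).det = linkFactor a b l.1 l.2 ^ 2 * ((2 - 2 * rotCos u)
      / (axisVol ρ u O P l.1 (l.2.regionPlus l.1) * axisVol ρ u O P l.1 (l.2.regionMinus l.1))) := by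
  obtain ⟨i, s⟩ := l
  have hc := h.axisCos_sq_ne
  have hS := h.coherent.rotSin_sq hc
  have hp := (h.plus_ne i s).2
  have hm := h.minus_ne i s
  have hu := h.coherent.unit i
  have ho := axisDot_mul_axisDot hu (regionPos ρ O (s.regionPlus i)) P
  have hdet : (linkBlock ρ u a b O P (i, s)).det = linkFactor a b i s ^ 2
      * (linkEta ρ u O P i s / linkDistO ρ u O i s * (linkEta ρ u O P i s / axisDot u i P P)
        - linkXi ρ u O P i s ^ 2) := by
    rw [linkBlock, det_smul, det_fin_two]
    simp only [of_apply, cons_val_zero, cons_val_one, cons_val', cons_val_fin_one, Fintype.card_fin]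
    ring
  rw [hdet]
  congr 1
  simp only [linkEta, linkXi]
  cases s
  · obtain ⟨k1, k2⟩ := h.coherent.rot_axisDot hc i O P
    simp only [Side.regionPlus, Side.regionMinus] at *
    exact block_identity hS (by simp only [axisVol, regionPos_exterior, regionPos_lobe]; exact k1)
      (by simp only [axisVol, regionPos_exterior, regionPos_lobe]; exact k2) hp hm ho
  · obtain ⟨k1, k2⟩ := h.coherent.rot_axisDot hc i (regionPos ρ O (.lobe (i + 1))) P
    simp only [Side.regionPlus, Side.regionMinus] at *
    have ho' := axisDot_mul_axisDot hu (regionPos ρ O (.lobe (i + 1))) P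
    have hd : axisDot u i (regionPos ρ O (.lobe (i + 1))) (regionPos ρ O (.lobe (i + 1)))
        = linkDistO ρ u O i .inn := by
      have := h.coherent.regionMinus_dot (O := O) i .inn
      simp only [Side.regionPlus, Side.regionMinus] at this
      simp only [linkDistO, axisDot, regionPos_dot_self, this, Side.regionPlus]
    rw [hd] at ho'
    -- On the inner link edge the positively oriented side is reached by the rotation, so the two
    -- regions exchange roles.
    have key := block_identity (v := axisVol ρ u O P i (.lobe (i + 1))) (v' := axisVol ρ u O P i .centre)
      (z' := axisDot u i (regionPos ρ O .centre) P) hS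
      (by simp only [axisVol, regionPos_centre i]; exact k1)
      (by rw [regionPos_centre i]; exact k2) hm hp ho'
    rw [mul_comm (axisVol ρ u O P i .centre), ← key]
    ring

end TrefoilInvariant

namespace TrefoilInvariant

variable {ρ : TrefoilGroup →* SO3}
  {u : Fin 3 → Fin 3 → ℝ} {a b : Fin 3 → ℝ} {O P : Fin 3 → ℝ}

/-! ### The normal form as a square system -/

/-- The functional that is paired with a coordinate. -/
def coneRow : ConeCoord → NormalRow
  | .op (.lobe j) => .inr (.inr (j + 2, .succ))
  | .op .centre => .inr (.inr (0, .centre))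
  | .op .exterior => .inr (.inr (0, .ext))
  | .ab i => .inr (.inr (![(2, .ext), (1, .lobe), (0, .lobe)] i))
  | .sigma => .inr (.inr (1, .ext))
  | .tau => .inl 1

def rowIndex : (LinkCoord ⊕ ConeCoord) ⊕ Fin 3 → NormalRow
  | .inl (.inl .m) => .inl 0
  | .inl (.inl (.o i s)) => .inr (.inl (0, (i, s)))
  | .inl (.inl (.p i s)) => .inr (.inl (1, (i, s)))
  | .inl (.inr c) => coneRow c
  | .inr j => .inr (.inr (![(2, .lobe), (1, .centre), (2, .centre)] j))

theorem rowIndex_injective : Function.Injective rowIndex := by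
  rintro ((x | x) | x) ((y | y) | y) hxy
  · cases x <;> cases y <;> simp_all [rowIndex]
  · cases x <;> rcases y with _ | (_ | _ | _) | _ | _ <;> simp [rowIndex, coneRow] at hxy
  · cases x <;> simp [rowIndex] at hxy
  · cases y <;> rcases x with _ | (_ | _ | _) | _ | _ <;> simp [rowIndex, coneRow] at hxy
  · revert x y; decide
  · revert x y; decide
  · cases y <;> simp [rowIndex] at hxy
  · revert x y; decide
  · revert x y; decide

noncomputable def rowEquiv : (LinkCoord ⊕ ConeCoord) ⊕ Fin 3 ≃ NormalRow :=
  Equiv.ofBijective rowIndex ((Fintype.bijective_iff_injective_and_card _).2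
    ⟨rowIndex_injective, rfl⟩)

/-- The matrix of the functionals. -/
noncomputable def rowMatrix (ρ : TrefoilGroup →* SO3) (u : Fin 3 → Fin 3 → ℝ) (a b O P : Fin 3 → ℝ) :
    Matrix NormalRow VarCoord ℝ :=
  LinearMap.toMatrix' ((normalRow ρ u a b O P).comp (edgeOfCoord a b))

theorem rowMatrix_mulVec (x : VarCoord → ℝ) :
    rowMatrix ρ u a b O P *ᵥ x = normalRow ρ u a b O P (edgeOfCoord a b x) := by
  rw [rowMatrix, LinearMap.toMatrix'_mulVec]; rfl

theorem normalRow_corner (ℓ : Edge → ℝ) (i : Fin 3) (c : Corner) :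
    normalRow ρ u a b O P ℓ (.inr (.inr (i, c))) = cornerRow ρ u a b O P i c ℓ := rfl

/-- The point with coordinates only in the second group. -/
def coneVec (β : Fin 3 → ℝ) (ω : Region → ℝ) (s t : ℝ) : VarCoord → ℝ
  | .inl (.inl _) => 0
  | .inl (.inr (.ab i)) => β i
  | .inl (.inr (.op r)) => ω r
  | .inl (.inr .sigma) => s
  | .inl (.inr .tau) => t
  | .inr _ => 0

section Cone

variable (h : IsGeneric ρ u a b O P) (β : Fin 3 → ℝ) (ω : Region → ℝ) (s t : ℝ)
include h

theorem IsGeneric.cornerRow_ext (i : Fin 3) :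
    cornerRow ρ u a b O P i .ext (edgeOfCoord a b (coneVec β ω s t))
      = -(β i / (axisFace u O i * axisFace u P i))
        - ω .exterior / (axisVol ρ u O P i .exterior * axisVol ρ u O P (i + 1) .exterior)
        + ![0, 0, s] i / (axisVol ρ u O P i .exterior * axisFace u O i)
        - ![0, 0, s] (i + 1) / (axisVol ρ u O P (i + 1) .exterior * axisFace u O i)
        - ![0, 0, t] i / (axisVol ρ u O P i .exterior * axisFace u P i)
        + ![0, 0, t] (i + 1) / (axisVol ρ u O P (i + 1) .exterior * axisFace u P i) := by
  have ha := h.a_ne i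
  have hb := h.b_ne i
  obtain ⟨e1, e2, e3, e4⟩ := h.coherent.cornerE_eq (O := O) i
  obtain ⟨f1, f2, f3, f4⟩ := cornerF_eq (u := u) (P := P) i
  have hs : sigmaOf (coneVec β ω s t) = ![0, 0, s] := rfl
  have ht : tauOf (coneVec β ω s t) = ![0, 0, t] := rfl
  simp only [cornerRow, e1, f1, Corner.axis, Corner.region, Corner.edgeAO, Corner.edgeBP,
    edgeOfCoord, LinearMap.coe_mk, AddHom.coe_mk, hs, ht, coneVec, add_zero, sub_zero, axisFace]
  rw [mul_div_cancel_left₀ _ (mul_ne_zero ha hb)]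
  simp only [mul_div_cancel_left₀ _ ha, mul_div_cancel_left₀ _ hb]
  ring

theorem IsGeneric.cornerRow_lobe (i : Fin 3) :
    cornerRow ρ u a b O P i .lobe (edgeOfCoord a b (coneVec β ω s t))
      = β i / (axisFace u O i * axisFace u P (i + 2))
        - ω (.lobe i) / (axisVol ρ u O P i (.lobe i) * axisVol ρ u O P (i + 2) (.lobe i))
        + ![0, 0, s] i / (axisVol ρ u O P i (.lobe i) * axisFace u O i)
        - ![0, 0, s] (i + 1) / (axisVol ρ u O P (i + 2) (.lobe i) * axisFace u O i)
        + ![0, 0, t] i / (axisVol ρ u O P i (.lobe i) * axisFace u P (i + 2))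
        - ![0, 0, t] (i + 2) / (axisVol ρ u O P (i + 2) (.lobe i) * axisFace u P (i + 2)) := by
  have ha := h.a_ne i
  have hb := h.b_ne i
  obtain ⟨e1, e2, e3, e4⟩ := h.coherent.cornerE_eq (O := O) i
  obtain ⟨f1, f2, f3, f4⟩ := cornerF_eq (u := u) (P := P) i
  have hs : sigmaOf (coneVec β ω s t) = ![0, 0, s] := rfl
  have ht : tauOf (coneVec β ω s t) = ![0, 0, t] := rfl
  simp only [cornerRow, e3, f3, Corner.axis, Corner.region, Corner.edgeAO, Corner.edgeBP,
    edgeOfCoord, LinearMap.coe_mk, AddHom.coe_mk, hs, ht, coneVec, add_zero, sub_zero, axisFace,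
    fin3_d]
  rw [mul_div_cancel_left₀ _ (mul_ne_zero ha hb)]
  simp only [mul_div_cancel_left₀ _ ha, mul_div_cancel_left₀ _ hb, mul_neg, div_neg, neg_mul]
  ring

theorem IsGeneric.cornerRow_succ (i : Fin 3) :
    cornerRow ρ u a b O P i .succ (edgeOfCoord a b (coneVec β ω s t))
      = β i / (axisFace u O (i + 1) * axisFace u P i)
        - ω (.lobe (i + 1)) / (axisVol ρ u O P i (.lobe (i + 1)) * axisVol ρ u O P (i + 1) (.lobe (i + 1)))
        - ![0, 0, s] (i + 2) / (axisVol ρ u O P i (.lobe (i + 1)) * axisFace u O (i + 1))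
        + ![0, 0, s] (i + 1) / (axisVol ρ u O P (i + 1) (.lobe (i + 1)) * axisFace u O (i + 1))
        - ![0, 0, t] i / (axisVol ρ u O P i (.lobe (i + 1)) * axisFace u P i)
        + ![0, 0, t] (i + 1) / (axisVol ρ u O P (i + 1) (.lobe (i + 1)) * axisFace u P i) := by
  have ha := h.a_ne i
  have hb := h.b_ne i
  obtain ⟨e1, e2, e3, e4⟩ := h.coherent.cornerE_eq (O := O) i
  obtain ⟨f1, f2, f3, f4⟩ := cornerF_eq (u := u) (P := P) i
  have hs : sigmaOf (coneVec β ω s t) = ![0, 0, s] := rfl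
  have ht : tauOf (coneVec β ω s t) = ![0, 0, t] := rfl
  simp only [cornerRow, e2, f2, Corner.axis, Corner.region, Corner.edgeAO, Corner.edgeBP,
    edgeOfCoord, LinearMap.coe_mk, AddHom.coe_mk, hs, ht, coneVec, add_zero, sub_zero, axisFace,
    fin3_a]
  rw [mul_div_cancel_left₀ _ (mul_ne_zero ha hb)]
  simp only [mul_div_cancel_left₀ _ ha, mul_div_cancel_left₀ _ hb, mul_neg, div_neg, neg_mul]
  ring

theorem IsGeneric.cornerRow_centre (i : Fin 3) :
    cornerRow ρ u a b O P i .centre (edgeOfCoord a b (coneVec β ω s t))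
      = -(β i / (axisFace u O (i + 1) * axisFace u P (i + 2)))
        - ω .centre / (axisVol ρ u O P i .centre * axisVol ρ u O P (i + 2) .centre)
        - ![0, 0, s] (i + 2) / (axisVol ρ u O P i .centre * axisFace u O (i + 1))
        + ![0, 0, s] (i + 1) / (axisVol ρ u O P (i + 2) .centre * axisFace u O (i + 1))
        + ![0, 0, t] i / (axisVol ρ u O P i .centre * axisFace u P (i + 2))
        - ![0, 0, t] (i + 2) / (axisVol ρ u O P (i + 2) .centre * axisFace u P (i + 2)) := by
  have ha := h.a_ne i
  have hb := h.b_ne i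
  obtain ⟨e1, e2, e3, e4⟩ := h.coherent.cornerE_eq (O := O) i
  obtain ⟨f1, f2, f3, f4⟩ := cornerF_eq (u := u) (P := P) i
  have hs : sigmaOf (coneVec β ω s t) = ![0, 0, s] := rfl
  have ht : tauOf (coneVec β ω s t) = ![0, 0, t] := rfl
  simp only [cornerRow, e4, f4, Corner.axis, Corner.region, Corner.edgeAO, Corner.edgeBP,
    edgeOfCoord, LinearMap.coe_mk, AddHom.coe_mk, hs, ht, coneVec, add_zero, sub_zero, axisFace,
    fin3_a, fin3_d]
  rw [mul_div_cancel_left₀ _ (mul_ne_zero ha hb)]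
  simp only [mul_div_cancel_left₀ _ ha, mul_div_cancel_left₀ _ hb, mul_neg, div_neg, neg_mul]
  ring

theorem IsGeneric.normalRow_link :
    normalRow ρ u a b O P (edgeOfCoord a b (coneVec β ω s t)) (.inl 1)
      = (ω (.lobe 0) / axisVol ρ u O P 0 (.lobe 0) - ω .exterior / axisVol ρ u O P 0 .exterior)
        / (b 2 - a 0) := by
  have hs : sigmaOf (coneVec β ω s t) = ![0, 0, s] := rfl
  have ht : tauOf (coneVec β ω s t) = ![0, 0, t] := rfl
  change (f₃ ρ (place u a b O P) *ᵥ dropLink _) (.linkOut 0) = _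
  rw [h.f₃_linkOut] <;>
    simp [dropLink, edgeOfCoord, hs, ht, coneVec]

end Cone

end TrefoilInvariant

/-! ### Gaussian elimination for the functionals of the quadrants. -/

namespace TrefoilInvariant

variable {ρ : TrefoilGroup →* SO3}
  {u : Fin 3 → Fin 3 → ℝ} {a b : Fin 3 → ℝ} {O P : Fin 3 → ℝ}

/-- Points at which all but one of the functionals that come earlier in the elimination vanish. -/
noncomputable def elimVec (ρ : TrefoilGroup →* SO3) (u : Fin 3 → Fin 3 → ℝ) (O P : Fin 3 → ℝ) :
    ConeCoord → VarCoord → ℝ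
  | .op (.lobe j) => coneVec 0 (Pi.single (.lobe j) 1) 0 0
  | .op .centre => coneVec 0 (Pi.single .centre 1) 0 0
  | .ab 1 => coneVec ![0, 1, 0] 0 0 0
  | .ab 2 => coneVec ![0, 0, 1] (Pi.single (.lobe 0) (axisVol ρ u O P 0 (.lobe 0)
      * axisVol ρ u O P 2 (.lobe 0) / (axisFace u P 2 * axisFace u O 0))) 0 0
  | .sigma => coneVec 0 (Pi.single (.lobe 1) (-(axisVol ρ u O P 1 (.lobe 1) / axisFace u O 1))) 1 0
  | .op .exterior => coneVec 0 (Pi.single .exterior 1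
      + Pi.single (.lobe 1) (axisVol ρ u O P 1 (.lobe 1) / axisVol ρ u O P 1 .exterior))
      (-(axisFace u O 1 / axisVol ρ u O P 1 .exterior)) 0
  | .tau => coneVec 0 (Pi.single (.lobe 0) (-(axisVol ρ u O P 0 (.lobe 0) / axisFace u P 2))
      + Pi.single (.lobe 1) (-(axisVol ρ u O P 1 (.lobe 1) / axisFace u P 1)))
      (axisFace u O 1 / axisFace u P 1) 1
  | .ab 0 =>
    let t := (axisVol ρ u O P 2 (.lobe 0) * axisFace u P 0
      + axisVol ρ u O P 1 .exterior * axisFace u P 2) / (axisFace u O 0 * axisFace u P 0)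
    let s := -(axisVol ρ u O P 2 .exterior / axisFace u P 1)
      + axisVol ρ u O P 0 .exterior * axisFace u O 1 / (axisFace u P 0 * axisFace u O 0)
      + t * axisFace u O 1 / axisFace u P 1
    coneVec ![1, 1, 1] (Pi.single .exterior (-(axisVol ρ u O P 0 .exterior
        * axisVol ρ u O P 1 .exterior / (axisFace u P 0 * axisFace u O 0)))
      + Pi.single (.lobe 0) (-(axisVol ρ u O P 0 (.lobe 0) * axisVol ρ u O P 1 .exterior
        / (axisFace u P 0 * axisFace u O 0)))
      + Pi.single (.lobe 1) (axisVol ρ u O P 0 (.lobe 1) * axisVol ρ u O P 1 (.lobe 1)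
        / (axisFace u P 0 * axisFace u O 1) - axisVol ρ u O P 1 (.lobe 1) * s / axisFace u O 1)) s t

/-- The order of the elimination. -/
def elimOrder : ConeCoord → ℕ
  | .op (.lobe 1) => 1
  | .ab 1 => 2
  | .op (.lobe 0) => 3
  | .ab 2 => 4
  | .sigma => 5
  | .op .exterior => 6
  | .tau => 7
  | .ab 0 => 8
  | .op (.lobe 2) => 9
  | .op .centre => 10

/-- The pivots of the elimination. -/
noncomputable def elimPivot (ρ : TrefoilGroup →* SO3) (u : Fin 3 → Fin 3 → ℝ) (a b O P : Fin 3 → ℝ) :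
    ConeCoord → ℝ
  | .op (.lobe 0) => -1 / (axisVol ρ u O P 0 (.lobe 0) * axisVol ρ u O P 2 (.lobe 0))
  | .op (.lobe 1) => -1 / (axisVol ρ u O P 0 (.lobe 1) * axisVol ρ u O P 1 (.lobe 1))
  | .op (.lobe 2) => -1 / (axisVol ρ u O P 1 (.lobe 2) * axisVol ρ u O P 2 (.lobe 2))
  | .op .centre => -1 / (axisVol ρ u O P 0 .centre * axisVol ρ u O P 2 .centre)
  | .op .exterior => -1 / (axisVol ρ u O P 0 .exterior * axisVol ρ u O P 1 .exterior)
  | .ab 1 => 1 / (axisFace u P 0 * axisFace u O 1)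
  | .ab 2 => -1 / (axisFace u P 2 * axisFace u O 0)
  | .sigma => -1 / (axisVol ρ u O P 2 .exterior * axisFace u O 1)
  | .tau => -1 / (axisFace u P 2 * (b 2 - a 0))
  | .ab 0 => -(1 - axisCos u) / ((1 + axisCos u) * (axisFace u P 1 * axisFace u O 2))

/-- The matrix of the functionals, with its rows numbered by coordinates as far as possible. -/
noncomputable def squareRows (ρ : TrefoilGroup →* SO3) (u : Fin 3 → Fin 3 → ℝ) (a b O P : Fin 3 → ℝ) :
    Matrix ((LinkCoord ⊕ ConeCoord) ⊕ Fin 3) VarCoord ℝ :=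
  (rowMatrix ρ u a b O P).submatrix rowEquiv id

theorem elimVec_apply (j : ConeCoord) :
    (∀ c, elimVec ρ u O P j (.inl (.inl c)) = 0) ∧ (∀ c, elimVec ρ u O P j (.inr c) = 0) := by
  rcases j with j | (_ | j | _) | _ | _ <;> (try fin_cases j) <;>
    exact ⟨fun _ => rfl, fun _ => rfl⟩

theorem elimVec_order (c j : ConeCoord) (hcj : c ≠ j) (hne : elimVec ρ u O P j (.inl (.inr c)) ≠ 0) :
    elimOrder c < elimOrder j := by
  by_contra hlt
  apply hne
  rcases j with j | (_ | j | _) | _ | _ <;> rcases c with c | (_ | c | _) | _ | _ <;>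
    (try fin_cases j) <;> (try fin_cases c) <;>
    first
    | exact absurd rfl hcj
    | exact absurd (by decide) hlt
    | (simp [elimVec, coneVec]; done)

theorem elimVec_self (j : ConeCoord) : elimVec ρ u O P j (.inl (.inr j)) = 1 := by
  rcases j with j | (_ | j | _) | _ | _ <;> (try fin_cases j) <;> simp [elimVec, coneVec]

namespace IsGeneric

variable (h : IsGeneric ρ u a b O P)
include h

theorem axisFace_O_ne (i : Fin 3) : axisFace u O i ≠ 0 := by
  have := h.cornerE_ne i .ext
  rwa [(h.coherent.cornerE_eq i).1] at this

theorem axisFace_P_ne (i : Fin 3) : axisFace u P i ≠ 0 := by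
  have := h.cornerF_ne i .ext
  rwa [(cornerF_eq i).1] at this

theorem axisVol_ne :
    (∀ i, axisVol ρ u O P i .exterior ≠ 0) ∧ (∀ i, axisVol ρ u O P i .centre ≠ 0) ∧
    (∀ i, axisVol ρ u O P i (.lobe i) ≠ 0) ∧ (∀ i, axisVol ρ u O P i (.lobe (i + 1)) ≠ 0) :=
  ⟨fun i => (h.plus_ne i .out).2, fun i => (h.plus_ne i .inn).2, fun i => h.minus_ne i .out,
    fun i => h.minus_ne i .inn⟩

/-- Each elimination vector is chosen to annihilate all functionals paired with earlier coordinates,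
so that the matrix of values is triangular. -/
theorem elim_rows (i j : ConeCoord) (hij : i ≠ j)
    (hne : normalRow ρ u a b O P (edgeOfCoord a b (elimVec ρ u O P j)) (coneRow i) ≠ 0) :
    elimOrder j < elimOrder i := by
  obtain ⟨ve, vc, vl, vs⟩ := h.axisVol_ne
  have v0 := ve 0
  have v1 := ve 1
  have v2 := ve 2
  have w0 := vl 0
  have w1 := vl 1
  have x0 := vs 0
  have x1 := vs 1
  have x2 := vs 2
  simp only [Fin.reduceAdd, zero_add] at x0 x1 x2
  have e0 := h.axisFace_O_ne 0
  have e1 := h.axisFace_O_ne 1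
  have e2 := h.axisFace_O_ne 2
  have f0 := h.axisFace_P_ne 0
  have f1 := h.axisFace_P_ne 1
  have f2 := h.axisFace_P_ne 2
  by_contra hlt
  apply hne
  rcases i with i | (_ | i | _) | _ | _ <;> rcases j with j | (_ | j | _) | _ | _ <;>
    (try fin_cases i) <;> (try fin_cases j) <;>
    first
    | exact absurd rfl hij
    | exact absurd (by decide) hlt
    | (simp only [coneRow, elimVec, normalRow_corner, h.cornerRow_ext, h.cornerRow_lobe,
        h.cornerRow_succ, h.cornerRow_centre, h.normalRow_link, Fin.reduceAdd, zero_add,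
        Fin.zero_eta, Fin.mk_one, Fin.reduceFinMk, cons_val_zero, cons_val_one, cons_val]
       simp
       done)
    | (simp [coneRow, elimVec, normalRow_corner, h.cornerRow_ext, h.cornerRow_lobe,
        h.cornerRow_succ, h.cornerRow_centre, h.normalRow_link]
       field_simp
       first
       | ring1
       | simp)

theorem elim_pivot (i : ConeCoord) :
    normalRow ρ u a b O P (edgeOfCoord a b (elimVec ρ u O P i)) (coneRow i)
      = elimPivot ρ u a b O P i := by
  obtain ⟨ve, vc, vl, vs⟩ := h.axisVol_ne
  have v0 := ve 0
  have v1 := ve 1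
  have v2 := ve 2
  have w0 := vl 0
  have w1 := vl 1
  have x0 := vs 0
  have x1 := vs 1
  have x2 := vs 2
  simp only [Fin.reduceAdd, zero_add] at x0 x1 x2
  have e0 := h.axisFace_O_ne 0
  have e1 := h.axisFace_O_ne 1
  have e2 := h.axisFace_O_ne 2
  have f0 := h.axisFace_P_ne 0
  have f1 := h.axisFace_P_ne 1
  have f2 := h.axisFace_P_ne 2
  have hab : b 2 - a 0 ≠ 0 := (h.plus_ne 0 .out).1
  have hc := h.axisCos_sq_ne
  have c1 : 1 + axisCos u ≠ 0 := fun e => hc (by rw [show axisCos u = -1 by linarith]; norm_num)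
  have key := h.coherent.volume_relation hc O P
  have key' := sum_face_vol ρ u O P
  rcases i with i | (_ | i | _) | _ | _ <;> (try fin_cases i)
  -- This is the coordinate `.ab 0`, the only one whose pivot is not immediately a monomial.
  · simp [coneRow, elimVec, normalRow_corner, h.cornerRow_ext, elimPivot]
    field_simp
    linear_combination key
  all_goals
    simp [coneRow, elimVec, normalRow_corner, h.cornerRow_ext, h.cornerRow_lobe,
        h.cornerRow_succ, h.cornerRow_centre, h.normalRow_link, elimPivot]
    try field_simp
    try ring

/-- With `W` the matrix of the elimination vectors, `W` is unipotent for `elimOrder` and `k * W` is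
triangular for the opposite order, with the pivots on its diagonal. -/
theorem det_squareRows : (squareRows ρ u a b O P).toBlocks₁₁.det
    = ∏ i, elimPivot ρ u a b O P i := by
  set k : Matrix ConeCoord ConeCoord ℝ := Matrix.of fun i j =>
    rowMatrix ρ u a b O P (coneRow i) (.inl (.inr j)) with hk
  have entry : ∀ r c, rowMatrix ρ u a b O P r c
      = normalRow ρ u a b O P (edgeOfCoord a b (Pi.single c 1)) r := by
    intro r c
    rw [← rowMatrix_mulVec, mulVec_single_one]; rfl
  -- The link functionals are themselves coordinates, so their rows form an identity block followed
  -- by zeros.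
  have hlink : ∀ (x : VarCoord → ℝ) (c : LinkCoord),
      normalRow ρ u a b O P (edgeOfCoord a b x) (rowIndex (.inl (.inl c))) = x (.inl (.inl c)) := by
    intro x c
    rcases c with _ | ⟨i, s⟩ | ⟨i, s⟩
    · rfl
    · change linkRowO a b i s _ = _
      have ha := h.a_ne i
      have hb := h.b_ne (s.lower i)
      cases s <;> simp only [Side.lower] at hb <;>
        simp only [linkRowO, Side.edgeAO, Side.lower, edgeOfCoord, LinearMap.coe_mk, AddHom.coe_mk,
          mul_div_cancel_left₀ _ ha, mul_div_cancel_left₀ _ hb, fin3_d, fin3_a] <;> ring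
    · change linkRowP a b i s _ = _
      have ha := h.a_ne i
      have hb := h.b_ne (s.lower i)
      cases s <;> simp only [Side.lower] at hb <;>
        simp only [linkRowP, Side.edgeBP, Side.lower, edgeOfCoord, LinearMap.coe_mk, AddHom.coe_mk,
          mul_div_cancel_left₀ _ ha, mul_div_cancel_left₀ _ hb, fin3_d, fin3_b] <;> ring
  have e1 : (squareRows ρ u a b O P).toBlocks₁₁ = fromBlocks 1 0
      (Matrix.of fun i j => rowMatrix ρ u a b O P (coneRow i) (.inl (.inl j))) k := by
    ext (i | i) (j | j)
    · simp only [toBlocks₁₁, squareRows, of_apply, submatrix_apply, id, entry, fromBlocks_apply₁₁]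
      rw [show rowEquiv (.inl (.inl i)) = rowIndex (.inl (.inl i)) from rfl, hlink, one_apply]
      simp [Pi.single_apply, eq_comm]
    · simp only [toBlocks₁₁, squareRows, of_apply, submatrix_apply, id, entry, fromBlocks_apply₁₂]
      rw [show rowEquiv (.inl (.inl i)) = rowIndex (.inl (.inl i)) from rfl, hlink]
      simp
    · rfl
    · rfl
  rw [e1, det_fromBlocks_zero₁₂, det_one, one_mul]
  set W : Matrix ConeCoord ConeCoord ℝ := Matrix.of fun c j => elimVec ρ u O P j (.inl (.inr c))
    with hW
  have hWd : W.det = 1 := by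
    rw [det_of_ranking W elimOrder (fun i j hij hne => elimVec_order i j hij hne)]
    exact Finset.prod_eq_one fun j _ => elimVec_self j
  have hM : ∀ i j, (k * W) i j
      = normalRow ρ u a b O P (edgeOfCoord a b (elimVec ρ u O P j)) (coneRow i) := by
    intro i j
    rw [← rowMatrix_mulVec]
    simp only [mul_apply, mulVec, dotProduct, Fintype.sum_sum_type]
    simp only [(elimVec_apply j).1, (elimVec_apply j).2, mul_zero, Finset.sum_const_zero,
      zero_add, add_zero]
    rfl
  have hd : (k * W).det = ∏ i, elimPivot ρ u a b O P i := by
    -- The largest value of `elimOrder` is 10, so the truncated subtraction reverses the order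
    -- faithfully.
    rw [det_of_ranking (k * W) (fun c => 10 - elimOrder c)]
    · exact Finset.prod_congr rfl fun i _ => by rw [hM, h.elim_pivot]
    · intro i j hij hne
      rw [hM] at hne
      have := h.elim_rows i j hij hne
      have h10 : elimOrder i ≤ 10 := by
        rcases i with i | (_ | i | _) | _ | _ <;> (try fin_cases i) <;> decide
      change 10 - elimOrder i < 10 - elimOrder j
      omega
  rw [det_mul, hWd, mul_one] at hd
  exact hd

end IsGeneric

end TrefoilInvariant

namespace TrefoilInvariant

variable {ρ : TrefoilGroup →* SO3}
  {u : Fin 3 → Fin 3 → ℝ} {a b : Fin 3 → ℝ} {O P : Fin 3 → ℝ}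

/-! ### The determinant of the normal form -/

theorem prod_side {M : Type*} [CommMonoid M] (G : Side → M) : ∏ s, G s = G .out * G .inn := by
  rw [show (Finset.univ : Finset Side) = {.out, .inn} from rfl, Finset.prod_pair (by decide)]

theorem prod_corner {M : Type*} [CommMonoid M] (G : Corner → M) :
    ∏ c, G c = G .ext * (G .succ * (G .lobe * G .centre)) := by
  rw [show (Finset.univ : Finset Corner) = {.ext, .succ, .lobe, .centre} from rfl,
    Finset.prod_insert (by decide), Finset.prod_insert (by decide), Finset.prod_pair (by decide)]

theorem prod_tet_split (F : Tet → ℝ) : ∏ T, F T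
    = (∏ i, ∏ s : Side, F (s.tetPlus i) * F (s.tetMinus i)) * ∏ i, ∏ c : Corner, F (c.tet i) := by
  have h : (Finset.univ : Finset Tet) = {.outExt 0, .outExt 1, .outExt 2, .outLobe 0, .outLobe 1,
    .outLobe 2, .inLobe 0, .inLobe 1, .inLobe 2, .inCentre 0, .inCentre 1, .inCentre 2,
    .crossExt 0, .crossExt 1, .crossExt 2, .crossLobeSucc 0, .crossLobeSucc 1, .crossLobeSucc 2,
    .crossLobe 0, .crossLobe 1, .crossLobe 2, .crossCentre 0, .crossCentre 1, .crossCentre 2} := by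
    decide
  rw [h]
  repeat rw [Finset.prod_insert (by decide)]
  rw [Finset.prod_singleton]
  simp only [prod_side, prod_corner, Fin.prod_univ_three, Side.tetPlus, Side.tetMinus, Corner.tet]
  ring

/-- The product of the volumes in the functional of a quadrant. -/
noncomputable def cornerProd (ρ : TrefoilGroup →* SO3) (u : Fin 3 → Fin 3 → ℝ) (O P : Fin 3 → ℝ)
    (i : Fin 3) (c : Corner) : ℝ :=
  axisVol ρ u O P i (c.region i) * axisVol ρ u O P (c.axis i) (c.region i)
    * cornerE ρ u O i c * cornerF u P i c

/-- Multiplying by the volumes clears the denominators: a link edge leaves `(2 - 2 cos φ₁)(ab)²`,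
since `(b - a)²` and the axis volumes cancel against its two tetrahedra, and a quadrant leaves a
monomial. The block of the distinguished edge has determinant `-1` whatever its diagonal entry. -/
theorem IsGeneric.det_normalForm (h : IsGeneric ρ u a b O P) :
    (normalForm ρ u a b O P).det * ∏ T, tetDet ρ (place u a b O P) T
      = -((2 - 2 * rotCos u) ^ 6 * (∏ i, a i * b i) ^ 8 * ∏ i, ∏ c, cornerProd ρ u O P i c) := by
  have hl : ∀ i, ∀ s : Side, (linkBlock ρ u a b O P (i, s)).det
      * (tetDet ρ (place u a b O P) (s.tetPlus i) * tetDet ρ (place u a b O P) (s.tetMinus i))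
      = (2 - 2 * rotCos u) * (a i * b (s.lower i)) ^ 2 := by
    intro i s
    rw [h.det_linkBlock, h.coherent.tetDet_tetPlus, h.coherent.tetDet_tetMinus, linkFactor]
    obtain ⟨h1, h2⟩ := h.plus_ne i s
    have h3 := h.minus_ne i s
    simp only
    field_simp
  have hcn : ∀ i, ∀ c : Corner, cornerCoeff ρ u a b O P i c * tetDet ρ (place u a b O P) (c.tet i)
      = -c.sign * (a i * b i * cornerProd ρ u O P i c) := by
    intro i c
    rw [cornerCoeff, div_mul_cancel₀ _ (tetDet_ne_zero h.general _), cornerProd]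
    ring
  rw [normalForm, det_fromBlocks_zero₂₁, det_fromBlocks_zero₂₁, det_blockDiagonal, det_diagonal,
    Fintype.prod_prod_type, Fintype.prod_prod_type, prod_tet_split, det_fin_two]
  have e1 : (∏ i, ∏ s, (linkBlock ρ u a b O P (i, s)).det)
      * (∏ i, ∏ s : Side, tetDet ρ (place u a b O P) (s.tetPlus i)
        * tetDet ρ (place u a b O P) (s.tetMinus i))
      = (2 - 2 * rotCos u) ^ 6 * (∏ i, a i * b i) ^ 4 := by
    rw [← Finset.prod_mul_distrib]
    simp only [← Finset.prod_mul_distrib, hl]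
    simp only [prod_side, Fin.prod_univ_three, Side.lower, Fin.reduceAdd, zero_add]
    ring
  have e2 : (∏ i, ∏ c, cornerCoeff ρ u a b O P i c)
      * (∏ i, ∏ c : Corner, tetDet ρ (place u a b O P) (c.tet i))
      = (∏ i, a i * b i) ^ 4 * ∏ i, ∏ c, cornerProd ρ u O P i c := by
    rw [← Finset.prod_mul_distrib]
    simp only [← Finset.prod_mul_distrib, hcn]
    simp only [prod_corner, Fin.prod_univ_three, Corner.sign]
    ring
  have e3 : (!![f₃ ρ (place u a b O P) (.linkOut 0) (.linkOut 0), 1; 1, 0] : Matrix _ _ ℝ) 0 0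
      * (!![f₃ ρ (place u a b O P) (.linkOut 0) (.linkOut 0), 1; 1, 0] : Matrix _ _ ℝ) 1 1
      - (!![f₃ ρ (place u a b O P) (.linkOut 0) (.linkOut 0), 1; 1, 0] : Matrix _ _ ℝ) 0 1
      * (!![f₃ ρ (place u a b O P) (.linkOut 0) (.linkOut 0), 1; 1, 0] : Matrix _ _ ℝ) 1 0 = -1 := by
    simp
  rw [e3]
  calc _ = -(((∏ i, ∏ s, (linkBlock ρ u a b O P (i, s)).det)
      * (∏ i, ∏ s : Side, tetDet ρ (place u a b O P) (s.tetPlus i)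
        * tetDet ρ (place u a b O P) (s.tetMinus i))) * ((∏ i, ∏ c, cornerCoeff ρ u a b O P i c)
      * (∏ i, ∏ c : Corner, tetDet ρ (place u a b O P) (c.tet i)))) := by ring
    _ = _ := by rw [e1, e2]; ring

end TrefoilInvariant

namespace TrefoilInvariant

variable {ρ : TrefoilGroup →* SO3} {Γ ξ : Vertex → Fin 3 → ℝ}
  {u : Fin 3 → Fin 3 → ℝ} {a b : Fin 3 → ℝ} {O P : Fin 3 → ℝ}

/-! ### The variations of the lengths under displacements of the vertices -/

/-- The linear map of a displacement to the variations of the lengths. -/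
noncomputable def edgeVarₗ (ρ : TrefoilGroup →* SO3) (Γ : Vertex → Fin 3 → ℝ) :
    (Vertex → Fin 3 → ℝ) →ₗ[ℝ] (Edge → ℝ) where
  toFun ξ := edgeVar ρ Γ ξ
  map_add' ξ η := by
    ext e
    simp only [edgeVar, liftPos_add, Pi.add_apply]
    rw [← dotProduct_add]; congr 1; abel
  map_smul' t ξ := by
    ext e
    have : ∀ w, liftPos ρ (t • ξ) w = t • liftPos ρ ξ w := fun w => by
      simp [liftPos, mulVec_smul]
    simp only [edgeVar, this, RingHom.id_apply, Pi.smul_apply, ← smul_sub, dotProduct_smul]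

/-- The half squared length is quadratic along a line of configurations; `edgeVar` is its linear
coefficient. -/
theorem f₂_apply (e : Edge) (c : Coord) :
    f₂ ρ u Γ e c = edgeVar ρ Γ (displacement u c) e := by
  have h : ∀ t : ℝ, halfSqLength ρ (Γ + t • displacement u c) e = halfSqLength ρ Γ e
      + t ^ 2 * halfSqLength ρ (displacement u c) e + t * edgeVar ρ Γ (displacement u c) e := by
    intro t
    have ht : ∀ w, liftPos ρ (t • displacement u c) w = t • liftPos ρ (displacement u c) w :=
      fun w => by simp [liftPos, mulVec_smul]
    simp only [halfSqLength_eq, liftPos_add, ht, halfSq_add, edgeVar, ← smul_sub,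
      dotProduct_smul, smul_eq_mul]
    congr 1
    simp only [halfSq, ← smul_sub, dotProduct_smul, smul_dotProduct, smul_eq_mul]
    ring
  simp only [f₂, of_apply, h]
  have hd : HasDerivAt (fun t : ℝ => halfSqLength ρ Γ e
      + t ^ 2 * halfSqLength ρ (displacement u c) e + t * edgeVar ρ Γ (displacement u c) e)
      (0 + (2 * (0 : ℝ) ^ (2 - 1) * 1) * halfSqLength ρ (displacement u c) e
        + 1 * edgeVar ρ Γ (displacement u c) e) 0 :=
    (((hasDerivAt_const (0 : ℝ) _).add (((hasDerivAt_id (0 : ℝ)).pow 2).mul_const _)).add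
      ((hasDerivAt_id (0 : ℝ)).mul_const _))
  rw [hd.deriv]; simp

/-- The displacement with given coordinates. -/
def displace (u : Fin 3 → Fin 3 → ℝ) (t : Coord → ℝ) : Vertex → Fin 3 → ℝ :=
  place u (fun i => t (.a i)) (fun i => t (.b i)) (fun i => t (.o i)) (fun i => t (.p i))

theorem sum_coord {M : Type*} [AddCommMonoid M] (F : Coord → M) : ∑ c, F c
    = (∑ i, F (.a i) + ∑ i, F (.b i)) + (∑ i, F (.o i) + ∑ i, F (.p i)) := by
  have h : (Finset.univ : Finset Coord) = {.a 0, .a 1, .a 2, .b 0, .b 1, .b 2, .o 0, .o 1, .o 2,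
    .p 0, .p 1, .p 2} := by decide
  rw [h]
  repeat rw [Finset.sum_insert (by decide)]
  rw [Finset.sum_singleton]
  simp only [Fin.sum_univ_three]
  abel

theorem sum_displacement (t : Coord → ℝ) : ∑ c, t c • displacement u c = displace u t := by
  rw [sum_coord]
  have key : ∀ x : Fin 3 → ℝ, ∑ j, x j • (Pi.single j 1 : Fin 3 → ℝ) = x := fun x => by
    ext k; simp [Finset.sum_apply, Pi.single_apply]
  ext v k
  have hs : ∀ (w w' : Vertex) (x : Fin 3 → ℝ), (Pi.single w x : Vertex → Fin 3 → ℝ) w' k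
      = if w' = w then x k else 0 := by
    intro w w' x
    by_cases e : w' = w
    · subst e; simp
    · simp [e]
  rcases v with i | i | _ | _ <;>
    simp [displacement, displace, place, Finset.sum_apply, hs, Pi.single_apply]

theorem f₂_mulVec (t : Coord → ℝ) : f₂ ρ u Γ *ᵥ t = edgeVar ρ Γ (displace u t) := by
  change _ = edgeVarₗ ρ Γ _
  rw [← sum_displacement, map_sum]
  ext e
  simp only [mulVec, dotProduct, f₂_apply, Finset.sum_apply, map_smul, Pi.smul_apply, smul_eq_mul]
  exact Finset.sum_congr rfl fun c _ => mul_comm _ _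

theorem IsCoherent.displace_equivariant (h : IsCoherent ρ u) (t : Coord → ℝ) :
    IsEquivariant ρ (displace u t) := h.equivariant _ _ _ _

/-- For a linear dependency, moving the four points while fixing the origin evaluates the stress by
the work done at the four points, times the sum of the coefficients. That sum will be the
determinant of the tetrahedron. -/
theorem stress_relation {aA aB aO aP : ℝ} {xA xB xO xP dA dB dO dP : Fin 3 → ℝ}
    (h : aA • xA + aB • xB + aO • xO + aP • xP = 0) :
    aA * aB * ((xA - xB) ⬝ᵥ (dA - dB)) + aA * aO * ((xA - xO) ⬝ᵥ (dA - dO))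
      + aA * aP * ((xA - xP) ⬝ᵥ (dA - dP)) + aB * aO * ((xB - xO) ⬝ᵥ (dB - dO))
      + aB * aP * ((xB - xP) ⬝ᵥ (dB - dP)) + aO * aP * ((xO - xP) ⬝ᵥ (dO - dP))
    = (aA + aB + aO + aP) * (aA * (xA ⬝ᵥ dA) + aB * (xB ⬝ᵥ dB) + aO * (xO ⬝ᵥ dO)
      + aP * (xP ⬝ᵥ dP)) := by
  have k : ∀ d : Fin 3 → ℝ, aA * (xA ⬝ᵥ d) + aB * (xB ⬝ᵥ d) + aO * (xO ⬝ᵥ d) + aP * (xP ⬝ᵥ d) = 0 := by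
    intro d
    have := congrArg (· ⬝ᵥ d) h
    simpa only [add_dotProduct, smul_dotProduct, smul_eq_mul, zero_dotProduct] using this
  simp only [sub_dotProduct, dotProduct_sub]
  linear_combination -aA * k dA - aB * k dB - aO * k dO - aP * k dP

/-- The functional of a quadrant at the variation given by a displacement. -/
theorem IsGeneric.cornerCoeff_mul_cornerRow (h : IsGeneric ρ u a b O P) (α β d q : Fin 3 → ℝ)
    (i : Fin 3) (c : Corner) :
    cornerCoeff ρ u a b O P i c * cornerRow ρ u a b O P i c
        (edgeVar ρ (place u a b O P) (place u α β d q))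
      = -c.sign * (axisVol ρ u O P (c.axis i) (c.region i) * α i
        - axisVol ρ u O P i (c.region i) * β i + cornerF u P i c * (O ⬝ᵥ d)
        - cornerE ρ u O i c * (P ⬝ᵥ q)) := by
  have hE := h.coherent.equivariant a b O P
  have hξ := h.coherent.equivariant α β d q
  obtain ⟨s1, s2, s3, s4, s5, s6⟩ := tetSide_corner i c
  have ts := edgeVar_tetSide hE hξ (c.tet i)
  have t1 := ts 0 1 (by decide)
  have t2 := ts 0 2 (by decide)
  have t3 := ts 0 3 (by decide)
  have t4 := ts 1 2 (by decide)
  have t5 := ts 1 3 (by decide)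
  have t6 := ts 2 3 (by decide)
  rw [s1] at t1; rw [s2] at t2; rw [s3] at t3; rw [s4] at t4; rw [s5] at t5; rw [s6] at t6
  simp only [h.coherent.tetPos_corner, cons_val_zero, cons_val_one, cons_val] at t1 t2 t3 t4 t5 t6
  have hd := tetDet_ne_zero h.general (c.tet i)
  have ha := h.a_ne i
  have hb := h.b_ne i
  have hv := h.corner_left_ne i c
  have hv' := h.corner_right_ne i c
  have he := h.cornerE_ne i c
  have hf := h.cornerF_ne i c
  rw [cornerCoeff, cornerRow, t1, t2, t3, t4, t5, t6]
  have hO : regionPos ρ O (c.region i) ⬝ᵥ regionPos ρ d (c.region i) = O ⬝ᵥ d := dot_rot _ _ _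
  have huu := h.coherent.unit i
  have huu' := h.coherent.unit (c.axis i)
  have hdet : tetDet ρ (place u a b O P) (c.tet i)
      = b i * axisVol ρ u O P (c.axis i) (c.region i) - a i * axisVol ρ u O P i (c.region i)
        + a i * b i * cornerF u P i c - a i * b i * cornerE ρ u O i c := by
    rw [tetDet, h.coherent.tetPos_corner]
    simp only [cons_val_zero, cons_val_one, cons_val, axisVol, cornerF, cornerE, triple,
      Pi.sub_apply, Pi.smul_apply, smul_eq_mul]
    ring
  -- Cramer's relation between the vertices of the quadrant. Its coefficients add up to `tetDet`, so
  -- the denominator of `cornerCoeff` cancels.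
  have hrel : (b i * axisVol ρ u O P (c.axis i) (c.region i)) • (a i • u i)
      + (-(a i * axisVol ρ u O P i (c.region i))) • (b i • u (c.axis i))
      + (a i * b i * cornerF u P i c) • regionPos ρ O (c.region i)
      + (-(a i * b i * cornerE ρ u O i c)) • P = 0 := by
    ext k
    simp only [axisVol, cornerF, cornerE, triple, Pi.add_apply, Pi.smul_apply, smul_eq_mul,
      Pi.zero_apply]
    fin_cases k <;> simp <;> ring
  have key := stress_relation (dA := α i • u i) (dB := β i • u (c.axis i))
    (dO := regionPos ρ d (c.region i)) (dP := q) hrel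
  rw [hO] at key
  simp only [smul_dotProduct (a i), smul_dotProduct (b i), dotProduct_smul (α i),
    dotProduct_smul (β i), huu, huu', smul_eq_mul] at key
  set AB := (a i • u i - b i • u (c.axis i)) ⬝ᵥ (α i • u i - β i • u (c.axis i))
  set AO := (a i • u i - regionPos ρ O (c.region i)) ⬝ᵥ (α i • u i - regionPos ρ d (c.region i))
  set AP := (a i • u i - P) ⬝ᵥ (α i • u i - q)
  set BO := (b i • u (c.axis i) - regionPos ρ O (c.region i)) ⬝ᵥ
    (β i • u (c.axis i) - regionPos ρ d (c.region i))
  set BP := (b i • u (c.axis i) - P) ⬝ᵥ (β i • u (c.axis i) - q)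
  set OP := (regionPos ρ O (c.region i) - P) ⬝ᵥ (regionPos ρ d (c.region i) - q)
  set D := tetDet ρ (place u a b O P) (c.tet i)
  set v := axisVol ρ u O P i (c.region i)
  set v' := axisVol ρ u O P (c.axis i) (c.region i)
  set e := cornerE ρ u O i c
  set f := cornerF u P i c
  have hD : b i * v' + -(a i * v) + a i * b i * f + -(a i * b i * e) = D := by rw [hdet]; ring
  rw [hD] at key
  field_simp
  refine mul_left_cancel₀ (mul_ne_zero ha hb) ?_
  linear_combination (-c.sign) * key

/-- Link edges, at the variation given by a displacement. -/
theorem IsCoherent.edgeVar_link (h : IsCoherent ρ u) (α β d q : Fin 3 → ℝ) (i : Fin 3) (s : Side) :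
    edgeVar ρ (place u a b O P) (place u α β d q) (s.link i)
      = (a i - b (s.lower i)) * (α i - β (s.lower i)) := by
  have key := edgeVar_tetSide (h.equivariant a b O P) (h.equivariant α β d q) (s.tetPlus i) 0 1
    (by decide)
  rw [(tetSide_tetPlus i s).1] at key
  rw [key]
  simp only [h.tetPos_tetPlus, cons_val_zero, cons_val_one, ← sub_smul, smul_dotProduct,
    dotProduct_smul, h.unit, smul_eq_mul, mul_one]
  ring

/-- The functionals of a link edge, at the variation given by a displacement of `O` and `P`. -/
theorem IsGeneric.linkRow_edgeVar (h : IsGeneric ρ u a b O P) (d q : Fin 3 → ℝ) (i : Fin 3)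
    (s : Side) :
    linkRowO a b i s (edgeVar ρ (place u a b O P) (place u 0 0 d q))
      = (O ⬝ᵥ d) * (1 / a i - 1 / b (s.lower i)) ∧
    linkRowP a b i s (edgeVar ρ (place u a b O P) (place u 0 0 d q))
      = (P ⬝ᵥ q) * (1 / a i - 1 / b (s.lower i)) := by
  have ts := edgeVar_tetSide (h.coherent.equivariant a b O P) (h.coherent.equivariant 0 0 d q)
    (s.tetPlus i)
  obtain ⟨s1, s2, s3, s4, s5, s6⟩ := tetSide_tetPlus i s
  have t2 := ts 0 2 (by decide)
  have t3 := ts 0 3 (by decide)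
  have t4 := ts 1 2 (by decide)
  have t5 := ts 1 3 (by decide)
  rw [s2] at t2; rw [s3] at t3; rw [s4] at t4; rw [s5] at t5
  simp only [h.coherent.tetPos_tetPlus, cons_val_zero, cons_val_one, cons_val, Pi.zero_apply,
    zero_smul, zero_sub] at t2 t3 t4 t5
  have ha := h.a_ne i
  have hb := h.b_ne (s.lower i)
  have hO : regionPos ρ O (s.regionPlus i) ⬝ᵥ regionPos ρ d (s.regionPlus i) = O ⬝ᵥ d :=
    dot_rot _ _ _
  constructor
  · rw [linkRowO, t2, t4]
    simp only [dotProduct_neg, sub_dotProduct, smul_dotProduct, hO, smul_eq_mul]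
    field_simp; ring
  · rw [linkRowP, t3, t5]
    simp only [dotProduct_neg, sub_dotProduct, smul_dotProduct, smul_eq_mul]
    field_simp; ring

theorem edgeVar_BO_AP (i : Fin 3) (d q : Fin 3 → ℝ) :
    edgeVar ρ (place u a b O P) (place u 0 0 d q) (.BO i)
      = (O ⬝ᵥ d) - b i * (u (i + 1) ⬝ᵥ d) ∧
    edgeVar ρ (place u a b O P) (place u 0 0 d q) (.AP i) = (P ⬝ᵥ q) - a i * (u i ⬝ᵥ q) := by
  constructor
  · simp only [edgeVar, edgeEnds, liftPos_one, place, Pi.zero_apply, zero_smul, zero_sub,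
      dotProduct_neg, sub_dotProduct, smul_dotProduct, smul_eq_mul]
    ring
  · simp only [edgeVar, edgeEnds, liftPos_one, place, Pi.zero_apply, zero_smul, zero_sub,
      dotProduct_neg, sub_dotProduct, smul_dotProduct, smul_eq_mul]
    ring

end TrefoilInvariant

namespace TrefoilInvariant

variable {ρ : TrefoilGroup →* SO3}
  {u : Fin 3 → Fin 3 → ℝ} {a b : Fin 3 → ℝ} {O P : Fin 3 → ℝ}

/-! ### A basis of displacements -/

/-- Coordinates of a basis of displacements: five that move one vertex on the link, the one that
moves all these vertices with unit speed along the link, the radial motions of `O` and `P`, and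
two rotations for each of `O` and `P`. -/
def moveVec (u : Fin 3 → Fin 3 → ℝ) (O P : Fin 3 → ℝ) :
    Fin 5 ⊕ (Fin 3 ⊕ (Fin 2 ⊕ Fin 2)) → Coord → ℝ
  | .inl l => ![Pi.single (.b 2) 1, Pi.single (.a 1) 1, Pi.single (.b 0) 1, Pi.single (.a 2) 1,
      Pi.single (.b 1) 1] l
  | .inr (.inl j) => ![fun | .a _ => 1 | .b _ => 1 | _ => 0, fun | .o k => O k | _ => 0,
      fun | .p k => P k | _ => 0] j
  | .inr (.inr (.inl j)) => fun | .o k => (O ⨯₃ (![u 0, u 1] j)) k | _ => 0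
  | .inr (.inr (.inr j)) => fun | .p k => (P ⨯₃ (![u 0, u 1] j)) k | _ => 0

/-- The matrix of the basis of displacements. -/
def moveMatrix (u : Fin 3 → Fin 3 → ℝ) (O P : Fin 3 → ℝ) :
    Matrix Coord (Fin 5 ⊕ (Fin 3 ⊕ (Fin 2 ⊕ Fin 2))) ℝ := Matrix.of fun c j => moveVec u O P j c

def coordSplit : Fin 6 ⊕ (Fin 3 ⊕ Fin 3) → Coord
  | .inl l => ![.b 2, .a 1, .b 0, .a 2, .b 1, .a 0] l
  | .inr (.inl j) => .o j
  | .inr (.inr j) => .p j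

def moveSplit : Fin 6 ⊕ (Fin 3 ⊕ Fin 3) → Fin 5 ⊕ (Fin 3 ⊕ (Fin 2 ⊕ Fin 2))
  | .inl l => ![.inl 0, .inl 1, .inl 2, .inl 3, .inl 4, .inr (.inl 0)] l
  | .inr (.inl j) => ![.inr (.inl 1), .inr (.inr (.inl 0)), .inr (.inr (.inl 1))] j
  | .inr (.inr j) => ![.inr (.inl 2), .inr (.inr (.inr 0)), .inr (.inr (.inr 1))] j

/-- The radial direction is orthogonal to the two rotational ones, and `(X × x) × (X × y)` is the
triple product times `X`. -/
theorem det_radial_rotations (x y X : Fin 3 → ℝ) :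
    (Matrix.of fun k j => ![X, X ⨯₃ x, X ⨯₃ y] j k : Matrix (Fin 3) (Fin 3) ℝ).det
      = (X ⬝ᵥ X) * triple x y X := by
  rw [det_fin_three]
  simp [cross_apply, triple, dot3]
  ring

/-- Displacements of the link vertices, of `O` and of `P` form separate blocks. The first is
unitriangular, the common motion along the knot being the last column. Rotating a point about its
own direction does nothing, so two rotations and the radial motion suffice for each of `O` and `P`.
-/
theorem sqDet_moveMatrix :
    sqDet (moveMatrix u O P) = ((O ⬝ᵥ O) * axisFace u O 0 * ((P ⬝ᵥ P) * axisFace u P 0)) ^ 2 := by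
  have b1 : Function.Bijective coordSplit := by
    refine (Fintype.bijective_iff_injective_and_card _).2 ⟨?_, rfl⟩
    unfold Function.Injective; decide
  have b2 : Function.Bijective moveSplit := by
    refine (Fintype.bijective_iff_injective_and_card _).2 ⟨?_, rfl⟩
    unfold Function.Injective; decide
  rw [← sqDet_submatrix (moveMatrix u O P) (Equiv.ofBijective _ b1) (Equiv.ofBijective _ b2)
    (Fintype.equivOfCardEq rfl), sqDet_self]
  congr 1
  have e : (moveMatrix u O P).submatrix (Equiv.ofBijective _ b1) (Equiv.ofBijective _ b2)
      = fromBlocks (Matrix.of fun i j : Fin 6 => moveVec u O P (moveSplit (.inl j)) (coordSplit (.inl i)))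
        0 0 (fromBlocks (Matrix.of fun k j => ![O, O ⨯₃ u 0, O ⨯₃ u 1] j k) 0 0
          (Matrix.of fun k j => ![P, P ⨯₃ u 0, P ⨯₃ u 1] j k)) := by
    ext (i | i | i) (j | j | j)
    · rfl
    · fin_cases i <;> fin_cases j <;> simp [moveMatrix, moveSplit, coordSplit, moveVec]
    · fin_cases i <;> fin_cases j <;> simp [moveMatrix, moveSplit, coordSplit, moveVec]
    · fin_cases j <;> simp [moveMatrix, moveSplit, coordSplit, moveVec]
    · fin_cases j <;> simp [moveMatrix, moveSplit, coordSplit, moveVec]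
    · fin_cases j <;> simp [moveMatrix, moveSplit, coordSplit, moveVec]
    · fin_cases j <;> simp [moveMatrix, moveSplit, coordSplit, moveVec]
    · fin_cases j <;> simp [moveMatrix, moveSplit, coordSplit, moveVec]
    · fin_cases j <;> simp [moveMatrix, moveSplit, coordSplit, moveVec]
  rw [e, det_fromBlocks_zero₂₁, det_fromBlocks_zero₂₁, det_radial_rotations, det_radial_rotations]
  have h6 : (Matrix.of fun i j : Fin 6 =>
      moveVec u O P (moveSplit (.inl j)) (coordSplit (.inl i))).det = 1 := by
    rw [det_of_ranking _ (fun i : Fin 6 => (i : ℕ))]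
    · refine Finset.prod_eq_one fun i _ => ?_
      fin_cases i <;> simp [moveSplit, coordSplit, moveVec]
    · intro i j hij hne
      fin_cases i <;> fin_cases j <;>
        first
        | exact absurd rfl hij
        | decide
        | (exfalso; apply hne; simp [moveSplit, coordSplit, moveVec]; done)
  rw [h6, one_mul]
  rfl

end TrefoilInvariant

namespace TrefoilInvariant

variable {ρ : TrefoilGroup →* SO3}
  {u : Fin 3 → Fin 3 → ℝ} {a b : Fin 3 → ℝ} {O P : Fin 3 → ℝ}

/-! ### A basis of edge variations -/

/-- The edge paired with a basis vector. -/
def pivotEdge : VarCoord ⊕ Fin 5 → Edge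
  | .inl (.inl (.inl .m)) => .linkOut 0
  | .inl (.inl (.inl (.o i .out))) => .AO₁ i
  | .inl (.inl (.inl (.o i .inn))) => .AO₂ i
  | .inl (.inl (.inl (.p i .out))) => .BP₁ (i + 2)
  | .inl (.inl (.inl (.p i .inn))) => .BP₂ (i + 1)
  | .inl (.inl (.inr (.ab i))) => .AB i
  | .inl (.inl (.inr (.op r))) => .OP r
  | .inl (.inl (.inr .sigma)) => .BO 1
  | .inl (.inl (.inr .tau)) => .AP 2
  | .inl (.inr (.inl j)) => .BO (![2, 0] j)
  | .inl (.inr (.inr j)) => .AP (![0, 1] j)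
  | .inr l => ![.linkIn 1, .linkOut 1, .linkIn 2, .linkOut 2, .linkIn 0] l

/-- The link edges are ranked in the order of a walk along the knot starting with `linkOut 0`. A
single link vertex affects the two link edges that meet there, and the later one is its pivot. -/
def edgeRank : Edge → ℕ
  | .linkOut i => ![2, 4, 6] i
  | .linkIn i => ![7, 3, 5] i
  | .BO _ => 1
  | .AP _ => 1
  | _ => 0

theorem pivotEdge_surjective : Function.Surjective pivotEdge := by
  have h : ∀ e, ∃ x, pivotEdge x = e := by
    intro e
    cases e with
    | linkOut i =>
      fin_cases i
      exacts [⟨.inl (.inl (.inl .m)), rfl⟩, ⟨.inr 1, rfl⟩, ⟨.inr 3, rfl⟩]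
    | linkIn i => fin_cases i; exacts [⟨.inr 4, rfl⟩, ⟨.inr 0, rfl⟩, ⟨.inr 2, rfl⟩]
    | AB i => exact ⟨.inl (.inl (.inr (.ab i))), rfl⟩
    | AO₁ i => exact ⟨.inl (.inl (.inl (.o i .out))), rfl⟩
    | AO₂ i => exact ⟨.inl (.inl (.inl (.o i .inn))), rfl⟩
    | AP i =>
      fin_cases i
      exacts [⟨.inl (.inr (.inr 0)), rfl⟩, ⟨.inl (.inr (.inr 1)), rfl⟩,
        ⟨.inl (.inl (.inr .tau)), rfl⟩]
    | BO i =>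
      fin_cases i
      exacts [⟨.inl (.inr (.inl 1)), rfl⟩, ⟨.inl (.inl (.inr .sigma)), rfl⟩,
        ⟨.inl (.inr (.inl 0)), rfl⟩]
    | BP₁ i => exact ⟨.inl (.inl (.inl (.p (i + 1) .out))), by simp only [pivotEdge, fin3_b]⟩
    | BP₂ i => exact ⟨.inl (.inl (.inl (.p (i + 2) .inn))), by simp only [pivotEdge, fin3_d]⟩
    | OP r => exact ⟨.inl (.inl (.inr (.op r))), rfl⟩
  exact h

noncomputable def pivotEquiv : VarCoord ⊕ Fin 5 ≃ Edge :=
  Equiv.ofBijective pivotEdge ((Fintype.bijective_iff_surjective_and_card _).2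
    ⟨pivotEdge_surjective, rfl⟩)

/-- The matrix of a basis of edge variations: those that vanish on all link edges but one, and
five displacements. -/
noncomputable def edgeBasis (ρ : TrefoilGroup →* SO3) (u : Fin 3 → Fin 3 → ℝ) (a b O P : Fin 3 → ℝ) :
    Matrix Edge (VarCoord ⊕ Fin 5) ℝ :=
  fromCols (LinearMap.toMatrix' (edgeOfCoord a b))
    (Matrix.of fun e l => (f₂ ρ u (place u a b O P) *ᵥ moveVec u O P (.inl l)) e)

def pivotValue (a b : Fin 3 → ℝ) : VarCoord ⊕ Fin 5 → ℝ
  | .inl (.inl (.inl .m)) => 1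
  | .inl (.inl (.inl (.o i _))) => a i
  | .inl (.inl (.inl (.p i .out))) => -b (i + 2)
  | .inl (.inl (.inl (.p i .inn))) => -b (i + 1)
  | .inl (.inl (.inr (.ab i))) => a i * b i
  | .inl (.inl (.inr (.op _))) => 1
  | .inl (.inl (.inr .sigma)) => b 1
  | .inl (.inl (.inr .tau)) => a 2
  | .inl (.inr (.inl j)) => b (![2, 0] j)
  | .inl (.inr (.inr j)) => a (![0, 1] j)
  | .inr l => ![b 2 - a 1, a 1 - b 0, b 0 - a 2, a 2 - b 1, b 1 - a 0] l

theorem sigmaOf_apply (x : VarCoord → ℝ) (j : Fin 3) : sigmaOf x j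
    = x (![.inr (.inl 0), .inr (.inl 1), .inl (.inr .sigma)] j) := by
  fin_cases j <;> rfl

theorem tauOf_apply (x : VarCoord → ℝ) (j : Fin 3) : tauOf x j
    = x (![.inr (.inr 0), .inr (.inr 1), .inl (.inr .tau)] j) := by
  fin_cases j <;> rfl

theorem edgeOfCoord_rank (c : VarCoord) (e : Edge) (he : e ≠ pivotEdge (.inl c))
    (hne : edgeOfCoord a b (Pi.single c 1) e ≠ 0) : edgeRank e < edgeRank (pivotEdge (.inl c)) := by
  by_contra hlt
  apply hne
  clear hne
  rcases e with k | k | k | k | k | k | k | k | k | k <;>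
  simp only [edgeOfCoord, LinearMap.coe_mk, AddHom.coe_mk, sigmaOf_apply, tauOf_apply] <;>
  rcases c with ((_ | ⟨i, _ | _⟩ | ⟨i, _ | _⟩) | (i | r | _ | _)) | (j | j)
  all_goals first
    | exact absurd Nat.one_pos hlt
    | (simp; done)
    | (simp only [pivotEdge, ne_eq, Edge.AB.injEq, Edge.OP.injEq] at he
       simp [Pi.single_apply, he]
       done)
    | (fin_cases k <;> first | exact absurd rfl he | (simp; done))
    | (fin_cases k <;> fin_cases i <;> first | exact absurd rfl he | (simp; done))
    | (fin_cases k <;> fin_cases j <;> first | exact absurd rfl he | (simp; done))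

theorem edgeOfCoord_pivot (c : VarCoord) :
    edgeOfCoord a b (Pi.single c 1) (pivotEdge (.inl c)) = pivotValue a b (.inl c) := by
  rcases c with ((_ | ⟨i, _ | _⟩ | ⟨i, _ | _⟩) | (i | r | _ | _)) | (j | j) <;>
    simp only [edgeOfCoord, LinearMap.coe_mk, AddHom.coe_mk, sigmaOf_apply, tauOf_apply, pivotEdge,
      pivotValue]
  · simp
  · fin_cases i <;> simp
  · fin_cases i <;> simp
  · fin_cases i <;> simp
  · fin_cases i <;> simp
  · simp
  · simp
  · simp
  · simp
  · fin_cases j <;> simp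
  · fin_cases j <;> simp

theorem IsCoherent.link_move (h : IsCoherent ρ u) (t : Coord → ℝ) (i : Fin 3) (s : Side) :
    (f₂ ρ u (place u a b O P) *ᵥ t) (s.link i)
      = (a i - b (s.lower i)) * (t (.a i) - t (.b (s.lower i))) := by
  rw [f₂_mulVec, displace, h.edgeVar_link]

/-- The matrix of the basis is triangular. Among the coordinate variations only `BO` and `AP`
variations spill over, into `AO` and `BP`; the displacements spill into earlier edges of the walk
along the knot and into edges off the knot, all of lower rank. -/
theorem IsCoherent.edgeBasis_rank (h : IsCoherent ρ u) (c : VarCoord ⊕ Fin 5) (e : Edge)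
    (he : e ≠ pivotEdge c) (hne : edgeBasis ρ u a b O P e c ≠ 0) :
    edgeRank e < edgeRank (pivotEdge c) := by
  rcases c with c | l
  · refine edgeOfCoord_rank (a := a) (b := b) c e he ?_
    rw [edgeBasis, fromCols_apply_inl] at hne
    rwa [LinearMap.toMatrix'_apply] at hne
  · rw [edgeBasis, fromCols_apply_inr, of_apply] at hne
    have lo : ∀ k, edgeRank (.linkOut k) = ![2, 4, 6] k := fun k => rfl
    have hi : ∀ k, edgeRank (.linkIn k) = ![7, 3, 5] k := fun k => rfl
    have hout : ∀ k t, (f₂ ρ u (place u a b O P) *ᵥ t) (.linkOut k)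
        = (a k - b (k + 2)) * (t (.a k) - t (.b (k + 2))) := fun k t => h.link_move t k .out
    have hinn : ∀ k t, (f₂ ρ u (place u a b O P) *ᵥ t) (.linkIn k)
        = (a k - b (k + 1)) * (t (.a k) - t (.b (k + 1))) := fun k t => h.link_move t k .inn
    have h3 : ∀ l : Fin 5, 2 < edgeRank (pivotEdge (.inr l)) := by decide
    have hl := h3 l
    by_contra hlt
    apply hne
    rcases e with k | k | k | k | k | k | k | k | k | k
    · rw [hout]
      fin_cases k <;> fin_cases l <;>
      first
      | exact absurd rfl he
      | exact absurd (by decide) hlt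
      | (simp [moveVec]; done)
    · rw [hinn]
      fin_cases k <;> fin_cases l <;>
      first
      | exact absurd rfl he
      | exact absurd (by decide) hlt
      | (simp [moveVec]; done)
    all_goals exact absurd (lt_of_le_of_lt (by simp [edgeRank]) hl) hlt

theorem IsCoherent.edgeBasis_pivot (h : IsCoherent ρ u) (c : VarCoord ⊕ Fin 5) :
    edgeBasis ρ u a b O P (pivotEdge c) c = pivotValue a b c := by
  rcases c with c | l
  · rw [edgeBasis, fromCols_apply_inl, LinearMap.toMatrix'_apply]
    exact edgeOfCoord_pivot c
  · rw [edgeBasis, fromCols_apply_inr, of_apply]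
    have hout : ∀ k t, (f₂ ρ u (place u a b O P) *ᵥ t) (.linkOut k)
        = (a k - b (k + 2)) * (t (.a k) - t (.b (k + 2))) := fun k t => h.link_move t k .out
    have hinn : ∀ k t, (f₂ ρ u (place u a b O P) *ᵥ t) (.linkIn k)
        = (a k - b (k + 1)) * (t (.a k) - t (.b (k + 1))) := fun k t => h.link_move t k .inn
    fin_cases l <;> simp [pivotEdge, hout, hinn, moveVec, pivotValue]

theorem prod_linkCoord (F : LinkCoord → ℝ) : ∏ c, F c
    = F .m * ((∏ i, F (.o i .out) * F (.o i .inn)) * ∏ i, F (.p i .out) * F (.p i .inn)) := by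
  have h : (Finset.univ : Finset LinkCoord) = {.m, .o 0 .out, .o 0 .inn, .o 1 .out, .o 1 .inn,
    .o 2 .out, .o 2 .inn, .p 0 .out, .p 0 .inn, .p 1 .out, .p 1 .inn, .p 2 .out, .p 2 .inn} := by
    decide
  rw [h]
  repeat rw [Finset.prod_insert (by decide)]
  rw [Finset.prod_singleton]
  simp only [Fin.prod_univ_three]
  ring

theorem prod_coneCoord (F : ConeCoord → ℝ) : ∏ c, F c
    = (∏ i, F (.ab i)) * (F (.op .exterior) * (∏ i, F (.op (.lobe i))) * F (.op .centre))
      * (F .sigma * F .tau) := by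
  have h : (Finset.univ : Finset ConeCoord) = {.ab 0, .ab 1, .ab 2, .op .exterior, .op (.lobe 0),
    .op (.lobe 1), .op (.lobe 2), .op .centre, .sigma, .tau} := by
    decide
  rw [h]
  repeat rw [Finset.prod_insert (by decide)]
  rw [Finset.prod_singleton]
  simp only [Fin.prod_univ_three]
  ring

/-- The product of the differences of positions over five of the six link edges. -/
def linkProd (a b : Fin 3 → ℝ) : ℝ :=
  (b 2 - a 1) * (a 1 - b 0) * (b 0 - a 2) * (a 2 - b 1) * (b 1 - a 0)

theorem IsCoherent.sqDet_edgeBasis (h : IsCoherent ρ u) :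
    sqDet (edgeBasis ρ u a b O P) = ((∏ i, a i * b i) ^ 4 * linkProd a b) ^ 2 := by
  rw [sqDet_eq _ pivotEquiv, det_of_ranking _ (fun c => edgeRank (pivotEdge c))]
  · congr 1
    have e : ∀ c, (edgeBasis ρ u a b O P).submatrix pivotEquiv id c c = pivotValue a b c :=
      fun c => h.edgeBasis_pivot c
    simp only [e, Fintype.prod_sum_type, prod_linkCoord, prod_coneCoord, pivotValue,
      Fin.prod_univ_three, Fin.prod_univ_two, linkProd, Fin.prod_univ_five, cons_val_zero,
      cons_val_one, cons_val, Fin.reduceAdd, zero_add]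
    ring
  · intro i j hij hne
    exact h.edgeBasis_rank j (pivotEdge i) (fun he => hij (pivotEquiv.injective he)) hne

end TrefoilInvariant

namespace TrefoilInvariant

variable {ρ : TrefoilGroup →* SO3}
  {u : Fin 3 → Fin 3 → ℝ} {a b : Fin 3 → ℝ} {O P : Fin 3 → ℝ}

/-! ### The relation between the minors -/

/-- The coordinates of the variation given by a vector of the basis of displacements. -/
noncomputable def moveCoord (ρ : TrefoilGroup →* SO3) (u : Fin 3 → Fin 3 → ℝ) (a b O P : Fin 3 → ℝ)
    (j : Fin 5 ⊕ (Fin 3 ⊕ (Fin 2 ⊕ Fin 2))) : VarCoord → ℝ :=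
  coordOfEdge a b (f₂ ρ u (place u a b O P) *ᵥ moveVec u O P j)

theorem displace_rotation (j : Fin 2 ⊕ Fin 2) : ∃ d q : Fin 3 → ℝ,
    displace u (moveVec u O P (.inr (.inr j))) = place u 0 0 d q ∧ O ⬝ᵥ d = 0 ∧ P ⬝ᵥ q = 0 ∧
    d = Sum.elim (fun j => O ⨯₃ (![u 0, u 1] j)) (fun _ : Fin 2 => (0 : Fin 3 → ℝ)) j ∧
    q = Sum.elim (fun _ : Fin 2 => (0 : Fin 3 → ℝ)) (fun j => P ⨯₃ (![u 0, u 1] j)) j := by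
  rcases j with j | j
  · exact ⟨O ⨯₃ (![u 0, u 1] j), 0, rfl, dot_self_cross _ _, dotProduct_zero _, rfl, rfl⟩
  · exact ⟨0, P ⨯₃ (![u 0, u 1] j), rfl, dotProduct_zero _, dot_self_cross _ _, rfl, rfl⟩

theorem IsCoherent.linkFree_move (h : IsCoherent ρ u) (j : Fin 3 ⊕ (Fin 2 ⊕ Fin 2)) :
    ∀ i, ∀ s : Side, (f₂ ρ u (place u a b O P) *ᵥ moveVec u O P (.inr j)) (s.link i) = 0 := by
  intro i s
  rw [h.link_move]
  refine mul_eq_zero_of_right _ ?_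
  rcases j with j | j | j
  · fin_cases j <;> simp [moveVec]
  · simp [moveVec]
  · simp [moveVec]

theorem IsGeneric.edgeOfCoord_move (h : IsGeneric ρ u a b O P) (j : Fin 3 ⊕ (Fin 2 ⊕ Fin 2)) :
    edgeOfCoord a b (moveCoord ρ u a b O P (.inr j))
      = f₂ ρ u (place u a b O P) *ᵥ moveVec u O P (.inr j) :=
  edgeOfCoord_coordOfEdge h.a_ne h.b_ne fun i s _ => h.coherent.linkFree_move j i s

theorem IsGeneric.f₃_mul_f₂ (h : IsGeneric ρ u a b O P) :
    f₃ ρ (place u a b O P) * f₂ ρ u (place u a b O P) = 0 := by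
  ext e c
  have := f₃_edgeVar (h.coherent.equivariant a b O P)
    (h.coherent.displace_equivariant (Pi.single c 1)) h.general (Pi.single e 1)
  rw [← f₂_mulVec, mulVec_single_one, single_one_dotProduct] at this
  exact this

/-- All functionals vanish on the rotations of `O` and `P`. -/
theorem IsGeneric.normalRow_rotation (h : IsGeneric ρ u a b O P) (j : Fin 2 ⊕ Fin 2) :
    normalRow ρ u a b O P (f₂ ρ u (place u a b O P) *ᵥ moveVec u O P (.inr (.inr j))) = 0 := by
  have hl := h.coherent.linkFree_move (a := a) (b := b) (O := O) (P := P) (.inr j)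
  have hf := h.f₃_mul_f₂
  ext r
  rcases r with r | ⟨r, i, s⟩ | ⟨i, c⟩
  · fin_cases r
    · exact hl 0 .out
    · change (f₃ ρ (place u a b O P) *ᵥ dropLink _) (.linkOut 0) = 0
      have h0 := hl 0 .out
      simp only [Side.link] at h0
      rw [dropLink, h0, zero_smul, sub_zero, mulVec_mulVec, hf, zero_mulVec]; rfl
  · obtain ⟨d, q, hd, hO, hP, -, -⟩ := displace_rotation (u := u) (O := O) (P := P) j
    rw [f₂_mulVec, hd]
    obtain ⟨h1, h2⟩ := h.linkRow_edgeVar d q i s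
    rw [hO, zero_mul] at h1
    rw [hP, zero_mul] at h2
    fin_cases r
    · exact h1
    · exact h2
  · obtain ⟨d, q, hd, hO, hP, -, -⟩ := displace_rotation (u := u) (O := O) (P := P) j
    rw [f₂_mulVec, hd]
    have key := h.cornerCoeff_mul_cornerRow 0 0 d q i c
    rw [hO, hP] at key
    simp only [Pi.zero_apply, mul_zero, sub_zero, add_zero] at key
    refine (mul_eq_zero.1 key).resolve_left ?_
    rw [cornerCoeff]
    refine div_ne_zero (neg_ne_zero.2 (mul_ne_zero (by cases c <;> simp [Corner.sign]) ?_))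
      (tetDet_ne_zero h.general _)
    exact mul_ne_zero (mul_ne_zero (mul_ne_zero (mul_ne_zero (mul_ne_zero (h.a_ne i) (h.b_ne i))
      (h.corner_left_ne i c)) (h.corner_right_ne i c)) (h.cornerE_ne i c)) (h.cornerF_ne i c)

/-- The last four coordinates are length variations at two axes each for `O` and for `P`. On
infinitesimal rotations about those same two axes they give skew 2 by 2 blocks. -/
theorem IsGeneric.det_rotationRows (h : IsGeneric ρ u a b O P) :
    (toRows₂ (Matrix.of fun x j => moveCoord ρ u a b O P (.inr (.inr j)) x :
      Matrix VarCoord (Fin 2 ⊕ Fin 2) ℝ)).det = (axisFace u O 0 * axisFace u P 0) ^ 2 := by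
  have hO : ∀ k j, moveCoord ρ u a b O P (.inr (.inr j)) (.inr (.inl k))
      = -(u (![0, 1] k) ⬝ᵥ Sum.elim (fun j => O ⨯₃ (![u 0, u 1] j)) (fun _ : Fin 2 => (0 : Fin 3 → ℝ)) j) := by
    intro k j
    obtain ⟨d, q, hd, hO, hP, rfl, rfl⟩ := displace_rotation (u := u) (O := O) (P := P) j
    rw [moveCoord, f₂_mulVec, hd, coordOfEdge, (edgeVar_BO_AP _ _ _).1, hO]
    have hb := h.b_ne (![2, 0] k)
    have e : ![2, 0] k + 1 = (![0, 1] k : Fin 3) := by fin_cases k <;> rfl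
    rw [e]
    field_simp; ring
  have hP : ∀ k j, moveCoord ρ u a b O P (.inr (.inr j)) (.inr (.inr k))
      = -(u (![0, 1] k) ⬝ᵥ Sum.elim (fun _ : Fin 2 => (0 : Fin 3 → ℝ)) (fun j => P ⨯₃ (![u 0, u 1] j)) j) := by
    intro k j
    obtain ⟨d, q, hd, hO, hP, rfl, rfl⟩ := displace_rotation (u := u) (O := O) (P := P) j
    rw [moveCoord, f₂_mulVec, hd, coordOfEdge, (edgeVar_BO_AP _ _ _).2, hP]
    have ha := h.a_ne (![0, 1] k)
    field_simp; ring
  have hX : ∀ X : Fin 3 → ℝ, u 0 ⬝ᵥ (X ⨯₃ u 1) = -axisFace u X 0 ∧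
      u 1 ⬝ᵥ (X ⨯₃ u 0) = axisFace u X 0 ∧ u 0 ⬝ᵥ (X ⨯₃ u 0) = 0 ∧ u 1 ⬝ᵥ (X ⨯₃ u 1) = 0 := by
    intro X
    rw [← triple_eq_dot_cross, ← triple_eq_dot_cross, ← triple_eq_dot_cross, ← triple_eq_dot_cross]
    refine ⟨?_, ?_, ?_, ?_⟩ <;> simp only [axisFace, triple, zero_add] <;> ring
  obtain ⟨o1, o2, o3, o4⟩ := hX O
  obtain ⟨p1, p2, p3, p4⟩ := hX P
  have e : toRows₂ (Matrix.of fun x j => moveCoord ρ u a b O P (.inr (.inr j)) x :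
      Matrix VarCoord (Fin 2 ⊕ Fin 2) ℝ) = fromBlocks !![0, axisFace u O 0; -axisFace u O 0, 0] 0 0
        !![0, axisFace u P 0; -axisFace u P 0, 0] := by
    ext (i | i) (j | j)
    · rw [toRows₂, of_apply, of_apply, hO]
      fin_cases i <;> fin_cases j <;> simp [o1, o2, o3, o4]
    · rw [toRows₂, of_apply, of_apply, hO]; simp
    · rw [toRows₂, of_apply, of_apply, hP]; simp
    · rw [toRows₂, of_apply, of_apply, hP]
      fin_cases i <;> fin_cases j <;> simp [p1, p2, p3, p4]
  rw [e, det_fromBlocks_zero₂₁, det_fin_two_of, det_fin_two_of]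
  ring

/-- The functionals of the quadrants that are not paired with coordinates. -/
theorem IsGeneric.det_moveRows (h : IsGeneric ρ u a b O P) :
    (Matrix.of fun (r j : Fin 3) => (normalForm ρ u a b O P *ᵥ normalRow ρ u a b O P
      (f₂ ρ u (place u a b O P) *ᵥ moveVec u O P (.inr (.inl j)))) (rowIndex (.inr r))).det
      * (1 + axisCos u) = 2 * (1 - axisCos u) * ((O ⬝ᵥ O) * (P ⬝ᵥ P))
        * (axisFace u P 1 * axisFace u O 2 * axisVol ρ u O P 1 .centre) := by
  have hrow : ∀ (x : NormalRow → ℝ) (i : Fin 3) (c : Corner),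
      (normalForm ρ u a b O P *ᵥ x) (.inr (.inr (i, c)))
        = cornerCoeff ρ u a b O P i c * x (.inr (.inr (i, c))) := by
    intro x i c
    rw [normalForm, fromBlocks_mulVec]
    simp only [Sum.elim_inr, Pi.add_apply, zero_mulVec, Pi.zero_apply, zero_add, fromBlocks_mulVec,
      mulVec_diagonal]
    rfl
  -- The three moves have `(α, O · d, P · q)` equal to `(1, 0, 0)`, `(0, O · O, 0)` and `(0, 0, P ·
  -- P)`, which gives the three columns of `volume_det` up to scale.
  have val : ∀ (i : Fin 3) (c : Corner) (j : Fin 3), (normalForm ρ u a b O P *ᵥ normalRow ρ u a b O P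
      (f₂ ρ u (place u a b O P) *ᵥ moveVec u O P (.inr (.inl j)))) (.inr (.inr (i, c)))
      = -c.sign * (![axisVol ρ u O P (c.axis i) (c.region i) - axisVol ρ u O P i (c.region i),
        cornerF u P i c * (O ⬝ᵥ O), -(cornerE ρ u O i c * (P ⬝ᵥ P))] j) := by
    intro i c j
    rw [hrow, normalRow_corner, f₂_mulVec, displace, h.cornerCoeff_mul_cornerRow]
    congr 1
    have z : (fun _ : Fin 3 => (0 : ℝ)) = 0 := rfl
    fin_cases j <;> simp [moveVec, z]
  have key := h.coherent.volume_det h.axisCos_sq_ne O P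
  rw [det_fin_three] at key ⊢
  simp only [of_apply, rowIndex, cons_val_zero, cons_val_one, cons_val, cons_val'] at key ⊢
  simp only [val, Corner.sign, Corner.axis, Corner.region, (h.coherent.cornerE_eq _).2.2.1,
    (h.coherent.cornerE_eq _).2.2.2, (cornerF_eq (u := u) (P := P) _).2.2.1,
    (cornerF_eq (u := u) (P := P) _).2.2.2, cons_val_zero, cons_val_one, cons_val,
    Fin.reduceAdd] at key ⊢
  simp only [axisFace, Fin.reduceAdd] at key ⊢
  linear_combination (-((O ⬝ᵥ O) * (P ⬝ᵥ P))) * key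

end TrefoilInvariant

/-! ### Assembly of the determinants into the relation between the minors. -/

namespace TrefoilInvariant

variable {ρ : TrefoilGroup →* SO3}
  {u : Fin 3 → Fin 3 → ℝ} {a b : Fin 3 → ℝ} {O P : Fin 3 → ℝ}

/-- The factors `(1 - c)/(1 + c)` in `D` and in the last pivot cancel, as do all the volumes; the
factor 2 in `D` becomes 4 after squaring. -/
theorem IsGeneric.monomial_relation (h : IsGeneric ρ u a b O P) {D : ℝ}
    (hD : D * (1 + axisCos u) = 2 * (1 - axisCos u) * ((O ⬝ᵥ O) * (P ⬝ᵥ P))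
        * (axisFace u P 1 * axisFace u O 2 * axisVol ρ u O P 1 .centre)) :
    D ^ 2 * ((axisFace u O 0 * axisFace u P 0) ^ 2) ^ 2
      = 4 * ((∏ i, ∏ c, cornerProd ρ u O P i c) * ((∏ i, elimPivot ρ u a b O P i) * (b 2 - a 0)) ^ 2
        * ((O ⬝ᵥ O) * axisFace u O 0 * ((P ⬝ᵥ P) * axisFace u P 0)) ^ 2) := by
  obtain ⟨ve, vc, vl, vs⟩ := h.axisVol_ne
  have v0 := ve 0
  have v1 := ve 1
  have v2 := ve 2
  have y0 := vc 0
  have y1 := vc 1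
  have y2 := vc 2
  have w0 := vl 0
  have w1 := vl 1
  have w2 := vl 2
  have x0 := vs 0
  have x1 := vs 1
  have x2 := vs 2
  simp only [Fin.reduceAdd, zero_add] at x0 x1 x2
  have e0 := h.axisFace_O_ne 0
  have e1 := h.axisFace_O_ne 1
  have e2 := h.axisFace_O_ne 2
  have f0 := h.axisFace_P_ne 0
  have f1 := h.axisFace_P_ne 1
  have f2 := h.axisFace_P_ne 2
  have hab : b 2 - a 0 ≠ 0 := (h.plus_ne 0 .out).1
  have hc := h.axisCos_sq_ne
  have c1 : 1 + axisCos u ≠ 0 := fun e => hc (by rw [show axisCos u = -1 by linarith]; norm_num)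
  have hD' : D = 2 * (1 - axisCos u) * ((O ⬝ᵥ O) * (P ⬝ᵥ P))
      * (axisFace u P 1 * axisFace u O 2 * axisVol ρ u O P 1 .centre) / (1 + axisCos u) := by
    rw [← hD]; field_simp
  have hE : ∀ i, cornerE ρ u O i .ext = axisFace u O i ∧
      cornerE ρ u O i .succ = -axisFace u O (i + 1) ∧ cornerE ρ u O i .lobe = axisFace u O i ∧
      cornerE ρ u O i .centre = -axisFace u O (i + 1) := fun i => by
    simp only [axisFace, fin3_a]; exact h.coherent.cornerE_eq i
  have hF : ∀ i, cornerF u P i .ext = axisFace u P i ∧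
      cornerF u P i .succ = axisFace u P i ∧ cornerF u P i .lobe = -axisFace u P (i + 2) ∧
      cornerF u P i .centre = -axisFace u P (i + 2) := fun i => by
    simp only [axisFace, fin3_d]; exact cornerF_eq i
  simp only [prod_corner, prod_coneCoord, Fin.prod_univ_three, cornerProd, (hE _).1, (hE _).2.1,
    (hE _).2.2.1, (hE _).2.2.2, (hF _).1, (hF _).2.1, (hF _).2.2.1, (hF _).2.2.2, Corner.axis,
    Corner.region, elimPivot, Fin.reduceAdd, zero_add]
  rw [hD']
  field_simp
  ring

/-- Twelve of the 24 orientation signs are positive, so the product of their negatives is 1. -/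
theorem prod_volume :
    ∏ T, (-6 * volume ρ (place u a b O P) T) = ∏ T, tetDet ρ (place u a b O P) T := by
  have e : ∀ T, -6 * volume ρ (place u a b O P) T
      = -tetOrientation T * tetDet ρ (place u a b O P) T := fun T => by rw [volume_eq]; ring
  simp only [e, Finset.prod_mul_distrib]
  rw [prod_tet_split (fun T => -tetOrientation T)]
  simp only [prod_side, prod_corner, Fin.prod_univ_three, Side.tetPlus, Side.tetMinus, Corner.tet,
    tetOrientation]
  norm_num

/-- On a common axis lengths are differences of coordinates; `linkProd` misses only the
distinguished edge, whose difference is `b 2 - a 0`. -/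
theorem IsGeneric.link_lengths (h : IsGeneric ρ u a b O P) :
    (∏ i, (2 * halfSqLength ρ (place u a b O P) (.linkOut i))
      * (2 * halfSqLength ρ (place u a b O P) (.linkIn i)))
    = (linkProd a b * (b 2 - a 0)) ^ 2 := by
  have e : ∀ i, ∀ s : Side, 2 * halfSqLength ρ (place u a b O P) (s.link i)
      = (a i - b (s.lower i)) ^ 2 := by
    intro i s
    have := h.coherent.edgeVar_link (a := a) (b := b) (O := O) (P := P) a b O P i s
    rw [pow_two, ← this, halfSqLength_eq, two_halfSq, edgeVar, ← neg_sub, neg_dotProduct_neg]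
  have e1 : ∀ i, 2 * halfSqLength ρ (place u a b O P) (.linkOut i) = (a i - b (i + 2)) ^ 2 :=
    fun i => e i .out
  have e2 : ∀ i, 2 * halfSqLength ρ (place u a b O P) (.linkIn i) = (a i - b (i + 1)) ^ 2 :=
    fun i => e i .inn
  simp only [e1, e2, Fin.prod_univ_three, linkProd, Fin.reduceAdd, zero_add]
  ring

/-- The value of the invariant in terms of the minors, for generic configurations. -/
theorem IsGeneric.minor_relation (h : IsGeneric ρ u a b O P) (s : MinorChoice 0 12 20) :
    s.minor₂ ρ u (place u a b O P) ^ 2 * (2 - 2 * rotCos u) ^ 6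
      = 4 * s.minor₃ ρ (place u a b O P) * ((∏ i,
        (2 * halfSqLength ρ (place u a b O P) (.linkOut i))
          * (2 * halfSqLength ρ (place u a b O P) (.linkIn i)))
        * ∏ T, (-6 * volume ρ (place u a b O P) T)) := by
  set S := f₃ ρ (place u a b O P) with hS
  set f := f₂ ρ u (place u a b O P) with hf
  have hC : Function.Bijective s.C₁ := by
    have := s.bijective_coord
    constructor
    · intro x y hxy
      have := @this.1 (.inr x) (.inr y) hxy
      exact Sum.inr_injective this
    · intro c
      obtain ⟨x | x, hx⟩ := this.2 c
      · exact x.elim0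
      · exact ⟨x, hx⟩
  set eC : Fin 12 ≃ Coord := Equiv.ofBijective _ hC with heC
  set Y : Matrix VarCoord (Fin 3) ℝ := Matrix.of fun x j => moveCoord ρ u a b O P (.inr (.inl j)) x
    with hY
  set R : Matrix VarCoord (Fin 2 ⊕ Fin 2) ℝ :=
    Matrix.of fun x j => moveCoord ρ u a b O P (.inr (.inr j)) x with hR
  set Bas : Matrix Edge VarCoord ℝ := LinearMap.toMatrix' (edgeOfCoord a b) with hBas
  set mv : Matrix Edge (Fin 5) ℝ := Matrix.of fun e l => (f *ᵥ moveVec u O P (.inl l)) e with hmv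
  set K := rowMatrix ρ u a b O P with hK
  set Λ := (normalForm ρ u a b O P).submatrix rowEquiv rowEquiv with hΛ
  have hlp : linkProd a b ≠ 0 := by
    have g : ∀ i, ∀ s : Side, b (s.lower i) - a i ≠ 0 := fun i s => (h.plus_ne i s).1
    have g1 := g 1 .inn; have g2 := g 1 .out; have g3 := g 2 .inn; have g4 := g 2 .out
    have g5 := g 0 .inn
    simp only [Side.lower, Fin.reduceAdd, zero_add] at g1 g2 g3 g4 g5
    rw [linkProd]
    refine mul_ne_zero (mul_ne_zero (mul_ne_zero (mul_ne_zero g1 ?_) g3) ?_) g5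
    · rw [← neg_sub]; exact neg_ne_zero.2 g2
    · rw [← neg_sub]; exact neg_ne_zero.2 g4
  have hp : (∏ i, a i * b i) ≠ 0 :=
    Finset.prod_ne_zero_iff.2 fun i _ => mul_ne_zero (h.a_ne i) (h.b_ne i)
  have hB : sqDet (fromCols Bas mv) = ((∏ i, a i * b i) ^ 4 * linkProd a b) ^ 2 :=
    h.coherent.sqDet_edgeBasis
  -- The images of all twelve basis displacements: the first five are columns of the edge basis
  -- themselves, the other seven have coordinates `Y` and `R` because they leave every link edge
  -- unchanged.
  have hT : f.submatrix id s.C₁ * (moveMatrix u O P).submatrix s.C₁ id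
      = fromCols mv (Bas * fromCols Y R) := by
    have e1 : f.submatrix id s.C₁ * (moveMatrix u O P).submatrix s.C₁ id = f * moveMatrix u O P := by
      have := submatrix_mul_equiv f (moveMatrix u O P) id eC id
      rw [submatrix_id_id] at this
      exact this
    rw [e1]
    have e2 : ∀ j, Bas *ᵥ moveCoord ρ u a b O P (.inr j) = f *ᵥ moveVec u O P (.inr j) := by
      intro j
      rw [hBas, LinearMap.toMatrix'_mulVec, h.edgeOfCoord_move]
    ext e (l | j | j)
    · rfl
    · exact (congrFun (e2 (.inl j)) e).symm
    · exact (congrFun (e2 (.inr j)) e).symm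
  have hKK : Basᵀ * S * Bas = (K.submatrix rowEquiv id)ᵀ * Λ * K.submatrix rowEquiv id := by
    have e1 : (K.submatrix rowEquiv id)ᵀ * Λ * K.submatrix rowEquiv id
        = Kᵀ * normalForm ρ u a b O P * K := by
      rw [hΛ, transpose_submatrix, submatrix_mul_equiv, submatrix_mul_equiv, submatrix_id_id]
    rw [e1]
    have gen : ∀ {ι κ : Type} [Fintype ι] [Fintype κ] (A : Matrix ι κ ℝ) (B : Matrix ι ι ℝ) (i j : κ),
        (Aᵀ * B * A) i j = (fun k => A k i) ⬝ᵥ (B *ᵥ fun k => A k j) := by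
      intro ι κ _ _ A B i j
      rw [Matrix.mul_assoc]; rfl
    ext i j
    rw [gen, gen]
    have eB : ∀ c, (fun k => Bas k c) = edgeOfCoord a b (Pi.single c 1) := fun c => by
      ext k; rw [hBas, LinearMap.toMatrix'_apply]
    have eK : ∀ c, (fun k => K k c) = normalRow ρ u a b O P (edgeOfCoord a b (Pi.single c 1)) :=
      fun c => by rw [← rowMatrix_mulVec, mulVec_single_one]; rfl
    rw [eB, eB, eK, eK]
    exact h.f₃_form_normal (linkFree_edgeOfCoord _) (linkFree_edgeOfCoord _)
  have eKm : ∀ j, K *ᵥ moveCoord ρ u a b O P (.inr j)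
      = normalRow ρ u a b O P (f *ᵥ moveVec u O P (.inr j)) := fun j => by
    rw [hK, rowMatrix_mulVec, h.edgeOfCoord_move]
  have hKR : K.submatrix rowEquiv id * R = 0 := by
    ext i j
    have := congrFun (eKm (.inr j)) (rowEquiv i)
    rw [h.normalRow_rotation] at this
    exact this
  have hR2 : R.toRows₂.det = (axisFace u O 0 * axisFace u P 0) ^ 2 := h.det_rotationRows
  have hD := h.det_moveRows
  set D := (Matrix.of fun (r j : Fin 3) => (normalForm ρ u a b O P *ᵥ normalRow ρ u a b O P
      (f₂ ρ u (place u a b O P) *ᵥ moveVec u O P (.inr (.inl j)))) (rowIndex (.inr r))).det with hDd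
  have hD3 : (Λ * K.submatrix rowEquiv id * Y).toRows₂.det = D := by
    rw [hDd, hΛ, submatrix_mul_equiv]
    congr 1
    ext r j
    rw [of_apply, ← hf, ← eKm (.inl j), mulVec_mulVec]
    rfl
  have hSF : S * f.submatrix id s.C₁ = 0 := by
    ext e c
    exact congrFun (congrFun h.f₃_mul_f₂ e) (s.C₁ c)
  -- The sizes are `m = 12`, `k = 20`, `Q = 13 + 10`, `y = 3`, `r = 4` and `L = 5`.
  have key := minor_reduction (S := S) (F := f.submatrix id s.C₁)
    (f₃_symm (h.coherent.equivariant a b O P) h.general)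
    hSF
    (Equiv.ofBijective _ s.bijective_edge) Bas mv pivotEquiv
    (by rw [hB]; exact pow_ne_zero _ (mul_ne_zero (pow_ne_zero _ hp) hlp))
    ((moveMatrix u O P).submatrix s.C₁ id) (Fintype.equivOfCardEq rfl) Y R hT
    (K.submatrix rowEquiv id) Λ
    (by rw [hΛ, transpose_submatrix, normalForm_transpose]) hKK hKR
    (by rw [hR2]; exact pow_ne_zero _ (mul_ne_zero (h.axisFace_O_ne 0) (h.axisFace_P_ne 0)))
    (Fintype.equivOfCardEq rfl)
  have hk11 : (K.submatrix rowEquiv id).toBlocks₁₁.det = ∏ i, elimPivot ρ u a b O P i :=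
    h.det_squareRows
  have hsT : sqDet ((moveMatrix u O P).submatrix s.C₁ id)
      = ((O ⬝ᵥ O) * axisFace u O 0 * ((P ⬝ᵥ P) * axisFace u P 0)) ^ 2 := by
    rw [← sqDet_moveMatrix]
    exact sqDet_submatrix _ eC (Equiv.refl _) (Fintype.equivOfCardEq rfl)
  have hLd : Λ.det = (normalForm ρ u a b O P).det := det_submatrix_equiv_self _ _
  have hm2 : ((f.submatrix id s.C₁).submatrix ((Equiv.ofBijective _ s.bijective_edge) ∘ Sum.inl) id).det
      = s.minor₂ ρ u (place u a b O P) := rfl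
  have hm3 : (S.submatrix ((Equiv.ofBijective _ s.bijective_edge) ∘ Sum.inr)
      ((Equiv.ofBijective _ s.bijective_edge) ∘ Sum.inr)).det = s.minor₃ ρ (place u a b O P) := rfl
  rw [hD3, hR2, hB, hk11, hsT, hLd, hm2, hm3, Fintype.card_fin] at key
  have mono := h.monomial_relation hD
  have nf := h.det_normalForm
  rw [prod_volume, h.link_lengths]
  -- The common factor of the two sides, nonzero because it equals the left side of the monomial
  -- relation.
  have hQ : 4 * ((∏ i, ∏ c, cornerProd ρ u O P i c) * ((∏ i, elimPivot ρ u a b O P i) * (b 2 - a 0)) ^ 2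
        * ((O ⬝ᵥ O) * axisFace u O 0 * ((P ⬝ᵥ P) * axisFace u P 0)) ^ 2) ≠ 0 := by
    rw [← mono]
    have e0 := h.axisFace_O_ne
    have f0 := h.axisFace_P_ne
    have hc := h.axisCos_sq_ne
    have c1 : 1 - axisCos u ≠ 0 := fun e => hc (by rw [show axisCos u = 1 by linarith]; norm_num)
    have oo : O ⬝ᵥ O ≠ 0 := fun e => e0 0 (by
      rw [dotProduct_self_eq_zero.1 e]; simp [axisFace, triple])
    have pp : P ⬝ᵥ P ≠ 0 := fun e => f0 0 (by
      rw [dotProduct_self_eq_zero.1 e]; simp [axisFace, triple])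
    have hD0 : D ≠ 0 := fun e => by
      rw [e, zero_mul] at hD
      exact mul_ne_zero (mul_ne_zero (mul_ne_zero two_ne_zero c1) (mul_ne_zero oo pp))
        (mul_ne_zero (mul_ne_zero (f0 1) (e0 2)) (h.axisVol_ne.2.1 1)) hD.symm
    exact mul_ne_zero (pow_ne_zero _ hD0)
      (pow_ne_zero _ (pow_ne_zero _ (mul_ne_zero (e0 0) (f0 0))))
  refine mul_left_cancel₀ (mul_ne_zero hQ (pow_ne_zero 8 hp)) ?_
  generalize (∏ T, tetDet ρ (place u a b O P) T) = τ at *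
  generalize (∏ i, ∏ c, cornerProd ρ u O P i c) = q at *
  generalize (∏ i, a i * b i) = p at *
  generalize (∏ i, elimPivot ρ u a b O P i) = k at *
  generalize (normalForm ρ u a b O P).det = n at *
  -- The combination eliminates the determinant of the normal form and the product of the pivots;
  -- the sign `(-1)^3` of the reduction cancels the minus sign of `det_normalForm`.
  linear_combination (-(4 * τ * (b 2 - a 0) ^ 2)) * key
    + (4 * (b 2 - a 0) ^ 2 * k ^ 2 * ((O ⬝ᵥ O) * axisFace u O 0 * ((P ⬝ᵥ P) * axisFace u P 0)) ^ 2
      * s.minor₂ ρ u (place u a b O P) ^ 2) * nf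
    + (4 * (b 2 - a 0) ^ 2 * τ * s.minor₃ ρ (place u a b O P) * p ^ 8 * linkProd a b ^ 2) * mono

end TrefoilInvariant

namespace TrefoilInvariant

variable {ρ : TrefoilGroup →* SO3}
  {u : Fin 3 → Fin 3 → ℝ} {a b : Fin 3 → ℝ} {O P : Fin 3 → ℝ}

/-! ### Continuity of the minors -/

theorem continuousAt_hingeRate {M : ℝ → Fin 4 → Fin 4 → ℝ} {m : Fin 4 → Fin 4 → ℝ} {t : ℝ}
    {p q r s : Fin 4} (hM : ∀ i j, ContinuousAt (fun t => M t i j) t) (h1 : 2 * M t p q ≠ 0)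
    (h2 : 2 * M t p r * (2 * M t p q) - (M t p r + M t p q - M t q r) ^ 2 ≠ 0)
    (h3 : 2 * M t p s * (2 * M t p q) - (M t p s + M t p q - M t q s) ^ 2 ≠ 0) :
    ContinuousAt (fun t => hingeRate (M t) m p q r s) t := by
  simp only [hingeRate]
  fun_prop (disch := assumption)

variable {γ : ℝ → Vertex → Fin 3 → ℝ}

theorem continuous_liftPos (hγ : Continuous γ) (w : TrefoilGroup × Vertex) :
    Continuous fun t => liftPos ρ (γ t) w := by
  have : Continuous fun t => γ t w.2 := (continuous_apply w.2).comp hγ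
  exact continuous_const.matrix_mulVec this

theorem continuous_halfSqLength (hγ : Continuous γ) (e : Edge) :
    Continuous fun t => halfSqLength ρ (γ t) e := by
  have h := fun w => continuous_liftPos (ρ := ρ) hγ w
  exact (Continuous.dotProduct ((h _).sub (h _)) ((h _).sub (h _))).div_const 2

theorem continuous_tetDet (hγ : Continuous γ) (T : Tet) :
    Continuous fun t => tetDet ρ (γ t) T := by
  have h := fun w k => (continuous_apply (A := fun _ : Fin 3 => ℝ) k).comp
    (continuous_liftPos (ρ := ρ) hγ w)
  simp only [Function.comp_def] at h
  simp only [tetDet, tetPos, triple, Pi.sub_apply]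
  fun_prop

theorem continuous_volume (hγ : Continuous γ) (T : Tet) :
    Continuous fun t => volume ρ (γ t) T := by
  simp only [volume_eq]
  exact (continuous_const.mul (continuous_tetDet hγ T)).div_const 6

theorem eventually_general (hγ : Continuous γ) {t : ℝ} (hG : InGeneralPosition ρ (γ t)) :
    ∀ᶠ x in nhds t, InGeneralPosition ρ (γ x) :=
  Filter.eventually_all.2 fun T => (continuous_volume hγ T).continuousAt.eventually_ne (hG T)

theorem continuous_f₂ (hγ : Continuous γ) : Continuous fun t => f₂ ρ u (γ t) := by
  refine continuous_matrix fun e c => ?_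
  have h := fun w => continuous_liftPos (ρ := ρ) hγ w
  simp only [f₂_apply, edgeVar]
  exact Continuous.dotProduct ((h _).sub (h _)) continuous_const

/-- Near a configuration in general position `f₃` is given by the rational formula, whose
denominators stay away from zero there. -/
theorem continuousAt_f₃ (hγ : Continuous γ) {t : ℝ} (hE : ∀ x, IsEquivariant ρ (γ x))
    (hG : InGeneralPosition ρ (γ t)) : ContinuousAt (fun x => f₃ ρ (γ x)) t := by
  refine continuousAt_pi.2 fun e => continuousAt_pi.2 fun e' => ?_
  have key : (fun x => f₃ ρ (γ x) e e') =ᶠ[nhds t] fun x => ∑ T : Tet, ∑ k : Fin 6,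
      if tetSide T (tetPairs k).1 (tetPairs k).2.1 = e then
        tetOrientation T / tetDet ρ (γ x) T * tetHinge ρ (γ x) T (Pi.single e' 1) k else 0 := by
    filter_upwards [eventually_general hγ hG] with x hx using f₃_apply (hE x) hx e e'
  refine ContinuousAt.congr ?_ key.symm
  refine tendsto_finsetSum _ fun T _ => tendsto_finsetSum _ fun k _ => ?_
  split_ifs
  · refine ContinuousAt.mul (ContinuousAt.div continuousAt_const
      (continuous_tetDet hγ T).continuousAt (tetDet_ne_zero hG T)) ?_
    have htri := triple_tetPos_ne_zero hG T k
    have htri' : triple (tetPos ρ (γ t) T (tetPairs k).2.1 - tetPos ρ (γ t) T (tetPairs k).1)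
        (tetPos ρ (γ t) T (tetPairs k).2.2.2 - tetPos ρ (γ t) T (tetPairs k).1)
        (tetPos ρ (γ t) T (tetPairs k).2.2.1 - tetPos ρ (γ t) T (tetPairs k).1) ≠ 0 := by
      rw [triple_swap]; exact neg_ne_zero.2 htri
    unfold tetHinge
    refine continuousAt_hingeRate (fun i j => ?_) ?_ ?_ ?_
    · have h := fun w => continuous_liftPos (ρ := ρ) hγ w
      exact ((Continuous.dotProduct ((h _).sub (h _)) ((h _).sub (h _))).div_const 2).continuousAt
    · rw [distTable, two_halfSq]; exact (dot_self_pos_of_triple htri).ne'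
    · simp only [distTable, polar_halfSq, two_halfSq]; exact (lagrange_pos htri).ne'
    · simp only [distTable, polar_halfSq, two_halfSq]; exact (lagrange_pos htri').ne'
  · exact continuousAt_const

theorem continuous_minor₂ (hγ : Continuous γ) {n m k : ℕ} (s : MinorChoice n m k) :
    Continuous fun t => s.minor₂ ρ u (γ t) :=
  ((continuous_f₂ hγ).matrix_submatrix _ _).matrix_det

theorem continuousAt_minor₃ (hγ : Continuous γ) {t : ℝ} (hE : ∀ x, IsEquivariant ρ (γ x))
    (hG : InGeneralPosition ρ (γ t)) {n m k : ℕ} (s : MinorChoice n m k) :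
    ContinuousAt (fun x => s.minor₃ ρ (γ x)) t :=
  ContinuousAt.comp (f := fun x => f₃ ρ (γ x)) (g := fun A => (A.submatrix s.B₃ s.B₃).det)
    (continuous_id.matrix_submatrix _ _).matrix_det.continuousAt (continuousAt_f₃ hγ hE hG)

/-! ### Configurations in general position -/

theorem eventually_add_mul_ne_zero (x : ℝ) {y : ℝ} (hy : y ≠ 0) :
    ∀ᶠ t : ℝ in nhdsWithin 0 {0}ᶜ, x + t * y ≠ 0 := by
  by_cases hx : x = 0
  · filter_upwards [self_mem_nhdsWithin] with t ht
    rw [hx, zero_add]; exact mul_ne_zero ht hy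
  · refine Filter.Eventually.filter_mono nhdsWithin_le_nhds ?_
    have : Continuous fun t : ℝ => x + t * y := by fun_prop
    exact this.continuousAt.eventually_ne (by simpa using hx)

/-- A vector in none of the planes that contain two of the axes. -/
def transverse (u : Fin 3 → Fin 3 → ℝ) : Fin 3 → ℝ :=
  u 0 ⨯₃ u 1 + u 1 ⨯₃ u 2 + u 2 ⨯₃ u 0

theorem triple_eq_cross_dot (x y z : Fin 3 → ℝ) : triple x y z = (x ⨯₃ y) ⬝ᵥ z := by
  rw [dot3]; simp [triple, cross_apply]; ring

/-- By the Lagrange identity. The value is nonzero whenever the axes are distinct, even if they are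
coplanar, so moving in this direction leaves all three planes spanned by pairs of axes. -/
theorem IsCoherent.triple_transverse (h : IsCoherent ρ u) (i : Fin 3) :
    triple (u i) (u (i + 1)) (transverse u) = (1 - axisCos u) ^ 2 := by
  have u0 := h.unit 0
  have u1 := h.unit 1
  have u2 := h.unit 2
  have c0 := h.dot_succ 0
  have c1 := h.dot_succ 1
  have c2 := h.dot_succ 2
  simp only [Fin.reduceAdd, zero_add] at c0 c1 c2
  rw [triple_eq_cross_dot, transverse]
  fin_cases i <;> simp only [Fin.reduceAdd, zero_add, Fin.zero_eta, Fin.mk_one, Fin.reduceFinMk,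
    dotProduct_add, cross_dot_cross, u0, u1, u2, c0, c1, c2, dotProduct_comm (u 1) (u 0),
    dotProduct_comm (u 2) (u 1), dotProduct_comm (u 0) (u 2)] <;> ring

/-- The value of the invariant in terms of the minors. -/
theorem IsCoherent.minor_relation (h : IsCoherent ρ u) (hc : axisCos u ^ 2 ≠ 1)
    (hG : InGeneralPosition ρ (place u a b O P)) (s : MinorChoice 0 12 20) :
    s.minor₂ ρ u (place u a b O P) ^ 2 * (2 - 2 * rotCos u) ^ 6
      = 4 * s.minor₃ ρ (place u a b O P) * ((∏ i,
        (2 * halfSqLength ρ (place u a b O P) (.linkOut i))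
          * (2 * halfSqLength ρ (place u a b O P) (.linkIn i)))
        * ∏ T, (-6 * volume ρ (place u a b O P) T)) := by
  set g := transverse u
  -- Each genericity condition is an affine function of `t` with nonzero slope along this line, so
  -- it holds for small nonzero `t`.
  set γ : ℝ → Vertex → Fin 3 → ℝ := fun t =>
    place u (fun i => a i + t * 1) (fun i => b i + t * 1) (O + t • g) (P + t • g) with hγd
  have hγ : Continuous γ := by
    refine continuous_pi fun v => ?_
    cases v <;> simp only [hγd, place] <;> fun_prop
  have h0 : γ 0 = place u a b O P := by simp [hγd]
  have hE : ∀ x, IsEquivariant ρ (γ x) := fun x => h.equivariant _ _ _ _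
  have hG0 : InGeneralPosition ρ (γ 0) := by rw [h0]; exact hG
  rw [← h0]
  have cL : ContinuousAt (fun t => s.minor₂ ρ u (γ t) ^ 2 * (2 - 2 * rotCos u) ^ 6) 0 :=
    (((continuous_minor₂ hγ s).pow 2).mul continuous_const).continuousAt
  have cR : ContinuousAt (fun t => 4 * s.minor₃ ρ (γ t) * ((∏ i,
        (2 * halfSqLength ρ (γ t) (.linkOut i)) * (2 * halfSqLength ρ (γ t) (.linkIn i)))
        * ∏ T, (-6 * volume ρ (γ t) T))) 0 := by
    refine (continuousAt_const.mul (continuousAt_minor₃ hγ hE hG0 s)).mul (Continuous.continuousAt ?_)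
    refine (continuous_finsetProd _ fun i _ => ?_).mul (continuous_finsetProd _ fun T _ => ?_)
    · exact (continuous_const.mul (continuous_halfSqLength hγ _)).mul
        (continuous_const.mul (continuous_halfSqLength hγ _))
    · exact continuous_const.mul (continuous_volume hγ T)
  have c1 : (1 - axisCos u) ^ 2 ≠ 0 := pow_ne_zero _ fun e =>
    hc (by rw [show axisCos u = 1 by linarith]; norm_num)
  have htr : ∀ i (x : Fin 3 → ℝ) (t : ℝ), triple (u i) (u (i + 1)) (x + t • g)
      = triple (u i) (u (i + 1)) x + t * (1 - axisCos u) ^ 2 := fun i x t => by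
    rw [← h.triple_transverse i]
    simp only [triple, Pi.add_apply, Pi.smul_apply, smul_eq_mul]; ring
  have ev : (fun t => s.minor₂ ρ u (γ t) ^ 2 * (2 - 2 * rotCos u) ^ 6)
      =ᶠ[nhdsWithin 0 {0}ᶜ] fun t => 4 * s.minor₃ ρ (γ t) * ((∏ i,
        (2 * halfSqLength ρ (γ t) (.linkOut i)) * (2 * halfSqLength ρ (γ t) (.linkIn i)))
        * ∏ T, (-6 * volume ρ (γ t) T)) := by
    filter_upwards [nhdsWithin_le_nhds (eventually_general hγ hG0),
      Filter.eventually_all.2 fun i => eventually_add_mul_ne_zero (a i) one_ne_zero,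
      Filter.eventually_all.2 fun i => eventually_add_mul_ne_zero (b i) one_ne_zero,
      Filter.eventually_all.2 fun i : Fin 3 =>
        eventually_add_mul_ne_zero (triple (u i) (u (i + 1)) O) c1,
      Filter.eventually_all.2 fun i : Fin 3 =>
        eventually_add_mul_ne_zero (triple (u i) (u (i + 1)) P) c1] with t hg ha hb he hf
    exact IsGeneric.minor_relation ⟨h, hg, ha, hb, fun i => by rw [htr]; exact he i,
      fun i => by rw [htr]; exact hf i⟩ s
  -- The relation is polynomial in the minors, lengths and volumes, so it passes to the limit at `t
  -- = 0`.
  exact tendsto_nhds_unique_of_eventuallyEq (cL.tendsto.mono_left nhdsWithin_le_nhds)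
    (cR.tendsto.mono_left nhdsWithin_le_nhds) ev

end TrefoilInvariant

namespace TrefoilInvariant

variable {ρ : TrefoilGroup →* SO3}
  {u : Fin 3 → Fin 3 → ℝ} {a b : Fin 3 → ℝ} {O P : Fin 3 → ℝ}

/-! ### Infinitesimal rigidity -/

section

variable {α β d q : Fin 3 → ℝ}
  (h0 : edgeVar ρ (place u a b O P) (place u α β d q) = 0)

include h0

theorem edgeVar_eq_zero_AO (i : Fin 3) : (a i • u i - O) ⬝ᵥ (α i • u i - d) = 0 := by
  have := congrFun h0 (.AO₁ i)
  simpa only [edgeVar, edgeEnds, liftPos_one, place, Pi.zero_apply] using this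

theorem edgeVar_eq_zero_BO (i : Fin 3) : (b i • u (i + 1) - O) ⬝ᵥ (β i • u (i + 1) - d) = 0 := by
  have := congrFun h0 (.BO i)
  simpa only [edgeVar, edgeEnds, liftPos_one, place, Pi.zero_apply] using this

theorem edgeVar_eq_zero_AP (i : Fin 3) : (a i • u i - P) ⬝ᵥ (α i • u i - q) = 0 := by
  have := congrFun h0 (.AP i)
  simpa only [edgeVar, edgeEnds, liftPos_one, place, Pi.zero_apply] using this

theorem edgeVar_eq_zero_BP (i : Fin 3) : (b i • u (i + 1) - P) ⬝ᵥ (β i • u (i + 1) - q) = 0 := by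
  have := congrFun h0 (.BP₁ i)
  simpa only [edgeVar, edgeEnds, liftPos_one, place, Pi.zero_apply] using this

theorem edgeVar_eq_zero_OP : (O - P) ⬝ᵥ (d - q) = 0 := by
  have := congrFun h0 (.OP .exterior)
  simpa only [edgeVar, edgeEnds, liftPos_one, place, regionLabel, Pi.zero_apply] using this

end

/-- Two points of one axis move along it with the same speed `δ` and keep their distances to `v`;
the difference of the conditions fixes the axial velocity of `v`. -/
theorem dot_of_two_points {x v w : Fin 3 → ℝ} {s t δ : ℝ} (hx : x ⬝ᵥ x = 1) (hst : s ≠ t)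
    (h1 : (s • x - v) ⬝ᵥ (δ • x - w) = 0) (h2 : (t • x - v) ⬝ᵥ (δ • x - w) = 0) :
    x ⬝ᵥ w = δ ∧ v ⬝ᵥ w = δ * (x ⬝ᵥ v) := by
  simp only [sub_dotProduct, dotProduct_sub, smul_dotProduct, dotProduct_smul, smul_eq_mul, hx,
    dotProduct_comm v x] at h1 h2
  have h3 : (s - t) * (δ - x ⬝ᵥ w) = 0 := by linear_combination h1 - h2
  have h4 : δ - x ⬝ᵥ w = 0 := (mul_eq_zero.1 h3).resolve_left (sub_ne_zero.2 hst)
  exact ⟨by linarith, by linear_combination h1 - s * h4⟩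

/-- `rotSin u` is proportional to the triple product of the axes, so its nonvanishing means that
they span 3-space. -/
theorem IsCoherent.eq_zero_of_dot (h : IsCoherent ρ u) (hc : axisCos u ^ 2 ≠ 1)
    (hS : rotSin u ≠ 0) {w : Fin 3 → ℝ} (hw : ∀ i, u i ⬝ᵥ w = 0) : w = 0 := by
  have h2 := h.axis_add_two hc 0
  simp only [zero_add] at h2
  have := hw 2
  rw [h2] at this
  simp only [add_dotProduct, smul_dotProduct, hw, add_zero, mul_zero, zero_add, smul_eq_mul,
    ← triple_eq_cross_dot, mul_eq_zero, hS, false_or] at this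
  refine eq_of_dot_eq (x := u 0) (y := u 1) ?_ ?_ ?_ ?_
  · rw [h.unit, h.unit, ← axisCos]; simpa using hc
  · rw [hw, dotProduct_zero]
  · rw [hw, dotProduct_zero]
  · rw [this]; simp [triple]

theorem IsCoherent.sum_dot (h : IsCoherent ρ u) (i : Fin 3) :
    u i ⬝ᵥ (u 0 + u 1 + u 2) = 1 + 2 * axisCos u := by
  have u0 := h.unit 0
  have u1 := h.unit 1
  have u2 := h.unit 2
  have c0 := h.dot_succ 0
  have c1 := h.dot_succ 1
  have c2 := h.dot_succ 2
  simp only [Fin.reduceAdd, zero_add] at c0 c1 c2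
  fin_cases i <;> simp only [Fin.zero_eta, Fin.mk_one, Fin.reduceFinMk,
    dotProduct_add, u0, u1, u2, c0, c1, c2, dotProduct_comm (u 1) (u 0),
    dotProduct_comm (u 2) (u 1), dotProduct_comm (u 0) (u 2)] <;> ring

theorem IsCoherent.smul_eq_of_dot (h : IsCoherent ρ u) (hc : axisCos u ^ 2 ≠ 1)
    (hS : rotSin u ≠ 0) {w : Fin 3 → ℝ} {δ : ℝ} (hw : ∀ i, u i ⬝ᵥ w = δ) :
    (1 + 2 * axisCos u) • w = δ • (u 0 + u 1 + u 2) := by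
  refine sub_eq_zero.1 (h.eq_zero_of_dot hc hS fun i => ?_)
  rw [dotProduct_sub, dotProduct_smul, dotProduct_smul, hw, h.sum_dot]
  simp only [smul_eq_mul]; ring

theorem IsCoherent.rotSin_sq_mul (h : IsCoherent ρ u) (hc : axisCos u ^ 2 ≠ 1) :
    rotSin u ^ 2 * (1 + axisCos u) ^ 2 = 1 + 2 * axisCos u := by
  have c1 : 1 + axisCos u ≠ 0 := fun e => hc (by rw [show axisCos u = -1 by linarith]; norm_num)
  rw [h.rotSin_sq hc, rotCos]
  field_simp
  ring

theorem triple_eq_zero_of_orthogonal {n x y z : Fin 3 → ℝ} (hn : n ≠ 0) (hx : n ⬝ᵥ x = 0)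
    (hy : n ⬝ᵥ y = 0) (hz : n ⬝ᵥ z = 0) : triple x y z = 0 := by
  have key : n ⬝ᵥ n * triple x y z
      = n ⬝ᵥ x * triple n y z + n ⬝ᵥ y * triple x n z + n ⬝ᵥ z * triple x y n := by
    simp only [triple, dot3]; ring
  rw [hx, hy, hz] at key
  have hn' : n ⬝ᵥ n ≠ 0 := fun e => hn (dotProduct_self_eq_zero.1 e)
  refine (mul_eq_zero.1 (key.trans ?_)).resolve_left hn'
  ring

theorem IsCoherent.exists_smul_cross (h : IsCoherent ρ u) (hc : axisCos u ^ 2 ≠ 1)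
    {w : Fin 3 → ℝ} (h0 : u 0 ⬝ᵥ w = 0) (h1 : u 1 ⬝ᵥ w = 0) : ∃ t : ℝ, w = t • (u 0 ⨯₃ u 1) := by
  have c1 : 1 - axisCos u ^ 2 ≠ 0 := fun e => hc (by linarith)
  refine ⟨triple (u 0) (u 1) w / (1 - axisCos u ^ 2), eq_of_dot_eq (x := u 0) (y := u 1) ?_ ?_ ?_ ?_⟩
  · rw [h.unit, h.unit, ← axisCos]; simpa using hc
  · rw [h0, dotProduct_smul, dot_self_cross, smul_zero]
  · rw [h1, dotProduct_smul, dot_cross_self, smul_zero]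
  · have hl : ∀ (x y z : Fin 3 → ℝ) (t : ℝ), triple x y (t • z) = t * triple x y z := by
      intro x y z t
      simp only [triple, Pi.smul_apply, smul_eq_mul]; ring
    rw [hl, triple_cross_self, h.unit, h.unit, ← axisCos]
    field_simp

/-- Infinitesimal rigidity of the equivariant configuration. The link edges force all link vertices
to move with one speed `δ`, and the edges to `O` and `P` then fix the components of their velocities
along all axes. The cases of coplanar and of independent axes need different arguments. -/
theorem IsCoherent.displacement_eq_zero (h : IsCoherent ρ u) (hc : axisCos u ^ 2 ≠ 1)
    (hG : InGeneralPosition ρ (place u a b O P)) {α β d q : Fin 3 → ℝ}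
    (h0 : edgeVar ρ (place u a b O P) (place u α β d q) = 0) :
    α = 0 ∧ β = 0 ∧ d = 0 ∧ q = 0 := by
  have hab : ∀ i, ∀ s : Side, a i - b (s.lower i) ≠ 0 := fun i s => by
    have := tetDet_ne_zero hG (s.tetPlus i)
    rw [h.tetDet_tetPlus] at this
    rw [← neg_sub]; exact neg_ne_zero.2 (mul_ne_zero_iff.1 this).1
  have hV : triple (u 0) O P ≠ 0 := by
    have := tetDet_ne_zero hG (Side.out.tetPlus 0)
    rw [h.tetDet_tetPlus] at this
    have := (mul_ne_zero_iff.1 this).2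
    simpa [axisVol, regionPos, Side.regionPlus, regionLabel] using this
  have hl : ∀ i, ∀ s : Side, α i = β (s.lower i) := fun i s => by
    have := congrFun h0 (s.link i)
    rw [h.edgeVar_link] at this
    exact sub_eq_zero.1 ((mul_eq_zero.1 this).resolve_left (hab i s))
  have l1 := hl 0 .out
  have l2 := hl 0 .inn
  have l3 := hl 1 .out
  have l4 := hl 1 .inn
  have l5 := hl 2 .out
  have l6 := hl 2 .inn
  simp only [Side.lower, Fin.reduceAdd, zero_add] at l1 l2 l3 l4 l5 l6
  set δ := α 0 with hδ
  have hα : ∀ i, α i = δ := by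
    intro i; fin_cases i
    · rfl
    · exact (l3.trans l6.symm).trans (l5.trans l2.symm)
    · exact l5.trans l2.symm
  have hβ : ∀ i, β i = δ := by
    intro i
    have := hl (i + 1) .out
    rw [hα] at this
    rw [this, Side.lower, fin3_b]
  have hd : ∀ i, u i ⬝ᵥ d = δ ∧ O ⬝ᵥ d = δ * (u i ⬝ᵥ O) := fun i => by
    have h1 := edgeVar_eq_zero_AO h0 i
    have h2 := edgeVar_eq_zero_BO h0 (i + 2)
    rw [fin3_d, hβ] at h2
    rw [hα] at h1
    exact dot_of_two_points (h.unit i) (sub_ne_zero.1 (hab i .out)) h1 h2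
  have hq : ∀ i, u i ⬝ᵥ q = δ ∧ P ⬝ᵥ q = δ * (u i ⬝ᵥ P) := fun i => by
    have h1 := edgeVar_eq_zero_AP h0 i
    have h2 := edgeVar_eq_zero_BP h0 (i + 2)
    rw [fin3_d, hβ] at h2
    rw [hα] at h1
    exact dot_of_two_points (h.unit i) (sub_ne_zero.1 (hab i .out)) h1 h2
  have hop := edgeVar_eq_zero_OP h0
  have hSq := h.rotSin_sq_mul hc
  have hc1 : axisCos u - 1 ≠ 0 := fun e => hc (by rw [show axisCos u = 1 by linarith]; norm_num)
  suffices δ = 0 ∧ d = 0 ∧ q = 0 from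
    ⟨funext fun i => (hα i).trans this.1, funext fun i => (hβ i).trans this.1, this.2⟩
  -- If the axes are coplanar, then `c = -1/2` and `u 2 = -(u 0 + u 1)`, so `δ = -2δ`. The points
  -- `O` and `P` could still move along the common normal, and the edge `OP` excludes this.
  by_cases hS : rotSin u = 0
  · have hk : 1 + 2 * axisCos u = 0 := by rw [← hSq, hS]; ring
    have h2 := h.axis_add_two hc 0
    simp only [zero_add, hS, zero_smul, add_zero] at h2
    have hC : rotCos u = -1 := by
      rw [rotCos, show axisCos u = -1 / 2 by linarith]; norm_num
    rw [hC] at h2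
    have hδ0 : δ = 0 := by
      have := (hd 2).1
      rw [h2, smul_dotProduct, add_dotProduct, (hd 0).1, (hd 1).1, smul_eq_mul] at this
      linarith
    simp only [hδ0, zero_mul] at hd hq
    obtain ⟨l, rfl⟩ := h.exists_smul_cross hc (hd 0).1 (hd 1).1
    obtain ⟨m, rfl⟩ := h.exists_smul_cross hc (hq 0).1 (hq 1).1
    set n := u 0 ⨯₃ u 1 with hn
    have hn0 : n ≠ 0 := fun e => by
      have := triple_cross_self (u 0) (u 1)
      rw [← hn, e, h.unit, h.unit, ← axisCos] at this
      exact hc (by simp [triple] at this; linarith)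
    have e1 : l * (O ⬝ᵥ n) = 0 := by simpa only [dotProduct_smul, smul_eq_mul] using (hd 0).2
    have e2 : m * (P ⬝ᵥ n) = 0 := by simpa only [dotProduct_smul, smul_eq_mul] using (hq 0).2
    have e3 : m * (O ⬝ᵥ n) + l * (P ⬝ᵥ n) = 0 := by
      simp only [sub_dotProduct, dotProduct_sub, dotProduct_smul, smul_eq_mul] at hop
      linear_combination e1 + e2 - hop
    have hcop : ¬ (O ⬝ᵥ n = 0 ∧ P ⬝ᵥ n = 0) := fun e => hV (triple_eq_zero_of_orthogonal hn0
      (by rw [dotProduct_comm, hn, dot_self_cross]) (by rw [dotProduct_comm, e.1])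
      (by rw [dotProduct_comm, e.2]))
    have hl0 : l = 0 := by
      by_contra hl0
      have e4 := (mul_eq_zero.1 e1).resolve_left hl0
      rw [e4, mul_zero, zero_add] at e3
      exact hcop ⟨e4, (mul_eq_zero.1 e3).resolve_left hl0⟩
    have hm0 : m = 0 := by
      by_contra hm0
      have e4 := (mul_eq_zero.1 e2).resolve_left hm0
      rw [e4, mul_zero, add_zero] at e3
      exact hcop ⟨(mul_eq_zero.1 e3).resolve_left hm0, e4⟩
    exact ⟨hδ0, by rw [hl0, zero_smul], by rw [hm0, zero_smul]⟩
  · have hk : 1 + 2 * axisCos u ≠ 0 := by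
      rw [← hSq]
      exact mul_ne_zero (pow_ne_zero _ hS) (pow_ne_zero _ fun e =>
        hc (by rw [show axisCos u = -1 by linarith]; norm_num))
    have hδ0 : δ = 0 := by
      -- If `δ` were nonzero, both `O` and its velocity would be multiples of `u 0 + u 1 + u 2`. The
      -- two values of their inner product agree only for `O = 0`, where the volumes vanish.
      by_contra hδ0
      have hO : ∀ i, u i ⬝ᵥ O = u 0 ⬝ᵥ O := fun i =>
        mul_left_cancel₀ hδ0 ((hd i).2.symm.trans (hd 0).2)
      have e1 := h.smul_eq_of_dot hc hS fun i => (hd i).1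
      have e2 := h.smul_eq_of_dot hc hS hO
      have e3 : (1 + 2 * axisCos u) • d ⬝ᵥ O = δ * (3 * (u 0 ⬝ᵥ O)) := by
        rw [e1, smul_dotProduct, add_dotProduct, add_dotProduct, hO 1, hO 2, smul_eq_mul]; ring
      rw [smul_dotProduct, dotProduct_comm, (hd 0).2, smul_eq_mul] at e3
      have e4 : δ * (axisCos u - 1) * (u 0 ⬝ᵥ O) = 0 := by linear_combination e3 / 2
      have e5 := (mul_eq_zero.1 e4).resolve_left (mul_ne_zero hδ0 hc1)
      rw [e5, zero_smul] at e2
      have e6 := (smul_eq_zero.1 e2).resolve_left hk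
      exact hV (by rw [e6]; simp [triple])
    simp only [hδ0] at hd hq
    exact ⟨hδ0, h.eq_zero_of_dot hc hS fun i => (hd i).1, h.eq_zero_of_dot hc hS fun i => (hq i).1⟩

theorem IsCoherent.f₂_injective (h : IsCoherent ρ u) (hc : axisCos u ^ 2 ≠ 1)
    (hG : InGeneralPosition ρ (place u a b O P)) :
    Function.Injective (f₂ ρ u (place u a b O P)).mulVec := by
  refine (injective_iff_map_eq_zero (f₂ ρ u (place u a b O P)).mulVecLin).2 fun t ht => ?_
  rw [mulVecLin_apply, f₂_mulVec] at ht
  obtain ⟨h1, h2, h3, h4⟩ := h.displacement_eq_zero hc hG ht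
  ext c
  cases c with
  | a i => exact congrFun h1 i
  | b i => exact congrFun h2 i
  | o i => exact congrFun h3 i
  | p i => exact congrFun h4 i

end TrefoilInvariant

namespace TrefoilInvariant

variable {ρ : TrefoilGroup →* SO3}
  {u : Fin 3 → Fin 3 → ℝ} {a b : Fin 3 → ℝ} {O P : Fin 3 → ℝ}

/-! ### The invariant -/

/-- The rows of a matrix of full column rank span, so a basis can be selected among them. -/
theorem exists_rows_det_ne_zero {m n : Type*} [Fintype m] [Fintype n] {k : ℕ}
    (A : Matrix m n ℝ) (hA : Function.Injective A.mulVec) (e : Fin k ≃ n) :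
    ∃ r : Fin k → m, Function.Injective r ∧ (A.submatrix r e).det ≠ 0 := by
  classical
  have hr : Module.finrank ℝ (Submodule.span ℝ (Set.range A.row)) = k := by
    rw [← rank_eq_finrank_span_row, rank, LinearMap.finrank_range_of_inj hA,
      Module.finrank_fintype_fun_eq_card, ← Fintype.card_congr e, Fintype.card_fin]
  have key := Submodule.exists_fun_fin_finrank_span_eq ℝ (Set.range A.row)
  rw [hr] at key
  obtain ⟨f, hf, -, hi⟩ := key
  choose r hrf using hf
  have hrow : f = A.row ∘ r := funext fun i => (hrf i).symm
  refine ⟨r, fun i j hij => hi.injective (by rw [← hrf, ← hrf, hij]), ?_⟩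
  rw [← isUnit_iff_ne_zero, ← isUnit_iff_isUnit_det, ← linearIndependent_rows_iff_isUnit]
  rw [hrow] at hi
  exact hi.map' (LinearMap.funLeft ℝ ℝ e)
    (LinearMap.ker_eq_bot.2 (LinearMap.funLeft_injective_of_surjective ℝ ℝ e e.surjective))

theorem exists_complement_bijective {m : Type*} [Fintype m] {k l : ℕ} (r : Fin k → m)
    (hr : Function.Injective r) (hm : Fintype.card m = k + l) :
    ∃ g : Fin l → m, Function.Bijective (Sum.elim r g) := by
  classical
  have hcard : Fintype.card {x : m // x ∉ Set.range r} = l := by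
    rw [Fintype.card_subtype_compl, hm, Fintype.card_congr (Equiv.ofInjective r hr).symm,
      Fintype.card_fin, Nat.add_sub_cancel_left]
  have e := (Fintype.equivFinOfCardEq hcard).symm
  refine ⟨fun i => e i, ?_⟩
  rw [Fintype.bijective_iff_injective_and_card]
  refine ⟨?_, by simp [hm]⟩
  refine hr.sumElim (Subtype.val_injective.comp e.injective) fun i j hij => (e j).2 ⟨i, hij⟩

/-- A choice of subsets of the bases with a nonzero minor of `f₂`. -/
theorem exists_minorChoice (Γ : Vertex → Fin 3 → ℝ) (h : Function.Injective (f₂ ρ u Γ).mulVec) :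
    ∃ s : MinorChoice 0 12 20, s.minor₂ ρ u Γ ≠ 0 := by
  have e : Fin 12 ≃ Coord := Fintype.equivOfCardEq rfl
  obtain ⟨r, hr, hd⟩ := exists_rows_det_ne_zero _ h e
  obtain ⟨g, hg⟩ := exists_complement_bijective (l := 20) r hr rfl
  refine ⟨⟨Fin.elim0, e, r, g, ⟨?_, fun c => ⟨.inr (e.symm c), by simp⟩⟩, hg⟩, hd⟩
  rintro (x | x) (y | y) hxy
  · exact x.elim0
  · exact x.elim0
  · exact y.elim0
  · exact congrArg _ (e.injective hxy)

theorem one_sub_rotCos_ne_zero (h : axisCos u ^ 2 ≠ 1) : 1 - rotCos u ≠ 0 := by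
  have c1 : 1 + axisCos u ≠ 0 := fun e => h (by rw [show axisCos u = -1 by linarith]; norm_num)
  rw [rotCos, one_sub_div c1, add_sub_cancel_right]
  exact one_div_ne_zero c1

/-- Since the rotation angle is not a multiple of a full turn, `1 - rotCos u = 1/(1 + c)` being
nonzero, a fixed vector attains equality in the Cauchy–Schwarz inequality with the axis. -/
theorem IsCoherent.eq_smul_of_fixed (h : IsCoherent ρ u) (hc : axisCos u ^ 2 ≠ 1) {i : Fin 3}
    {v : Fin 3 → ℝ} (hv : (ρ (wirt i) : Matrix (Fin 3) (Fin 3) ℝ) *ᵥ v = v) :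
    v = (u i ⬝ᵥ v) • u i := by
  have h1 := congrArg (fun w => w ⬝ᵥ v) (h.rodrigues hc i v)
  simp only [hv, add_dotProduct, smul_dotProduct, smul_eq_mul] at h1
  rw [dotProduct_comm (u i ⨯₃ v), dot_cross_self] at h1
  have h2 : (1 - rotCos u) * (v ⬝ᵥ v - (u i ⬝ᵥ v) ^ 2) = 0 := by linear_combination h1
  have h3 := (mul_eq_zero.1 h2).resolve_left (one_sub_rotCos_ne_zero hc)
  refine sub_eq_zero.1 (dotProduct_self_eq_zero.1 ?_)
  simp only [sub_dotProduct, dotProduct_sub, smul_dotProduct, dotProduct_smul, smul_eq_mul, h.unit,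
    dotProduct_comm v (u i)]
  linear_combination h3

theorem IsCoherent.eq_place (h : IsCoherent ρ u) (hc : axisCos u ^ 2 ≠ 1)
    {Γ : Vertex → Fin 3 → ℝ} (hE : IsEquivariant ρ Γ) :
    Γ = place u (fun i => u i ⬝ᵥ Γ (.A i)) (fun i => u (i + 1) ⬝ᵥ Γ (.B i)) (Γ .O) (Γ .P) := by
  funext v
  cases v with
  | A i => exact h.eq_smul_of_fixed hc (hE i).1
  | B i => exact h.eq_smul_of_fixed hc (hE i).2
  | O => rfl
  | P => rfl

/-- The change of the basis of `(dx)` for the directing vectors `ε i • u i` instead of `u i`. -/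
def coordSign (ε : Fin 3 → ℝ) : Coord → ℝ
  | .a i => ε i
  | .b i => ε (i + 1)
  | .o _ => 1
  | .p _ => 1

/-- An arbitrary family of directing vectors differs from a coherent one by signs; these multiply
columns of `f₂` and disappear in the square of the minor. -/
theorem f₂_smul (ε : Fin 3 → ℝ) (Γ : Vertex → Fin 3 → ℝ) :
    f₂ ρ (fun i => ε i • u i) Γ = f₂ ρ u Γ * diagonal (coordSign ε) := by
  have key : ∀ t : Coord → ℝ, f₂ ρ (fun i => ε i • u i) Γ *ᵥ t
      = (f₂ ρ u Γ * diagonal (coordSign ε)) *ᵥ t := fun t => by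
    rw [← mulVec_mulVec, f₂_mulVec, f₂_mulVec]
    congr 1
    funext v
    cases v <;> simp [displace, place, mulVec_diagonal, coordSign, smul_smul, mul_comm]
  ext e c
  have := congrFun (key (Pi.single c 1)) e
  simpa only [mulVec_single_one, col_apply] using this

theorem coordSign_sq {ε : Fin 3 → ℝ} (hε : ∀ i, ε i ^ 2 = 1) (c : Coord) : coordSign ε c ^ 2 = 1 := by
  cases c <;> simp [coordSign, hε]

theorem MinorChoice.minor₂_smul_sq {n m k : ℕ} (s : MinorChoice n m k) {ε : Fin 3 → ℝ}
    (hε : ∀ i, ε i ^ 2 = 1) (Γ : Vertex → Fin 3 → ℝ) :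
    s.minor₂ ρ (fun i => ε i • u i) Γ ^ 2 = s.minor₂ ρ u Γ ^ 2 := by
  have : (f₂ ρ u Γ * diagonal (coordSign ε)).submatrix s.B₂ s.C₁
      = (f₂ ρ u Γ).submatrix s.B₂ s.C₁ * diagonal (coordSign ε ∘ s.C₁) := by
    ext i j; simp [mul_diagonal]
  rw [minor₂, f₂_smul, this, det_mul, det_diagonal, mul_pow, ← Finset.prod_pow]
  simp only [Function.comp_apply, coordSign_sq hε, Finset.prod_const_one, mul_one]
  rfl

theorem f₂_smul_injective {ε : Fin 3 → ℝ} (hε : ∀ i, ε i ^ 2 = 1) {Γ : Vertex → Fin 3 → ℝ}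
    (h : Function.Injective (f₂ ρ u Γ).mulVec) :
    Function.Injective (f₂ ρ (fun i => ε i • u i) Γ).mulVec := by
  intro t t' ht
  simp only [f₂_smul, ← mulVec_mulVec] at ht
  have := h ht
  ext c
  have := congrFun this c
  simp only [mulVec_diagonal] at this
  exact mul_left_cancel₀ (fun e => by simpa [e] using coordSign_sq hε c) this

theorem IsCoherent.exists_sign (h : IsCoherent ρ u) (hc : axisCos u ^ 2 ≠ 1)
    {u' : Fin 3 → Fin 3 → ℝ} (hu : IsAxisFamily ρ u') :
    ∃ ε : Fin 3 → ℝ, (∀ i, ε i ^ 2 = 1) ∧ u' = fun i => ε i • u i := by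
  have e := fun i => h.eq_smul_of_fixed hc (hu i).2
  refine ⟨fun i => u i ⬝ᵥ u' i, fun i => ?_, funext e⟩
  have := (hu i).1
  rw [e i, smul_dotProduct, dotProduct_smul, h.unit] at this
  simpa [pow_two] using this

/-- Coherent axes give the relation between the minors for every choice; it remains to transfer it
to the given axes and to divide. -/
theorem IsCoherent.invariant_eq (h : IsCoherent ρ u) (hc : axisCos u ^ 2 ≠ 1)
    (hbot : centralizerAlgebra ρ = ⊥) {φ₁ : ℝ} (hφ : Real.cos φ₁ = rotCos u)
    {u' : Fin 3 → Fin 3 → ℝ} (hu : IsAxisFamily ρ u') {Γ : Vertex → Fin 3 → ℝ}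
    (hE : IsEquivariant ρ Γ) (hG : InGeneralPosition ρ Γ) :
    (∃ (β : Module.Basis (Fin 0) ℝ (centralizerAlgebra ρ)) (s : MinorChoice 0 12 20),
      s.Nondegenerate ρ u' Γ β) ∧
    ∀ (β : Module.Basis (Fin 0) ℝ (centralizerAlgebra ρ)) (s : MinorChoice 0 12 20),
      s.Nondegenerate ρ u' Γ β → s.invariant ρ u' Γ β φ₁ = 4 := by
  obtain ⟨ε, hε, rfl⟩ := h.exists_sign hc hu
  have hpl := h.eq_place hc hE
  have hG' := hG
  rw [hpl] at hG'
  have hinj : Function.Injective (f₂ ρ u Γ).mulVec := by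
    rw [hpl]; exact h.f₂_injective hc hG'
  have hinj' := f₂_smul_injective hε hinj
  have rel : ∀ s : MinorChoice 0 12 20, s.minor₂ ρ (fun i => ε i • u i) Γ ^ 2
      * (2 - 2 * Real.cos φ₁) ^ 6 = 4 * s.minor₃ ρ Γ * ((∏ i, (2 * halfSqLength ρ Γ (.linkOut i))
        * (2 * halfSqLength ρ Γ (.linkIn i))) * ∏ T, (-6 * volume ρ Γ T)) := fun s => by
    have := h.minor_relation hc hG' s
    rw [← hpl] at this
    rw [s.minor₂_smul_sq hε, hφ, this]
  have hφ1 : (2 - 2 * Real.cos φ₁) ^ 6 ≠ 0 := pow_ne_zero _ fun e =>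
    one_sub_rotCos_ne_zero hc (by rw [← hφ]; linarith)
  have m1 : ∀ (β : Module.Basis (Fin 0) ℝ (centralizerAlgebra ρ)) (s : MinorChoice 0 12 20),
      s.minor₁ ρ (fun i => ε i • u i) Γ β = 1 := fun β s => det_isEmpty
  have hrank : (f₂ ρ (fun i => ε i • u i) Γ).rank = 12 := by
    rw [rank, LinearMap.finrank_range_of_inj hinj', Module.finrank_fintype_fun_eq_card]; rfl
  constructor
  · have : Subsingleton (centralizerAlgebra ρ) := (Submodule.subsingleton_iff_eq_bot).2 hbot
    -- A nonzero minor of `f₂` is enough: if the minor of `f₃` vanished, the relation would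
    -- contradict `2 - 2 cos φ₁ ≠ 0`.
    obtain ⟨s, hs⟩ := exists_minorChoice Γ hinj'
    refine ⟨Module.Basis.empty _, s, by rw [m1]; exact one_ne_zero, hs, fun e => ?_⟩
    have := rel s
    rw [e, mul_zero, zero_mul] at this
    exact mul_ne_zero (pow_ne_zero 2 hs) hφ1 this
  · intro β s hs
    have hN : (∏ i, (2 * halfSqLength ρ Γ (.linkOut i)) * (2 * halfSqLength ρ Γ (.linkIn i)))
        * ∏ T, (-6 * volume ρ Γ T) ≠ 0 := by
      have hL := halfSqLength_pos' hE hG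
      refine mul_ne_zero (Finset.prod_ne_zero_iff.2 fun i _ => ?_)
        (Finset.prod_ne_zero_iff.2 fun T _ => mul_ne_zero (by norm_num) (hG T))
      exact mul_ne_zero (mul_ne_zero two_ne_zero (hL _).ne') (mul_ne_zero two_ne_zero (hL _).ne')
    have h3 := hs.2.2
    -- The rank of `f₂` is 12, so the sign in the torsion is `+1`.
    rw [MinorChoice.invariant, MinorChoice.torsion, m1, hrank, one_pow, mul_one,
      Even.neg_one_pow (by decide), mul_one, div_mul_div_comm, div_eq_iff (mul_ne_zero h3 hN), rel]
    ring

end TrefoilInvariant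

namespace TrefoilInvariant

variable {ρ : TrefoilGroup →* SO3} {u : Fin 3 → Fin 3 → ℝ}

/-! ### Rotations -/

theorem rotation_mulVec (n : Fin 3 → ℝ) (θ : ℝ) (v : Fin 3 → ℝ) : rotation n θ *ᵥ v
    = Real.cos θ • v + Real.sin θ • (n ⨯₃ v) + ((1 - Real.cos θ) * (n ⬝ᵥ v)) • n := by
  ext i
  simp only [cross_apply, Pi.add_apply, Pi.smul_apply, smul_eq_mul, dot3]
  fin_cases i <;> simp [rotation, mulVec, dot3, vecMulVec_apply] <;> ring

theorem rotation_pi (n : Fin 3 → ℝ) : rotation n Real.pi = (2 : ℝ) • vecMulVec n n - 1 := by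
  rw [rotation, Real.cos_pi, Real.sin_pi, zero_smul, add_zero, neg_one_smul]
  norm_num
  abel

theorem trace_rotation {n : Fin 3 → ℝ} (hn : n ⬝ᵥ n = 1) (θ : ℝ) :
    (rotation n θ).trace = 1 + 2 * Real.cos θ := by
  simp [rotation, trace_fin_three]
  linear_combination (1 - Real.cos θ) * hn

theorem matrix_ext_mulVec {M N : Matrix (Fin 3) (Fin 3) ℝ} (h : ∀ v, M *ᵥ v = N *ᵥ v) : M = N := by
  ext i j
  have := congrFun (h (Pi.single j 1)) i
  simpa only [mulVec_single_one, col_apply] using this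

theorem IsRotationThrough.trace_eq {R : SO3} {θ : ℝ} (h : IsRotationThrough R θ) :
    (R : Matrix (Fin 3) (Fin 3) ℝ).trace = 1 + 2 * Real.cos θ := by
  obtain ⟨n, hn, e⟩ := h
  rw [e, trace_rotation hn]

theorem IsCoherent.exists_rotation (h : IsCoherent ρ u) (hc : axisCos u ^ 2 ≠ 1) :
    ∃ φ₁, Real.cos φ₁ = rotCos u ∧ ∀ i, IsRotationThrough (ρ (wirt i)) φ₁ := by
  have hn : ‖(⟨rotCos u, rotSin u⟩ : ℂ)‖ = 1 := by
    have := h.rotSin_sq hc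
    rw [← sq_eq_sq₀ (norm_nonneg _) zero_le_one, Complex.sq_norm, Complex.normSq_mk]
    linarith
  obtain ⟨θ, hθ⟩ := (Complex.norm_eq_one_iff _).1 hn
  have h1 : Real.cos θ = rotCos u := by
    rw [← Complex.exp_ofReal_mul_I_re, hθ]
  have h2 : Real.sin θ = rotSin u := by
    rw [← Complex.exp_ofReal_mul_I_im, hθ]
  refine ⟨θ, h1, fun i => ⟨u i, h.unit i, matrix_ext_mulVec fun v => ?_⟩⟩
  rw [rotation_mulVec, h1, h2, h.rodrigues hc]

/-- Euler's theorem: `R - 1 = -R (R - 1)ᵀ`, so in odd dimension `det (R - 1)` equals its own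
negative. -/
theorem exists_unit_fixed (R : SO3) :
    ∃ v : Fin 3 → ℝ, v ⬝ᵥ v = 1 ∧ (R : Matrix (Fin 3) (Fin 3) ℝ) *ᵥ v = v := by
  have hO := mem_specialOrthogonalGroup_iff.1 R.2
  have hRR : (R : Matrix (Fin 3) (Fin 3) ℝ) * (R : Matrix (Fin 3) (Fin 3) ℝ)ᵀ = 1 :=
    (mem_orthogonalGroup_iff _ _).1 hO.1
  have hdet : ((R : Matrix (Fin 3) (Fin 3) ℝ) - 1).det = 0 := by
    have e : (R : Matrix (Fin 3) (Fin 3) ℝ) - 1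
        = (R : Matrix (Fin 3) (Fin 3) ℝ) * -(((R : Matrix (Fin 3) (Fin 3) ℝ) - 1)ᵀ) := by
      rw [transpose_sub, transpose_one, neg_sub, mul_sub, mul_one, hRR]
    have e2 := congrArg det e
    rw [det_mul, hO.2, one_mul, det_neg, det_transpose, Fintype.card_fin] at e2
    linarith
  obtain ⟨v, hv, hv0⟩ := exists_mulVec_eq_zero_iff.2 hdet
  rw [sub_mulVec, one_mulVec, sub_eq_zero] at hv0
  have hpos : 0 < v ⬝ᵥ v := lt_of_le_of_ne (by rw [dot3]; nlinarith [sq_nonneg (v 0), sq_nonneg (v 1), sq_nonneg (v 2)])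
    fun e => hv (dotProduct_self_eq_zero.1 e.symm)
  refine ⟨(Real.sqrt (v ⬝ᵥ v))⁻¹ • v, ?_, by rw [mulVec_smul, hv0]⟩
  rw [smul_dotProduct, dotProduct_smul, smul_eq_mul, smul_eq_mul, ← mul_assoc, ← mul_inv,
    Real.mul_self_sqrt hpos.le, inv_mul_cancel₀ hpos.ne']

/-! ### The images of the Wirtinger generators -/

theorem subgroup_eq_top {K : Subgroup TrefoilGroup} (hA : genA ∈ K) (hB : genB ∈ K) : K = ⊤ := by
  rw [eq_top_iff, ← PresentedGroup.closure_range_of, Subgroup.closure_le]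
  rintro _ ⟨i, rfl⟩
  fin_cases i
  · exact hA
  · exact hB

theorem commute_of_commute (h : Commute (ρ genA) (ρ genB)) (x y : TrefoilGroup) :
    ρ x * ρ y = ρ y * ρ x := by
  have h1 : ∀ y, ρ y ∈ Subgroup.centralizer {ρ genA, ρ genB} := fun y => by
    have : (Subgroup.centralizer {ρ genA, ρ genB}).comap ρ = ⊤ := by
      refine subgroup_eq_top ?_ ?_ <;>
        simp [Subgroup.mem_centralizer_iff, h.eq]
    exact (this ▸ Subgroup.mem_top y : y ∈ (Subgroup.centralizer {ρ genA, ρ genB}).comap ρ)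
  have h2 : ∀ x, ρ x ∈ Subgroup.centralizer {ρ y} := fun x => by
    have := Subgroup.mem_centralizer_iff.1 (h1 y)
    have : (Subgroup.centralizer {ρ y}).comap ρ = ⊤ := by
      refine subgroup_eq_top ?_ ?_ <;> rw [Subgroup.mem_comap, Subgroup.mem_centralizer_iff] <;>
        rintro _ rfl
      · exact (this _ (by simp)).symm
      · exact (this _ (by simp)).symm
    exact (this ▸ Subgroup.mem_top x : x ∈ (Subgroup.centralizer {ρ y}).comap ρ)
  exact (Subgroup.mem_centralizer_iff.1 (h2 x) _ rfl).symm

/-- The product of two consecutive Wirtinger generators. -/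
def meridianProd : TrefoilGroup := wirt 0 * wirt 1

/-- With `ρ(a)² = 1` also `ρ(b)³ = 1`, so all these are identities between words in a quotient of
`ℤ/2 * ℤ/3`. The common product is `a b a⁻¹`, whose cube becomes trivial. -/
theorem meridianProd_eq (h : ρ genA ^ 2 = 1) :
    (∀ i, ρ (wirt i) * ρ (wirt (i + 1)) = ρ meridianProd) ∧
    (∀ i, ρ (wirt (i + 1)) * ρ meridianProd = ρ meridianProd * ρ (wirt i)) ∧
    ρ meridianProd ^ 3 = 1 ∧ ρ genA = ρ meridianProd * ρ (wirt 0) ∧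
    ρ genB = (ρ (wirt 0))⁻¹ * ρ genA := by
  have hB : ρ genB ^ 3 = 1 := by rw [← map_pow, ← genA_sq, map_pow, h]
  have w0 : ρ (wirt 0) = ρ genA * (ρ genB)⁻¹ := by simp [wirt]
  have w1 : ρ (wirt 1) = (ρ genB)⁻¹ * ρ genA := by simp [wirt]
  have w2 : ρ (wirt 2) = (ρ genA)⁻¹ * ρ genB * ρ genA * ρ genB * (ρ genA)⁻¹ := by simp [wirt]
  have wD : ρ meridianProd = ρ (wirt 0) * ρ (wirt 1) := map_mul _ _ _
  rw [wD]
  have iA : (ρ genA)⁻¹ = ρ genA := by rw [inv_eq_iff_mul_eq_one, ← pow_two, h]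
  have iB : (ρ genB)⁻¹ = ρ genB * ρ genB := by
    rw [inv_eq_iff_mul_eq_one, ← mul_assoc, ← hB, pow_succ, pow_two]
  generalize ρ genA = A at *
  generalize ρ genB = B at *
  have hAA : ∀ X, A * (A * X) = X := fun X => by rw [← mul_assoc, ← pow_two, h, one_mul]
  have hBB : ∀ X, B * (B * (B * X)) = X := fun X => by
    rw [← mul_assoc, ← mul_assoc, ← pow_two, ← pow_succ, hB, one_mul]
  have hAA' : A * A = 1 := by rw [← pow_two, h]
  have hBB' : B * (B * B) = 1 := by rw [← mul_assoc, ← pow_two, ← pow_succ, hB]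
  refine ⟨fun i => ?_, fun i => ?_, ?_, ?_, ?_⟩
  · fin_cases i <;> simp [w0, w1, w2, iA, iB, mul_assoc, hAA, hBB, hBB']
  · fin_cases i <;> simp [w0, w1, w2, iA, iB, mul_assoc, hAA, hBB, hBB']
  · simp [w0, w1, iB, mul_assoc, hAA, hBB, hAA', pow_succ]
  · simp [w0, w1, iB, mul_assoc, hAA, hBB, hBB']
  · simp [w0, iB, mul_assoc, hAA', hBB']

theorem mul_mulVec (R S : SO3) (v : Fin 3 → ℝ) :
    ((R * S : SO3) : Matrix (Fin 3) (Fin 3) ℝ) *ᵥ v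
      = (R : Matrix (Fin 3) (Fin 3) ℝ) *ᵥ (S : Matrix (Fin 3) (Fin 3) ℝ) *ᵥ v := by
  rw [mulVec_mulVec]; rfl

theorem one_mulVec_SO3 (v : Fin 3 → ℝ) : ((1 : SO3) : Matrix (Fin 3) (Fin 3) ℝ) *ᵥ v = v :=
  one_mulVec v

theorem inv_mulVec_of_fixed {R : SO3} {v : Fin 3 → ℝ}
    (h : (R : Matrix (Fin 3) (Fin 3) ℝ) *ᵥ v = v) :
    ((R⁻¹ : SO3) : Matrix (Fin 3) (Fin 3) ℝ) *ᵥ v = v := by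
  conv_lhs => rw [← h]
  rw [← mul_mulVec, inv_mul_cancel, one_mulVec_SO3]

/-- Transport one axis by `D`, the image of `meridianProd`. The three directions close up because
`D³ = 1`; from `ρ(xᵢ) ρ(xᵢ₊₁) = D` and the fact that `ρ(xᵢ₊₁)` fixes its axis, `ρ(xᵢ)` acts on the
next axis as `D` does. -/
theorem exists_isCoherent (h : ρ genA ^ 2 = 1) : ∃ u, IsCoherent ρ u := by
  obtain ⟨h1, h2, h3, -, -⟩ := meridianProd_eq h
  obtain ⟨v, hv, hf⟩ := exists_unit_fixed (ρ (wirt 0))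
  set D : Matrix (Fin 3) (Fin 3) ℝ := (ρ meridianProd : Matrix (Fin 3) (Fin 3) ℝ) with hD
  have hD3 : D *ᵥ D *ᵥ D *ᵥ v = v := by
    rw [hD, ← mul_mulVec, ← mul_mulVec, ← pow_two, ← pow_succ, h3, one_mulVec_SO3]
  have hstep : ∀ i, D *ᵥ (![v, D *ᵥ v, D *ᵥ D *ᵥ v] : Fin 3 → Fin 3 → ℝ) i
      = (![v, D *ᵥ v, D *ᵥ D *ᵥ v] : Fin 3 → Fin 3 → ℝ) (i + 1) := fun i => by
    fin_cases i
    · rfl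
    · rfl
    · exact hD3
  set w : Fin 3 → Fin 3 → ℝ := ![v, D *ᵥ v, D *ᵥ D *ᵥ v] with hw
  have hfix : ∀ i, (ρ (wirt i) : Matrix (Fin 3) (Fin 3) ℝ) *ᵥ w i = w i →
      (ρ (wirt (i + 1)) : Matrix (Fin 3) (Fin 3) ℝ) *ᵥ w (i + 1) = w (i + 1) := fun i hi => by
    rw [← hstep, hD, ← mul_mulVec, h2, mul_mulVec, hi]
  have f0 : (ρ (wirt 0) : Matrix (Fin 3) (Fin 3) ℝ) *ᵥ w 0 = w 0 := hf
  have f1 := hfix 0 f0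
  have f2 := hfix 1 f1
  have hunit : ∀ i, w i ⬝ᵥ w i = 1 → w (i + 1) ⬝ᵥ w (i + 1) = 1 := fun i hi => by
    rw [← hstep, hD, dot_rot, hi]
  have n0 : w 0 ⬝ᵥ w 0 = 1 := hv
  have n1 := hunit 0 n0
  have n2 := hunit 1 n1
  have hfixed : ∀ i, (ρ (wirt i) : Matrix (Fin 3) (Fin 3) ℝ) *ᵥ w i = w i := fun i => by
    fin_cases i
    exacts [f0, f1, f2]
  refine ⟨w, ⟨fun i => ?_, hfixed, fun i => ?_⟩⟩
  · fin_cases i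
    exacts [n0, n1, n2]
  · have := congrArg (fun R : SO3 => (R : Matrix (Fin 3) (Fin 3) ℝ) *ᵥ w (i + 1)) (h1 i)
    simp only [mul_mulVec, hfixed] at this
    rw [this, ← hD, hstep, fin3_a]

end TrefoilInvariant

/-! ### Consequences of the non-abelian image, the rotation angle and the centralizer algebra. -/

namespace TrefoilInvariant

variable {ρ : TrefoilGroup →* SO3} {u : Fin 3 → Fin 3 → ℝ}

theorem eq_smul_of_dot_sq {x y : Fin 3 → ℝ} (hx : x ⬝ᵥ x = 1) (hy : y ⬝ᵥ y = 1)
    (h : (x ⬝ᵥ y) ^ 2 = 1) : y = (x ⬝ᵥ y) • x := by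
  refine sub_eq_zero.1 (dotProduct_self_eq_zero.1 ?_)
  simp only [sub_dotProduct, dotProduct_sub, smul_dotProduct, dotProduct_smul, smul_eq_mul, hx, hy,
    dotProduct_comm y x]
  linear_combination -h

/-- The axes are distinct, because the image of the representation is not abelian. -/
theorem IsCoherent.axisCos_sq_ne_one (h : IsCoherent ρ u)
    (h2 : ρ genA ^ 2 = 1) {n : Fin 3 → ℝ} (hn : n ⬝ᵥ n = 1)
    (hA : (ρ genA : Matrix (Fin 3) (Fin 3) ℝ) = rotation n Real.pi)
    (hρ : ∃ g h : TrefoilGroup, ρ g * ρ h ≠ ρ h * ρ g) : axisCos u ^ 2 ≠ 1 := by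
  intro hc
  -- If two axes coincide, both generators fix their common direction. The half turn `ρ(a)` then has
  -- this axis, so it commutes with `ρ(b)`.
  obtain ⟨m1, -, -, m4, m5⟩ := meridianProd_eq h2
  have hu := eq_smul_of_dot_sq (h.unit 0) (h.unit 1) hc
  have x1 : (ρ (wirt 1) : Matrix (Fin 3) (Fin 3) ℝ) *ᵥ u 0 = u 0 := by
    have e := h.fixed 1
    rw [hu, mulVec_smul] at e
    refine smul_right_injective _ (fun e0 => ?_) e
    rw [axisCos, e0] at hc
    norm_num at hc
  have x0 := h.fixed 0
  have hDu : (ρ meridianProd : Matrix (Fin 3) (Fin 3) ℝ) *ᵥ u 0 = u 0 := by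
    rw [← m1 0, mul_mulVec]
    change _ *ᵥ (ρ (wirt 1) : Matrix (Fin 3) (Fin 3) ℝ) *ᵥ u 0 = u 0
    rw [x1, x0]
  have hAu : (ρ genA : Matrix (Fin 3) (Fin 3) ℝ) *ᵥ u 0 = u 0 := by
    rw [m4, mul_mulVec, x0, hDu]
  have hBu : (ρ genB : Matrix (Fin 3) (Fin 3) ℝ) *ᵥ u 0 = u 0 := by
    rw [m5, mul_mulVec, hAu, inv_mulVec_of_fixed x0]
  have hnu : u 0 = (n ⬝ᵥ u 0) • n := by
    have e := hAu
    rw [hA, rotation_mulVec, Real.cos_pi, Real.sin_pi, zero_smul, add_zero] at e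
    ext k
    have := congrFun e k
    simp only [Pi.add_apply, Pi.smul_apply, smul_eq_mul] at this ⊢
    linarith
  have hs : (n ⬝ᵥ u 0) ^ 2 = 1 := by
    have := h.unit 0
    rw [hnu, smul_dotProduct, dotProduct_smul, hn] at this
    simpa [pow_two] using this
  have hA' : ∀ v, (ρ genA : Matrix (Fin 3) (Fin 3) ℝ) *ᵥ v = (2 * (u 0 ⬝ᵥ v)) • u 0 - v := fun v => by
    rw [hA, rotation_mulVec, Real.cos_pi, Real.sin_pi, zero_smul, add_zero]
    generalize n ⬝ᵥ u 0 = s at *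
    rw [hnu, smul_dotProduct, smul_smul, neg_one_smul, neg_add_eq_sub]
    congr 2
    simp only [smul_eq_mul]
    linear_combination (-2 * (n ⬝ᵥ v)) * hs
  have hcomm : Commute (ρ genA) (ρ genB) := by
    refine Subtype.ext (matrix_ext_mulVec fun v => ?_)
    rw [mul_mulVec, mul_mulVec, hA', hA', mulVec_sub, mulVec_smul, hBu]
    conv_lhs => rw [← hBu, dot_rot, hBu]
  obtain ⟨x, y, hxy⟩ := hρ
  exact hxy (commute_of_commute hcomm x y)

/-- The trace of a product of a rotation through a half turn and the inverse of one through a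
third of a full turn. -/
theorem trace_wirt {nA nB : Fin 3 → ℝ} (hnA : nA ⬝ᵥ nA = 1) (hnB : nB ⬝ᵥ nB = 1)
    (hA : (ρ genA : Matrix (Fin 3) (Fin 3) ℝ) = rotation nA Real.pi)
    (hB : (ρ genB : Matrix (Fin 3) (Fin 3) ℝ) = rotation nB (2 * Real.pi / 3)) :
    (ρ (wirt 0) : Matrix (Fin 3) (Fin 3) ℝ).trace = 3 * (nA ⬝ᵥ nB) ^ 2 - 1 := by
  have hc : Real.cos (2 * Real.pi / 3) = -1 / 2 := by
    rw [show 2 * Real.pi / 3 = Real.pi - Real.pi / 3 by ring, Real.cos_pi_sub, Real.cos_pi_div_three]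
    ring
  have e : (ρ (wirt 0) : Matrix (Fin 3) (Fin 3) ℝ)
      = rotation nA Real.pi * (rotation nB (2 * Real.pi / 3))ᵀ := by
    have : ρ (wirt 0) = ρ genA * (ρ genB)⁻¹ := by simp [wirt]
    rw [this, ← hA, ← hB]; rfl
  rw [dot3] at hnA hnB
  rw [e, rotation_pi, dot3]
  simp only [trace_fin_three, mul_apply, Fin.sum_univ_three, transpose_apply, rotation, hc,
    vecMulVec, Matrix.sub_apply, Matrix.smul_apply, Matrix.add_apply, of_apply, one_apply, smul_eq_mul]
  simp
  linear_combination (-1) * hnA + (-3 / 2) * hnB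

theorem cos_angle_toLp {x y : Fin 3 → ℝ} (hx : x ⬝ᵥ x = 1) (hy : y ⬝ᵥ y = 1) :
    Real.cos (InnerProductGeometry.angle (WithLp.toLp 2 x : EuclideanSpace ℝ (Fin 3))
      (WithLp.toLp 2 y)) = x ⬝ᵥ y := by
  have hn : ∀ z : Fin 3 → ℝ, z ⬝ᵥ z = 1 → ‖(WithLp.toLp 2 z : EuclideanSpace ℝ (Fin 3))‖ = 1 := by
    intro z hz
    rw [← sq_eq_sq₀ (norm_nonneg _) zero_le_one, ← real_inner_self_eq_norm_sq,
      EuclideanSpace.inner_toLp_toLp]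
    simpa using hz
  rw [InnerProductGeometry.cos_angle, hn x hx, hn y hy, EuclideanSpace.inner_toLp_toLp]
  simp [dotProduct_comm]

/-- A fixed vector lies on the axes of both `ρ(x₁)` and `ρ(x₂)`, which meet only in the origin. -/
theorem IsCoherent.eq_zero_of_fixed (h : IsCoherent ρ u) (hc : axisCos u ^ 2 ≠ 1) {v : Fin 3 → ℝ}
    (hv : ∀ g, (ρ g : Matrix (Fin 3) (Fin 3) ℝ) *ᵥ v = v) : v = 0 := by
  have h0 := h.eq_smul_of_fixed hc (hv (wirt 0))
  have h1 := h.eq_smul_of_fixed hc (hv (wirt 1))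
  have e0 : u 1 ⬝ᵥ v = axisCos u * (u 0 ⬝ᵥ v) := by
    conv_lhs => rw [h0, dotProduct_smul, dotProduct_comm (u 1) (u 0)]
    rw [axisCos, smul_eq_mul, mul_comm]
  have e1 : u 0 ⬝ᵥ v = axisCos u * (u 1 ⬝ᵥ v) := by
    conv_lhs => rw [h1, dotProduct_smul]
    rw [axisCos, smul_eq_mul, mul_comm]
  have : (1 - axisCos u ^ 2) * (u 0 ⬝ᵥ v) = 0 := by rw [e0] at e1; linear_combination e1
  rw [h0, (mul_eq_zero.1 this).resolve_left (fun e => hc (by linarith)), zero_smul]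

/-- The axial vector of a skew-symmetric matrix. -/
def axialVec (W : Matrix (Fin 3) (Fin 3) ℝ) : Fin 3 → ℝ := ![W 2 1, W 0 2, W 1 0]

theorem skew_mulVec {W : Matrix (Fin 3) (Fin 3) ℝ} (hW : Wᵀ = -W) (v : Fin 3 → ℝ) :
    W *ᵥ v = axialVec W ⨯₃ v := by
  have e : ∀ i j, W j i = -W i j := fun i j => congrFun (congrFun hW i) j
  have d : ∀ i, W i i = 0 := fun i => by linarith [e i i]
  ext k
  fin_cases k <;> simp [mulVec, dot3, axialVec, cross_apply, d, e 1 0, e 2 1, e 0 2] <;> ring1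

theorem eq_zero_of_cross {x : Fin 3 → ℝ} (h : ∀ y, x ⨯₃ y = 0) : x = 0 := by
  have h0 := h ![1, 0, 0]
  have h1 := h ![0, 1, 0]
  rw [cross_apply] at h0 h1
  have a := congrFun h0 1
  have b := congrFun h0 2
  have c := congrFun h1 2
  simp at a b c
  ext k
  fin_cases k <;> simp [a, b, c]

/-- The translation part is a fixed vector. The axial vector of the rotation part is fixed as well,
because rotations respect cross products. -/
theorem IsCoherent.centralizerAlgebra_eq_bot (h : IsCoherent ρ u) (hc : axisCos u ^ 2 ≠ 1) :
    centralizerAlgebra ρ = ⊥ := by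
  rw [eq_bot_iff]
  rintro ⟨W, τ⟩ ⟨hW, hX⟩
  have hτ : τ = 0 := h.eq_zero_of_fixed hc fun g => (hX g).2
  have hw : axialVec W = 0 := h.eq_zero_of_fixed hc fun g => by
    have hRR : (ρ g : Matrix (Fin 3) (Fin 3) ℝ)ᵀ * (ρ g : Matrix (Fin 3) (Fin 3) ℝ) = 1 :=
      (mem_orthogonalGroup_iff' _ _).1 (mem_specialOrthogonalGroup_iff.1 (ρ g).2).1
    have hcom : (ρ g : Matrix (Fin 3) (Fin 3) ℝ) * W = W * (ρ g : Matrix (Fin 3) (Fin 3) ℝ) := by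
      have := congrArg (fun M => M * (ρ g : Matrix (Fin 3) (Fin 3) ℝ)) (hX g).1
      simpa only [Matrix.mul_assoc, hRR, Matrix.mul_one] using this
    refine sub_eq_zero.1 (eq_zero_of_cross fun y => ?_)
    have hy : y = (ρ g : Matrix (Fin 3) (Fin 3) ℝ) *ᵥ ((ρ g)⁻¹ : SO3).1 *ᵥ y := by
      rw [← mul_mulVec, mul_inv_cancel, one_mulVec_SO3]
    rw [map_sub, LinearMap.sub_apply, sub_eq_zero]
    conv_lhs => rw [hy, ← rot_cross, ← skew_mulVec hW, mulVec_mulVec, hcom, ← mulVec_mulVec, ← hy]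
    exact skew_mulVec hW y
  have hW0 : W = 0 := matrix_ext_mulVec fun v => by
    rw [skew_mulVec hW, hw]; simp
  rw [Submodule.mem_bot, hτ, hW0]
  rfl

end TrefoilInvariant

namespace TrefoilInvariant

variable {ρ : TrefoilGroup →* SO3} {u : Fin 3 → Fin 3 → ℝ}

/-! ### Existence of configurations in general position -/

/-- A real vector space is not a finite union of proper subspaces. -/
theorem exists_forall_apply_ne_zero {ι : Type*} [Fintype ι] {M : Type*} [AddCommGroup M] [Module ℝ M]
    (f : ι → (Fin 3 → ℝ) →ₗ[ℝ] M) (hf : ∀ i, f i ≠ 0) : ∃ v, ∀ i, f i v ≠ 0 := by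
  by_contra! h
  obtain ⟨i, hi⟩ := Subspace.exists_eq_top_of_iUnion_eq_univ (p := fun i => (f i).ker)
    (Set.eq_univ_of_forall fun v => by
      obtain ⟨i, hi⟩ := h v
      exact Set.mem_iUnion.2 ⟨i, hi⟩)
  exact hf i (LinearMap.ker_eq_top.1 hi)

/-- Put the link vertices at `t` and `2t` along the axes. To first order in `t`, six times a volume
is `t [Y - X, g O, P]` up to orientation, which is nonzero for suitable `O` and `P`; a small nonzero
`t` then works for all tetrahedra. -/
theorem IsCoherent.exists_general (h : IsCoherent ρ u) :
    ∃ Γ, IsEquivariant ρ Γ ∧ InGeneralPosition ρ Γ := by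
  set X : Tet → Fin 3 → ℝ := fun T => tetPos ρ (place u (fun _ => 1) (fun _ => 2) 0 0) T 0 with hX
  set Y : Tet → Fin 3 → ℝ := fun T => tetPos ρ (place u (fun _ => 1) (fun _ => 2) 0 0) T 1 with hY
  set g : Tet → TrefoilGroup := fun T => (tetVertex T 2).1 with hg
  -- The two vertices have different norms, 1 and 2, so they never coincide.
  have hw : ∀ T, Y T - X T ≠ 0 := by
    intro T e
    have key : ∀ i j, ¬ ((2 : ℝ) • u i - (1 : ℝ) • u j = 0) := by
      intro i j e
      have e2 := congrArg (fun v => v ⬝ᵥ v) (sub_eq_zero.1 e)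
      simp only [smul_dotProduct, dotProduct_smul, h.unit, smul_eq_mul] at e2
      norm_num at e2
    simp only [hX, hY, h.tetPos_place] at e
    cases T <;> exact key _ _ e
  obtain ⟨o, ho⟩ := exists_forall_apply_ne_zero (fun T => crossProduct (Y T - X T) ∘ₗ
      (ρ (g T) : Matrix (Fin 3) (Fin 3) ℝ).mulVecLin) fun T e => hw T (eq_zero_of_cross fun y => by
    have := LinearMap.congr_fun e (((ρ (g T))⁻¹ : SO3).1 *ᵥ y)
    simp only [LinearMap.comp_apply, mulVecLin_apply, ← mul_mulVec, mul_inv_cancel,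
      one_mulVec_SO3] at this
    exact this)
  simp only [LinearMap.comp_apply, mulVecLin_apply] at ho
  obtain ⟨p, hp⟩ := exists_forall_apply_ne_zero (fun T => dotProductBilin ℝ ℝ ((Y T - X T) ⨯₃
      ((ρ (g T) : Matrix (Fin 3) (Fin 3) ℝ) *ᵥ o))) fun T e => ho T
    (dotProduct_self_eq_zero.1 (LinearMap.congr_fun e _))
  set γ : ℝ → Vertex → Fin 3 → ℝ := fun t => place u (fun _ => t * 1) (fun _ => t * 2) o p with hγ
  have hdet : ∀ t T, tetDet ρ (γ t) T = t * triple (Y T - X T)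
      ((ρ (g T) : Matrix (Fin 3) (Fin 3) ℝ) *ᵥ o - t • X T) (p - t • X T) := by
    intro t T
    have hpos : tetPos ρ (γ t) T 0 = t • X T ∧ tetPos ρ (γ t) T 1 = t • Y T ∧
        tetPos ρ (γ t) T 2 = (ρ (g T) : Matrix (Fin 3) (Fin 3) ℝ) *ᵥ o ∧ tetPos ρ (γ t) T 3 = p := by
      cases T <;> simp [tetPos, liftPos, tetVertex, hX, hY, hg, hγ, place, mulVec_smul, smul_smul]
    rw [tetDet, hpos.1, hpos.2.1, hpos.2.2.1, hpos.2.2.2, ← smul_sub]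
    simp only [triple, Pi.smul_apply, smul_eq_mul]
    ring
  have hev : ∀ T, ∀ᶠ t : ℝ in nhds 0, triple (Y T - X T)
      ((ρ (g T) : Matrix (Fin 3) (Fin 3) ℝ) *ᵥ o - t • X T) (p - t • X T) ≠ 0 := fun T => by
    have hcont : Continuous fun t : ℝ => triple (Y T - X T)
        ((ρ (g T) : Matrix (Fin 3) (Fin 3) ℝ) *ᵥ o - t • X T) (p - t • X T) := by
      simp only [triple, Pi.sub_apply, Pi.smul_apply, smul_eq_mul]
      fun_prop
    refine hcont.continuousAt.eventually_ne ?_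
    rw [zero_smul, sub_zero, sub_zero, triple_eq_cross_dot]
    exact hp T
  obtain ⟨t, ht, ht0⟩ := ((Filter.Eventually.filter_mono nhdsWithin_le_nhds
    (Filter.eventually_all.2 hev)).and
      (self_mem_nhdsWithin : ({0}ᶜ : Set ℝ) ∈ nhdsWithin 0 {0}ᶜ)).exists
  refine ⟨γ t, h.equivariant _ _ _ _, fun T => ?_⟩
  have hO : tetOrientation T ≠ 0 := fun e => by simpa [e] using tetOrientation_sq T
  rw [volume_eq, hdet]
  exact div_ne_zero (mul_ne_zero hO (mul_ne_zero ht0 (ht T))) (by norm_num)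

end TrefoilInvariant
-- The theorem.
theorem mainTheorem2
    (nA nB : Fin 3 → ℝ) (hnA : nA ⬝ᵥ nA = 1) (hnB : nB ⬝ᵥ nB = 1)
    (φ : ℝ)
    (hφ : φ = InnerProductGeometry.angle
      (WithLp.toLp 2 nA : EuclideanSpace ℝ (Fin 3)) (WithLp.toLp 2 nB))
    (ρ : TrefoilInvariant.TrefoilGroup →* TrefoilInvariant.SO3)
    (hA : (ρ TrefoilInvariant.genA : Matrix (Fin 3) (Fin 3) ℝ) =
      TrefoilInvariant.rotation nA Real.pi)
    (hB : (ρ TrefoilInvariant.genB : Matrix (Fin 3) (Fin 3) ℝ) =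
      TrefoilInvariant.rotation nB (2 * Real.pi / 3))
    (hρ : ∃ g h : TrefoilInvariant.TrefoilGroup, ρ g * ρ h ≠ ρ h * ρ g) :
    (∃ φ₁ : ℝ, ∀ i : Fin 3,
      TrefoilInvariant.IsRotationThrough (ρ (TrefoilInvariant.wirt i)) φ₁) ∧
    (∃ u : Fin 3 → Fin 3 → ℝ, TrefoilInvariant.IsAxisFamily ρ u) ∧
    (∃ Γ : TrefoilInvariant.Vertex → Fin 3 → ℝ,
      TrefoilInvariant.IsEquivariant ρ Γ ∧ TrefoilInvariant.InGeneralPosition ρ Γ) ∧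
    TrefoilInvariant.centralizerAlgebra ρ = ⊥ ∧
    ∀ φ₁ : ℝ,
      (∀ i : Fin 3, TrefoilInvariant.IsRotationThrough (ρ (TrefoilInvariant.wirt i)) φ₁) →
      Real.cos φ₁ = 3 / 2 * Real.cos φ ^ 2 - 1 ∧
      ∀ (u : Fin 3 → Fin 3 → ℝ) (Γ : TrefoilInvariant.Vertex → Fin 3 → ℝ),
        TrefoilInvariant.IsAxisFamily ρ u →
        TrefoilInvariant.IsEquivariant ρ Γ →
        TrefoilInvariant.InGeneralPosition ρ Γ →
        (∃ (β : Module.Basis (Fin 0) ℝ (TrefoilInvariant.centralizerAlgebra ρ))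
          (s : TrefoilInvariant.MinorChoice 0 12 20), s.Nondegenerate ρ u Γ β) ∧
        ∀ (β : Module.Basis (Fin 0) ℝ (TrefoilInvariant.centralizerAlgebra ρ))
          (s : TrefoilInvariant.MinorChoice 0 12 20), s.Nondegenerate ρ u Γ β →
          s.invariant ρ u Γ β φ₁ = 4 := by
  have hA2 : ρ TrefoilInvariant.genA ^ 2 = 1 := by
    refine Subtype.ext (TrefoilInvariant.matrix_ext_mulVec fun v => ?_)
    change ((ρ TrefoilInvariant.genA ^ 2 : TrefoilInvariant.SO3) : Matrix (Fin 3) (Fin 3) ℝ) *ᵥ v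
      = (1 : Matrix (Fin 3) (Fin 3) ℝ) *ᵥ v
    rw [pow_two, TrefoilInvariant.mul_mulVec, hA, one_mulVec]
    simp only [TrefoilInvariant.rotation_pi, sub_mulVec, one_mulVec, smul_mulVec, vecMulVec_mulVec,
      dotProduct_sub, dotProduct_smul, hnA]
    ext k
    simp
    ring
  obtain ⟨u, hu⟩ := TrefoilInvariant.exists_isCoherent hA2
  have hc := hu.axisCos_sq_ne_one hA2 hnA hA hρ
  obtain ⟨θ, hθ, hrot⟩ := hu.exists_rotation hc
  have hbot := hu.centralizerAlgebra_eq_bot hc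
  refine ⟨⟨θ, hrot⟩, ⟨u, fun i => ⟨hu.unit i, hu.fixed i⟩⟩, hu.exists_general, hbot,
    fun φ₁ h₁ => ⟨?_, fun u' Γ hu' hE hG => hu.invariant_eq hc hbot ?_ hu' hE hG⟩⟩
  · have := (h₁ 0).trace_eq
    rw [TrefoilInvariant.trace_wirt hnA hnB hA hB] at this
    rw [hφ, TrefoilInvariant.cos_angle_toLp hnA hnB]
    linarith
  -- An arbitrary admissible angle and the one built from the axes have the same cosine, since both
  -- determine the trace of `ρ(x₁)`.
  · have := (h₁ 0).trace_eq.symm.trans (hrot 0).trace_eq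
    linarith
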